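/- Let $d\ge 1$ and fix a smooth radial function $\chi:\mathbb R^d\to\mathbb R$ supported in the ball $B(0,4/3)$ with value $1$ on $B(0,3/4)$; put $\varphi(\xi)=\chi(\xi/2)-\chi(\xi)$, $\dot\Delta_j=\varphi(2^{-j}D)$, $\dot S_j=\chi(2^{-j}D)$ for $j\in\mathbb Z$. Let $\mathcal S'_h$ be the set of tempered distributions $u$ with $\|\dot S_ju\|_{L^\infty}\to0$ as $j\to-\infty$, let $$\|u\|_{\dot B^{\sigma}_{p,r}}=\Bigl\|2^{j\sigma}\|\dot\Delta_ju\|_{L^p(\mathbb R^d)}\Bigr\|_{\ell^r(\mathbb Z)},$$ and let $\dot B^\sigma_{p,r}$ be the set of $u\in\mathcal S'_h$ for which this is finite. Let $\Lambda_1$ be the Fourier multiplier with symbol $|\xi|_1=\sum_{i=1}^d|\xi_i|$, and define the paraproduct and the remainder by $$T_fg=\sum_{j\in\mathbb Z}\dot S_{j-1}f\,\dot\Delta_jg,\qquad R(f,g)=\sum_{j\in\mathbb Z}\ \sum_{|j'-j|\le1}\dot\Delta_jf\,\dot\Delta_{j'}g,$$ where the series are limits in $\mathcal S'$ of the sums over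 $-M\le j\le N$ as $M,N\to\infty$. For $c_0>0$, $t\ge0$ and tempered distributions $f,g$ write $F=e^{\sqrt{c_0t}\Lambda_1}f$ and $G=e^{\sqrt{c_0t}\Lambda_1}g$. Let $1<p,q<\infty$ and $1\le r,r_1,r_2\le\infty$. (i) Let $s,\sigma\in\mathbb R$ be such that either $\sigma>0$ and $\frac1r=\frac1{r_1}+\frac1{r_2}$, or $\sigma=0$, $r_1=1$ and $r=r_2$. There is a constant $C$, independent of $c_0,t,f,g$, such that whenever $F\in\dot B^{\frac dq-\sigma}_{q,r_1}$ and $G\in\dot B^{s}_{p,r_2}$, the series $T_fg$ converges in $\mathcal S'$, $e^{\sqrt{c_0t}\Lambda_1}T_fg$ is a well-defined element of $\mathcal S'_h$, and $$\|e^{\sqrt{c_0t}\Lambda_1}T_fg\|_{\dot B^{s-\sigma}_{p,r}}\le C\,\|F\|_{\dot B^{\frac dq-\sigma}_{q,r_1}}\|G\|_{\dot B^{s}_{p,r_2}}.$$ (ii) Let $\frac1r=\frac1{r_1}+\frac1{r_2}$ and let $s_1,s_2\in\mathbb R$ with $s_1+s_2>0$. There is a constant $C$, independent of $c_0,t,f,g$,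 such that whenever $F\in\dot B^{s_1+\frac dq}_{q,r_1}$, $G\in\dot B^{s_2}_{p,r_2}$ and the series $R(f,g)$ converges in $\mathcal S'$ to an element of $\mathcal S'_h$, then $e^{\sqrt{c_0t}\Lambda_1}R(f,g)$ is a well-defined element of $\mathcal S'_h$ and $$\|e^{\sqrt{c_0t}\Lambda_1}R(f,g)\|_{\dot B^{s_1+s_2}_{p,r}}\le C\,\|F\|_{\dot B^{s_1+\frac dq}_{q,r_1}}\|G\|_{\dot B^{s_2}_{p,r_2}}.$$ Moreover, if $s_1+s_2<\frac dp$, or if $s_1+s_2=\frac dp$ and $r=1$, then for all such $F$ and $G$ the series $R(f,g)$ does converge in $\mathcal S'$ to an element of $\mathcal S'_h$. -/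

import Mathlib

open MeasureTheory Filter Topology
open scoped ENNReal NNReal SchwartzMap FourierTransform ContDiff

noncomputable section

namespace GevreyBesov

/-- The Euclidean space `ℝ^d`. -/
abbrev Space (d : ℕ) : Type := EuclideanSpace ℝ (Fin d)

variable {d : ℕ}

/-! ### Tempered distributions given by functions -/

/-- The tempered distribution `u` is the (locally integrable) function `w`. Such a `w` is unique up
to a null set. -/
def RepresentedBy (u : 𝓢'(Space d, ℂ)) (w : Space d → ℂ) : Prop :=
  AEStronglyMeasurable w volume ∧
    ∀ φ : 𝓢(Space d, ℂ), Integrable (fun x => φ x * w x) volume ∧ u φ = ∫ x, φ x * w x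

/-- The `L^p` norm of a tempered distribution; it is `∞` if `u` is not a function. -/
def lpNorm (p : ℝ≥0∞) (u : 𝓢'(Space d, ℂ)) : ℝ≥0∞ :=
  ⨅ (w : Space d → ℂ) (_ : RepresentedBy u w), eLpNorm w p volume

/-- `P` is the pointwise product of the distributions `u` and `v`, both of them functions. -/
def IsProduct (u v P : 𝓢'(Space d, ℂ)) : Prop :=
  ∃ w z : Space d → ℂ, RepresentedBy u w ∧ RepresentedBy v z ∧
    RepresentedBy P (fun x => w x * z x)

/-- The two-sided series `∑_{j ∈ ℤ} u j` converges to `U` in the space of tempered distributions: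
the sums over `-M ≤ j ≤ N` tend to `U` as `M, N → ∞`. -/
def SeriesConvergesTo (u : ℤ → 𝓢'(Space d, ℂ)) (U : 𝓢'(Space d, ℂ)) : Prop :=
  Tendsto (fun N : ℕ × ℕ => ∑ j ∈ Finset.Icc (-(N.1 : ℤ)) (N.2 : ℤ), u j) atTop (𝓝 U)

/-! ### Fourier multipliers

The convention for the Fourier transform is `û(ξ) = ∫ e^{-i x·ξ} u(x) dx`, whereas Mathlib's
transform is `𝓕 u (η) = ∫ e^{-2π i x·η} u(x) dx`; hence the frequency `ξ` is `2π η`. -/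

/-- The operator `θ(D)` on tempered distributions, for a smooth symbol `θ` of temperate growth. -/
def smoothMul (θ : Space d → ℂ) : 𝓢'(Space d, ℂ) →L[ℂ] 𝓢'(Space d, ℂ) :=
  TemperedDistribution.fourierMultiplierCLM ℂ (fun η => θ ((2 * Real.pi) • η))

/-- The function `m(-D) φ`, that is, the transpose of `m(D)` applied to the test function `φ`. -/
def transposeMul (m : Space d → ℂ) (φ : 𝓢(Space d, ℂ)) : Space d → ℂ :=
  𝓕 (fun η : Space d => m ((2 * Real.pi) • η) * (𝓕⁻ φ : 𝓢(Space d, ℂ)) η)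

/-- `v = m(D) u` for a continuous symbol `m` that need be neither smooth nor bounded. Every
low-frequency part `θ(D) u` of `u` has to be a bounded function `w`, and `v` is determined by
duality against the (dense set of) band-limited test functions: if `θ = 1` on the frequencies of `φ`
then `⟨v, φ⟩ = ⟨θ(D) u, m(-D) φ⟩`, an absolutely convergent integral. -/
def IsMultiplierImage (m : Space d → ℂ) (u v : 𝓢'(Space d, ℂ)) : Prop :=
  ∀ θ : Space d → ℂ, ContDiff ℝ ∞ θ → HasCompactSupport θ →
    ∃ w : Space d → ℂ, RepresentedBy (smoothMul θ u) w ∧ eLpNorm w ⊤ volume < ⊤ ∧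
      ∀ φ : 𝓢(Space d, ℂ),
        (∀ η ∈ tsupport (𝓕⁻ φ : 𝓢(Space d, ℂ)), θ ((2 * Real.pi) • η) = 1) →
          Integrable (fun x => transposeMul m φ x * w x) volume ∧
            v φ = ∫ x, transposeMul m φ x * w x

/-- The symbol `e^{a |ξ|_1}` of `e^{a Λ₁}`, where `|ξ|_1 = ∑ |ξ_i|`. -/
def gevreySymbol (a : ℝ) (ξ : Space d) : ℂ := (Real.exp (a * ∑ i, |ξ i|) : ℝ)

/-- `v = e^{√(c₀ t) Λ₁} u`. -/
def IsGevreyImage (c₀ t : ℝ) (u v : 𝓢'(Space d, ℂ)) : Prop :=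
  IsMultiplierImage (gevreySymbol (Real.sqrt (c₀ * t))) u v

/-! ### Littlewood-Paley decomposition and homogeneous Besov spaces -/

/-- A smooth radial function supported in the ball of radius `4/3`, with value `1` on the ball of
radius `3/4`. -/
structure IsCutoff (χ : Space d → ℝ) : Prop where
  smooth : ContDiff ℝ ∞ χ
  radial : ∀ ξ η : Space d, ‖ξ‖ = ‖η‖ → χ ξ = χ η
  support : tsupport χ ⊆ Metric.closedBall 0 (4 / 3)
  eq_one : ∀ ξ ∈ Metric.closedBall (0 : Space d) (3 / 4), χ ξ = 1

/-- The low-frequency cut-off `Ṡ_j = χ(2^{-j} D)`. -/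
def lowFreq (χ : Space d → ℝ) (j : ℤ) : 𝓢'(Space d, ℂ) →L[ℂ] 𝓢'(Space d, ℂ) :=
  smoothMul (fun ξ => (χ ((2 : ℝ) ^ (-j) • ξ) : ℂ))

/-- The dyadic block `Δ̇_j = φ(2^{-j} D)` with `φ(ξ) = χ(ξ/2) - χ(ξ)`. -/
def block (χ : Space d → ℝ) (j : ℤ) : 𝓢'(Space d, ℂ) →L[ℂ] 𝓢'(Space d, ℂ) :=
  smoothMul (fun ξ =>
    ((χ ((1 / 2 : ℝ) • ((2 : ℝ) ^ (-j) • ξ)) - χ ((2 : ℝ) ^ (-j) • ξ) : ℝ) : ℂ))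

/-- The space `𝒮'_h` of tempered distributions with `‖Ṡ_j u‖_{L^∞} → 0` as `j → -∞`. -/
def MemSh (χ : Space d → ℝ) (u : 𝓢'(Space d, ℂ)) : Prop :=
  Tendsto (fun j : ℤ => lpNorm ⊤ (lowFreq χ j u)) atBot (𝓝 0)

/-- The `ℓ^r(ℤ)` norm, `1 ≤ r ≤ ∞`, of a sequence with values in `[0, ∞]`. -/
def seqNorm (r : ℝ≥0∞) (a : ℤ → ℝ≥0∞) : ℝ≥0∞ :=
  if r = ⊤ then ⨆ j, a j else (∑' j, a j ^ r.toReal) ^ (1 / r.toReal)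

/-- The homogeneous Besov norm `‖ 2^{jσ} ‖Δ̇_j u‖_{L^p} ‖_{ℓ^r(ℤ)}`. -/
def besovNorm (χ : Space d → ℝ) (σ : ℝ) (p r : ℝ≥0∞) (u : 𝓢'(Space d, ℂ)) : ℝ≥0∞ :=
  seqNorm r (fun j => (2 : ℝ≥0∞) ^ ((j : ℝ) * σ) * lpNorm p (block χ j u))

/-- The homogeneous Besov space: elements of `𝒮'_h` with finite Besov norm. -/
def MemBesov (χ : Space d → ℝ) (σ : ℝ) (p r : ℝ≥0∞) (u : 𝓢'(Space d, ℂ)) : Prop :=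
  MemSh χ u ∧ besovNorm χ σ p r u < ⊤

/-! ### Paraproduct and remainder -/

/-- `T = T_f g = ∑_j Ṡ_{j-1} f Δ̇_j g`, with convergence in the tempered distributions. -/
def IsParaproduct (χ : Space d → ℝ) (f g T : 𝓢'(Space d, ℂ)) : Prop :=
  ∃ W : ℤ → 𝓢'(Space d, ℂ),
    (∀ j, IsProduct (lowFreq χ (j - 1) f) (block χ j g) (W j)) ∧ SeriesConvergesTo W T

/-- `R = R(f,g) = ∑_j ∑_{|j'-j| ≤ 1} Δ̇_j f Δ̇_{j'} g`, with convergence in the tempered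
distributions. -/
def IsRemainder (χ : Space d → ℝ) (f g R : 𝓢'(Space d, ℂ)) : Prop :=
  ∃ W : ℤ → ℤ → 𝓢'(Space d, ℂ),
    (∀ j j', IsProduct (block χ j f) (block χ j' g) (W j j')) ∧
      SeriesConvergesTo (fun j => ∑ j' ∈ Finset.Icc (j - 1) (j + 1), W j j') R

end GevreyBesov

end

/-!
# Paraproduct and remainder in Gevrey classes over homogeneous Besov spaces

The operator `e^{aΛ₁}` is unbounded, but it may be moved through a product. With `U = e^{aΛ₁} u` and
`V = e^{aΛ₁} v`, the map `(U, V) ↦ e^{aΛ₁}(uv)` has the bilinear symbol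
`e^{a(|ξ+ζ|₁ - |ξ|₁ - |ζ|₁)}`, whose exponent is `≤ 0` by the triangle inequality. As `|·|₁` is a sum
over the coordinates, the symbol is a product of one-dimensional ones, and on the line it is
elementary: according to the signs of `t`, `s` and `t + s`, the number `|t+s| - |t| - |s|` is `0`,
`-2|t|` or `-2|s|`. So the symbol is a sum of `6^d` products `m₀(ξ+ζ) m₁(ξ) m₂(ζ)`, in which the
factors are products of indicator functions of half-spaces and of exponentials `e^{-2a|ξ_i|}`
(`exp_abs_add_eq_sum`, `gevreySymbol_add_eq_sum`). All of them are Fourier multipliers of `L^p`,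
`1 < p < ∞`, uniformly in `a ≥ 0`:

* `e^{-2a|ξ_i|}` is the Fourier transform of a Poisson kernel, a probability measure
  (`exists_poisson`, `lpMul_exp_neg`);
* the half-space projections are bounded by the theorem of M. Riesz (`exists_lpMul_half`). If the
  spectrum of `u` lies in a half-space, then `u` is the boundary value of a function which is
  holomorphic in one complex variable, and `∫ Ψ(u) ≥ 0` for subharmonic `Ψ`
  (`Spec.integral_comp_nonneg`). Explicit choices of `Ψ` control the `L^p` norm of `u` by that of
  its real part (`exists_eLpNorm_le_re`).

Together with Bernstein's inequality this gives, uniformly in `a`, the bound of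
`‖e^{aΛ₁} Δ̇_k (Δ̇_l u Δ̇_m v)‖_{L^p}` by `2^{ld/q} ‖Δ̇_l U‖_{L^q} ‖Δ̇_m V‖_{L^p}`
(`exists_bilinear_dyadic`). The estimates of the paraproduct and of the remainder then follow as
they do for `a = 0`: the terms of the two series have their spectra in annuli and in balls of size
`2^j` (`annSym_add`, `lowSym_add`), and what remains are inequalities of Hölder and Young for
sequences (`exists_seqNorm_para_le`, `exists_seqNorm_rem_le`).

The other half of the argument is the existence of the objects.

* The paraproduct `∑ Ṡ_{j-1} f Δ̇_j g` need not converge absolutely as `j → -∞`. Summation by parts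
  replaces its terms by `Δ̇_{j-1} f Ṡ_{j+1} g`, and these are summable because `∑_{l<0} Δ̇_l f`
  converges absolutely in `L^∞` (`exists_paraproduct`). Towards `j = ∞` the sup norms of the terms
  may grow exponentially; since the spectra lie in dyadic annuli, the series is a power of the
  Laplacian of an absolutely convergent one (`exists_hasSum_of_annular`).
* In the same way `e^{aΛ₁} T` exists as soon as the blocks `e^{aΛ₁} Δ̇_k T` have a finite Besov norm
  (`exists_gevreyRel`, `exists_gevreyImage_of_series`).
* The remainder converges absolutely in `L^∞` at low frequencies, which is where `s₁ + s₂ < d/p`, or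
  equality with `r = 1`, is used, and in `L^p` at high frequencies (`exists_memSh_of_series`).

Concretely, all the functions that occur are bounded, an operator `m(D)` with `m` localized to a
compact set of frequencies is convolution with an integrable kernel (`HasKer`, `op`), and the
duality in the definition of `IsMultiplierImage` is traded for a relation between such functions
(`GevreyRel`). Identities for `L^p` multipliers are proved for functions with a bounded, compactly
supported Fourier transform (`Spec`), and reach bounded functions by truncation in space.
-/

noncomputable section

namespace GevreyBesov

variable {d : ℕ}

/-! ### Convolution with integrable kernels -/

/-- Minkowski's integral inequality for a superposition of translates of one function. -/
theorem eLpNorm_integral_translate_le {Ω : Type*} [MeasurableSpace Ω] {μ : Measure Ω} [SFinite μ]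
    {k : Ω → ℂ} (hk : AEStronglyMeasurable k μ) {τ : Ω → Space d} (hτ : Measurable τ)
    {w : Space d → ℂ} (hw : AEStronglyMeasurable w volume) {p : ℝ} (hp : 1 ≤ p) :
    eLpNorm (fun x => ∫ o, k o * w (x - τ o) ∂μ) (ENNReal.ofReal p) volume ≤
      (∫⁻ o, ‖k o‖ₑ ∂μ) * eLpNorm w (ENNReal.ofReal p) volume := by
  have hp0 : 0 < p := by linarith
  have hq0 : ENNReal.ofReal p ≠ 0 := by simpa using hp0
  have hmp : MeasurePreserving (fun z : Ω × Space d => (z.1, z.2 - τ z.1)) (μ.prod volume)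
      (μ.prod volume) := by
    refine MeasurePreserving.skew_product (f := id) (g := fun o x => x - τ o)
      (MeasurePreserving.id μ) (by fun_prop) (ae_of_all _ fun o => ?_)
    exact (measurePreserving_sub_right volume (τ o)).map_eq
  have hW : AEStronglyMeasurable (fun z : Ω × Space d => w (z.2 - τ z.1)) (μ.prod volume) :=
    (hw.comp_snd (μ := μ)).comp_measurePreserving hmp
  have hA : AEMeasurable (fun z : Ω × Space d => ‖k z.1‖ₑ * ‖w (z.2 - τ z.1)‖ₑ ^ p)
      (μ.prod volume) := hk.comp_fst.enorm.mul (hW.enorm.pow_const _)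
  rw [eLpNorm_eq_lintegral_rpow_enorm_toReal hq0 ENNReal.ofReal_ne_top,
    eLpNorm_eq_lintegral_rpow_enorm_toReal hq0 ENNReal.ofReal_ne_top, ENNReal.toReal_ofReal hp0.le]
  set K := ∫⁻ o, ‖k o‖ₑ ∂μ with hK
  set N := ∫⁻ x, ‖w x‖ₑ ^ p with hN
  -- Hölder's inequality with respect to the weight `‖k‖`
  have key : ∀ᵐ x, ‖∫ o, k o * w (x - τ o) ∂μ‖ₑ ^ p ≤
      K ^ (p - 1) * ∫⁻ o, ‖k o‖ₑ * ‖w (x - τ o)‖ₑ ^ p ∂μ := by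
    have h2 : ∀ᵐ x : Space d, AEMeasurable (fun o => ‖w (x - τ o)‖ₑ) μ := by
      have := hW.enorm.prod_swap
      filter_upwards [AEStronglyMeasurable.prodMk_left (f := fun z : Space d × Ω =>
        ‖w (z.1 - τ z.2)‖ₑ) (μ := volume) (ν := μ) this.aestronglyMeasurable] with x hx
      exact hx.aemeasurable
    filter_upwards [h2] with x hx
    have h1 : ‖∫ o, k o * w (x - τ o) ∂μ‖ₑ ≤ ∫⁻ o, ‖k o‖ₑ * ‖w (x - τ o)‖ₑ ∂μ := by
      refine (enorm_integral_le_lintegral_enorm _).trans_eq ?_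
      simp_rw [enorm_mul]
    refine (ENNReal.rpow_le_rpow h1 hp0.le).trans ?_
    rcases hp.eq_or_lt with rfl | hp1
    · simp
    have hpq : p.HolderConjugate (p / (p - 1)) := Real.HolderConjugate.conjExponent hp1
    have hpq' := hpq.symm
    have h3 := ENNReal.lintegral_mul_le_Lp_mul_Lq μ hpq'
      (f := fun o => ‖k o‖ₑ ^ ((p - 1) / p)) (g := fun o => ‖k o‖ₑ ^ (1 / p) * ‖w (x - τ o)‖ₑ)
      (hk.enorm.pow_const _) ((hk.enorm.pow_const _).mul hx)
    have h4 : ∀ o, ((fun o => ‖k o‖ₑ ^ ((p - 1) / p)) * (fun o => ‖k o‖ₑ ^ (1 / p) *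
        ‖w (x - τ o)‖ₑ)) o = ‖k o‖ₑ * ‖w (x - τ o)‖ₑ := by
      intro o
      simp only [Pi.mul_apply]
      rw [← mul_assoc, ← ENNReal.rpow_add_of_nonneg _ _ (by apply div_nonneg <;> linarith)
        (by positivity)]
      have : (p - 1) / p + 1 / p = 1 := by field_simp; ring
      rw [this, ENNReal.rpow_one]
    simp_rw [h4] at h3
    refine (ENNReal.rpow_le_rpow h3 hp0.le).trans_eq ?_
    rw [ENNReal.mul_rpow_of_nonneg _ _ hp0.le, ← ENNReal.rpow_mul, ← ENNReal.rpow_mul]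
    congr 1
    · rw [show 1 / (p / (p - 1)) * p = p - 1 by
        have : p - 1 ≠ 0 := by linarith
        field_simp]
      congr 1
      refine lintegral_congr fun o => ?_
      rw [← ENNReal.rpow_mul, show (p - 1) / p * (p / (p - 1)) = 1 by
        have : p - 1 ≠ 0 := by linarith
        field_simp, ENNReal.rpow_one]
    · rw [one_div_mul_cancel hp0.ne', ENNReal.rpow_one]
      refine lintegral_congr fun o => ?_
      rw [ENNReal.mul_rpow_of_nonneg _ _ hp0.le, ← ENNReal.rpow_mul, one_div_mul_cancel hp0.ne',
        ENNReal.rpow_one]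
  have hswap : ∫⁻ x, ∫⁻ o, ‖k o‖ₑ * ‖w (x - τ o)‖ₑ ^ p ∂μ = K * N := by
    rw [← lintegral_lintegral_swap hA, hK, ← lintegral_mul_const'' _ hk.enorm]
    refine lintegral_congr fun o => ?_
    have h5 : AEMeasurable (fun x => ‖w (x - τ o)‖ₑ ^ p) volume :=
      ((hw.comp_measurePreserving (measurePreserving_sub_right volume (τ o))).enorm.pow_const _)
    rw [lintegral_const_mul'' _ h5, hN]
    congr 1
    exact lintegral_sub_right_eq_self (fun x => ‖w x‖ₑ ^ p) (τ o)
  have hfin : ∫⁻ x, ‖∫ o, k o * w (x - τ o) ∂μ‖ₑ ^ p ≤ K ^ p * N := by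
    have h6 : AEMeasurable (fun x => ∫⁻ o, ‖k o‖ₑ * ‖w (x - τ o)‖ₑ ^ p ∂μ) volume :=
      hA.prod_swap.lintegral_prod_right'
    refine (lintegral_mono_ae key).trans ?_
    rw [lintegral_const_mul'' _ h6, hswap, ← mul_assoc]
    gcongr
    nth_rewrite 2 [← ENNReal.rpow_one K]
    rw [← ENNReal.rpow_add_of_nonneg _ _ (by linarith) zero_le_one, sub_add_cancel]
  refine (ENNReal.rpow_le_rpow hfin (by positivity)).trans_eq ?_
  rw [ENNReal.mul_rpow_of_nonneg _ _ (by positivity), ← ENNReal.rpow_mul, mul_one_div_cancel hp0.ne',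
    ENNReal.rpow_one]

/-- Convolution `(k * w)(x) = ∫ k(y) w(x - y) dy` of a kernel with a function. -/
def cv (k w : Space d → ℂ) (x : Space d) : ℂ := ∫ y, k y * w (x - y)

/-- The symbol `m` (a function of Mathlib's frequency variable) is the Fourier transform of the
integrable kernel `k`; thus `m(D)` acts as convolution with `k`. -/
def HasKer (m k : Space d → ℂ) : Prop := Integrable k volume ∧ ∀ η, 𝓕 k η = m η

theorem cv_congr_ae {k w w' : Space d → ℂ} (h : w =ᵐ[volume] w') : cv k w = cv k w' := by
  ext x
  refine integral_congr_ae ?_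
  have := (Measure.measurePreserving_sub_left volume x).quasiMeasurePreserving.ae h
  filter_upwards [this] with y hy
  rw [hy]

theorem cv_congr_ae_left {k k' w : Space d → ℂ} (h : k =ᵐ[volume] k') : cv k w = cv k' w := by
  ext x
  refine integral_congr_ae ?_
  filter_upwards [h] with y hy
  rw [hy]

theorem aestronglyMeasurable_comp_sub {w : Space d → ℂ} (hw : AEStronglyMeasurable w volume)
    (x : Space d) : AEStronglyMeasurable (fun y => w (x - y)) volume :=
  hw.comp_measurePreserving (Measure.measurePreserving_sub_left volume x)

theorem ae_norm_le_of_memLp_top {w : Space d → ℂ} (hw : MemLp w ⊤ volume) :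
    ∀ᵐ x, ‖w x‖ ≤ (eLpNorm w ⊤ volume).toReal := by
  filter_upwards [ae_le_eLpNormEssSup (f := w) (μ := volume)] with x hx
  rw [← toReal_enorm]
  exact ENNReal.toReal_mono hw.2.ne (by simpa using hx)

theorem cv_integrable {k w : Space d → ℂ} (hk : Integrable k volume) (hw : MemLp w ⊤ volume)
    (x : Space d) : Integrable (fun y => k y * w (x - y)) volume := by
  refine hk.mul_bdd (c := (eLpNorm w ⊤ volume).toReal) (aestronglyMeasurable_comp_sub hw.1 x) ?_
  exact (Measure.measurePreserving_sub_left volume x).quasiMeasurePreserving.ae (ae_norm_le_of_memLp_top hw)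

theorem aestronglyMeasurable_cv {k w : Space d → ℂ} (hk : AEStronglyMeasurable k volume)
    (hw : AEStronglyMeasurable w volume) : AEStronglyMeasurable (cv k w) volume :=
  (hk.convolution_integrand (ContinuousLinearMap.mul ℂ ℂ) hw).integral_prod_right'

theorem enorm_cv_le {k w : Space d → ℂ} (hk : AEStronglyMeasurable k volume) (x : Space d) :
    ‖cv k w x‖ₑ ≤ eLpNorm k 1 volume * eLpNorm w ⊤ volume := by
  refine (enorm_integral_le_lintegral_enorm _).trans ?_
  rw [eLpNorm_one_eq_lintegral_enorm, ← lintegral_mul_const'' _ hk.enorm]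
  refine lintegral_mono_ae ?_
  have := (Measure.measurePreserving_sub_left volume x).quasiMeasurePreserving.ae
    (ae_le_eLpNormEssSup (f := w) (μ := volume))
  filter_upwards [this] with y hy
  rw [enorm_mul]
  gcongr
  simpa using hy

theorem eLpNorm_cv_top_le {k w : Space d → ℂ} (hk : AEStronglyMeasurable k volume) :
    eLpNorm (cv k w) ⊤ volume ≤ eLpNorm k 1 volume * eLpNorm w ⊤ volume := by
  rw [eLpNorm_exponent_top]
  exact eLpNormEssSup_le_of_ae_enorm_bound (ae_of_all _ fun x => enorm_cv_le hk x)

/-- Young's inequality `L¹ * L^p ⊆ L^p`. -/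
theorem eLpNorm_cv_le {k w : Space d → ℂ} (hk : AEStronglyMeasurable k volume)
    (hw : AEStronglyMeasurable w volume) {p : ℝ} (hp : 1 ≤ p) :
    eLpNorm (cv k w) (ENNReal.ofReal p) volume ≤
      eLpNorm k 1 volume * eLpNorm w (ENNReal.ofReal p) volume := by
  rw [eLpNorm_one_eq_lintegral_enorm]
  exact eLpNorm_integral_translate_le hk measurable_id hw hp

theorem memLp_cv_top {k w : Space d → ℂ} (hk : Integrable k volume) (hw : MemLp w ⊤ volume) :
    MemLp (cv k w) ⊤ volume :=
  ⟨aestronglyMeasurable_cv hk.1 hw.1, (eLpNorm_cv_top_le hk.1).trans_lt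
    (ENNReal.mul_lt_top (by simpa [memLp_one_iff_integrable] using (memLp_one_iff_integrable.2 hk).2)
      hw.2)⟩

/-- Hölder's inequality for a convolution. -/
theorem enorm_cv_le_holder {k w : Space d → ℂ} (hk : AEStronglyMeasurable k volume)
    (hw : AEStronglyMeasurable w volume) {p q : ℝ} (hpq : p.HolderConjugate q) (x : Space d) :
    ‖cv k w x‖ₑ ≤ eLpNorm k (ENNReal.ofReal q) volume * eLpNorm w (ENNReal.ofReal p) volume := by
  refine (enorm_integral_le_lintegral_enorm _).trans ?_
  simp_rw [enorm_mul]
  refine (ENNReal.lintegral_mul_le_Lp_mul_Lq volume hpq.symm hk.enorm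
    (aestronglyMeasurable_comp_sub hw x).enorm).trans_eq ?_
  have hp := hpq.pos
  have hq := hpq.symm.pos
  rw [eLpNorm_eq_lintegral_rpow_enorm_toReal (by simpa using hq) ENNReal.ofReal_ne_top,
    eLpNorm_eq_lintegral_rpow_enorm_toReal (by simpa using hp) ENNReal.ofReal_ne_top,
    ENNReal.toReal_ofReal hp.le, ENNReal.toReal_ofReal hq.le]
  congr 2
  exact lintegral_sub_left_eq_self (fun y => ‖w y‖ₑ ^ p) x

theorem HasKer.aesm {m k : Space d → ℂ} (h : HasKer m k) : AEStronglyMeasurable k volume := h.1.1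

theorem HasKer.bound {m k : Space d → ℂ} (h : HasKer m k) (η : Space d) :
    ‖m η‖ ≤ ∫ y, ‖k y‖ := by
  rw [← h.2 η]
  exact VectorFourier.norm_fourierIntegral_le_integral_norm _ _ _ _ _

theorem HasKer.continuous {m k : Space d → ℂ} (h : HasKer m k) : Continuous m := by
  have : m = 𝓕 k := funext fun η => (h.2 η).symm
  rw [this]
  exact VectorFourier.fourierIntegral_continuous Real.continuous_fourierChar continuous_inner h.1

/-- The transpose of a multiplier with an integrable kernel. -/
theorem HasKer.transpose {m k : Space d → ℂ} (h : HasKer m k) (φ : 𝓢(Space d, ℂ)) (x : Space d) :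
    𝓕 (fun η => m η * (𝓕⁻ φ : 𝓢(Space d, ℂ)) η) x = ∫ y, k y * φ (x + y) := by
  set ψ : 𝓢(Space d, ℂ) := 𝓕⁻ φ with hψ
  have hφ : φ = 𝓕 ψ := by simp [hψ]
  have h1 : ∀ η, m η = 𝓕 k η := fun η => (h.2 η).symm
  have hint : Integrable (fun η => Real.fourierChar (-inner ℝ η x) • ψ η) := by
    simpa using (Real.fourierIntegral_convergent_iff x).2 ψ.integrable
  have key := VectorFourier.integral_fourierIntegral_smul_eq_flip (μ := volume) (ν := volume)
    (L := innerₗ (Space d)) (e := Real.fourierChar) Real.continuous_fourierChar continuous_inner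
    h.1 hint
  rw [Real.fourier_eq]
  calc _ = ∫ ξ, VectorFourier.fourierIntegral Real.fourierChar volume (innerₗ (Space d)) k ξ •
        (Real.fourierChar (-inner ℝ ξ x) • ψ ξ) := by
        refine integral_congr_ae (ae_of_all _ fun η => ?_)
        simp only [h1, Circle.smul_def, smul_eq_mul]
        rw [mul_left_comm]; rfl
    _ = _ := key
    _ = _ := by
        refine integral_congr_ae (ae_of_all _ fun y => ?_)
        simp only [smul_eq_mul]
        congr 1
        rw [hφ, SchwartzMap.fourier_coe, Real.fourier_eq]
        simp only [VectorFourier.fourierIntegral]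
        refine integral_congr_ae (ae_of_all _ fun η => ?_)
        simp only [LinearMap.flip_apply, innerₗ_apply_apply, inner_add_right, neg_add,
          AddChar.map_add_eq_mul, smul_smul, real_inner_comm]
        rw [mul_comm]

/-- Fubini's theorem for a convolution tested against a Schwartz function. -/
theorem integral_mul_cv {k w : Space d → ℂ} (hk : Integrable k volume) (hw : MemLp w ⊤ volume)
    (φ : 𝓢(Space d, ℂ)) :
    Integrable (fun x => (∫ y, k y * φ (x + y)) * w x) volume ∧
      ∫ x, φ x * cv k w x = ∫ x, (∫ y, k y * φ (x + y)) * w x := by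
  have hφ : Integrable φ volume := φ.integrable
  -- the joint integrand is dominated by `‖k y‖ ‖φ (x + y)‖`
  have h1 : Integrable (fun z : Space d × Space d => k z.2 * φ (z.1 + z.2))
      (volume.prod volume) := by
    have h := (hk.mul_prod hφ).swap
    have hm : MeasurePreserving (fun z : Space d × Space d => (z.1 + z.2, z.2))
        (volume.prod volume) (volume.prod volume) := measurePreserving_add_prod volume volume
    exact (hm.integrable_comp h.1).2 h
  have h2 : Integrable (fun z : Space d × Space d => k z.2 * φ (z.1 + z.2) * w z.1)
      (volume.prod volume) := by
    refine h1.mul_bdd (c := (eLpNorm w ⊤ volume).toReal) hw.1.comp_fst ?_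
    exact Measure.quasiMeasurePreserving_fst.ae (ae_norm_le_of_memLp_top hw)
  refine ⟨?_, ?_⟩
  · have := h2.integral_prod_left
    refine this.congr (ae_of_all _ fun x => ?_)
    simp only [integral_mul_const]
  · have h3 : ∫ x, (∫ y, k y * φ (x + y)) * w x = ∫ x, ∫ y, k y * φ (x + y) * w x := by
      simp only [integral_mul_const]
    rw [h3, integral_integral_swap h2]
    have h4 : ∀ y, ∫ x, k y * φ (x + y) * w x = ∫ x, k y * φ x * w (x - y) := by
      intro y
      rw [← integral_add_right_eq_self (fun x => k y * φ x * w (x - y)) y]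
      simp
    simp_rw [h4]
    have h5 : Integrable (fun z : Space d × Space d => k z.2 * φ z.1 * w (z.1 - z.2))
        (volume.prod volume) := by
      have hm : MeasurePreserving (fun z : Space d × Space d => (z.1 - z.2, z.2))
        (volume.prod volume) (volume.prod volume) := measurePreserving_sub_prod volume volume
      have := (hm.integrable_comp h2.1).2 h2
      refine this.congr (ae_of_all _ fun z => ?_)
      simp
    rw [← integral_integral_swap h5]
    refine integral_congr_ae (ae_of_all _ fun x => ?_)
    simp only [cv]
    rw [← integral_const_mul]
    refine integral_congr_ae (ae_of_all _ fun y => ?_)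
    simp only
    ring

/-- An integrable kernel is determined by its Fourier transform. -/
theorem HasKer.unique {m k k' : Space d → ℂ} (h : HasKer m k) (h' : HasKer m k') :
    k =ᵐ[volume] k' := by
  have hint := h.1.sub h'.1
  have h0 : ∀ φ : 𝓢(Space d, ℂ), ∫ x, (k - k') x * φ x = 0 := by
    intro φ
    set ψ : 𝓢(Space d, ℂ) := 𝓕⁻ φ with hψ
    have hφ : φ = 𝓕 ψ := by simp [hψ]
    have key := VectorFourier.integral_fourierIntegral_smul_eq_flip (μ := volume) (ν := volume)
      (L := innerₗ (Space d)) (e := Real.fourierChar) Real.continuous_fourierChar continuous_inner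
      hint ψ.integrable
    have e1 : ∀ ξ, VectorFourier.fourierIntegral Real.fourierChar volume (innerₗ (Space d))
        (k - k') ξ = 0 := by
      intro ξ
      rw [sub_eq_add_neg, VectorFourier.fourierIntegral_add Real.continuous_fourierChar
        continuous_inner h.1 h'.1.neg]
      have : VectorFourier.fourierIntegral Real.fourierChar volume (innerₗ (Space d)) (-k') =
        -VectorFourier.fourierIntegral Real.fourierChar volume (innerₗ (Space d)) k' := by
        ext η
        simp [VectorFourier.fourierIntegral, integral_neg]
      have a1 := h.2 ξ
      have a2 := h'.2 ξ
      rw [this]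
      simp only [Pi.add_apply, Pi.neg_apply]
      change 𝓕 k ξ + -𝓕 k' ξ = 0
      rw [a1, a2]; ring
    simp only [e1, zero_smul, integral_zero] at key
    rw [hφ, SchwartzMap.fourier_coe]
    rw [key]
    refine integral_congr_ae (ae_of_all _ fun y => ?_)
    simp only [smul_eq_mul]
    congr 1
    simp only [Real.fourier_eq, VectorFourier.fourierIntegral, LinearMap.flip_apply,
      innerₗ_apply_apply]
    simp [real_inner_comm]
  have := ae_eq_zero_of_integral_contDiff_smul_eq_zero hint.locallyIntegrable (fun g hg hc => by
    have hc' : HasCompactSupport (fun x => (g x : ℂ)) := hc.comp_left (g := ((↑) : ℝ → ℂ)) rfl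
    have hg' : ContDiff ℝ ∞ (fun x => (g x : ℂ)) := Complex.ofRealCLM.contDiff.comp hg
    have := h0 (hc'.toSchwartzMap hg')
    rw [← this]
    refine integral_congr_ae (ae_of_all _ fun y => ?_)
    simp [mul_comm])
  filter_upwards [this] with x hx
  exact sub_eq_zero.1 hx

/-- Convolving with a kernel of `m'` and then with one of `m` is convolving with one of `m m'`. -/
theorem cv_cv {m m' k k' k'' w : Space d → ℂ} (h : HasKer m k) (h' : HasKer m' k')
    (h'' : HasKer (fun η => m η * m' η) k'') (hw : MemLp w ⊤ volume) :
    cv k (cv k' w) = cv k'' w := by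
  set L := ContinuousLinearMap.mul ℂ ℂ with hL
  have hc : HasKer (fun η => m η * m' η) (MeasureTheory.convolution k k' L volume) := by
    refine ⟨h.1.integrable_convolution L h'.1, fun η => ?_⟩
    rw [Real.fourier_mul_convolution_eq h.1 h'.1, h.2, h'.2]
  rw [cv_congr_ae_left (h''.unique hc)]
  ext x
  have hj : Integrable (fun z : Space d × Space d => k z.1 * k' (z.2 - z.1)) (volume.prod volume) := by
    have hh := h.1.convolution_integrand L h'.1
    exact hh.swap
  have hj2 : Integrable (fun z : Space d × Space d => k z.1 * k' (z.2 - z.1) * w (x - z.2))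
      (volume.prod volume) := by
    refine hj.mul_bdd (c := (eLpNorm w ⊤ volume).toReal)
      (aestronglyMeasurable_comp_sub hw.1 x).comp_snd ?_
    exact Measure.quasiMeasurePreserving_snd.ae ((Measure.measurePreserving_sub_left volume x).quasiMeasurePreserving.ae
      (ae_norm_le_of_memLp_top hw))
  simp only [cv, MeasureTheory.convolution, hL, ContinuousLinearMap.mul_apply']
  calc ∫ y, k y * ∫ z, k' z * w (x - y - z)
      = ∫ y, ∫ u, k y * k' (u - y) * w (x - u) := by
        refine integral_congr_ae (ae_of_all _ fun y => ?_)
        simp only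
        rw [← integral_sub_right_eq_self (fun z => k' z * w (x - y - z)) y, ← integral_const_mul]
        refine integral_congr_ae (ae_of_all _ fun u => ?_)
        simp only [sub_sub_sub_cancel_right, mul_assoc]
    _ = ∫ u, ∫ y, k y * k' (u - y) * w (x - u) := integral_integral_swap hj2
    _ = _ := by simp only [integral_mul_const]

/-- The kernel of a smooth compactly supported symbol. -/
theorem exists_hasKer_of_smooth {θ : Space d → ℂ} (h1 : ContDiff ℝ ∞ θ) (h2 : HasCompactSupport θ) :
    ∃ k : 𝓢(Space d, ℂ), HasKer θ k := by
  refine ⟨𝓕⁻ (h2.toSchwartzMap h1), SchwartzMap.integrable _, fun η => ?_⟩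
  rw [← SchwartzMap.fourier_coe]
  simp

/-! ### Dilations -/

theorem lintegral_comp_inv_smul (f : Space d → ℝ≥0∞) {c : ℝ} (hc : 0 < c) :
    ∫⁻ x, f (c⁻¹ • x) = ENNReal.ofReal (c ^ d) * ∫⁻ x, f x := by
  have h1 : ∫⁻ x, f (c⁻¹ • x) = ∫⁻ y, f y ∂(Measure.map (fun x => c⁻¹ • x) volume) :=
    (lintegral_map_equiv f (Homeomorph.smul
      (isUnit_iff_ne_zero.2 (inv_ne_zero hc.ne')).unit).toMeasurableEquiv).symm
  rw [h1, Measure.map_addHaar_smul volume (inv_ne_zero hc.ne'), lintegral_smul_measure]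
  simp [abs_of_pos (pow_pos hc d)]

theorem HasKer.dilate {m k : Space d → ℂ} (h : HasKer m k) {c : ℝ} (hc : 0 < c) :
    HasKer (fun η => m (c • η)) (fun x => ((c⁻¹ ^ d : ℝ) : ℂ) * k (c⁻¹ • x)) := by
  refine ⟨(h.1.comp_smul (inv_ne_zero hc.ne')).const_mul _, fun η => ?_⟩
  simp only
  rw [← h.2, Real.fourier_eq, Real.fourier_eq]
  have h2 := Measure.integral_comp_inv_smul_of_nonneg (volume : Measure (Space d))
    (fun v => Real.fourierChar (-inner ℝ v (c • η)) • k v) hc.le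
  have h3 : ∀ v : Space d, inner ℝ (c⁻¹ • v) (c • η) = (inner ℝ v η : ℝ) := by
    intro v
    rw [inner_smul_left, inner_smul_right]
    simp [inv_mul_cancel_left₀ hc.ne']
  simp only [h3, finrank_euclideanSpace, Fintype.card_fin] at h2
  have h4 : ∀ v : Space d, Real.fourierChar (-inner ℝ v η) • (((c⁻¹ ^ d : ℝ) : ℂ) * k (c⁻¹ • v)) =
      (c⁻¹ ^ d : ℝ) • (Real.fourierChar (-inner ℝ v η) • k (c⁻¹ • v)) := by
    intro v
    simp only [Circle.smul_def, smul_eq_mul, Complex.real_smul]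
    ring
  simp_rw [h4]
  rw [integral_smul, h2, smul_smul, ← mul_pow, inv_mul_cancel₀ hc.ne', one_pow, one_smul]

theorem eLpNorm_dilate {k : Space d → ℂ} {c : ℝ} (hc : 0 < c) {q : ℝ} (hq : 1 ≤ q) :
    eLpNorm (fun x => ((c⁻¹ ^ d : ℝ) : ℂ) * k (c⁻¹ • x)) (ENNReal.ofReal q) volume =
      ENNReal.ofReal (c ^ (-(d * (1 - 1 / q)) : ℝ)) * eLpNorm k (ENNReal.ofReal q) volume := by
  have hq0 : 0 < q := by linarith
  rw [eLpNorm_eq_lintegral_rpow_enorm_toReal (by simpa using hq0) ENNReal.ofReal_ne_top,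
    eLpNorm_eq_lintegral_rpow_enorm_toReal (by simpa using hq0) ENNReal.ofReal_ne_top,
    ENNReal.toReal_ofReal hq0.le]
  have hcd : 0 < c⁻¹ ^ d := pow_pos (inv_pos.2 hc) d
  have h1 : ∀ x : Space d, ‖((c⁻¹ ^ d : ℝ) : ℂ) * k (c⁻¹ • x)‖ₑ ^ q =
      ENNReal.ofReal (c⁻¹ ^ d) ^ q * ‖k (c⁻¹ • x)‖ₑ ^ q := by
    intro x
    rw [enorm_mul, ENNReal.mul_rpow_of_nonneg _ _ hq0.le]
    congr 2
    rw [← ofReal_norm, Complex.norm_real, Real.norm_of_nonneg hcd.le]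
  simp_rw [h1]
  rw [lintegral_const_mul' _ _ (by finiteness), lintegral_comp_inv_smul (fun x => ‖k x‖ₑ ^ q) hc,
    ← mul_assoc, ENNReal.mul_rpow_of_nonneg _ _ (by positivity)]
  congr 1
  rw [ENNReal.mul_rpow_of_nonneg _ _ (by positivity), ← ENNReal.rpow_mul,
    mul_one_div_cancel hq0.ne', ENNReal.rpow_one,
    ENNReal.ofReal_rpow_of_nonneg (by positivity) (by positivity),
    ← ENNReal.ofReal_mul (by positivity)]
  congr 1
  rw [← Real.rpow_natCast c d, ← Real.rpow_natCast c⁻¹ d, ← Real.rpow_mul hc.le,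
    Real.inv_rpow hc.le, ← Real.rpow_neg hc.le, ← Real.rpow_add hc]
  congr 1
  ring

theorem eLpNorm_one_dilate {k : Space d → ℂ} {c : ℝ} (hc : 0 < c) :
    eLpNorm (fun x => ((c⁻¹ ^ d : ℝ) : ℂ) * k (c⁻¹ • x)) 1 volume = eLpNorm k 1 volume := by
  have := eLpNorm_dilate (k := k) hc (q := 1) le_rfl
  simpa using this

/-! ### Poisson kernels -/

/-- The Fourier transform of `e^{-b|x|}` on the line. -/
theorem fourier_exp_neg_abs {b : ℝ} (hb : 0 < b) (ξ : ℝ) :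
    Integrable (fun x : ℝ => (Real.exp (-b * |x|) : ℂ)) ∧
    𝓕 (fun x : ℝ => (Real.exp (-b * |x|) : ℂ)) ξ =
      ((2 * b / (b ^ 2 + (2 * Real.pi * ξ) ^ 2) : ℝ) : ℂ) := by
  set α : ℂ := b - 2 * Real.pi * ξ * Complex.I with hα
  set β : ℂ := -b - 2 * Real.pi * ξ * Complex.I with hβ
  have hαr : 0 < α.re := by simp [hα, hb]
  have hβr : β.re < 0 := by simp [hβ, hb]
  have e1 : Set.EqOn (fun x : ℝ => Real.fourierChar (-(x * ξ)) • (Real.exp (-b * |x|) : ℂ))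
      (fun x => Complex.exp (α * x)) (Set.Iic 0) := by
    intro x hx
    simp only [Circle.smul_def, Real.fourierChar_apply, smul_eq_mul, abs_of_nonpos hx.out,
      Complex.ofReal_exp, ← Complex.exp_add, hα]
    congr 1
    push_cast
    ring
  have e2 : Set.EqOn (fun x : ℝ => Real.fourierChar (-(x * ξ)) • (Real.exp (-b * |x|) : ℂ))
      (fun x => Complex.exp (β * x)) (Set.Ioi 0) := by
    intro x hx
    simp only [Circle.smul_def, Real.fourierChar_apply, smul_eq_mul, abs_of_pos hx.out,
      Complex.ofReal_exp, ← Complex.exp_add, hβ]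
    congr 1
    push_cast
    ring
  have i1 : IntegrableOn (fun x : ℝ => Real.fourierChar (-(x * ξ)) • (Real.exp (-b * |x|) : ℂ))
      (Set.Iic 0) :=
    (integrableOn_exp_mul_complex_Iic hαr 0).congr_fun e1.symm measurableSet_Iic
  have i2 : IntegrableOn (fun x : ℝ => Real.fourierChar (-(x * ξ)) • (Real.exp (-b * |x|) : ℂ))
      (Set.Ioi 0) :=
    (integrableOn_exp_mul_complex_Ioi hβr 0).congr_fun e2.symm measurableSet_Ioi
  refine ⟨?_, ?_⟩
  · have h := (i1.union i2)
    rw [Set.Iic_union_Ioi, integrableOn_univ] at h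
    have h' := (Real.fourierIntegral_convergent_iff (V := ℝ) (μ := volume)
      (f := fun x : ℝ => (Real.exp (-b * |x|) : ℂ)) ξ).1
    refine h' (h.congr (ae_of_all _ fun x => ?_))
    simp [mul_comm]
  · rw [Real.fourier_real_eq, ← intervalIntegral.integral_Iic_add_Ioi i1 i2,
      setIntegral_congr_fun measurableSet_Iic e1, setIntegral_congr_fun measurableSet_Ioi e2,
      integral_exp_mul_complex_Iic hαr, integral_exp_mul_complex_Ioi hβr]
    have hα0 : α ≠ 0 := fun h => by simp [h] at hαr
    have hβ0 : β ≠ 0 := fun h => by simp [h] at hβr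
    have hD : ((b ^ 2 + (2 * Real.pi * ξ) ^ 2 : ℝ) : ℂ) = -(α * β) := by
      simp only [hα, hβ]; push_cast; ring_nf; simp [Complex.I_sq]
    rw [Complex.ofReal_div, hD]
    simp only [Complex.ofReal_zero, mul_zero, Complex.exp_zero]
    have : β - α = -(2 * b : ℂ) := by simp only [hα, hβ]; ring
    field_simp
    push_cast
    linear_combination this

/-- The Poisson kernel as a probability measure on the line: its Fourier transform is
`e^{-b|ξ|}`. For `b = 0` it is the Dirac mass. -/
theorem exists_poisson {b : ℝ} (hb : 0 ≤ b) :
    ∃ ν : Measure ℝ, IsProbabilityMeasure ν ∧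
      ∀ ξ : ℝ, ∫ s, (Real.fourierChar (-(s * ξ)) : ℂ) ∂ν = (Real.exp (-b * |ξ|) : ℝ) := by
  rcases hb.eq_or_lt with rfl | hb
  · exact ⟨Measure.dirac 0, inferInstance, fun ξ => by simp⟩
  set f : ℝ → ℂ := fun x : ℝ => (Real.exp (-b * |x|) : ℂ) with hf
  set g : ℝ → ℝ := fun ξ => 2 * b / (b ^ 2 + (2 * Real.pi * ξ) ^ 2) with hg
  have hfg : 𝓕 f = fun ξ => (g ξ : ℂ) := funext fun ξ => (fourier_exp_neg_abs hb ξ).2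
  have hgc : Continuous g := by
    refine continuous_const.div (by fun_prop) fun ξ => ?_
    positivity
  have hg0 : ∀ ξ, 0 ≤ g ξ := fun ξ => by simp only [hg]; positivity
  have hgi : Integrable g := by
    have h1 := integrable_inv_one_add_sq.comp_mul_left' (R := 2 * Real.pi / b) (by positivity)
    refine (h1.const_mul (2 / b)).congr (ae_of_all _ fun ξ => ?_)
    simp only [hg]
    field_simp
  have hinv : ∀ x, 𝓕⁻ (fun ξ => (g ξ : ℂ)) x = f x := by
    intro x
    rw [← hfg]
    refine (fourier_exp_neg_abs hb 0).1.fourierInv_fourier_eq ?_ ?_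
    · rw [hfg]; exact hgi.ofReal
    · exact Continuous.continuousAt (by fun_prop)
  have hint : ∀ ξ : ℝ, ∫ s, (Real.fourierChar (-(s * ξ)) : ℂ) * (g s : ℂ) =
      (Real.exp (-b * |ξ|) : ℝ) := by
    intro ξ
    have := hinv (-ξ)
    rw [Real.fourierInv_eq] at this
    simp only [hf, abs_neg] at this
    rw [← this]
    refine integral_congr_ae (ae_of_all _ fun s => ?_)
    simp [Circle.smul_def, mul_comm]
  refine ⟨volume.withDensity (fun s => ENNReal.ofReal (g s)), ?_, fun ξ => ?_⟩
  · constructor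
    rw [withDensity_apply _ MeasurableSet.univ, Measure.restrict_univ,
      ← ofReal_integral_eq_lintegral_ofReal hgi (ae_of_all _ hg0)]
    have := hint 0
    simp only [mul_zero, neg_zero, AddChar.map_zero_eq_one, Circle.coe_one, one_mul, abs_zero,
      Real.exp_zero] at this
    rw [integral_complex_ofReal] at this
    rw [Complex.ofReal_inj.1 this]
    simp
  · rw [integral_withDensity_eq_integral_toReal_smul hgc.measurable.ennreal_ofReal
      (ae_of_all _ fun _ => ENNReal.ofReal_lt_top), ← hint ξ]
    refine integral_congr_ae (ae_of_all _ fun s => ?_)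
    simp only [ENNReal.toReal_ofReal (hg0 s), Complex.real_smul]
    ring

/-- The Poisson kernel in the direction of a coordinate axis. -/
theorem exists_poisson_coord (i : Fin d) {b : ℝ} (hb : 0 ≤ b) :
    ∃ μ : Measure (Space d), IsProbabilityMeasure μ ∧
      ∀ η : Space d, ∫ y, (Real.fourierChar (-inner ℝ y η) : ℂ) ∂μ =
        (Real.exp (-b * |η i|) : ℝ) := by
  obtain ⟨ν, hν, h⟩ := exists_poisson hb
  have hm : Measurable (fun s : ℝ => EuclideanSpace.single i s) := by
    have h1 : (fun s : ℝ => EuclideanSpace.single i s) =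
        fun s : ℝ => s • EuclideanSpace.single i (1 : ℝ) := by
      ext s j
      by_cases hj : j = i <;> simp [hj]
    rw [h1]
    exact (by fun_prop : Continuous fun s : ℝ => s • EuclideanSpace.single i (1 : ℝ)).measurable
  refine ⟨ν.map (fun s => EuclideanSpace.single i s), Measure.isProbabilityMeasure_map
    hm.aemeasurable, fun η => ?_⟩
  rw [integral_map hm.aemeasurable (Continuous.aestronglyMeasurable (by fun_prop)), ← h (η i)]
  refine integral_congr_ae (ae_of_all _ fun s => ?_)
  simp [EuclideanSpace.inner_single_left]

/-- Multiplying a symbol by the Fourier transform of a probability measure does not increase the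
`L¹` norm of its kernel. -/
theorem HasKer.mul_measure {m k : Space d → ℂ} (h : HasKer m k) (μ : Measure (Space d))
    [IsProbabilityMeasure μ] :
    HasKer (fun η => m η * ∫ y, (Real.fourierChar (-inner ℝ y η) : ℂ) ∂μ)
      (fun x => ∫ y, k (x - y) ∂μ) ∧
    eLpNorm (fun x => ∫ y, k (x - y) ∂μ) 1 volume ≤ eLpNorm k 1 volume := by
  have hmp : MeasurePreserving (fun z : Space d × Space d => (z.1, z.2 - z.1)) (μ.prod volume)
      (μ.prod volume) := by
    refine MeasurePreserving.skew_product (f := id) (g := fun o x => x - o)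
      (MeasurePreserving.id μ) (by fun_prop) (ae_of_all _ fun o => ?_)
    exact (measurePreserving_sub_right volume o).map_eq
  have hj : Integrable (fun z : Space d × Space d => k (z.2 - z.1)) (μ.prod volume) :=
    (hmp.integrable_comp (h.1.comp_snd (μ := μ)).1).2 (h.1.comp_snd (μ := μ))
  refine ⟨⟨hj.integral_prod_right, fun η => ?_⟩, ?_⟩
  · rw [Real.fourier_eq]
    have hj2 : Integrable (fun z : Space d × Space d =>
        (Real.fourierChar (-inner ℝ z.2 η) : ℂ) * k (z.2 - z.1)) (μ.prod volume) := by
      refine hj.bdd_mul (c := 1) (Continuous.aestronglyMeasurable (by fun_prop)) ?_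
      exact ae_of_all _ fun z => (Circle.norm_coe _).le
    have h1 : ∀ v : Space d, Real.fourierChar (-inner ℝ v η) • ∫ y, k (v - y) ∂μ =
        ∫ y, (Real.fourierChar (-inner ℝ v η) : ℂ) * k (v - y) ∂μ := by
      intro v
      rw [integral_const_mul]; rfl
    simp_rw [h1]
    rw [← integral_integral_swap (f := fun y v => (Real.fourierChar (-inner ℝ v η) : ℂ) * k (v - y))
      hj2, ← integral_const_mul]
    refine integral_congr_ae (ae_of_all _ fun y => ?_)
    simp only
    rw [← integral_add_right_eq_self (fun v => (Real.fourierChar (-inner ℝ v η) : ℂ) * k (v - y)) y,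
      ← h.2, Real.fourier_eq, ← integral_mul_const]
    refine integral_congr_ae (ae_of_all _ fun v => ?_)
    simp only [add_sub_cancel_right, inner_add_left, neg_add, AddChar.map_add_eq_mul,
      Circle.smul_def, smul_eq_mul, Circle.coe_mul]
    ring
  · have := eLpNorm_integral_translate_le (μ := μ) (k := fun _ => 1) aestronglyMeasurable_const
      (τ := id) measurable_id h.1.1 (p := 1) le_rfl
    simpa using this

theorem exists_hasKer_mul_exp_neg {m k : Space d → ℂ} (h : HasKer m k) {b : ℝ} (hb : 0 ≤ b)
    (S : Finset (Fin d)) :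
    ∃ k', HasKer (fun η => m η * (Real.exp (-b * ∑ i ∈ S, |η i|) : ℝ)) k' ∧
      eLpNorm k' 1 volume ≤ eLpNorm k 1 volume := by
  induction S using Finset.induction_on with
  | empty => exact ⟨k, by simpa using h, le_rfl⟩
  | insert i S hi ih =>
    obtain ⟨k', h1, h2⟩ := ih
    obtain ⟨μ, hμ, h3⟩ := exists_poisson_coord i hb
    refine ⟨_, ?_, (h1.mul_measure μ).2.trans h2⟩
    convert (h1.mul_measure μ).1 using 2 with η
    rw [h3, Finset.sum_insert hi, mul_add, add_comm, Real.exp_add]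
    push_cast
    ring

theorem HasKer.sub {m k m' k' : Space d → ℂ} (h : HasKer m k) (h' : HasKer m' k') :
    HasKer (fun η => m η - m' η) (fun x => k x - k' x) := by
  refine ⟨h.1.sub h'.1, fun η => ?_⟩
  simp only
  rw [← h.2, ← h'.2, Real.fourier_eq, Real.fourier_eq, Real.fourier_eq, ← integral_sub]
  · simp only [smul_sub]
  · simpa using (Real.fourierIntegral_convergent_iff η).2 h.1
  · simpa using (Real.fourierIntegral_convergent_iff η).2 h'.1

/-- A smooth compactly supported symbol times `e^{b |η|₁}` has an integrable kernel, because
`e^{b|t|} = 2 cosh (b t) - e^{-b|t|}`. -/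
theorem exists_hasKer_mul_exp {b : ℝ} (hb : 0 ≤ b) (S : Finset (Fin d)) {θ : Space d → ℂ}
    (h1 : ContDiff ℝ ∞ θ) (h2 : HasCompactSupport θ) :
    ∃ k, HasKer (fun η => θ η * (Real.exp (b * ∑ i ∈ S, |η i|) : ℝ)) k := by
  induction S using Finset.induction_on generalizing θ with
  | empty =>
    obtain ⟨k, hk⟩ := exists_hasKer_of_smooth h1 h2
    exact ⟨k, by simpa using hk⟩
  | insert i S hi ih =>
    have hc : ContDiff ℝ ∞ (fun η : Space d => ((2 * Real.cosh (b * η i) : ℝ) : ℂ)) := by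
      refine Complex.ofRealCLM.contDiff.comp ?_
      have : ContDiff ℝ ∞ (fun η : Space d => η i) :=
        (EuclideanSpace.proj (𝕜 := ℝ) i).contDiff
      exact contDiff_const.mul (Real.contDiff_cosh.comp (contDiff_const.mul this))
    obtain ⟨k₁, hk₁⟩ := ih (θ := fun η => θ η * ((2 * Real.cosh (b * η i) : ℝ) : ℂ)) (h1.mul hc)
      h2.mul_right
    obtain ⟨k₂, hk₂⟩ := ih h1 h2
    obtain ⟨k₃, hk₃, -⟩ := exists_hasKer_mul_exp_neg hk₂ hb {i}
    refine ⟨fun x => k₁ x - k₃ x, ?_⟩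
    convert hk₁.sub hk₃ using 2 with η
    have hexp : Real.exp (b * |η i|) = 2 * Real.cosh (b * η i) - Real.exp (-b * |η i|) := by
      rw [Real.cosh_eq]
      rcases abs_cases (η i) with ⟨h, -⟩ | ⟨h, -⟩ <;> rw [h] <;> ring_nf
    rw [Finset.sum_insert hi, mul_add, Real.exp_add, hexp, Finset.sum_singleton]
    push_cast
    ring

/-! ### Bounded, compactly supported spectra -/

/-- A bounded measurable function on the frequency side which vanishes outside a ball. -/
structure Spec (h : Space d → ℂ) : Prop where
  meas : Measurable h
  bdd : ∃ C, ∀ η, ‖h η‖ ≤ C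
  supp : ∃ R, ∀ η, R < ‖η‖ → h η = 0

theorem Spec.memLp {h : Space d → ℂ} (hh : Spec h) (p : ℝ≥0∞) : MemLp h p volume := by
  obtain ⟨C, hC⟩ := hh.bdd
  obtain ⟨R, hR⟩ := hh.supp
  have h1 : MemLp h p (volume.restrict (Metric.closedBall 0 R)) :=
    have : IsFiniteMeasure (volume.restrict (Metric.closedBall (0 : Space d) R)) :=
      ⟨by simpa using measure_closedBall_lt_top⟩
    MemLp.of_bound hh.meas.aestronglyMeasurable C (ae_of_all _ hC)
  rw [← memLp_indicator_iff_restrict Metric.isClosed_closedBall.measurableSet] at h1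
  convert h1 using 1
  ext η
  by_cases hη : η ∈ Metric.closedBall (0 : Space d) R
  · rw [Set.indicator_of_mem hη]
  · rw [Set.indicator_of_notMem hη]
    exact hR η (by simpa using hη)

theorem Spec.integrable {h : Space d → ℂ} (hh : Spec h) : Integrable h volume :=
  memLp_one_iff_integrable.1 (hh.memLp 1)

theorem Spec.mul_bdd {h m : Space d → ℂ} (hh : Spec h) (hm : Measurable m) {C : ℝ}
    (hC : ∀ η, ‖m η‖ ≤ C) : Spec (fun η => m η * h η) := by
  obtain ⟨D, hD⟩ := hh.bdd
  obtain ⟨R, hR⟩ := hh.supp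
  refine ⟨hm.mul hh.meas, ⟨C * D, fun η => ?_⟩, R, fun η hη => by simp [hR η hη]⟩
  rw [norm_mul]
  exact mul_le_mul (hC η) (hD η) (norm_nonneg _) ((norm_nonneg _).trans (hC η))

theorem Spec.exists_norm_mul_le {h m : Space d → ℂ} (hh : Spec h) (hm : Continuous m) :
    ∃ C, 0 ≤ C ∧ ∀ η, h η ≠ 0 → ‖m η‖ ≤ C := by
  obtain ⟨R, hR⟩ := hh.supp
  obtain ⟨C, hC⟩ := (isCompact_closedBall (0 : Space d) R).exists_bound_of_continuousOn
    hm.continuousOn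
  refine ⟨max C 0, le_max_right _ _, fun η hη => (hC η ?_).trans (le_max_left _ _)⟩
  by_contra hn
  exact hη (hR η (by simpa using hn))

theorem Spec.mul_cont {h m : Space d → ℂ} (hh : Spec h) (hm : Continuous m) :
    Spec (fun η => m η * h η) := by
  obtain ⟨C, hC0, hC⟩ := hh.exists_norm_mul_le hm
  obtain ⟨D, hD⟩ := hh.bdd
  obtain ⟨R, hR⟩ := hh.supp
  refine ⟨hm.measurable.mul hh.meas, ⟨C * D, fun η => ?_⟩, R, fun η hη => by simp [hR η hη]⟩
  by_cases h0 : h η = 0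
  · simpa [h0] using mul_nonneg hC0 ((norm_nonneg _).trans (hD η))
  rw [norm_mul]
  exact mul_le_mul (hC η h0) (hD η) (norm_nonneg _) hC0

theorem Spec.add {h g : Space d → ℂ} (hh : Spec h) (hg : Spec g) : Spec (fun η => h η + g η) := by
  obtain ⟨C, hC⟩ := hh.bdd
  obtain ⟨D, hD⟩ := hg.bdd
  obtain ⟨R, hR⟩ := hh.supp
  obtain ⟨S, hS⟩ := hg.supp
  refine ⟨hh.meas.add hg.meas, ⟨C + D, fun η => (norm_add_le _ _).trans (add_le_add (hC η) (hD η))⟩,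
    max R S, fun η hη => ?_⟩
  rw [hR η ((le_max_left _ _).trans_lt hη), hS η ((le_max_right _ _).trans_lt hη), add_zero]

theorem norm_fourierInv_le (h : Space d → ℂ) (x : Space d) : ‖𝓕⁻ h x‖ ≤ ∫ η, ‖h η‖ := by
  rw [Real.fourierInv_eq]
  refine (norm_integral_le_integral_norm _).trans_eq ?_
  simp

theorem Spec.integrable_char {h : Space d → ℂ} (hh : Spec h) (x : Space d) :
    Integrable (fun η => (Real.fourierChar (inner ℝ η x) : ℂ) * h η) volume :=
  hh.integrable.bdd_mul (c := 1) (Continuous.aestronglyMeasurable (by fun_prop))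
    (ae_of_all _ fun _ => (Circle.norm_coe _).le)

theorem fourierInv_eq_mul (h : Space d → ℂ) (x : Space d) :
    𝓕⁻ h x = ∫ η, (Real.fourierChar (inner ℝ η x) : ℂ) * h η := Real.fourierInv_eq _ _

theorem Spec.continuous_fourierInv {h : Space d → ℂ} (hh : Spec h) : Continuous (𝓕⁻ h) := by
  have : 𝓕⁻ h = fun x => ∫ η, (Real.fourierChar (inner ℝ η x) : ℂ) * h η :=
    funext (fourierInv_eq_mul h)
  rw [this]
  refine continuous_of_dominated (bound := fun η => ‖h η‖) (fun x => (hh.integrable_char x).1)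
    (fun x => ae_of_all _ fun η => ?_) hh.integrable.norm (ae_of_all _ fun η => ?_)
  · rw [norm_mul, Circle.norm_coe, one_mul]
  · fun_prop

theorem Spec.fourierInv_add {h g : Space d → ℂ} (hh : Spec h) (hg : Spec g) (x : Space d) :
    𝓕⁻ (fun η => h η + g η) x = 𝓕⁻ h x + 𝓕⁻ g x := by
  simp only [fourierInv_eq_mul, mul_add]
  exact integral_add (hh.integrable_char x) (hg.integrable_char x)

theorem fourierInv_const_mul (c : ℂ) (h : Space d → ℂ) (x : Space d) :
    𝓕⁻ (fun η => c * h η) x = c * 𝓕⁻ h x := by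
  simp only [fourierInv_eq_mul, ← integral_const_mul]
  refine integral_congr_ae (ae_of_all _ fun η => ?_)
  simp only
  ring

/-- Plancherel's theorem. -/
theorem Spec.plancherel {h : Space d → ℂ} (hh : Spec h) :
    MemLp (𝓕⁻ h) 2 volume ∧ ∫ x, ‖𝓕⁻ h x‖ ^ 2 = ∫ η, ‖h η‖ ^ 2 := by
  set H : Lp ℂ 2 (volume : Measure (Space d)) := (hh.memLp 2).toLp h with hH
  set g : Lp ℂ 2 (volume : Measure (Space d)) := 𝓕⁻ H with hg
  have hHh : H =ᵐ[volume] h := (hh.memLp 2).coeFn_toLp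
  have hgl : LocallyIntegrable (fun x => 𝓕⁻ h x - g x) volume :=
    hh.continuous_fourierInv.locallyIntegrable.sub ((Lp.memLp g).locallyIntegrable (by norm_num))
  have key : ∀ φ : 𝓢(Space d, ℂ), ∫ x, φ x * (𝓕⁻ h x - g x) = 0 := by
    intro φ
    have h1 : (g : 𝓢'(Space d, ℂ)) φ = (H : 𝓢'(Space d, ℂ)) (𝓕⁻ φ) := by
      rw [hg, ← Lp.fourierInv_toTemperedDistribution_eq]
      rfl
    rw [Lp.toTemperedDistribution_apply, Lp.toTemperedDistribution_apply] at h1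
    have h2 : ∫ x, (𝓕⁻ φ : 𝓢(Space d, ℂ)) x • H x = ∫ x, (𝓕⁻ φ : 𝓢(Space d, ℂ)) x • h x :=
      integral_congr_ae (by filter_upwards [hHh] with x hx; rw [hx])
    have h3 : ∫ x, (𝓕⁻ φ : 𝓢(Space d, ℂ)) x • h x = ∫ x, φ x • 𝓕⁻ h x := by
      have hφ : ∀ x, (𝓕⁻ φ : 𝓢(Space d, ℂ)) x =
          𝓕 (fun y => φ (-y)) x := by
        intro x
        rw [SchwartzMap.fourierInv_coe, Real.fourierInv_eq_fourier_comp_neg]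
      have key := VectorFourier.integral_fourierIntegral_smul_eq_flip (μ := volume) (ν := volume)
        (L := innerₗ (Space d)) (e := Real.fourierChar) Real.continuous_fourierChar
        continuous_inner (φ.integrable (μ := volume)).comp_neg hh.integrable
      simp_rw [hφ]
      refine Eq.trans ?_ (key.trans ?_)
      · rfl
      · rw [← integral_neg_eq_self]
        refine integral_congr_ae (ae_of_all _ fun y => ?_)
        simp only [neg_neg]
        congr 1
        rw [Real.fourierInv_eq]
        simp only [VectorFourier.fourierIntegral, LinearMap.flip_apply, innerₗ_apply_apply]
        refine integral_congr_ae (ae_of_all _ fun η => ?_)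
        simp only [inner_neg_left, neg_neg]
        rw [real_inner_comm]
    have i1 : Integrable (fun x => φ x * 𝓕⁻ h x) volume :=
      φ.integrable.mul_bdd (c := ∫ η, ‖h η‖) hh.continuous_fourierInv.aestronglyMeasurable
        (ae_of_all _ (norm_fourierInv_le h))
    have i2 : Integrable (fun x => φ x * g x) volume :=
      (φ.memLp 2 volume).integrable_mul (Lp.memLp g)
    simp_rw [mul_sub]
    rw [integral_sub i1 i2, sub_eq_zero]
    simp only [smul_eq_mul] at h1 h2 h3
    rw [h1, h2, h3]
  have hae := ae_eq_zero_of_integral_contDiff_smul_eq_zero hgl (fun ψ hψ hc => by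
    have hc' : HasCompactSupport (fun x => (ψ x : ℂ)) := hc.comp_left (g := ((↑) : ℝ → ℂ)) rfl
    have hg' : ContDiff ℝ ∞ (fun x => (ψ x : ℂ)) := Complex.ofRealCLM.contDiff.comp hψ
    have := key (hc'.toSchwartzMap hg')
    rw [← this]
    refine integral_congr_ae (ae_of_all _ fun y => ?_)
    simp)
  have heq : 𝓕⁻ h =ᵐ[volume] g := by
    filter_upwards [hae] with x hx using sub_eq_zero.1 hx
  have hn : ‖g‖ = ‖H‖ := by
    rw [← Lp.norm_fourier_eq g, hg, FourierTransform.fourier_fourierInv_eq]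
  have hsq : ∀ u : Lp ℂ 2 (volume : Measure (Space d)), ∫ x, ‖u x‖ ^ 2 = ‖u‖ ^ 2 := by
    intro u
    have := L2.inner_def (𝕜 := ℂ) u u
    rw [inner_self_eq_norm_sq_to_K] at this
    have h4 : ∫ x, inner ℂ (u x) (u x) = ((∫ x, ‖u x‖ ^ 2 : ℝ) : ℂ) := by
      rw [← integral_complex_ofReal]
      refine integral_congr_ae (ae_of_all _ fun x => ?_)
      simp only [inner_self_eq_norm_sq_to_K]
      norm_cast
    rw [h4] at this
    apply Complex.ofReal_injective
    rw [← this]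
    simp
  refine ⟨(memLp_congr_ae heq).2 (Lp.memLp g), ?_⟩
  have e1 : ∫ x, ‖𝓕⁻ h x‖ ^ 2 = ∫ x, ‖g x‖ ^ 2 :=
    integral_congr_ae (by filter_upwards [heq] with x hx; rw [hx])
  have e2 : ∫ x, ‖h x‖ ^ 2 = ∫ x, ‖H x‖ ^ 2 :=
    integral_congr_ae (by filter_upwards [hHh] with x hx; rw [hx])
  rw [e1, e2, hsq, hsq, hn]

/-! ### Exponential families of spectra -/

/-- The spectrum `c^k e^{s c} h`: the `k`-th derivative in `s` of the spectrum `e^{s c} h`. -/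
def expSpec (c h : Space d → ℂ) (k : ℕ) (s : ℝ) (η : Space d) : ℂ :=
  c η ^ k * (Complex.exp (s * c η) * h η)

section ExpSpec

variable {c h : Space d → ℂ}

theorem Spec.spec_exp (hh : Spec h) (hc : Continuous c) (k : ℕ) (s : ℝ) :
    Spec (expSpec c h k s) :=
  (hh.mul_cont (m := fun η => Complex.exp (s * c η)) (by fun_prop)).mul_cont
    (m := fun η => c η ^ k) (by fun_prop)

/-- On a compact set of frequencies the factor `c^k e^{s c}` is bounded, locally uniformly in `s`. -/
theorem Spec.expSpec_bound (hh : Spec h) (hc : Continuous c) (k : ℕ) (s₀ : ℝ) :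
    ∃ B, 0 ≤ B ∧ ∀ s, |s - s₀| ≤ 1 → ∀ η, ‖expSpec c h k s η‖ ≤ B * ‖h η‖ := by
  obtain ⟨C, hC0, hC⟩ := hh.exists_norm_mul_le hc
  refine ⟨C ^ k * Real.exp ((|s₀| + 1) * C), by positivity, fun s hs η => ?_⟩
  by_cases h0 : h η = 0
  · simp [expSpec, h0]
  have h1 := hC η h0
  have hs' : |s| ≤ |s₀| + 1 := by
    have := abs_sub_abs_le_abs_sub s s₀
    linarith
  simp only [expSpec]
  rw [norm_mul, norm_pow, norm_mul, Complex.norm_exp, mul_assoc]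
  have h2 : ((s : ℂ) * c η).re ≤ (|s₀| + 1) * C := by
    refine (Complex.re_le_norm _).trans ?_
    rw [norm_mul, Complex.norm_real, Real.norm_eq_abs]
    gcongr
  gcongr

theorem Spec.hasDerivAt_expSpec (hh : Spec h) (hc : Continuous c) (k : ℕ) (s : ℝ) (x : Space d) :
    HasDerivAt (fun s => 𝓕⁻ (expSpec c h k s) x)
      (𝓕⁻ (expSpec c h (k + 1) s) x) s := by
  obtain ⟨B, hB0, hB⟩ := hh.expSpec_bound hc (k + 1) s
  simp only [fourierInv_eq_mul]
  refine (hasDerivAt_integral_of_dominated_loc_of_deriv_le (Metric.closedBall_mem_nhds s one_pos)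
    (F' := fun s η => (Real.fourierChar (inner ℝ η x) : ℂ) * expSpec c h (k + 1) s η)
    (bound := fun η => B * ‖h η‖)
    (Eventually.of_forall fun s => ((hh.spec_exp hc k s).integrable_char x).1)
    ((hh.spec_exp hc k s).integrable_char x) ((hh.spec_exp hc (k + 1) s).integrable_char x).1
    (ae_of_all _ fun η s' hs' => ?_) (hh.integrable.norm.const_mul B)
    (ae_of_all _ fun η s' _ => ?_)).2
  · rw [norm_mul, Circle.norm_coe, one_mul]
    exact hB s' (by simpa [Real.dist_eq] using hs') η
  · refine HasDerivAt.const_mul _ ?_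
    have h1 : HasDerivAt (fun s : ℝ => Complex.exp (s * c η)) (Complex.exp (s' * c η) * c η) s' := by
      have := ((hasDerivAt_id s').ofReal_comp.mul_const (c η)).cexp
      simpa using this
    have h2 := (h1.mul_const (h η)).const_mul (c η ^ k)
    refine h2.congr_deriv ?_
    simp only [expSpec]
    ring

theorem Spec.continuous_expSpec (hh : Spec h) (hc : Continuous c) (k : ℕ) :
    Continuous (fun z : ℝ × Space d => 𝓕⁻ (expSpec c h k z.1) z.2) := by
  rw [continuous_iff_continuousAt]
  rintro ⟨s₀, x₀⟩
  obtain ⟨B, hB0, hB⟩ := hh.expSpec_bound hc k s₀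
  simp only [fourierInv_eq_mul]
  refine continuousAt_of_dominated (bound := fun η => B * ‖h η‖)
    (Eventually.of_forall fun z => ((hh.spec_exp hc k z.1).integrable_char z.2).1) ?_
    (hh.integrable.norm.const_mul B) (ae_of_all _ fun η => ?_)
  · have : ∀ᶠ z : ℝ × Space d in 𝓝 (s₀, x₀), z.1 ∈ Metric.closedBall s₀ 1 :=
      continuous_fst.continuousAt.eventually (Metric.closedBall_mem_nhds s₀ one_pos)
    filter_upwards [this] with z hz
    refine ae_of_all _ fun η => ?_
    rw [norm_mul, Circle.norm_coe, one_mul]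
    exact hB z.1 (by simpa [Real.dist_eq] using hz) η
  · refine Continuous.continuousAt ?_
    simp only [expSpec]
    fun_prop

/-- A square integrable envelope of the functions with spectra `expSpec c h k s`, `|s - s₀| ≤ 1`:
the squared modulus is controlled by the fundamental theorem of calculus in `s`. -/
theorem Spec.exists_envelope (hh : Spec h) (hc : Continuous c) (k : ℕ) (s₀ : ℝ) :
    ∃ D : Space d → ℝ, Integrable D volume ∧
      ∀ s, |s - s₀| ≤ 1 → ∀ x, ‖𝓕⁻ (expSpec c h k s) x‖ ^ 2 ≤ D x := by
  obtain ⟨F, hF⟩ : ∃ F : ℕ → ℝ → Space d → ℂ, ∀ k s, F k s = 𝓕⁻ (expSpec c h k s) :=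
    ⟨_, fun _ _ => rfl⟩
  have hFc : ∀ k, Continuous (fun z : ℝ × Space d => F k z.1 z.2) := by
    simp only [hF]
    exact hh.continuous_expSpec hc
  have hFP : ∀ k s, MemLp (F k s) 2 volume := fun k s => by
    rw [hF]; exact (hh.spec_exp hc k s).plancherel.1
  have hFs : ∀ k x, Continuous (fun s => F k s x) := fun k x =>
    (hFc k).comp (by fun_prop : Continuous fun s : ℝ => (s, x))
  -- the uniform bound of the `L²` norms
  have hL2 : ∀ k, ∃ B, ∀ s, |s - s₀| ≤ 1 → ∫ x, ‖F k s x‖ ^ 2 ≤ B := by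
    intro k
    obtain ⟨B, hB0, hB⟩ := hh.expSpec_bound hc k s₀
    refine ⟨∫ η, (B * ‖h η‖) ^ 2, fun s hs => ?_⟩
    rw [hF, (hh.spec_exp hc k s).plancherel.2]
    refine integral_mono ?_ ?_ fun η => ?_
    · exact ((hh.spec_exp hc k s).memLp 2).integrable_norm_pow (by norm_num)
    · simp_rw [mul_pow]
      exact ((hh.memLp 2).integrable_norm_pow (by norm_num)).const_mul _
    · exact pow_le_pow_left₀ (norm_nonneg _) (hB s hs η) 2
  have hprod : ∀ k, Integrable (fun z : Space d × ℝ => ‖F k z.2 z.1‖ ^ 2)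
      (volume.prod (volume.restrict (Set.Icc (s₀ - 1) (s₀ + 1)))) := by
    intro k
    have hm : Continuous (fun z : Space d × ℝ => ‖F k z.2 z.1‖ ^ 2) :=
      ((hFc k).comp continuous_swap).norm.pow 2
    rw [integrable_prod_iff' hm.aestronglyMeasurable]
    refine ⟨ae_of_all _ fun s => ?_, ?_⟩
    · exact (hFP k s).integrable_norm_pow (by norm_num)
    · obtain ⟨B, hB⟩ := hL2 k
      refine Measure.integrableOn_of_bounded (M := B) (by simp) ?_ ?_
      · exact (hm.aestronglyMeasurable (μ := volume.prod
          volume)).norm.prod_swap.integral_prod_right'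
      · filter_upwards [ae_restrict_mem measurableSet_Icc] with s hs
        have hs' : |s - s₀| ≤ 1 := by rw [abs_le]; constructor <;> linarith [hs.1, hs.2]
        simp only [norm_pow, norm_norm]
        rw [Real.norm_of_nonneg (integral_nonneg fun x => by positivity)]
        exact hB s hs'
  refine ⟨fun x => ‖F k s₀ x‖ ^ 2 + ∫ s in Set.Icc (s₀ - 1) (s₀ + 1),
    (‖F k s x‖ ^ 2 + ‖F (k + 1) s x‖ ^ 2), ?_, fun s hs x => ?_⟩
  · refine ((hFP k s₀).integrable_norm_pow (by norm_num)).add ?_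
    exact ((hprod k).add (hprod (k + 1))).integral_prod_left
  · have hd : ∀ s, HasDerivAt (fun s => ‖F k s x‖ ^ 2) (2 * inner ℝ (F k s x) (F (k + 1) s x)) s :=
      fun s => by
        have := hh.hasDerivAt_expSpec hc k s x
        simp only [← hF] at this
        exact this.norm_sq
    have hcont : Continuous (fun s => 2 * inner ℝ (F k s x) (F (k + 1) s x)) :=
      continuous_const.mul ((hFs k x).inner (hFs (k + 1) x))
    have hftc : ‖F k s x‖ ^ 2 - ‖F k s₀ x‖ ^ 2 =
        ∫ t in s₀..s, 2 * inner ℝ (F k t x) (F (k + 1) t x) :=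
      (intervalIntegral.integral_eq_sub_of_hasDerivAt (fun t _ => hd t)
        (hcont.intervalIntegrable _ _)).symm
    have hgc : Continuous (fun t => ‖F k t x‖ ^ 2 + ‖F (k + 1) t x‖ ^ 2) :=
      ((hFs k x).norm.pow 2).add ((hFs (k + 1) x).norm.pow 2)
    have hsub : Set.uIoc s₀ s ⊆ Set.Icc (s₀ - 1) (s₀ + 1) := by
      rw [abs_le] at hs
      refine Set.uIoc_subset_uIcc.trans (Set.uIcc_subset_Icc ?_ ?_) <;> constructor <;> linarith
    have hle : ‖∫ t in s₀..s, 2 * inner ℝ (F k t x) (F (k + 1) t x)‖ ≤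
        ∫ t in Set.Icc (s₀ - 1) (s₀ + 1), (‖F k t x‖ ^ 2 + ‖F (k + 1) t x‖ ^ 2) := by
      refine intervalIntegral.norm_integral_le_integral_norm_uIoc.trans ?_
      refine (setIntegral_mono (g := fun t => ‖F k t x‖ ^ 2 + ‖F (k + 1) t x‖ ^ 2)
        (hcont.norm.integrableOn_uIoc) hgc.integrableOn_uIoc fun t => ?_).trans ?_
      · rw [norm_mul, Real.norm_two]
        have h1 := norm_inner_le_norm (𝕜 := ℝ) (F k t x) (F (k + 1) t x)
        nlinarith [sq_nonneg (‖F k t x‖ - ‖F (k + 1) t x‖)]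
      · refine setIntegral_mono_set hgc.integrableOn_Icc (ae_of_all _ fun t => ?_)
          hsub.eventuallyLE
        simp only [Pi.zero_apply]
        positivity
    have := (le_abs_self _).trans hle
    rw [← hF]
    linarith

end ExpSpec

/-! ### Subharmonic functionals of functions with spectrum in a half-space -/

/-- A `C²` function which vanishes at the origin together with its gradient is quadratically
small on bounded sets; so `Ψ(u)` is integrable for bounded square integrable `u`. -/
theorem exists_taylor_bound {Ψ : ℂ → ℝ} (hΨ : ContDiff ℝ 2 Ψ) (h0 : Ψ 0 = 0)
    (h1 : fderiv ℝ Ψ 0 = 0) (ρ : ℝ) :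
    ∃ C, 0 ≤ C ∧ ∀ z : ℂ, ‖z‖ ≤ ρ → ‖fderiv ℝ (fderiv ℝ Ψ) z‖ ≤ C ∧
      ‖fderiv ℝ Ψ z‖ ≤ C * ‖z‖ ∧ |Ψ z| ≤ C * ‖z‖ ^ 2 := by
  have hD1 : ContDiff ℝ 1 (fderiv ℝ Ψ) := hΨ.fderiv_right (by norm_num)
  have hD2 : Continuous (fderiv ℝ (fderiv ℝ Ψ)) := hD1.continuous_fderiv (by norm_num)
  have hn : Continuous fun z => ‖fderiv ℝ (fderiv ℝ Ψ) z‖ := Continuous.norm (E := ℂ →L[ℝ] ℂ →L[ℝ] ℝ) hD2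
  obtain ⟨C, hC⟩ := (isCompact_closedBall (0 : ℂ) ρ).exists_bound_of_continuousOn
    (f := fun z => ‖fderiv ℝ (fderiv ℝ Ψ) z‖) hn.continuousOn
  have hC' : ∀ z : ℂ, ‖z‖ ≤ ρ → ‖fderiv ℝ (fderiv ℝ Ψ) z‖ ≤ max C 0 := fun z hz =>
    ((le_abs_self _).trans (hC z (by simpa using hz))).trans (le_max_left _ _)
  have hb1 : ∀ z : ℂ, ‖z‖ ≤ ρ → ‖fderiv ℝ Ψ z‖ ≤ max C 0 * ‖z‖ := by
    intro z hz
    have := (convex_closedBall (0 : ℂ) ρ).norm_image_sub_le_of_norm_fderiv_le (𝕜 := ℝ)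
      (f := fderiv ℝ Ψ) (C := max C 0) (x := 0) (y := z)
      (fun w _ => (hD1.differentiable (by norm_num)).differentiableAt)
      (fun w hw => hC' w (by simpa using hw))
      (by simpa using (norm_nonneg _).trans hz) (by simpa using hz)
    simpa [h1] using this
  refine ⟨max C 0, le_max_right _ _, fun z hz => ⟨hC' z hz, hb1 z hz, ?_⟩⟩
  have := (convex_closedBall (0 : ℂ) ‖z‖).norm_image_sub_le_of_norm_fderiv_le (𝕜 := ℝ)
    (f := Ψ) (C := max C 0 * ‖z‖) (x := 0) (y := z)
    (fun w _ => (hΨ.differentiable (by norm_num)).differentiableAt)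
    (fun w hw => (hb1 w ((by simpa using hw : ‖w‖ ≤ ‖z‖).trans hz)).trans (by
      have : ‖w‖ ≤ ‖z‖ := by simpa using hw
      gcongr))
    (by simp) (by simp)
  simp only [h0, sub_zero, Real.norm_eq_abs] at this
  calc _ ≤ _ := this
    _ = _ := by ring

section

variable {c h : Space d → ℂ} {Ψ : ℂ → ℝ}

theorem Spec.integrable_comp (hh : Spec h) (hΨ : ContDiff ℝ 2 Ψ) (h0 : Ψ 0 = 0)
    (h1 : fderiv ℝ Ψ 0 = 0) : Integrable (fun x => Ψ (𝓕⁻ h x)) volume := by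
  obtain ⟨C, hC0, hC⟩ := exists_taylor_bound hΨ h0 h1 (∫ η, ‖h η‖)
  refine ((hh.plancherel.1.integrable_norm_pow (by norm_num)).const_mul C).mono'
    (hΨ.continuous.comp hh.continuous_fourierInv).aestronglyMeasurable (ae_of_all _ fun x => ?_)
  exact (hC _ (norm_fourierInv_le h x)).2.2

/-- Two derivatives in `s` of the integral of `Ψ(u_s)`, where `u_s` has spectrum `e^{s c} h`. -/
theorem Spec.hasDerivAt_integral_comp (hh : Spec h) (hc : Continuous c) (hΨ : ContDiff ℝ 2 Ψ)
    (h0 : Ψ 0 = 0) (h1 : fderiv ℝ Ψ 0 = 0) (s₀ : ℝ) :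
    HasDerivAt (fun s => ∫ x, Ψ (𝓕⁻ (expSpec c h 0 s) x))
      (∫ x, fderiv ℝ Ψ (𝓕⁻ (expSpec c h 0 s₀) x) (𝓕⁻ (expSpec c h 1 s₀) x)) s₀ ∧
    Integrable (fun x => fderiv ℝ (fderiv ℝ Ψ) (𝓕⁻ (expSpec c h 0 s₀) x)
      (𝓕⁻ (expSpec c h 1 s₀) x) (𝓕⁻ (expSpec c h 1 s₀) x) +
      fderiv ℝ Ψ (𝓕⁻ (expSpec c h 0 s₀) x) (𝓕⁻ (expSpec c h 2 s₀) x)) volume ∧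
    HasDerivAt (fun s => ∫ x, fderiv ℝ Ψ (𝓕⁻ (expSpec c h 0 s) x) (𝓕⁻ (expSpec c h 1 s) x))
      (∫ x, (fderiv ℝ (fderiv ℝ Ψ) (𝓕⁻ (expSpec c h 0 s₀) x)
        (𝓕⁻ (expSpec c h 1 s₀) x) (𝓕⁻ (expSpec c h 1 s₀) x) +
        fderiv ℝ Ψ (𝓕⁻ (expSpec c h 0 s₀) x) (𝓕⁻ (expSpec c h 2 s₀) x))) s₀ := by
  obtain ⟨B, hB0, hB⟩ := hh.expSpec_bound hc 0 s₀
  obtain ⟨D0, iD0, hD0⟩ := hh.exists_envelope hc 0 s₀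
  obtain ⟨D1, iD1, hD1⟩ := hh.exists_envelope hc 1 s₀
  obtain ⟨D2, iD2, hD2⟩ := hh.exists_envelope hc 2 s₀
  obtain ⟨C, hC0, hC⟩ := exists_taylor_bound hΨ h0 h1 (∫ η, B * ‖h η‖)
  obtain ⟨F, hF⟩ : ∃ F : ℕ → ℝ → Space d → ℂ, ∀ k s, 𝓕⁻ (expSpec c h k s) = F k s :=
    ⟨_, fun _ _ => rfl⟩
  have hFd : ∀ k s x, HasDerivAt (fun s => F k s x) (F (k + 1) s x) s := fun k s x => by
    have := hh.hasDerivAt_expSpec hc k s x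
    simpa only [hF] using this
  have hFc : ∀ k s, Continuous (F k s) := fun k s => by
    rw [← hF]; exact (hh.spec_exp hc k s).continuous_fourierInv
  have hρ : ∀ s, |s - s₀| ≤ 1 → ∀ x, ‖F 0 s x‖ ≤ ∫ η, B * ‖h η‖ := by
    intro s hs x
    rw [← hF]
    refine (norm_fourierInv_le _ x).trans (integral_mono (hh.spec_exp hc 0 s).integrable.norm
      (hh.integrable.norm.const_mul B) fun η => hB s hs η)
  have hi0 : Integrable (fun x => Ψ (F 0 s₀ x)) volume := by
    rw [← hF]; exact (hh.spec_exp hc 0 s₀).integrable_comp hΨ h0 h1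
  simp only [hF] at *
  have cD1 : ContDiff ℝ 1 (fderiv ℝ Ψ) := hΨ.fderiv_right (by norm_num)
  have cD2 : Continuous (fderiv ℝ (fderiv ℝ Ψ)) := cD1.continuous_fderiv (by norm_num)
  have hm1 : ∀ s k, Continuous (fun x => fderiv ℝ Ψ (F 0 s x) (F k s x)) := fun s k =>
    (cD1.continuous.comp (hFc 0 s)).clm_apply (hFc k s)
  have hm2 : ∀ s, Continuous (fun x => fderiv ℝ (fderiv ℝ Ψ) (F 0 s x) (F 1 s x) (F 1 s x)) :=
    fun s => ((cD2.comp (hFc 0 s)).clm_apply (hFc 1 s)).clm_apply (hFc 1 s)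
  have hb1 : ∀ s, |s - s₀| ≤ 1 → ∀ x, ‖fderiv ℝ Ψ (F 0 s x) (F 1 s x)‖ ≤
      C * (D0 x + D1 x) := by
    intro s hs x
    obtain ⟨-, hc1, -⟩ := hC _ (hρ s hs x)
    refine (ContinuousLinearMap.le_opNorm _ _).trans ?_
    have e0 := hD0 s hs x
    have e1 := hD1 s hs x
    calc _ ≤ C * ‖F 0 s x‖ * ‖F 1 s x‖ := by gcongr
      _ = C * (‖F 0 s x‖ * ‖F 1 s x‖) := by ring
      _ ≤ _ := by
        gcongr
        nlinarith [sq_nonneg (‖F 0 s x‖ - ‖F 1 s x‖), sq_nonneg ‖F 0 s x‖, sq_nonneg ‖F 1 s x‖]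
  have hb2 : ∀ s, |s - s₀| ≤ 1 → ∀ x, ‖fderiv ℝ (fderiv ℝ Ψ) (F 0 s x) (F 1 s x) (F 1 s x) +
      fderiv ℝ Ψ (F 0 s x) (F 2 s x)‖ ≤ C * (D1 x + (D0 x + D2 x)) := by
    intro s hs x
    obtain ⟨hc2, hc1, -⟩ := hC _ (hρ s hs x)
    have e0 := hD0 s hs x
    have e1 := hD1 s hs x
    have e2 := hD2 s hs x
    have a1 : ‖fderiv ℝ (fderiv ℝ Ψ) (F 0 s x) (F 1 s x) (F 1 s x)‖ ≤ C * D1 x := by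
      refine (ContinuousLinearMap.le_opNorm₂ _ _ _).trans ?_
      calc _ ≤ C * ‖F 1 s x‖ * ‖F 1 s x‖ := by gcongr
        _ = C * ‖F 1 s x‖ ^ 2 := by ring
        _ ≤ _ := by gcongr
    have a2 : ‖fderiv ℝ Ψ (F 0 s x) (F 2 s x)‖ ≤ C * (D0 x + D2 x) := by
      refine (ContinuousLinearMap.le_opNorm _ _).trans ?_
      calc _ ≤ C * ‖F 0 s x‖ * ‖F 2 s x‖ := by gcongr
        _ = C * (‖F 0 s x‖ * ‖F 2 s x‖) := by ring
        _ ≤ _ := by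
          gcongr
          nlinarith [sq_nonneg (‖F 0 s x‖ - ‖F 2 s x‖), sq_nonneg ‖F 0 s x‖, sq_nonneg ‖F 2 s x‖]
    exact (norm_add_le _ _).trans (by linarith)
  have hball : ∀ s ∈ Metric.closedBall s₀ 1, |s - s₀| ≤ 1 := fun s hs => by
    simpa [Real.dist_eq] using hs
  have hs₀ : |s₀ - s₀| ≤ 1 := by simp
  refine ⟨?_, ?_, ?_⟩
  · refine (hasDerivAt_integral_of_dominated_loc_of_deriv_le
      (Metric.closedBall_mem_nhds s₀ one_pos)
      (F' := fun s x => fderiv ℝ Ψ (F 0 s x) (F 1 s x)) (bound := fun x => C * (D0 x + D1 x))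
      (Eventually.of_forall fun s => (hΨ.continuous.comp (hFc 0 s)).aestronglyMeasurable)
      hi0 (hm1 s₀ 1).aestronglyMeasurable (ae_of_all _ fun x s hs => hb1 s (hball s hs) x)
      ((iD0.add iD1).const_mul C) (ae_of_all _ fun x s _ => ?_)).2
    exact ((hΨ.differentiable (by norm_num)).differentiableAt.hasFDerivAt
      (x := F 0 s x)).comp_hasDerivAt s (hFd 0 s x)
  · exact ((iD1.add (iD0.add iD2)).const_mul C).mono'
      ((hm2 s₀).add (hm1 s₀ 2)).aestronglyMeasurable (ae_of_all _ (hb2 s₀ hs₀))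
  · refine (hasDerivAt_integral_of_dominated_loc_of_deriv_le
      (Metric.closedBall_mem_nhds s₀ one_pos)
      (F' := fun s x => fderiv ℝ (fderiv ℝ Ψ) (F 0 s x) (F 1 s x) (F 1 s x) +
        fderiv ℝ Ψ (F 0 s x) (F 2 s x)) (bound := fun x => C * (D1 x + (D0 x + D2 x)))
      (Eventually.of_forall fun s => (hm1 s 1).aestronglyMeasurable)
      (((iD0.add iD1).const_mul C).mono' (hm1 s₀ 1).aestronglyMeasurable
        (ae_of_all _ (hb1 s₀ hs₀))) ((hm2 s₀).add (hm1 s₀ 2)).aestronglyMeasurable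
      (ae_of_all _ fun x s hs => hb2 s (hball s hs) x)
      ((iD1.add (iD0.add iD2)).const_mul C) (ae_of_all _ fun x s _ => ?_)).2
    have d1 : HasDerivAt (fun s => fderiv ℝ Ψ (F 0 s x))
        (fderiv ℝ (fderiv ℝ Ψ) (F 0 s x) (F 1 s x)) s :=
      ((cD1.differentiable (by norm_num)).differentiableAt.hasFDerivAt
        (x := F 0 s x)).comp_hasDerivAt s (hFd 0 s x)
    exact d1.clm_apply (hFd 1 s x)

/-- The translation of a function in the direction of a coordinate axis multiplies its spectrum by
a character. -/
theorem fourierInv_expSpec_I (i : Fin d) (h : Space d → ℂ) (s : ℝ) (x : Space d) :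
    𝓕⁻ (expSpec (fun η => 2 * Real.pi * Complex.I * η i) h 0 s) x =
      𝓕⁻ h (x + EuclideanSpace.single i s) := by
  simp only [fourierInv_eq_mul, expSpec]
  refine integral_congr_ae (ae_of_all _ fun η => ?_)
  simp only [pow_zero, one_mul, ← mul_assoc, inner_add_right, AddChar.map_add_eq_mul,
    Circle.coe_mul]
  congr 2
  rw [Real.fourierChar_apply]
  congr 1
  simp [EuclideanSpace.inner_single_right]
  ring

/-- If `u` has its spectrum in the half-space `η_i > 0` and `Ψ` is subharmonic, then
`∫ Ψ(u) ≥ 0`: the integral over the horizontal hyperplanes of the harmonic extension of `u` is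
convex and tends to `0` at infinity. -/
theorem Spec.integral_comp_nonneg (hh : Spec h) (i : Fin d) (hpos : ∀ η, h η ≠ 0 → 0 < η i)
    (hΨ : ContDiff ℝ 2 Ψ) (h0 : Ψ 0 = 0) (h1 : fderiv ℝ Ψ 0 = 0)
    (hsub : ∀ z, 0 ≤ fderiv ℝ (fderiv ℝ Ψ) z 1 1 +
      fderiv ℝ (fderiv ℝ Ψ) z Complex.I Complex.I) :
    0 ≤ ∫ x, Ψ (𝓕⁻ h x) := by
  -- The spectrum `e^{s c} h` is that of the harmonic extension of `u` at height `s` above the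
  -- hyperplane: its derivative in `s` has the symbol `c`, and its derivative in `x_i` has the symbol
  -- `e`. Since `e = -i c`, both together form a complex derivative.
  set c : Space d → ℂ := fun η => -(2 * Real.pi * η i) with hc
  set e : Space d → ℂ := fun η => 2 * Real.pi * Complex.I * η i with he
  have hcc : Continuous c := by fun_prop
  have hec : Continuous e := by fun_prop
  set J : ℝ → ℝ := fun s => ∫ x, Ψ (𝓕⁻ (expSpec c h 0 s) x) with hJ
  have hd1 : ∀ s, HasDerivAt J _ s := fun s => (hh.hasDerivAt_integral_comp hcc hΨ h0 h1 s).1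
  have hd2 := fun s => (hh.hasDerivAt_integral_comp hcc hΨ h0 h1 s).2.2
  -- the second derivative in the horizontal variable integrates to zero
  have hzero : ∀ g : Space d → ℂ, Spec g → ∫ x, (fderiv ℝ (fderiv ℝ Ψ) (𝓕⁻ g x)
      (𝓕⁻ (fun η => e η * g η) x) (𝓕⁻ (fun η => e η * g η) x) +
      fderiv ℝ Ψ (𝓕⁻ g x) (𝓕⁻ (fun η => e η ^ 2 * g η) x)) = 0 := by
    intro g hg
    have k1 := fun s => (hg.hasDerivAt_integral_comp hec hΨ h0 h1 s).1
    have k2 := (hg.hasDerivAt_integral_comp hec hΨ h0 h1 0).2.2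
    have hconst : (fun s : ℝ => ∫ x, Ψ (𝓕⁻ (expSpec e g 0 s) x)) = fun _ => ∫ x, Ψ (𝓕⁻ g x) := by
      ext s
      simp only [he, fourierInv_expSpec_I]
      exact integral_add_right_eq_self (fun x => Ψ (𝓕⁻ g x)) _
    rw [hconst] at k1
    have k3 : (fun s => ∫ x, fderiv ℝ Ψ (𝓕⁻ (expSpec e g 0 s) x) (𝓕⁻ (expSpec e g 1 s) x)) =
        fun _ => 0 := by
      ext s
      exact (k1 s).unique (hasDerivAt_const s _)
    rw [k3] at k2
    have k4 := k2.unique (hasDerivAt_const 0 (0 : ℝ))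
    have e0 : expSpec e g 0 0 = g := by ext η; simp [expSpec]
    have e1 : expSpec e g 1 0 = fun η => e η * g η := by ext η; simp [expSpec]
    have e2 : expSpec e g 2 0 = fun η => e η ^ 2 * g η := by ext η; simp [expSpec]
    rw [e0, e1, e2] at k4
    exact k4
  -- Adding this vanishing term to the second derivative of `J` produces the Laplacian of `Ψ` times `|∂_s u|²`, by the
  -- Cauchy-Riemann equations.
  have hconv : ConvexOn ℝ Set.univ J := by
    have hdJ : deriv J = _ := funext fun s => (hd1 s).deriv
    refine convexOn_univ_of_deriv2_nonneg (fun s => (hd1 s).differentiableAt) ?_ fun s => ?_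
    · rw [hdJ]; exact fun s => (hd2 s).differentiableAt
    · simp only [Function.iterate_succ, Function.iterate_zero, Function.comp_apply, id]
      rw [hdJ, (hd2 s).deriv]
      set g := expSpec c h 0 s with hg
      have hgs : Spec g := hh.spec_exp hcc 0 s
      have iz := (hgs.hasDerivAt_integral_comp hec hΨ h0 h1 0).2.1
      have e0 : expSpec e g 0 0 = g := by ext η; simp [expSpec]
      have e1 : expSpec e g 1 0 = fun η => e η * g η := by ext η; simp [expSpec]
      have e2 : expSpec e g 2 0 = fun η => e η ^ 2 * g η := by ext η; simp [expSpec]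
      rw [e0, e1, e2] at iz
      have f1 : ∀ x, 𝓕⁻ (fun η => e η * g η) x = -(Complex.I * 𝓕⁻ (expSpec c h 1 s) x) := by
        intro x
        rw [← fourierInv_const_mul, ← neg_one_mul, ← fourierInv_const_mul]
        refine congrArg (fun k : Space d → ℂ => 𝓕⁻ k x) (funext fun η => ?_)
        simp only [hg, expSpec, he, hc]
        ring
      have f2 : ∀ x, 𝓕⁻ (fun η => e η ^ 2 * g η) x = -𝓕⁻ (expSpec c h 2 s) x := by
        intro x
        rw [← neg_one_mul, ← fourierInv_const_mul]
        refine congrArg (fun k : Space d → ℂ => 𝓕⁻ k x) (funext fun η => ?_)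
        simp only [hg, expSpec, he, hc]
        ring_nf
        simp only [Complex.I_sq]
        ring
      have key := hzero g hgs
      have hadd := integral_add (hh.hasDerivAt_integral_comp hcc hΨ h0 h1 s).2.1 iz
      rw [key, add_zero] at hadd
      rw [← hadd]
      refine integral_nonneg fun x => ?_
      simp only [f1, f2, ← hg]
      obtain ⟨u, hu⟩ : ∃ u, u = 𝓕⁻ (expSpec c h 1 s) x := ⟨_, rfl⟩
      rw [← hu]
      set A := fderiv ℝ (fderiv ℝ Ψ) (𝓕⁻ g x) with hA
      have u1 : u = u.re • (1 : ℂ) + u.im • Complex.I := by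
        simp only [Complex.real_smul, mul_one]
        exact (Complex.re_add_im u).symm
      have u2 : Complex.I * u = (-u.im) • (1 : ℂ) + u.re • Complex.I := by
        conv_lhs => rw [← Complex.re_add_im u]
        simp only [Complex.real_smul, mul_one]
        ring_nf
        simp only [Complex.I_sq]
        push_cast
        ring
      have hs := hsub (𝓕⁻ g x)
      have : A u u + A (Complex.I * u) (Complex.I * u) =
          (u.re ^ 2 + u.im ^ 2) * (A 1 1 + A Complex.I Complex.I) := by
        rw [u2]
        conv_lhs => rw [u1]
        simp only [map_add, map_smul, add_apply, smul_apply, smul_eq_mul]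
        simp only [Complex.add_re, Complex.add_im, Complex.smul_re, Complex.smul_im,
          Complex.one_re, Complex.one_im, Complex.I_re, Complex.I_im, smul_eq_mul]
        ring
      simp only [map_neg, neg_apply, neg_neg, Pi.zero_apply]
      have h5 : 0 ≤ A u u + A (Complex.I * u) (Complex.I * u) := by
        rw [this]
        exact mul_nonneg (by positivity) hs
      linarith
  have hlim : Tendsto J atTop (𝓝 0) := by
    obtain ⟨C, hC0, hC⟩ := exists_taylor_bound hΨ h0 h1 (∫ η, ‖h η‖)
    have hle : ∀ s, 0 ≤ s → ∀ η, ‖expSpec c h 0 s η‖ ≤ ‖h η‖ := by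
      intro s hs η
      by_cases hη : h η = 0
      · simp [expSpec, hη]
      simp only [expSpec, pow_zero, one_mul, norm_mul, Complex.norm_exp]
      refine mul_le_of_le_one_left (norm_nonneg _) (Real.exp_le_one_iff.2 ?_)
      have := hpos η hη
      have h6 : ((s : ℂ) * c η).re = -(s * (2 * Real.pi * η i)) := by
        rw [Complex.re_ofReal_mul]
        simp [hc]
      rw [h6]
      have : 0 ≤ s * (2 * Real.pi * η i) := by positivity
      linarith
    have hbound : ∀ s, 0 ≤ s → |J s| ≤ C * ∫ η, ‖expSpec c h 0 s η‖ ^ 2 := by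
      intro s hs
      rw [← (hh.spec_exp hcc 0 s).plancherel.2, ← integral_const_mul]
      refine abs_integral_le_integral_abs.trans (integral_mono
        ((hh.spec_exp hcc 0 s).integrable_comp hΨ h0 h1).abs
        (((hh.spec_exp hcc 0 s).plancherel.1.integrable_norm_pow (by norm_num)).const_mul C)
        fun x => ?_)
      refine (hC _ ((norm_fourierInv_le _ x).trans ?_)).2.2
      exact integral_mono (hh.spec_exp hcc 0 s).integrable.norm hh.integrable.norm (hle s hs)
    have ht : Tendsto (fun s : ℝ => ∫ η, ‖expSpec c h 0 s η‖ ^ 2) atTop (𝓝 (∫ _ : Space d, (0 : ℝ))) := by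
      refine tendsto_integral_filter_of_dominated_convergence (fun η => ‖h η‖ ^ 2)
        (Eventually.of_forall fun s =>
          ((hh.spec_exp hcc 0 s).meas.norm.pow_const 2).aestronglyMeasurable) ?_
        ((hh.memLp 2).integrable_norm_pow (by norm_num)) (ae_of_all _ fun η => ?_)
      · filter_upwards [eventually_ge_atTop 0] with s hs
        refine ae_of_all _ fun η => ?_
        rw [Real.norm_of_nonneg (by positivity)]
        exact pow_le_pow_left₀ (norm_nonneg _) (hle s hs η) 2
      · by_cases hη : h η = 0
        · simp [expSpec, hη]
        have hp := hpos η hη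
        have h7 : ∀ s : ℝ, ‖expSpec c h 0 s η‖ ^ 2 =
            (Real.exp (-(s * (2 * Real.pi * η i))) * ‖h η‖) ^ 2 := by
          intro s
          simp only [expSpec, pow_zero, one_mul, norm_mul, Complex.norm_exp]
          rw [Complex.re_ofReal_mul]
          simp [hc]
        simp_rw [h7]
        have h8 : Tendsto (fun s : ℝ => Real.exp (-(s * (2 * Real.pi * η i)))) atTop (𝓝 0) :=
          Real.tendsto_exp_neg_atTop_nhds_zero.comp
            (tendsto_id.atTop_mul_const (by positivity))
        simpa using (h8.mul_const ‖h η‖).pow 2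
    simp only [integral_zero] at ht
    refine squeeze_zero_norm' ?_ (by simpa using ht.const_mul C)
    filter_upwards [eventually_ge_atTop 0] with s hs using hbound s hs
  -- Convexity gives `J 0 ≥ 2 J(T) - J(2T)`, and the right-hand side tends to `0`.
  have hmid : ∀ T : ℝ, 2 * J T - J (2 * T) ≤ J 0 := by
    intro T
    have := hconv.2 (Set.mem_univ (0 : ℝ)) (Set.mem_univ (2 * T))
      (by norm_num : (0 : ℝ) ≤ 1 / 2) (by norm_num : (0 : ℝ) ≤ 1 / 2) (by norm_num)
    simp only [smul_eq_mul, mul_zero, zero_add] at this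
    rw [show (1 / 2 : ℝ) * (2 * T) = T by ring] at this
    linarith
  have hJ0 : J 0 = ∫ x, Ψ (𝓕⁻ h x) := by
    simp only [hJ]
    have : expSpec c h 0 0 = h := by ext η; simp [expSpec]
    rw [this]
  rw [← hJ0]
  have hl2 : Tendsto (fun T => 2 * J T - J (2 * T)) atTop (𝓝 0) := by
    have := (hlim.const_mul 2).sub (hlim.comp (tendsto_id.const_mul_atTop (two_pos (α := ℝ))))
    simpa using this
  exact le_of_tendsto' hl2 hmid

end

/-! ### Explicit subharmonic functions -/

/-- A second directional derivative is computed along the line through `z`. -/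
theorem fderiv_fderiv_apply_eq {Ψ : ℂ → ℝ} (hΨ : ContDiff ℝ 2 Ψ) (z v : ℂ) {g : ℝ → ℝ} {c : ℝ}
    (h1 : ∀ τ : ℝ, HasDerivAt (fun τ : ℝ => Ψ (z + τ • v)) (g τ) τ) (h2 : HasDerivAt g c 0) :
    fderiv ℝ (fderiv ℝ Ψ) z v v = c := by
  have cD1 : ContDiff ℝ 1 (fderiv ℝ Ψ) := hΨ.fderiv_right (by norm_num)
  have hl : ∀ τ : ℝ, HasDerivAt (fun τ : ℝ => z + τ • v) v τ := fun τ => by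
    simpa using ((hasDerivAt_id τ).smul_const v).const_add z
  have hg : g = fun τ => fderiv ℝ Ψ (z + τ • v) v := by
    ext τ
    exact (h1 τ).unique (((hΨ.differentiable (by norm_num)).differentiableAt.hasFDerivAt
      (x := z + τ • v)).comp_hasDerivAt τ (hl τ))
  rw [hg] at h2
  have h3 : HasDerivAt (fun τ : ℝ => fderiv ℝ Ψ (z + τ • v))
      (fderiv ℝ (fderiv ℝ Ψ) (z + (0 : ℝ) • v) v) 0 :=
    ((cD1.differentiable (by norm_num)).differentiableAt.hasFDerivAt
      (x := z + (0 : ℝ) • v)).comp_hasDerivAt 0 (hl 0)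
  have h4 := h3.clm_apply (hasDerivAt_const (0 : ℝ) v)
  have h5 := h2.unique h4
  simp only [zero_smul, add_zero, map_zero] at h5
  exact h5.symm

theorem fderiv_zero_of_even {Ψ : ℂ → ℝ} (hΨ : Differentiable ℝ Ψ) (h : ∀ z, Ψ (-z) = Ψ z) : fderiv ℝ Ψ 0 = 0 := by
  ext v
  have h1 := (hΨ 0).hasFDerivAt.comp_hasDerivAt_of_eq (x := 0) (f := fun τ : ℝ => τ • v)
    ((hasDerivAt_id (0 : ℝ)).smul_const v) (by simp)
  have h2 := (hΨ 0).hasFDerivAt.comp_hasDerivAt_of_eq (x := 0) (f := fun τ : ℝ => τ • (-v))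
    ((hasDerivAt_id (0 : ℝ)).smul_const (-v)) (by simp)
  have h3 : (Ψ ∘ fun τ : ℝ => τ • (-v)) = Ψ ∘ fun τ : ℝ => τ • v := by
    ext τ
    simp only [Function.comp_apply, smul_neg, h]
  rw [h3] at h2
  have h4 := h1.unique h2
  simp only [one_smul, map_neg] at h4
  simp only [zero_apply]
  linarith

theorem hasDerivAt_rpow_sq {A : ℝ} (hA : 0 < A) (β x : ℝ) :
    HasDerivAt (fun x : ℝ => (A + x ^ 2) ^ β) (2 * β * x * (A + x ^ 2) ^ (β - 1)) x := by
  have h1 : HasDerivAt (fun x : ℝ => A + x ^ 2) (2 * x) x := by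
    simpa using (hasDerivAt_pow 2 x).const_add A
  convert h1.rpow_const (p := β) (Or.inl (by positivity)) using 1
  ring

theorem hasDerivAt_deriv_rpow_sq {A : ℝ} (hA : 0 < A) (β x : ℝ) :
    HasDerivAt (fun x : ℝ => 2 * β * x * (A + x ^ 2) ^ (β - 1))
      (2 * β * (A + x ^ 2) ^ (β - 1) + 4 * β * (β - 1) * x ^ 2 * (A + x ^ 2) ^ (β - 2)) x := by
  have h1 : HasDerivAt (fun x : ℝ => 2 * β * x) (2 * β) x := by
    simpa using (hasDerivAt_id x).const_mul (2 * β)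
  refine (h1.fun_mul (hasDerivAt_rpow_sq hA (β - 1) x)).congr_deriv ?_
  rw [show β - 1 - 1 = β - 2 by ring]
  ring

theorem contDiff_rpow_normSq {A : ℝ} (hA : 0 < A) (β : ℝ) :
    ContDiff ℝ 2 (fun z : ℂ => (A + z.re ^ 2 + z.im ^ 2) ^ β) := by
  have h1 : ContDiff ℝ 2 (fun z : ℂ => z.re) := Complex.reCLM.contDiff
  have h2 : ContDiff ℝ 2 (fun z : ℂ => z.im) := Complex.imCLM.contDiff
  exact ((contDiff_const.add (h1.pow 2)).add (h2.pow 2)).rpow_const_of_ne fun z => by positivity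

theorem contDiff_rpow_re {A : ℝ} (hA : 0 < A) (β : ℝ) :
    ContDiff ℝ 2 (fun z : ℂ => (A + z.re ^ 2) ^ β) := by
  have h1 : ContDiff ℝ 2 (fun z : ℂ => z.re) := Complex.reCLM.contDiff
  exact (contDiff_const.add (h1.pow 2)).rpow_const_of_ne fun z => by positivity

/-- The Laplacian of `(A + x²)^β`. The parameter `A > 0` makes the functions of this part smooth at
the origin. -/
theorem trace_rpow_re {A : ℝ} (hA : 0 < A) (β : ℝ) (z : ℂ) :
    fderiv ℝ (fderiv ℝ (fun z : ℂ => (A + z.re ^ 2) ^ β)) z 1 1 +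
      fderiv ℝ (fderiv ℝ (fun z : ℂ => (A + z.re ^ 2) ^ β)) z Complex.I Complex.I =
    2 * β * (A + z.re ^ 2) ^ (β - 1) +
      4 * β * (β - 1) * z.re ^ 2 * (A + z.re ^ 2) ^ (β - 2) := by
  rw [fderiv_fderiv_apply_eq (contDiff_rpow_re hA β) z 1
    (g := fun τ => 2 * β * (z.re + τ) * (A + (z.re + τ) ^ 2) ^ (β - 1))
    (c := 2 * β * (A + z.re ^ 2) ^ (β - 1) +
      4 * β * (β - 1) * z.re ^ 2 * (A + z.re ^ 2) ^ (β - 2)),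
    fderiv_fderiv_apply_eq (contDiff_rpow_re hA β) z Complex.I (g := fun _ => 0) (c := 0), add_zero]
  · intro τ
    simpa using hasDerivAt_const τ ((A + z.re ^ 2) ^ β)
  · exact hasDerivAt_const _ _
  · intro τ
    simpa using (hasDerivAt_rpow_sq hA β (z.re + τ)).comp_const_add z.re τ
  · have := HasDerivAt.comp_const_add z.re (0 : ℝ)
      (f := fun x : ℝ => 2 * β * x * (A + x ^ 2) ^ (β - 1))
      (by simpa using hasDerivAt_deriv_rpow_sq hA β z.re)
    simpa using this

/-- The Laplacian of `(A + |z|²)^β`. -/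
theorem trace_rpow_normSq {A : ℝ} (hA : 0 < A) (β : ℝ) (z : ℂ) :
    fderiv ℝ (fderiv ℝ (fun z : ℂ => (A + z.re ^ 2 + z.im ^ 2) ^ β)) z 1 1 +
      fderiv ℝ (fderiv ℝ (fun z : ℂ => (A + z.re ^ 2 + z.im ^ 2) ^ β)) z Complex.I Complex.I =
    4 * β * (A + z.re ^ 2 + z.im ^ 2) ^ (β - 1) +
      4 * β * (β - 1) * (z.re ^ 2 + z.im ^ 2) * (A + z.re ^ 2 + z.im ^ 2) ^ (β - 2) := by
  have hx : 0 < A + z.re ^ 2 := by positivity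
  have hy : 0 < A + z.im ^ 2 := by positivity
  rw [fderiv_fderiv_apply_eq (contDiff_rpow_normSq hA β) z 1
    (g := fun τ => 2 * β * (z.re + τ) * (A + z.im ^ 2 + (z.re + τ) ^ 2) ^ (β - 1))
    (c := 2 * β * (A + z.im ^ 2 + z.re ^ 2) ^ (β - 1) +
      4 * β * (β - 1) * z.re ^ 2 * (A + z.im ^ 2 + z.re ^ 2) ^ (β - 2)),
    fderiv_fderiv_apply_eq (contDiff_rpow_normSq hA β) z Complex.I
    (g := fun τ => 2 * β * (z.im + τ) * (A + z.re ^ 2 + (z.im + τ) ^ 2) ^ (β - 1))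
    (c := 2 * β * (A + z.re ^ 2 + z.im ^ 2) ^ (β - 1) +
      4 * β * (β - 1) * z.im ^ 2 * (A + z.re ^ 2 + z.im ^ 2) ^ (β - 2))]
  · rw [add_right_comm A (z.im ^ 2)]
    ring
  · intro τ
    simpa using (hasDerivAt_rpow_sq hx β (z.im + τ)).comp_const_add z.im τ
  · have := HasDerivAt.comp_const_add z.im (0 : ℝ)
      (f := fun x : ℝ => 2 * β * x * (A + z.re ^ 2 + x ^ 2) ^ (β - 1))
      (by simpa using hasDerivAt_deriv_rpow_sq hx β z.im)
    simpa using this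
  · intro τ
    have := (hasDerivAt_rpow_sq hy β (z.re + τ)).comp_const_add z.re τ
    simpa [add_right_comm A (z.im ^ 2)] using this
  · have := HasDerivAt.comp_const_add z.re (0 : ℝ)
      (f := fun x : ℝ => 2 * β * x * (A + z.im ^ 2 + x ^ 2) ^ (β - 1))
      (by simpa using hasDerivAt_deriv_rpow_sq hy β z.re)
    simpa using this

theorem contDiff_re_sq_mul_rpow {A : ℝ} (hA : 0 < A) (b : ℝ) :
    ContDiff ℝ 2 (fun z : ℂ => z.re ^ 2 * (A + z.re ^ 2 + z.im ^ 2) ^ b) := by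
  have h1 : ContDiff ℝ 2 (fun z : ℂ => z.re) := Complex.reCLM.contDiff
  exact (h1.pow 2).mul (contDiff_rpow_normSq hA b)

/-- The Laplacian of `x² (A + |z|²)^b`. -/
theorem trace_re_sq_mul_rpow {A : ℝ} (hA : 0 < A) (b : ℝ) (z : ℂ) :
    fderiv ℝ (fderiv ℝ (fun z : ℂ => z.re ^ 2 * (A + z.re ^ 2 + z.im ^ 2) ^ b)) z 1 1 +
      fderiv ℝ (fderiv ℝ (fun z : ℂ => z.re ^ 2 * (A + z.re ^ 2 + z.im ^ 2) ^ b)) z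
        Complex.I Complex.I =
    2 * (A + z.re ^ 2 + z.im ^ 2) ^ b +
      12 * b * z.re ^ 2 * (A + z.re ^ 2 + z.im ^ 2) ^ (b - 1) +
      4 * b * (b - 1) * z.re ^ 2 * (z.re ^ 2 + z.im ^ 2) *
        (A + z.re ^ 2 + z.im ^ 2) ^ (b - 2) := by
  have hx : 0 < A + z.re ^ 2 := by positivity
  have hy : 0 < A + z.im ^ 2 := by positivity
  have hd1 : ∀ x : ℝ, HasDerivAt (fun x : ℝ => x ^ 2 * (A + z.im ^ 2 + x ^ 2) ^ b)
      (2 * x * (A + z.im ^ 2 + x ^ 2) ^ b +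
        x ^ 2 * (2 * b * x * (A + z.im ^ 2 + x ^ 2) ^ (b - 1))) x := fun x => by
    have h2 : HasDerivAt (fun x : ℝ => x ^ 2) (2 * x) x := by simpa using hasDerivAt_pow 2 x
    exact h2.fun_mul (hasDerivAt_rpow_sq hy b x)
  have hd2 : ∀ x : ℝ, HasDerivAt (fun x : ℝ => 2 * x * (A + z.im ^ 2 + x ^ 2) ^ b +
        x ^ 2 * (2 * b * x * (A + z.im ^ 2 + x ^ 2) ^ (b - 1)))
      (2 * (A + z.im ^ 2 + x ^ 2) ^ b + 2 * x * (2 * b * x * (A + z.im ^ 2 + x ^ 2) ^ (b - 1)) +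
      (2 * x * (2 * b * x * (A + z.im ^ 2 + x ^ 2) ^ (b - 1)) +
        x ^ 2 * (2 * b * (A + z.im ^ 2 + x ^ 2) ^ (b - 1) +
      4 * b * (b - 1) * x ^ 2 * (A + z.im ^ 2 + x ^ 2) ^ (b - 2)))) x := fun x => by
    have h1 : HasDerivAt (fun x : ℝ => 2 * x) 2 x := by
      simpa using (hasDerivAt_id x).const_mul (2 : ℝ)
    have h2 : HasDerivAt (fun x : ℝ => x ^ 2) (2 * x) x := by simpa using hasDerivAt_pow 2 x
    exact (h1.mul (hasDerivAt_rpow_sq hy b x)).add (h2.mul (hasDerivAt_deriv_rpow_sq hy b x))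
  rw [fderiv_fderiv_apply_eq (contDiff_re_sq_mul_rpow hA b) z 1
    (g := fun τ => 2 * (z.re + τ) * (A + z.im ^ 2 + (z.re + τ) ^ 2) ^ b +
        (z.re + τ) ^ 2 * (2 * b * (z.re + τ) * (A + z.im ^ 2 + (z.re + τ) ^ 2) ^ (b - 1)))
    (c := _) ?_ (by simpa using HasDerivAt.comp_const_add z.re (0 : ℝ) (hd2 (z.re + 0))),
    fderiv_fderiv_apply_eq (contDiff_re_sq_mul_rpow hA b) z Complex.I
    (g := fun τ => z.re ^ 2 * (2 * b * (z.im + τ) * (A + z.re ^ 2 + (z.im + τ) ^ 2) ^ (b - 1)))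
    (c := z.re ^ 2 * (2 * b * (A + z.re ^ 2 + z.im ^ 2) ^ (b - 1) +
      4 * b * (b - 1) * z.im ^ 2 * (A + z.re ^ 2 + z.im ^ 2) ^ (b - 2)))]
  · rw [add_right_comm A (z.im ^ 2)]
    ring
  · intro τ
    have := ((hasDerivAt_rpow_sq hx b (z.im + τ)).comp_const_add z.im τ).const_mul (z.re ^ 2)
    simpa using this
  · have := (HasDerivAt.comp_const_add z.im (0 : ℝ)
      (f := fun x : ℝ => 2 * b * x * (A + z.re ^ 2 + x ^ 2) ^ (b - 1))
      (by simpa using hasDerivAt_deriv_rpow_sq hx b z.im)).const_mul (z.re ^ 2)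
    simpa using this
  · intro τ
    have := (hd1 (z.re + τ)).comp_const_add z.re τ
    simpa [add_right_comm A (z.im ^ 2)] using this

/-! ### Functions with spectrum in a half-space are controlled by their real part -/

theorem fderiv_fderiv_sub {f g : ℂ → ℝ} (hf : ContDiff ℝ 2 f) (hg : ContDiff ℝ 2 g) (κ a b : ℝ)
    (z v : ℂ) : fderiv ℝ (fderiv ℝ (fun z => κ * (f z - a) - (g z - b))) z v v =
      κ * fderiv ℝ (fderiv ℝ f) z v v - fderiv ℝ (fderiv ℝ g) z v v := by
  have e1 : fderiv ℝ (fun z => κ * (f z - a) - (g z - b)) =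
      fun z => κ • fderiv ℝ f z - fderiv ℝ g z := by
    ext1 z
    have h1 := ((hf.differentiable (by norm_num)).differentiableAt (x := z)).hasFDerivAt
    have h2 := ((hg.differentiable (by norm_num)).differentiableAt (x := z)).hasFDerivAt
    exact (((h1.sub_const a).const_mul κ).sub (h2.sub_const b)).fderiv
  rw [e1]
  have h1 := (((hf.fderiv_right (m := 1) (by norm_num)).differentiable
    (by norm_num)).differentiableAt (x := z)).hasFDerivAt
  have h2 := (((hg.fderiv_right (m := 1) (by norm_num)).differentiable
    (by norm_num)).differentiableAt (x := z)).hasFDerivAt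
  have h3 := ((h1.const_smul κ).sub h2).fderiv
  have h4 : fderiv ℝ (fun z => κ • fderiv ℝ f z - fderiv ℝ g z) z =
      κ • fderiv ℝ (fderiv ℝ f) z - fderiv ℝ (fderiv ℝ g) z := h3
  rw [h4]
  simp

/-- For `1 < p ≤ 2` the function `2/(p-1) (A + x²)^{p/2} - (A + |z|²)^{p/2}` is subharmonic; here
`X = x²` and `Y = y²`. -/
theorem trace_nonneg_le_two {p : ℝ} (hp : 1 < p) (hp2 : p ≤ 2) {A X Y : ℝ} (hA : 0 < A)
    (hX : 0 ≤ X) (hY : 0 ≤ Y) :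
    0 ≤ 2 / (p - 1) * (2 * (p / 2) * (A + X) ^ (p / 2 - 1) +
      4 * (p / 2) * (p / 2 - 1) * X * (A + X) ^ (p / 2 - 2)) -
      (4 * (p / 2) * (A + X + Y) ^ (p / 2 - 1) +
      4 * (p / 2) * (p / 2 - 1) * (X + Y) * (A + X + Y) ^ (p / 2 - 2)) := by
  have ht : 0 < A + X := by positivity
  have hs : 0 < A + X + Y := by positivity
  have e1 : (A + X) ^ (p / 2 - 1) = (A + X) * (A + X) ^ (p / 2 - 2) := by
    nth_rewrite 2 [← Real.rpow_one (A + X)]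
    rw [← Real.rpow_add ht]; congr 1; ring
  have e2 : (A + X + Y) ^ (p / 2 - 1) = (A + X + Y) * (A + X + Y) ^ (p / 2 - 2) := by
    nth_rewrite 2 [← Real.rpow_one (A + X + Y)]
    rw [← Real.rpow_add hs]; congr 1; ring
  have hle : (A + X + Y) ^ (p / 2 - 1) ≤ (A + X) ^ (p / 2 - 1) :=
    Real.rpow_le_rpow_of_nonpos ht (by linarith) (by linarith)
  have hT : 0 < (A + X) ^ (p / 2 - 2) := by positivity
  have hS : 0 < (A + X + Y) ^ (p / 2 - 2) := by positivity
  set T := (A + X) ^ (p / 2 - 2)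
  set S := (A + X + Y) ^ (p / 2 - 2)
  rw [e1, e2] at hle
  rw [e1, e2]
  have h1 : p * ((A + X) * T) * (p - 1) ≤ 2 * (p / 2) * ((A + X) * T) +
      4 * (p / 2) * (p / 2 - 1) * X * T := by
    have : 0 ≤ p * (2 - p) * T * A := by
      have : 0 ≤ 2 - p := by linarith
      positivity
    nlinarith
  have h2 : 2 * p * ((A + X) * T) ≤ 2 / (p - 1) * (2 * (p / 2) * ((A + X) * T) +
      4 * (p / 2) * (p / 2 - 1) * X * T) := by
    have hp1 : 0 < p - 1 := by linarith
    rw [div_mul_eq_mul_div, le_div_iff₀ hp1]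
    nlinarith
  have h3 : 4 * (p / 2) * (p / 2 - 1) * (X + Y) * S ≤ 0 := by
    have : 0 ≤ 4 * (p / 2) * (1 - p / 2) * (X + Y) * S := by
      have : 0 ≤ 1 - p / 2 := by linarith
      positivity
    linarith
  have h4 : 2 * p * ((A + X + Y) * S) ≤ 2 * p * ((A + X) * T) := by gcongr
  linarith

/-- For `p ≥ 2` the function `p²/2 x² (A + |z|²)^{p/2-1} - (A + |z|²)^{p/2}` is subharmonic; here
`X = x²` and `Y = y²`. -/
theorem trace_nonneg_two_le {p : ℝ} (hp : 2 ≤ p) {A X Y : ℝ} (hA : 0 < A)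
    (hX : 0 ≤ X) (hY : 0 ≤ Y) :
    0 ≤ p ^ 2 / 2 * (2 * (A + X + Y) ^ (p / 2 - 1) +
      12 * (p / 2 - 1) * X * (A + X + Y) ^ (p / 2 - 1 - 1) +
      4 * (p / 2 - 1) * (p / 2 - 1 - 1) * X * (X + Y) * (A + X + Y) ^ (p / 2 - 1 - 2)) -
      (4 * (p / 2) * (A + X + Y) ^ (p / 2 - 1) +
      4 * (p / 2) * (p / 2 - 1) * (X + Y) * (A + X + Y) ^ (p / 2 - 2)) := by
  have hs : 0 < A + X + Y := by positivity
  have e1 : (A + X + Y) ^ (p / 2 - 1) =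
      (A + X + Y) * ((A + X + Y) * (A + X + Y) ^ (p / 2 - 1 - 2)) := by
    rw [← mul_assoc, ← sq, ← Real.rpow_natCast, ← Real.rpow_add hs]; congr 1; push_cast; ring
  have e2 : (A + X + Y) ^ (p / 2 - 2) = (A + X + Y) * (A + X + Y) ^ (p / 2 - 1 - 2) := by
    nth_rewrite 2 [← Real.rpow_one (A + X + Y)]
    rw [← Real.rpow_add hs]; congr 1; ring
  have e3 : p / 2 - 1 - 1 = p / 2 - 2 := by ring
  rw [e3, e1, e2]
  have hS : 0 < (A + X + Y) ^ (p / 2 - 1 - 2) := by positivity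
  set S := (A + X + Y) ^ (p / 2 - 1 - 2)
  set s := A + X + Y with hsd
  obtain ⟨b, hb⟩ : ∃ b, b = p / 2 - 1 := ⟨_, rfl⟩
  have hb0 : 0 ≤ b := by linarith
  have hp' : p = 2 * (b + 1) := by linarith
  have hXY : X + Y ≤ s := by linarith
  have hp2 : p / 2 - 2 = b - 1 := by linarith
  rw [← hb, hp2]
  have h1 : 0 ≤ 12 * b * X * (s * S) + 4 * b * (b - 1) * X * (X + Y) * S := by
    have h2 : 0 ≤ b * X * S * (3 * s - (X + Y)) := by
      have : 0 ≤ 3 * s - (X + Y) := by linarith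
      positivity
    have h3 : 0 ≤ b * b * X * (X + Y) * S := by positivity
    nlinarith
  have h4 : 4 * (p / 2) * (s * (s * S)) + 4 * (p / 2) * b * (X + Y) * (s * S) ≤
      p ^ 2 * (s * (s * S)) := by
    have h5 : 4 * (p / 2) * b * (X + Y) * (s * S) ≤ 4 * (p / 2) * b * s * (s * S) := by gcongr
    rw [hp'] at h5 ⊢
    have h6 : 0 ≤ b * (b + 1) * (s * (s * S)) := by positivity
    nlinarith
  have h7 : 0 ≤ p ^ 2 / 2 * (12 * b * X * (s * S) + 4 * b * (b - 1) * X * (X + Y) * S) := by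
    positivity
  linarith

section

variable {h : Space d → ℂ}

theorem Spec.integrable_sub_of_even (hh : Spec h) {f : ℂ → ℝ} (hf : ContDiff ℝ 2 f)
    (he : ∀ z, f (-z) = f z) : Integrable (fun x => f (𝓕⁻ h x) - f 0) volume := by
  have hf' : ContDiff ℝ 2 (fun z => f z - f 0) := hf.sub contDiff_const
  exact hh.integrable_comp hf' (by simp)
    (fderiv_zero_of_even (hf'.differentiable (by norm_num)) (by simp [he]))

/-- `Spec.integral_comp_nonneg` for `Ψ = κ f - g`, normalized to vanish at the origin. The gradients
vanish there because `f` and `g` are even. -/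
theorem Spec.integral_le_of_trace (hh : Spec h) (i : Fin d) (hpos : ∀ η, h η ≠ 0 → 0 < η i)
    {f g : ℂ → ℝ} (hf : ContDiff ℝ 2 f) (hg : ContDiff ℝ 2 g) (hfe : ∀ z, f (-z) = f z)
    (hge : ∀ z, g (-z) = g z) (κ : ℝ)
    (htr : ∀ z, 0 ≤ κ * (fderiv ℝ (fderiv ℝ f) z 1 1 +
      fderiv ℝ (fderiv ℝ f) z Complex.I Complex.I) - (fderiv ℝ (fderiv ℝ g) z 1 1 +
      fderiv ℝ (fderiv ℝ g) z Complex.I Complex.I)) :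
    ∫ x, (g (𝓕⁻ h x) - g 0) ≤ κ * ∫ x, (f (𝓕⁻ h x) - f 0) := by
  have hΨ : ContDiff ℝ 2 (fun z => κ * (f z - f 0) - (g z - g 0)) :=
    (contDiff_const.mul (hf.sub contDiff_const)).sub (hg.sub contDiff_const)
  have := hh.integral_comp_nonneg i hpos hΨ (by simp)
    (fderiv_zero_of_even (hΨ.differentiable (by norm_num)) (by simp [hfe, hge])) (fun z => by
      rw [fderiv_fderiv_sub hf hg, fderiv_fderiv_sub hf hg]
      have := htr z
      linarith)
  rw [integral_sub ((hh.integrable_sub_of_even hf hfe).const_mul κ)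
    (hh.integrable_sub_of_even hg hge), integral_const_mul] at this
  linarith

theorem enorm_ofReal_eq (r : ℝ) : ‖(r : ℂ)‖ₑ = ‖r‖ₑ := by
  rw [← ofReal_norm, ← ofReal_norm, Complex.norm_real]

theorem ofReal_rpow_normSq (z : ℂ) {p : ℝ} (hp : 0 ≤ p) :
    ENNReal.ofReal ((z.re ^ 2 + z.im ^ 2) ^ (p / 2)) = ‖z‖ₑ ^ p := by
  rw [← ofReal_norm, ENNReal.ofReal_rpow_of_nonneg (norm_nonneg _) hp]
  congr 1
  have : z.re ^ 2 + z.im ^ 2 = ‖z‖ ^ (2 : ℝ) := by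
    rw [Real.rpow_two, Complex.sq_norm, Complex.normSq_apply]; ring
  rw [this, ← Real.rpow_mul (norm_nonneg _)]
  congr 1
  ring

/-- The inequality of M. Riesz for `1 < p ≤ 2`, obtained from the smoothed powers as `A → 0` by
Fatou's lemma. -/
theorem Spec.lintegral_le_of_le_two (hh : Spec h) (i : Fin d) (hpos : ∀ η, h η ≠ 0 → 0 < η i)
    {p : ℝ} (hp : 1 < p) (hp2 : p ≤ 2) :
    ∫⁻ x, ‖𝓕⁻ h x‖ₑ ^ p ≤
      ENNReal.ofReal (2 / (p - 1)) * ∫⁻ x, ‖(𝓕⁻ h x).re‖ₑ ^ p := by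
  obtain ⟨F, hF⟩ : ∃ F, F = 𝓕⁻ h := ⟨_, rfl⟩
  have hFc : Continuous F := hF ▸ hh.continuous_fourierInv
  have hstep : ∀ A : ℝ, 0 < A →
      ∫⁻ x, ENNReal.ofReal ((A + (F x).re ^ 2 + (F x).im ^ 2) ^ (p / 2) - A ^ (p / 2)) ≤
      ENNReal.ofReal (2 / (p - 1)) * ∫⁻ x, ‖(F x).re‖ₑ ^ p := by
    intro A hA
    have hg := contDiff_rpow_normSq hA (p / 2)
    have hf := contDiff_rpow_re hA (p / 2)
    have h1 := hh.integral_le_of_trace i hpos hf hg (by simp) (by simp) (2 / (p - 1)) (fun z => by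
      rw [trace_rpow_re hA, trace_rpow_normSq hA]
      exact trace_nonneg_le_two hp hp2 hA (sq_nonneg _) (sq_nonneg _))
    have i1 := hh.integrable_sub_of_even hg (by simp)
    have i2 := hh.integrable_sub_of_even hf (by simp)
    simp only [Complex.zero_re, Complex.zero_im, ne_eq, OfNat.ofNat_ne_zero, not_false_eq_true,
      zero_pow, add_zero, ← hF] at h1 i1 i2
    rw [← ofReal_integral_eq_lintegral_ofReal i1 (ae_of_all _ fun x => sub_nonneg.2 (by
      have : A ≤ A + (F x).re ^ 2 + (F x).im ^ 2 := by nlinarith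
      gcongr))]
    refine (ENNReal.ofReal_le_ofReal h1).trans ?_
    have hp1 : 0 ≤ 2 / (p - 1) := div_nonneg (by norm_num) (by linarith)
    rw [ENNReal.ofReal_mul hp1]
    gcongr
    rw [ofReal_integral_eq_lintegral_ofReal i2 (ae_of_all _ fun x => sub_nonneg.2 (by
      have : A ≤ A + (F x).re ^ 2 := by nlinarith
      gcongr))]
    refine lintegral_mono fun x => ?_
    have h2 : (A + (F x).re ^ 2) ^ (p / 2) - A ^ (p / 2) ≤ ((F x).re ^ 2) ^ (p / 2) := by
      have := Real.rpow_add_le_add_rpow hA.le (sq_nonneg (F x).re) (by linarith : 0 ≤ p / 2)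
        (by linarith)
      linarith
    refine (ENNReal.ofReal_le_ofReal h2).trans_eq ?_
    have := ofReal_rpow_normSq (((F x).re : ℝ) : ℂ) (by linarith : 0 ≤ p)
    rw [enorm_ofReal_eq] at this
    simpa using this
  rw [← hF]
  have hlim : ∀ x, Tendsto (fun n : ℕ => ENNReal.ofReal
      ((1 / ((n : ℝ) + 1) + (F x).re ^ 2 + (F x).im ^ 2) ^ (p / 2) -
        (1 / ((n : ℝ) + 1)) ^ (p / 2))) atTop (𝓝 (‖F x‖ₑ ^ p)) := by
    intro x
    rw [← ofReal_rpow_normSq _ (by linarith : 0 ≤ p)]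
    refine (ENNReal.continuous_ofReal.tendsto _).comp ?_
    have h0 : Tendsto (fun n : ℕ => 1 / ((n : ℝ) + 1)) atTop (𝓝 0) :=
      tendsto_one_div_add_atTop_nhds_zero_nat
    have h3 := ((h0.add_const ((F x).re ^ 2)).add_const ((F x).im ^ 2)).rpow_const
      (p := p / 2) (Or.inr (by linarith))
    have h4 := h0.rpow_const (p := p / 2) (Or.inr (by linarith))
    have h5 := h3.sub h4
    rwa [Real.zero_rpow (by linarith), sub_zero, zero_add] at h5
  calc ∫⁻ x, ‖F x‖ₑ ^ p = ∫⁻ x, liminf (fun n : ℕ => ENNReal.ofReal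
      ((1 / ((n : ℝ) + 1) + (F x).re ^ 2 + (F x).im ^ 2) ^ (p / 2) -
        (1 / ((n : ℝ) + 1)) ^ (p / 2))) atTop :=
        lintegral_congr fun x => (hlim x).liminf_eq.symm
    _ ≤ liminf (fun n : ℕ => ∫⁻ x, ENNReal.ofReal
      ((1 / ((n : ℝ) + 1) + (F x).re ^ 2 + (F x).im ^ 2) ^ (p / 2) -
        (1 / ((n : ℝ) + 1)) ^ (p / 2))) atTop := lintegral_liminf_le fun n => by fun_prop
    _ ≤ _ := liminf_le_of_le (by isBoundedDefault) fun b hb => by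
      obtain ⟨n, hn⟩ := hb.exists
      exact hn.trans (hstep _ (by positivity))

/-- Finiteness of the `L^p` norm for `p ≥ 2`. It is needed in order to absorb a power of this norm. -/
theorem Spec.lintegral_fourierInv_lt_top (hh : Spec h) {p : ℝ} (hp : 2 ≤ p) :
    ∫⁻ x, ‖𝓕⁻ h x‖ₑ ^ p < ⊤ := by
  have h2 : ∫⁻ x, ‖𝓕⁻ h x‖ₑ ^ (2 : ℝ) < ⊤ := by
    simpa using lintegral_rpow_enorm_lt_top_of_eLpNorm_lt_top (by norm_num) (by norm_num)
      hh.plancherel.1.2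
  have hM : ∀ x, ‖𝓕⁻ h x‖ₑ ≤ ENNReal.ofReal (∫ η, ‖h η‖) := fun x => by
    rw [← ofReal_norm]
    exact ENNReal.ofReal_le_ofReal (norm_fourierInv_le h x)
  calc ∫⁻ x, ‖𝓕⁻ h x‖ₑ ^ p
      ≤ ∫⁻ x, ENNReal.ofReal (∫ η, ‖h η‖) ^ (p - 2) * ‖𝓕⁻ h x‖ₑ ^ (2 : ℝ) := by
        refine lintegral_mono fun x => ?_
        calc ‖𝓕⁻ h x‖ₑ ^ p = ‖𝓕⁻ h x‖ₑ ^ (p - 2) * ‖𝓕⁻ h x‖ₑ ^ (2 : ℝ) := by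
              rw [← ENNReal.rpow_add_of_nonneg _ _ (by linarith) (by norm_num), sub_add_cancel]
          _ ≤ _ := by
              gcongr
              exact hM x
    _ = ENNReal.ofReal (∫ η, ‖h η‖) ^ (p - 2) * ∫⁻ x, ‖𝓕⁻ h x‖ₑ ^ (2 : ℝ) :=
        lintegral_const_mul' _ _ (ENNReal.rpow_ne_top_of_nonneg (by linarith) ENNReal.ofReal_ne_top)
    _ < ⊤ := ENNReal.mul_lt_top
        (ENNReal.rpow_lt_top_of_nonneg (by linarith) ENNReal.ofReal_ne_top) h2

/-- The inequality that replaces `Spec.lintegral_le_of_le_two` for `p > 2`, where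
`C |x|^p - |z|^p` is not subharmonic for any `C`; Hölder's inequality turns the right-hand side
into powers of the two norms. -/
theorem Spec.lintegral_le_of_two_lt (hh : Spec h) (i : Fin d) (hpos : ∀ η, h η ≠ 0 → 0 < η i)
    {p : ℝ} (hp : 2 < p) :
    ∫⁻ x, ‖𝓕⁻ h x‖ₑ ^ p ≤
      ENNReal.ofReal (p ^ 2 / 2) * ∫⁻ x, ‖(𝓕⁻ h x).re‖ₑ ^ (2 : ℝ) * ‖𝓕⁻ h x‖ₑ ^ (p - 2) := by
  obtain ⟨F, hF⟩ : ∃ F, F = 𝓕⁻ h := ⟨_, rfl⟩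
  have hFc : Continuous F := hF ▸ hh.continuous_fourierInv
  have i2 : ∀ A : ℝ, 0 < A → Integrable
      (fun x => (F x).re ^ 2 * (A + (F x).re ^ 2 + (F x).im ^ 2) ^ (p / 2 - 1)) volume := by
    intro A hA
    have := hh.integrable_sub_of_even (contDiff_re_sq_mul_rpow hA (p / 2 - 1)) (by simp)
    simpa [← hF] using this
  have hstep : ∀ A : ℝ, 0 < A →
      ∫⁻ x, ENNReal.ofReal ((A + (F x).re ^ 2 + (F x).im ^ 2) ^ (p / 2) - A ^ (p / 2)) ≤
      ENNReal.ofReal (p ^ 2 / 2) * ∫⁻ x, ENNReal.ofReal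
        ((F x).re ^ 2 * (A + (F x).re ^ 2 + (F x).im ^ 2) ^ (p / 2 - 1)) := by
    intro A hA
    have hg := contDiff_rpow_normSq hA (p / 2)
    have hf := contDiff_re_sq_mul_rpow hA (p / 2 - 1)
    have h1 := hh.integral_le_of_trace i hpos hf hg (by simp) (by simp) (p ^ 2 / 2) (fun z => by
      rw [trace_re_sq_mul_rpow hA, trace_rpow_normSq hA]
      exact trace_nonneg_two_le hp.le hA (sq_nonneg _) (sq_nonneg _))
    have i1 := hh.integrable_sub_of_even hg (by simp)
    simp only [Complex.zero_re, Complex.zero_im, ne_eq, OfNat.ofNat_ne_zero, not_false_eq_true,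
      zero_pow, add_zero, ← hF, zero_mul, sub_zero] at h1 i1
    rw [← ofReal_integral_eq_lintegral_ofReal i1 (ae_of_all _ fun x => sub_nonneg.2 (by
      have : A ≤ A + (F x).re ^ 2 + (F x).im ^ 2 := by nlinarith
      have : 0 ≤ p / 2 := by linarith
      gcongr)), ← ofReal_integral_eq_lintegral_ofReal (i2 A hA)
      (ae_of_all _ fun x => by positivity), ← ENNReal.ofReal_mul (by positivity)]
    exact ENNReal.ofReal_le_ofReal h1
  rw [← hF]
  have h0 : Tendsto (fun n : ℕ => 1 / ((n : ℝ) + 1)) atTop (𝓝 0) :=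
    tendsto_one_div_add_atTop_nhds_zero_nat
  have hlim : ∀ x, Tendsto (fun n : ℕ => ENNReal.ofReal
      ((1 / ((n : ℝ) + 1) + (F x).re ^ 2 + (F x).im ^ 2) ^ (p / 2) -
        (1 / ((n : ℝ) + 1)) ^ (p / 2))) atTop (𝓝 (‖F x‖ₑ ^ p)) := by
    intro x
    rw [← ofReal_rpow_normSq _ (by linarith : 0 ≤ p)]
    refine (ENNReal.continuous_ofReal.tendsto _).comp ?_
    have h3 := ((h0.add_const ((F x).re ^ 2)).add_const ((F x).im ^ 2)).rpow_const
      (p := p / 2) (Or.inr (by linarith))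
    have h4 := h0.rpow_const (p := p / 2) (Or.inr (by linarith))
    have h5 := h3.sub h4
    rwa [Real.zero_rpow (by linarith), sub_zero, zero_add] at h5
  have hlim2 : Tendsto (fun n : ℕ => ∫⁻ x, ENNReal.ofReal ((F x).re ^ 2 *
      (1 / ((n : ℝ) + 1) + (F x).re ^ 2 + (F x).im ^ 2) ^ (p / 2 - 1))) atTop
      (𝓝 (∫⁻ x, ‖(F x).re‖ₑ ^ (2 : ℝ) * ‖F x‖ₑ ^ (p - 2))) := by
    refine tendsto_lintegral_of_dominated_convergence (fun x => ENNReal.ofReal ((F x).re ^ 2 *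
      (1 + (F x).re ^ 2 + (F x).im ^ 2) ^ (p / 2 - 1))) (fun n => ?_) (fun n => ?_) ?_ ?_
    · fun_prop
    · refine ae_of_all _ fun x => ENNReal.ofReal_le_ofReal ?_
      have h1 : 1 / ((n : ℝ) + 1) ≤ 1 := by
        rw [div_le_one (by positivity)]; linarith [n.cast_nonneg (α := ℝ)]
      have h2 : 0 ≤ p / 2 - 1 := by linarith
      gcongr
    · exact ((i2 1 one_pos).lintegral_lt_top).ne
    · refine ae_of_all _ fun x => ?_
      have h6 : ‖(F x).re‖ₑ ^ (2 : ℝ) * ‖F x‖ₑ ^ (p - 2) = ENNReal.ofReal ((F x).re ^ 2 *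
          ((F x).re ^ 2 + (F x).im ^ 2) ^ (p / 2 - 1)) := by
        rw [ENNReal.ofReal_mul (sq_nonneg _), show p / 2 - 1 = (p - 2) / 2 by ring,
          ofReal_rpow_normSq _ (by linarith)]
        have := ofReal_rpow_normSq (((F x).re : ℝ) : ℂ) (by norm_num : (0 : ℝ) ≤ 2)
        rw [enorm_ofReal_eq] at this
        congr 1
        simpa using this.symm
      rw [h6]
      refine (ENNReal.continuous_ofReal.tendsto _).comp ?_
      have h3 := (((h0.add_const ((F x).re ^ 2)).add_const ((F x).im ^ 2)).rpow_const
        (p := p / 2 - 1) (Or.inr (by linarith))).const_mul ((F x).re ^ 2)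
      rwa [zero_add] at h3
  calc ∫⁻ x, ‖F x‖ₑ ^ p = ∫⁻ x, liminf (fun n : ℕ => ENNReal.ofReal
      ((1 / ((n : ℝ) + 1) + (F x).re ^ 2 + (F x).im ^ 2) ^ (p / 2) -
        (1 / ((n : ℝ) + 1)) ^ (p / 2))) atTop :=
        lintegral_congr fun x => (hlim x).liminf_eq.symm
    _ ≤ liminf (fun n : ℕ => ∫⁻ x, ENNReal.ofReal
      ((1 / ((n : ℝ) + 1) + (F x).re ^ 2 + (F x).im ^ 2) ^ (p / 2) -
        (1 / ((n : ℝ) + 1)) ^ (p / 2))) atTop := lintegral_liminf_le fun n => by fun_prop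
    _ ≤ liminf (fun n : ℕ => ENNReal.ofReal (p ^ 2 / 2) * ∫⁻ x, ENNReal.ofReal ((F x).re ^ 2 *
      (1 / ((n : ℝ) + 1) + (F x).re ^ 2 + (F x).im ^ 2) ^ (p / 2 - 1))) atTop :=
        liminf_le_liminf (Eventually.of_forall fun n => hstep _ (by positivity))
    _ = _ := (ENNReal.Tendsto.const_mul hlim2 (Or.inr ENNReal.ofReal_ne_top)).liminf_eq

end

/-- A function whose spectrum lies in a half-space is controlled in `L^p` by its real part. This is
the theorem of M. Riesz on conjugate functions. -/
theorem exists_eLpNorm_le_re {p : ℝ} (hp : 1 < p) :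
    ∃ K : ℝ≥0, ∀ {d : ℕ} {h : Space d → ℂ} (_ : Spec h) (i : Fin d)
      (_ : ∀ η, h η ≠ 0 → 0 < η i), eLpNorm (𝓕⁻ h) (ENNReal.ofReal p) volume ≤
        K * eLpNorm (fun x => (𝓕⁻ h x).re) (ENNReal.ofReal p) volume := by
  have hp0 : 0 < p := by linarith
  have hpt : (ENNReal.ofReal p).toReal = p := ENNReal.toReal_ofReal hp0.le
  have hpn : ENNReal.ofReal p ≠ 0 := by simpa using hp0
  rcases le_or_gt p 2 with hp2 | hp2
  · refine ⟨((2 / (p - 1)).toNNReal) ^ (1 / p), fun hh i hpos => ?_⟩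
    rw [eLpNorm_eq_lintegral_rpow_enorm_toReal hpn ENNReal.ofReal_ne_top,
      eLpNorm_eq_lintegral_rpow_enorm_toReal hpn ENNReal.ofReal_ne_top, hpt,
      ENNReal.coe_rpow_of_nonneg _ (by positivity), ← ENNReal.mul_rpow_of_nonneg _ _ (by positivity)]
    exact ENNReal.rpow_le_rpow (hh.lintegral_le_of_le_two i hpos hp hp2) (by positivity)
  · refine ⟨((p ^ 2 / 2).toNNReal) ^ (1 / 2 : ℝ), fun {d h} hh i hpos => ?_⟩
    have h1 := hh.lintegral_le_of_two_lt i hpos hp2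
    have hXtop : ∫⁻ x, ‖𝓕⁻ h x‖ₑ ^ p ≠ ⊤ := (hh.lintegral_fourierInv_lt_top hp2.le).ne
    have hcont := hh.continuous_fourierInv
    obtain ⟨F, hF⟩ : ∃ F, F = 𝓕⁻ h := ⟨_, rfl⟩
    simp only [← hF] at *
    have h2 := ENNReal.lintegral_mul_le_Lp_mul_Lq volume
      (f := fun x => ‖(F x).re‖ₑ ^ (2 : ℝ)) (g := fun x => ‖F x‖ₑ ^ (p - 2))
      (p := p / 2) (q := p / (p - 2))
      (Real.holderConjugate_iff.2 ⟨by linarith, by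
        have : p - 2 ≠ 0 := by linarith
        field_simp; ring⟩) (by fun_prop) (by fun_prop)
    simp only [Pi.mul_apply, ← ENNReal.rpow_mul] at h2
    rw [show 2 * (p / 2) = p by ring, show (p - 2) * (p / (p - 2)) = p by
      have : p - 2 ≠ 0 := by linarith
      field_simp] at h2
    rw [eLpNorm_eq_lintegral_rpow_enorm_toReal hpn ENNReal.ofReal_ne_top,
      eLpNorm_eq_lintegral_rpow_enorm_toReal hpn ENNReal.ofReal_ne_top, hpt]
    set X := ∫⁻ x, ‖F x‖ₑ ^ p
    set Y := ∫⁻ x, ‖(F x).re‖ₑ ^ p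
    rcases eq_or_ne X 0 with hX0 | hX0
    · rw [hX0, ENNReal.zero_rpow_of_pos (by positivity)]
      exact zero_le
    have h3 : X ≤ ENNReal.ofReal (p ^ 2 / 2) * (Y ^ (1 / (p / 2)) * X ^ (1 / (p / (p - 2)))) :=
      h1.trans (by gcongr)
    have h4 : X ^ (2 / p) ≤ ENNReal.ofReal (p ^ 2 / 2) * Y ^ (2 / p) := by
      have e1 : X ^ (2 / p) = X * X ^ (-(1 / (p / (p - 2)))) := by
        nth_rewrite 2 [← ENNReal.rpow_one X]
        rw [← ENNReal.rpow_add _ _ hX0 hXtop]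
        congr 1
        have : p - 2 ≠ 0 := by linarith
        field_simp
        ring
      rw [e1]
      calc _ ≤ ENNReal.ofReal (p ^ 2 / 2) * (Y ^ (1 / (p / 2)) * X ^ (1 / (p / (p - 2)))) *
            X ^ (-(1 / (p / (p - 2)))) := by gcongr
        _ = ENNReal.ofReal (p ^ 2 / 2) * Y ^ (1 / (p / 2)) * (X ^ (1 / (p / (p - 2))) *
            X ^ (-(1 / (p / (p - 2))))) := by ring
        _ = _ := by
          rw [← ENNReal.rpow_add _ _ hX0 hXtop, add_neg_cancel, ENNReal.rpow_zero, mul_one]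
          congr 2
          field_simp
    have h5 := ENNReal.rpow_le_rpow h4 (by norm_num : (0 : ℝ) ≤ 1 / 2)
    rw [ENNReal.mul_rpow_of_nonneg _ _ (by norm_num), ← ENNReal.rpow_mul, ← ENNReal.rpow_mul,
      show 2 / p * (1 / 2) = 1 / p by field_simp] at h5
    rw [ENNReal.coe_rpow_of_nonneg _ (by norm_num)]
    exact h5

/-! ### Multipliers of `L^p`: half-spaces and Poisson kernels -/

theorem fourierInv_congr_ae {h g : Space d → ℂ} (e : h =ᵐ[volume] g) : 𝓕⁻ h = 𝓕⁻ g := by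
  ext x
  simp only [fourierInv_eq_mul]
  refine integral_congr_ae ?_
  filter_upwards [e] with η hη
  rw [hη]

/-- Multiplying a spectrum by the Fourier transform of `k μ` amounts to convolving with `k μ`. -/
theorem Spec.fourierInv_mul_eq_integral {h k m : Space d → ℂ} (hh : Spec h) {μ : Measure (Space d)}
    [SFinite μ] (hk : Integrable k μ)
    (hm : ∀ η, ∫ y, (Real.fourierChar (-inner ℝ y η) : ℂ) * k y ∂μ = m η) (x : Space d) :
    𝓕⁻ (fun η => m η * h η) x = ∫ y, k y * 𝓕⁻ h (x - y) ∂μ := by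
  have hint : Integrable (fun z : Space d × Space d =>
      (Real.fourierChar (inner ℝ z.2 (x - z.1)) : ℂ) * (k z.1 * h z.2)) (μ.prod volume) :=
    (hk.mul_prod hh.integrable).bdd_mul (c := 1) (Continuous.aestronglyMeasurable (by fun_prop))
      (ae_of_all _ fun _ => (Circle.norm_coe _).le)
  calc 𝓕⁻ (fun η => m η * h η) x
      = ∫ η, ∫ y, (Real.fourierChar (inner ℝ η (x - y)) : ℂ) * (k y * h η) ∂μ := by
        rw [fourierInv_eq_mul]
        refine integral_congr_ae (ae_of_all _ fun η => ?_)
        simp only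
        rw [← hm, ← integral_mul_const, ← integral_const_mul]
        refine integral_congr_ae (ae_of_all _ fun y => ?_)
        simp only [sub_eq_add_neg, inner_add_right, inner_neg_right, AddChar.map_add_eq_mul, Circle.coe_mul]
        rw [real_inner_comm η y]
        ring
    _ = ∫ y, (∫ η, (Real.fourierChar (inner ℝ η (x - y)) : ℂ) * (k y * h η)) ∂μ :=
        (integral_integral_swap hint).symm
    _ = _ := by
        refine integral_congr_ae (ae_of_all _ fun y => ?_)
        simp only [fourierInv_eq_mul, ← integral_const_mul]
        refine integral_congr_ae (ae_of_all _ fun η => ?_)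
        simp only
        ring

theorem HasKer.cv_fourierInv {m k h : Space d → ℂ} (hk : HasKer m k) (hh : Spec h) :
    cv k (𝓕⁻ h) = 𝓕⁻ (fun η => m η * h η) := by
  ext x
  rw [hh.fourierInv_mul_eq_integral hk.1 (fun η => by rw [← hk.2, Real.fourier_eq]; rfl)]
  rfl

/-- `m` is a Fourier multiplier of `L^p` with norm at most `C`, tested on the functions whose
spectrum is bounded and compactly supported. -/
structure LpMul (p : ℝ≥0∞) (m : Space d → ℂ) (C : ℝ≥0) : Prop where
  meas : Measurable m
  bdd : ∃ B, ∀ η, ‖m η‖ ≤ B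
  bound : ∀ h, Spec h →
    eLpNorm (𝓕⁻ (fun η => m η * h η)) p volume ≤ C * eLpNorm (𝓕⁻ h) p volume

theorem LpMul.spec {p : ℝ≥0∞} {m h : Space d → ℂ} {C : ℝ≥0} (hm : LpMul p m C) (hh : Spec h) :
    Spec (fun η => m η * h η) := by
  obtain ⟨B, hB⟩ := hm.bdd
  exact hh.mul_bdd hm.meas hB

theorem LpMul.mono {p : ℝ≥0∞} {m : Space d → ℂ} {C C' : ℝ≥0} (hm : LpMul p m C) (hC : C ≤ C') :
    LpMul p m C' :=
  ⟨hm.meas, hm.bdd, fun h hh => (hm.bound h hh).trans (by gcongr)⟩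

theorem LpMul.one (p : ℝ≥0∞) : LpMul p (fun _ : Space d => (1 : ℂ)) 1 :=
  ⟨measurable_const, ⟨1, by simp⟩, by simp⟩

theorem LpMul.mul {p : ℝ≥0∞} {m m' : Space d → ℂ} {C C' : ℝ≥0} (hm : LpMul p m C)
    (hm' : LpMul p m' C') : LpMul p (fun η => m η * m' η) (C * C') := by
  obtain ⟨B, hB⟩ := hm.bdd
  obtain ⟨B', hB'⟩ := hm'.bdd
  refine ⟨hm.meas.mul hm'.meas, ⟨B * B', fun η => ?_⟩, fun h hh => ?_⟩
  · rw [norm_mul]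
    exact mul_le_mul (hB η) (hB' η) (norm_nonneg _) ((norm_nonneg _).trans (hB η))
  · simp only [mul_assoc]
    refine (hm.bound _ (hm'.spec hh)).trans ?_
    push_cast
    rw [mul_assoc]
    gcongr
    exact hm'.bound h hh

theorem LpMul.prod {ι : Type*} {p : ℝ≥0∞} (s : Finset ι) {m : ι → Space d → ℂ} {C : ℝ≥0}
    (hm : ∀ i ∈ s, LpMul p (m i) C) : LpMul p (fun η => ∏ i ∈ s, m i η) (C ^ s.card) := by
  classical
  induction s using Finset.induction_on with
  | empty => simpa using LpMul.one p
  | insert i s hi ih =>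
    simp only [Finset.prod_insert hi, Finset.card_insert_of_notMem hi, pow_succ']
    exact (hm i (Finset.mem_insert_self i s)).mul
      (ih fun j hj => hm j (Finset.mem_insert_of_mem hj))

theorem LpMul.one_sub {p : ℝ≥0∞} (hp : 1 ≤ p) {m : Space d → ℂ} {C : ℝ≥0} (hm : LpMul p m C) :
    LpMul p (fun η => 1 - m η) (1 + C) := by
  obtain ⟨B, hB⟩ := hm.bdd
  refine ⟨measurable_const.sub hm.meas, ⟨1 + B, fun η => (norm_sub_le _ _).trans ?_⟩, fun h hh => ?_⟩
  · simpa using hB η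
  have h1 : Spec (fun η => -1 * (m η * h η)) :=
    (hm.spec hh).mul_bdd (m := fun _ => -1) measurable_const (C := 1) (by simp)
  have h2 : 𝓕⁻ (fun η => (1 - m η) * h η) = 𝓕⁻ h - 𝓕⁻ (fun η => m η * h η) := by
    ext x
    have : (fun η => (1 - m η) * h η) = fun η => h η + -1 * (m η * h η) := by
      ext η; ring
    rw [this, hh.fourierInv_add h1, fourierInv_const_mul, Pi.sub_apply]
    ring
  rw [h2]
  refine (eLpNorm_sub_le hh.continuous_fourierInv.aestronglyMeasurable
    (hm.spec hh).continuous_fourierInv.aestronglyMeasurable hp).trans ?_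
  push_cast
  rw [add_mul, one_mul]
  gcongr
  exact hm.bound h hh

/-- The multiplier `e^{-b|η_i|}` is a contraction of `L^p`, being convolution with a probability
measure. -/
theorem lpMul_exp_neg {p : ℝ} (hp : 1 ≤ p) (i : Fin d) {b : ℝ} (hb : 0 ≤ b) :
    LpMul (ENNReal.ofReal p) (fun η => (Real.exp (-b * |η i|) : ℂ)) 1 := by
  refine ⟨by fun_prop, ⟨1, fun η => ?_⟩, fun h hh => ?_⟩
  · rw [Complex.norm_real, Real.norm_of_nonneg (Real.exp_nonneg _), Real.exp_le_one_iff]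
    have : 0 ≤ b * |η i| := by positivity
    linarith
  obtain ⟨μ, hμ, h3⟩ := exists_poisson_coord i hb
  have h4 : 𝓕⁻ (fun η => (Real.exp (-b * |η i|) : ℂ) * h η) =
      fun x => ∫ y, (1 : ℂ) * 𝓕⁻ h (x - y) ∂μ := by
    ext x
    exact hh.fourierInv_mul_eq_integral (μ := μ) (k := fun _ => 1) (integrable_const _)
      (fun η => by simpa using h3 η) x
  rw [h4]
  have := eLpNorm_integral_translate_le (μ := μ) (k := fun _ => (1 : ℂ)) (τ := id)
    aestronglyMeasurable_const measurable_id hh.continuous_fourierInv.aestronglyMeasurable hp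
  simpa using this

/-- The spectrum of the complex conjugate. -/
theorem fourierInv_conj (h : Space d → ℂ) (x : Space d) :
    𝓕⁻ (fun η => starRingEnd ℂ (h (-η))) x = starRingEnd ℂ (𝓕⁻ h x) := by
  simp only [fourierInv_eq_mul]
  rw [← integral_conj, ← integral_neg_eq_self]
  refine integral_congr_ae (ae_of_all _ fun η => ?_)
  simp only [neg_neg, map_mul, inner_neg_left, AddChar.map_neg_eq_inv, Circle.coe_inv_eq_conj]

theorem Spec.conj {h : Space d → ℂ} (hh : Spec h) : Spec (fun η => starRingEnd ℂ (h (-η))) := by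
  obtain ⟨C, hC⟩ := hh.bdd
  obtain ⟨R, hR⟩ := hh.supp
  exact ⟨Complex.continuous_conj.measurable.comp (hh.meas.comp measurable_neg),
    ⟨C, fun η => by simpa using hC (-η)⟩, R, fun η hη => by simp [hR (-η) (by simpa using hη)]⟩

theorem Spec.const_mul {h : Space d → ℂ} (hh : Spec h) (c : ℂ) : Spec (fun η => c * h η) :=
  hh.mul_bdd (m := fun _ => c) measurable_const (C := ‖c‖) (fun _ => le_rfl)

/-- The indicator function of the half-space `η_i > 0`. -/
def posHalf (i : Fin d) (η : Space d) : ℂ := if 0 < η i then 1 else 0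

/-- The indicator function of the half-space `η_i ≤ 0`. -/
def negHalf (i : Fin d) (η : Space d) : ℂ := if 0 < η i then 0 else 1

theorem measurable_posHalf (i : Fin d) : Measurable (posHalf i) :=
  Measurable.ite (measurableSet_lt measurable_const (by fun_prop)) measurable_const measurable_const

theorem norm_posHalf_le (i : Fin d) (η : Space d) : ‖posHalf i η‖ ≤ 1 := by
  unfold posHalf; split_ifs <;> simp

theorem ae_coord_ne_zero (i : Fin d) : ∀ᵐ η : Space d, η i ≠ 0 := by
  have h1 : volume ({η : Space d | η i = 0}) = 0 := by
    have := Measure.addHaar_submodule (volume : Measure (Space d))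
      (LinearMap.ker (EuclideanSpace.proj i : Space d →L[ℝ] ℝ).toLinearMap) (by
        intro htop
        have h2 : EuclideanSpace.single i (1 : ℝ) ∈ LinearMap.ker
          (EuclideanSpace.proj i : Space d →L[ℝ] ℝ).toLinearMap := by
          rw [htop]; trivial
        simp at h2)
    convert this using 2
    ext η
    simp
  exact measure_eq_zero_iff_ae_notMem.1 h1

/-- The half-space projection of a function with Hermitian spectrum, that is, of a real function:
twice the real part of the projection is the function itself. -/
theorem Spec.eLpNorm_posHalf_le {p : ℝ≥0∞} {K : ℝ≥0}
    {h : Space d → ℂ} (hh : Spec h) (i : Fin d) (hsym : ∀ η, starRingEnd ℂ (h (-η)) = h η)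
    (hK : ∀ {g : Space d → ℂ} (_ : Spec g) (_ : ∀ η, g η ≠ 0 → 0 < η i),
      eLpNorm (𝓕⁻ g) p volume ≤ K * eLpNorm (fun x => (𝓕⁻ g x).re) p volume) :
    eLpNorm (𝓕⁻ (fun η => posHalf i η * h η)) p volume ≤ K * eLpNorm (𝓕⁻ h) p volume := by
  have hg : Spec (fun η => posHalf i η * h η) :=
    hh.mul_bdd (measurable_posHalf i) (norm_posHalf_le i)
  refine (hK hg fun η hη => ?_).trans ?_
  · by_contra hn
    simp [posHalf, hn] at hη
  gcongr
  refine eLpNorm_mono fun x => ?_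
  have h1 : 𝓕⁻ h x = 𝓕⁻ (fun η => posHalf i η * h η) x +
      starRingEnd ℂ (𝓕⁻ (fun η => posHalf i η * h η) x) := by
    rw [← fourierInv_conj, ← hg.fourierInv_add hg.conj]
    refine congrFun (fourierInv_congr_ae ?_) x
    filter_upwards [ae_coord_ne_zero i] with η hη
    rw [map_mul, hsym]
    rcases lt_or_gt_of_ne hη with h0 | h0
    · simp [posHalf, h0, h0.not_gt]
    · simp [posHalf, h0, h0.not_gt]
  rw [h1, Complex.add_conj]
  simp only [Complex.norm_real, Real.norm_eq_abs, abs_mul]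
  have := abs_nonneg (𝓕⁻ (fun η => posHalf i η * h η) x).re
  norm_num
  linarith

/-- The half-spaces `η_i > 0` and `η_i ≤ 0` are multipliers of `L^p`, `1 < p < ∞`. -/
theorem exists_lpMul_half {p : ℝ} (hp : 1 < p) :
    ∃ K : ℝ≥0, 1 ≤ K ∧ ∀ {d : ℕ} (i : Fin d), LpMul (ENNReal.ofReal p) (posHalf i) K ∧
      LpMul (ENNReal.ofReal p) (negHalf i) K := by
  obtain ⟨K, hK⟩ := exists_eLpNorm_le_re hp
  have hp1 : 1 ≤ ENNReal.ofReal p := by simpa using hp.le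
  have hpos : ∀ {d : ℕ} (i : Fin d), LpMul (ENNReal.ofReal p) (posHalf i) (K + K) := by
    intro d i
    refine ⟨measurable_posHalf i, ⟨1, norm_posHalf_le i⟩, fun h hh => ?_⟩
    -- `h = h₁ + i h₂`, where `h₁` and `h₂` are the spectra of the real and the imaginary part
    have hs : ∀ c : ℂ, Spec (fun η => 1 / 2 * (c * h η + starRingEnd ℂ (c * h (-η)))) := fun c =>
      ((hh.const_mul c).add (hh.const_mul c).conj).const_mul (1 / 2)
    have hb : ∀ c : ℂ, ‖c‖ = 1 → eLpNorm (𝓕⁻ (fun η => posHalf i η *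
        (1 / 2 * (c * h η + starRingEnd ℂ (c * h (-η)))))) (ENNReal.ofReal p) volume ≤
        K * eLpNorm (𝓕⁻ h) (ENNReal.ofReal p) volume := by
      intro c hc
      refine ((hs c).eLpNorm_posHalf_le i (fun η => ?_) (fun hg h0 => hK hg i h0)).trans ?_
      · simp only [map_mul, map_add, neg_neg, Complex.conj_conj, map_div₀, map_one, map_ofNat]
        ring
      gcongr
      refine eLpNorm_mono fun x => ?_
      rw [fourierInv_const_mul, (hh.const_mul c).fourierInv_add (hh.const_mul c).conj]
      have h3 := fourierInv_conj (fun η => c * h η) x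
      rw [h3, fourierInv_const_mul]
      have h1 : ‖c * 𝓕⁻ h x‖ = ‖𝓕⁻ h x‖ := by rw [norm_mul, hc, one_mul]
      rw [Complex.add_conj]
      have h2 := Complex.abs_re_le_norm (c * 𝓕⁻ h x)
      rw [h1] at h2
      have h4 : (1 / 2 : ℂ) * ((2 * (c * 𝓕⁻ h x).re : ℝ) : ℂ) = ((c * 𝓕⁻ h x).re : ℂ) := by
        push_cast; ring
      rw [h4, Complex.norm_real]
      exact h2
    have hsp : ∀ c : ℂ, Spec (fun η => posHalf i η *
        (1 / 2 * (c * h η + starRingEnd ℂ (c * h (-η))))) := fun c =>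
      (hs c).mul_bdd (measurable_posHalf i) (norm_posHalf_le i)
    have hdec : 𝓕⁻ (fun η => posHalf i η * h η) = 𝓕⁻ (fun η => posHalf i η *
        (1 / 2 * (1 * h η + starRingEnd ℂ (1 * h (-η))))) + Complex.I • 𝓕⁻ (fun η => posHalf i η *
        (1 / 2 * (-Complex.I * h η + starRingEnd ℂ (-Complex.I * h (-η))))) := by
      ext x
      rw [Pi.add_apply, Pi.smul_apply, smul_eq_mul, ← fourierInv_const_mul,
        ← (hsp 1).fourierInv_add ((hsp (-Complex.I)).const_mul Complex.I)]
      refine congrArg (fun k : Space d → ℂ => 𝓕⁻ k x) (funext fun η => ?_)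
      simp only [map_mul, map_neg, Complex.conj_I, map_one]
      ring_nf
      simp only [Complex.I_sq]
      ring
    rw [hdec]
    refine (eLpNorm_add_le (hsp 1).continuous_fourierInv.aestronglyMeasurable
      ((hsp (-Complex.I)).continuous_fourierInv.aestronglyMeasurable.const_smul _) hp1).trans ?_
    rw [eLpNorm_const_smul]
    have hI : ‖Complex.I‖ₑ = 1 := by simp [← ofReal_norm]
    push_cast
    rw [add_mul, hI, one_mul]
    exact add_le_add (hb 1 (by simp)) (hb (-Complex.I) (by simp))
  refine ⟨1 + (K + K), le_self_add, fun i => ⟨(hpos i).mono le_add_self, ?_⟩⟩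
  have h1 := (hpos i).one_sub hp1
  have h2 : (fun η => 1 - posHalf i η) = negHalf i := by
    ext η; unfold posHalf negHalf; split_ifs <;> simp
  rwa [h2] at h1

/-! ### The bilinear estimate for `e^{a Λ₁}` -/

theorem Spec.cv_integrand {h g : Space d → ℂ} (hh : Spec h) (hg : Spec g) (x : Space d) :
    Integrable (fun y => h y * g (x - y)) volume := cv_integrable hh.integrable (hg.memLp ⊤) x

theorem Spec.cv {h g : Space d → ℂ} (hh : Spec h) (hg : Spec g) : Spec (cv h g) := by
  obtain ⟨C, hC⟩ := hg.bdd
  obtain ⟨R, hR⟩ := hh.supp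
  obtain ⟨S, hS⟩ := hg.supp
  refine ⟨?_, ⟨∫ y, ‖h y‖ * C, fun x => ?_⟩, R + S, fun x hx => ?_⟩
  · have hm : Measurable (fun z : Space d × Space d => h z.2 * g (z.1 - z.2)) :=
      (hh.meas.comp measurable_snd).mul (hg.meas.comp (measurable_fst.sub measurable_snd))
    exact (hm.stronglyMeasurable.integral_prod_right').measurable
  · refine (norm_integral_le_integral_norm _).trans (integral_mono (hh.cv_integrand hg x).norm
      (hh.integrable.norm.mul_const C) fun y => ?_)
    simp only [norm_mul]
    gcongr
    exact hC _
  · refine integral_eq_zero_of_ae (ae_of_all _ fun y => ?_)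
    simp only [Pi.zero_apply, mul_eq_zero]
    by_contra! hn
    have h1 : ‖y‖ ≤ R := not_lt.1 fun h0 => hn.1 (hR y h0)
    have h2 : ‖x - y‖ ≤ S := not_lt.1 fun h0 => hn.2 (hS _ h0)
    have h3 := norm_add_le (x - y) y
    rw [sub_add_cancel] at h3
    linarith

theorem Spec.fourierInv_cv {h g : Space d → ℂ} (hh : Spec h) (hg : Spec g) (x : Space d) :
    𝓕⁻ (GevreyBesov.cv h g) x = 𝓕⁻ h x * 𝓕⁻ g x := by
  simp only [Real.fourierInv_eq_fourier_neg]
  exact Real.fourier_mul_convolution_eq hh.integrable hg.integrable (-x)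

/-- On the line, the symbol `e^{A(|t+s| - |t| - |s|)}` is a function of `t` times a function of `s`
on each of the six sectors cut out by the signs of `t`, `s` and `t + s`. This is the factor of the
indicator function of a sector which depends on the sum of the frequencies. -/
def outerFactor (i : Fin d) : Fin 6 → Space d → ℂ :=
  ![fun _ => 1, fun _ => 1, posHalf i, negHalf i, posHalf i, negHalf i]

/-- The factor of the sector decomposition which depends on the first frequency. -/
def leftFactor (A : ℝ) (i : Fin d) : Fin 6 → Space d → ℂ :=
  ![posHalf i, negHalf i, posHalf i, fun η => posHalf i η * (Real.exp (-(2 * A) * |η i|) : ℂ),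
    fun η => negHalf i η * (Real.exp (-(2 * A) * |η i|) : ℂ), negHalf i]

/-- The factor of the sector decomposition which depends on the second frequency. -/
def rightFactor (A : ℝ) (i : Fin d) : Fin 6 → Space d → ℂ :=
  ![posHalf i, negHalf i, fun η => negHalf i η * (Real.exp (-(2 * A) * |η i|) : ℂ), negHalf i,
    posHalf i, fun η => posHalf i η * (Real.exp (-(2 * A) * |η i|) : ℂ)]

/-- The six sectors: in the `k`-th one the exponent `|t+s| - |t| - |s|` is `0`, `-2|t|` or `-2|s|`.
The factors use the half-lines `t > 0` and `t ≤ 0`, so that the identity holds at every point. -/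
theorem exp_abs_add_eq_sum (A : ℝ) (i : Fin d) (ξ ζ : Space d) :
    ((Real.exp (A * |(ξ + ζ) i|) * (Real.exp (-A * |ξ i|) * Real.exp (-A * |ζ i|)) : ℝ) : ℂ) =
      ∑ τ, outerFactor i τ (ξ + ζ) * (leftFactor A i τ ξ * rightFactor A i τ ζ) := by
  rw [← Real.exp_add, ← Real.exp_add, Fin.sum_univ_six]
  simp only [outerFactor, leftFactor, rightFactor, posHalf, negHalf, Matrix.cons_val,
    PiLp.add_apply]
  by_cases h1 : 0 < ξ i <;> by_cases h2 : 0 < ζ i <;> by_cases h3 : 0 < ξ i + ζ i <;>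
    simp only [h1, h2, h3, if_true, if_false, mul_one, mul_zero, one_mul, zero_mul, add_zero,
      zero_add, Complex.ofReal_inj] <;>
    simp only [not_lt] at * <;>
    first
    | linarith
    | (simp only [abs_of_pos, abs_of_nonpos, h1, h2, h3]
       first
       | (rw [← Complex.ofReal_one, Complex.ofReal_inj, Real.exp_eq_one_iff]; ring)
       | (congr 2; ring))

theorem gevreySymbol_eq_prod (A : ℝ) (η : Space d) :
    gevreySymbol A η = ∏ i, ((Real.exp (A * |η i|) : ℝ) : ℂ) := by
  rw [gevreySymbol, Finset.mul_sum, Real.exp_sum, Complex.ofReal_prod]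

theorem continuous_gevreySymbol (A : ℝ) : Continuous (gevreySymbol A : Space d → ℂ) := by
  unfold gevreySymbol
  fun_prop

/-- The bilinear symbol `e^{A(|ξ+ζ|₁ - |ξ|₁ - |ζ|₁)}` is a sum of `6^d` products of symbols in
`ξ + ζ`, `ξ` and `ζ`. -/
theorem gevreySymbol_add_eq_sum (A : ℝ) (ξ ζ : Space d) :
    gevreySymbol A (ξ + ζ) * (gevreySymbol (-A) ξ * gevreySymbol (-A) ζ) =
      ∑ τ : Fin d → Fin 6, (∏ i, outerFactor i (τ i) (ξ + ζ)) *
        ((∏ i, leftFactor A i (τ i) ξ) * ∏ i, rightFactor A i (τ i) ζ) := by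
  simp only [gevreySymbol_eq_prod, ← Finset.prod_mul_distrib, ← Complex.ofReal_mul,
    exp_abs_add_eq_sum]
  rw [Finset.prod_univ_sum, Fintype.piFinset_univ]

/-- The factors of the sector decomposition are multipliers of `L^p`, uniformly in `A ≥ 0`. -/
theorem exists_lpMul_factors {p : ℝ} (hp : 1 < p) :
    ∃ K : ℝ≥0, ∀ {d : ℕ} {A : ℝ} (_ : 0 ≤ A) (i : Fin d) (τ : Fin 6),
      LpMul (ENNReal.ofReal p) (outerFactor i τ) K ∧
      LpMul (ENNReal.ofReal p) (leftFactor A i τ) K ∧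
      LpMul (ENNReal.ofReal p) (rightFactor A i τ) K := by
  obtain ⟨K, hK1, hK⟩ := exists_lpMul_half hp
  refine ⟨K, fun {d A} hA i τ => ?_⟩
  have h0 : LpMul (ENNReal.ofReal p) (fun _ : Space d => (1 : ℂ)) K := (LpMul.one _).mono hK1
  have h1 := (hK i).1
  have h2 := (hK i).2
  have h3 : LpMul (ENNReal.ofReal p)
      (fun η => posHalf i η * (Real.exp (-(2 * A) * |η i|) : ℂ)) K := by
    simpa using h1.mul (lpMul_exp_neg hp.le i (by positivity : 0 ≤ 2 * A))
  have h4 : LpMul (ENNReal.ofReal p)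
      (fun η => negHalf i η * (Real.exp (-(2 * A) * |η i|) : ℂ)) K := by
    simpa using h2.mul (lpMul_exp_neg hp.le i (by positivity : 0 ≤ 2 * A))
  fin_cases τ
  exacts [⟨h0, h1, h1⟩, ⟨h0, h2, h2⟩, ⟨h1, h1, h4⟩, ⟨h2, h3, h2⟩, ⟨h1, h4, h1⟩, ⟨h2, h2, h3⟩]

theorem fourierInv_sum {ι : Type*} (s : Finset ι) {f : ι → Space d → ℂ}
    (hf : ∀ i ∈ s, Spec (f i)) :
    𝓕⁻ (fun η => ∑ i ∈ s, f i η) = ∑ i ∈ s, 𝓕⁻ (f i) := by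
  ext x
  simp only [fourierInv_eq_mul, Finset.sum_apply, Finset.mul_sum]
  exact integral_finsetSum s fun i hi => (hf i hi).integrable_char x

/-- The bilinear estimate for spectra: the operator `(u, v) ↦ ρ(D) e^{AΛ}(e^{-AΛ} u · e^{-AΛ} v)`
is bounded uniformly in `A ≥ 0`. The factor `u` goes from `L^q` to `L^∞` by Hölder's inequality for
the kernel of `θ`, a symbol which is `1` on the spectrum of `u`: this is Bernstein's inequality. -/
theorem exists_bilinear_spec (d : ℕ) {p q : ℝ} (hp : 1 < p) (hq : 1 < q) :
    ∃ C : ℝ≥0, ∀ {A : ℝ} (_ : 0 ≤ A) {q' : ℝ} (_ : q.HolderConjugate q')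
      {h g ρ kρ θ kθ : Space d → ℂ} (_ : Spec h) (_ : Spec g) (_ : HasKer ρ kρ) (_ : HasKer θ kθ)
      (_ : ∀ η, θ η * h η = h η),
      eLpNorm (𝓕⁻ (fun η => ρ η * (gevreySymbol A η * cv (fun ξ => gevreySymbol (-A) ξ * h ξ)
        (fun ξ => gevreySymbol (-A) ξ * g ξ) η))) (ENNReal.ofReal p) volume ≤
      C * (eLpNorm kρ 1 volume * eLpNorm kθ (ENNReal.ofReal q') volume) *
        (eLpNorm (𝓕⁻ h) (ENNReal.ofReal q) volume * eLpNorm (𝓕⁻ g) (ENNReal.ofReal p) volume) := by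
  obtain ⟨K, hK⟩ := exists_lpMul_factors hp
  obtain ⟨L, hL⟩ := exists_lpMul_factors hq
  have hp1 : 1 ≤ ENNReal.ofReal p := by simpa using hp.le
  refine ⟨Fintype.card (Fin d → Fin 6) * (K ^ d * (L ^ d * K ^ d)),
    fun {A} hA {q'} hqq {h g ρ kρ θ kθ} hh hg hρ hθ hθh => ?_⟩
  set O : (Fin d → Fin 6) → Space d → ℂ := fun τ η => ∏ i, outerFactor i (τ i) η with hO
  set U : (Fin d → Fin 6) → Space d → ℂ := fun τ η => ∏ i, leftFactor A i (τ i) η with hU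
  set V : (Fin d → Fin 6) → Space d → ℂ := fun τ η => ∏ i, rightFactor A i (τ i) η with hV
  have mO : ∀ τ, LpMul (ENNReal.ofReal p) (O τ) (K ^ d) := fun τ => by
    simpa using LpMul.prod Finset.univ fun i _ => (hK hA i (τ i)).1
  have mU : ∀ τ, LpMul (ENNReal.ofReal q) (U τ) (L ^ d) := fun τ => by
    simpa using LpMul.prod Finset.univ fun i _ => (hL hA i (τ i)).2.1
  have mV : ∀ τ, LpMul (ENNReal.ofReal p) (V τ) (K ^ d) := fun τ => by
    simpa using LpMul.prod Finset.univ fun i _ => (hK hA i (τ i)).2.2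
  have sc : ∀ τ, Spec (cv (fun ξ => U τ ξ * h ξ) (fun ξ => V τ ξ * g ξ)) := fun τ =>
    ((mU τ).spec hh).cv ((mV τ).spec hg)
  have sO : ∀ τ, Spec (fun η => O τ η * cv (fun ξ => U τ ξ * h ξ) (fun ξ => V τ ξ * g ξ) η) :=
    fun τ => (mO τ).spec (sc τ)
  have sρ : ∀ τ, Spec (fun η => ρ η *
      (O τ η * cv (fun ξ => U τ ξ * h ξ) (fun ξ => V τ ξ * g ξ) η)) :=
    fun τ => (sO τ).mul_cont hρ.continuous
  have hsum : (fun η => ρ η * (gevreySymbol A η * cv (fun ξ => gevreySymbol (-A) ξ * h ξ)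
      (fun ξ => gevreySymbol (-A) ξ * g ξ) η)) = fun η => ∑ τ, ρ η *
        (O τ η * cv (fun ξ => U τ ξ * h ξ) (fun ξ => V τ ξ * g ξ) η) := by
    ext η
    rw [← Finset.mul_sum]
    congr 1
    simp only [cv, ← integral_const_mul]
    rw [← integral_finsetSum _ fun τ _ =>
      (((mU τ).spec hh).cv_integrand ((mV τ).spec hg) η).const_mul (O τ η)]
    refine integral_congr_ae (ae_of_all _ fun ξ => ?_)
    have := gevreySymbol_add_eq_sum A ξ (η - ξ)
    rw [add_sub_cancel] at this
    calc _ = gevreySymbol A η * (gevreySymbol (-A) ξ * gevreySymbol (-A) (η - ξ)) *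
          (h ξ * g (η - ξ)) := by ring
      _ = _ := by
        rw [this, Finset.sum_mul]
        refine Finset.sum_congr rfl fun τ _ => ?_
        simp only [hO, hU, hV]
        ring
  rw [hsum, fourierInv_sum _ fun τ _ => sρ τ]
  refine (eLpNorm_sum_le (fun τ _ => (sρ τ).continuous_fourierInv.aestronglyMeasurable) hp1).trans ?_
  have hone : ∀ τ, eLpNorm (𝓕⁻ (fun η => ρ η *
      (O τ η * cv (fun ξ => U τ ξ * h ξ) (fun ξ => V τ ξ * g ξ) η))) (ENNReal.ofReal p) volume ≤
      (K ^ d * (L ^ d * K ^ d) : ℝ≥0) *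
        (eLpNorm kρ 1 volume * eLpNorm kθ (ENNReal.ofReal q') volume) *
        (eLpNorm (𝓕⁻ h) (ENNReal.ofReal q) volume *
          eLpNorm (𝓕⁻ g) (ENNReal.ofReal p) volume) := by
    intro τ
    rw [← hρ.cv_fourierInv (sO τ)]
    refine (eLpNorm_cv_le hρ.aesm (sO τ).continuous_fourierInv.aestronglyMeasurable hp.le).trans ?_
    have h1 := (mO τ).bound _ (sc τ)
    have h2 : ∀ x, ‖𝓕⁻ (fun ξ => U τ ξ * h ξ) x‖ₑ ≤ eLpNorm kθ (ENNReal.ofReal q') volume *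
        (L ^ d * eLpNorm (𝓕⁻ h) (ENNReal.ofReal q) volume) := by
      intro x
      have e1 : 𝓕⁻ (fun ξ => U τ ξ * h ξ) = cv kθ (𝓕⁻ (fun ξ => U τ ξ * h ξ)) := by
        rw [hθ.cv_fourierInv ((mU τ).spec hh)]
        refine congrArg _ (funext fun ξ => ?_)
        rw [mul_left_comm, hθh]
      rw [e1]
      refine (enorm_cv_le_holder hθ.aesm
        ((mU τ).spec hh).continuous_fourierInv.aestronglyMeasurable hqq x).trans ?_
      gcongr
      simpa using (mU τ).bound h hh
    have h3 : eLpNorm (𝓕⁻ (cv (fun ξ => U τ ξ * h ξ) (fun ξ => V τ ξ * g ξ)))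
        (ENNReal.ofReal p) volume ≤ (eLpNorm kθ (ENNReal.ofReal q') volume *
        (L ^ d * eLpNorm (𝓕⁻ h) (ENNReal.ofReal q) volume)) *
        (K ^ d * eLpNorm (𝓕⁻ g) (ENNReal.ofReal p) volume) := by
      have e2 : 𝓕⁻ (cv (fun ξ => U τ ξ * h ξ) (fun ξ => V τ ξ * g ξ)) =
          fun x => 𝓕⁻ (fun ξ => U τ ξ * h ξ) x * 𝓕⁻ (fun ξ => V τ ξ * g ξ) x := by
        ext x
        exact ((mU τ).spec hh).fourierInv_cv ((mV τ).spec hg) x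
      rw [e2]
      have h4 := (mV τ).bound g hg
      push_cast at h4
      refine le_trans ?_ (mul_le_mul_right h4 _)
      refine eLpNorm_le_mul_eLpNorm_of_ae_le_mul'' _
        ((mV τ).spec hg).continuous_fourierInv.aestronglyMeasurable (ae_of_all _ fun x => ?_)
      rw [enorm_mul]
      gcongr
      exact h2 x
    refine (mul_le_mul_right (h1.trans (mul_le_mul_right h3 _)) _).trans_eq ?_
    push_cast
    ring
  refine (Finset.sum_le_sum fun τ _ => hone τ).trans_eq ?_
  rw [Finset.sum_const, Finset.card_univ, nsmul_eq_mul]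
  push_cast
  ring

/-! ### The bilinear estimate for bounded functions -/

theorem cv_comm (k w : Space d → ℂ) : cv k w = cv w k := by
  ext x
  simp only [cv]
  rw [← integral_sub_left_eq_self _ volume x]
  simp only [sub_sub_cancel, mul_comm]

/-- For every radius there is a smooth compactly supported function, equal to `1` on the ball. -/
theorem exists_smooth_eq_one (R : ℝ) : ∃ θ : Space d → ℂ, ContDiff ℝ ∞ θ ∧ HasCompactSupport θ ∧
    ∀ η, ‖η‖ ≤ R → θ η = 1 := by
  let b : ContDiffBump (0 : Space d) := ⟨|R| + 1, |R| + 2, by positivity, by linarith⟩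
  refine ⟨fun η => (b η : ℂ), Complex.ofRealCLM.contDiff.comp b.contDiff,
    b.hasCompactSupport.comp_left (g := ((↑) : ℝ → ℂ)) rfl, fun η hη => ?_⟩
  have h1 := le_abs_self R
  have h2 : b η = 1 := b.one_of_mem_closedBall (by
    rw [mem_closedBall_zero_iff]
    change ‖η‖ ≤ |R| + 1
    linarith)
  simp [h2]

theorem _root_.HasCompactSupport.exists_norm_le {m : Space d → ℂ} (hm : HasCompactSupport m) :
    ∃ R, ∀ η, m η ≠ 0 → ‖η‖ ≤ R := by
  obtain ⟨R, hR⟩ := hm.isCompact.isBounded.subset_closedBall 0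
  exact ⟨R, fun η hη => by simpa using hR (subset_tsupport m hη)⟩

theorem fourier_integrable_hasKer {W : Space d → ℂ} (hW : Integrable W volume) : HasKer (𝓕 W) W :=
  ⟨hW, fun _ => rfl⟩

theorem HasKer.spec_mul_fourier {m k W : Space d → ℂ} (hk : HasKer m k) (hm : HasCompactSupport m)
    (hW : Integrable W volume) : Spec (fun η => m η * 𝓕 W η) := by
  have hc := (fourier_integrable_hasKer hW).continuous
  obtain ⟨R, hR⟩ := hm.exists_norm_le
  refine ⟨hk.continuous.measurable.mul hc.measurable, ⟨(∫ y, ‖k y‖) * ∫ y, ‖W y‖, fun η => ?_⟩, R,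
    fun η hη => ?_⟩
  · rw [norm_mul]
    exact mul_le_mul (hk.bound η) ((fourier_integrable_hasKer hW).bound η) (norm_nonneg _)
      (integral_nonneg fun _ => norm_nonneg _)
  · by_contra hn
    exact hη.not_ge (hR η (left_ne_zero_of_mul hn))

/-- For an integrable bounded function `W`, the operator `m(D)` acts on the Fourier side. The function
`W` itself need not be band-limited, so `m(D) W` is rewritten as `m(D) θ(D) W` with a smooth `θ`
equal to `1` on the support of `m`. -/
theorem HasKer.cv_eq_fourierInv {m k W : Space d → ℂ} (hk : HasKer m k) (hm : HasCompactSupport m)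
    (hW : Integrable W volume) (hW' : MemLp W ⊤ volume) :
    cv k W = 𝓕⁻ (fun η => m η * 𝓕 W η) := by
  obtain ⟨R, hR⟩ := hm.exists_norm_le
  obtain ⟨θ, h1, h2, h3⟩ := exists_smooth_eq_one (d := d) R
  obtain ⟨k', hk'⟩ := exists_hasKer_of_smooth h1 h2
  have hmθ : ∀ η, m η * θ η = m η := fun η => by
    by_cases h0 : m η = 0
    · simp [h0]
    · rw [h3 η (hR η h0), mul_one]
  have e1 : cv k W = cv k (cv k' W) :=
    (cv_cv hk hk' (by simpa only [hmθ] using hk) hW').symm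
  have sθ : Spec θ := by
    obtain ⟨S, hS⟩ := h2.exists_norm_le
    exact ⟨h1.continuous.measurable, ⟨_, hk'.bound⟩, S, fun η hη => by
      by_contra hn; exact hη.not_ge (hS η hn)⟩
  have e2 : (k' : Space d → ℂ) = 𝓕⁻ θ := by
    have : 𝓕 (k' : Space d → ℂ) = θ := funext hk'.2
    rw [← this]
    exact (Continuous.fourierInv_fourier_eq k'.continuous hk'.1 (by rw [this]; exact sθ.integrable)).symm
  have hWk := fourier_integrable_hasKer hW
  have s1 : Spec (fun η => 𝓕 W η * θ η) := sθ.mul_cont hWk.continuous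
  rw [e1, cv_comm k' W, e2, hWk.cv_fourierInv sθ, hk.cv_fourierInv s1]
  refine congrArg _ (funext fun η => ?_)
  rw [mul_left_comm, hmθ, mul_comm]

/-- Dominated convergence for convolutions. -/
theorem tendsto_cv {k g w : Space d → ℂ} {wn : ℕ → Space d → ℂ} (hk : Integrable k volume)
    (hg : MemLp g ⊤ volume) (hwn : ∀ n, AEStronglyMeasurable (wn n) volume)
    (hb : ∀ n y, ‖wn n y‖ ≤ ‖g y‖) (hl : ∀ y, Tendsto (fun n => wn n y) atTop (𝓝 (w y)))
    (x : Space d) : Tendsto (fun n => cv k (wn n) x) atTop (𝓝 (cv k w x)) := by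
  refine tendsto_integral_of_dominated_convergence (fun y => ‖k y * g (x - y)‖)
    (fun n => hk.1.mul (aestronglyMeasurable_comp_sub (hwn n) x)) (cv_integrable hk hg x).norm
    (fun n => ae_of_all _ fun y => ?_) (ae_of_all _ fun y => (hl (x - y)).const_mul (k y))
  rw [norm_mul, norm_mul]
  gcongr
  exact hb n _

/-- The truncation of a function to the ball of radius `n`. -/
def trunc (n : ℕ) (W : Space d → ℂ) : Space d → ℂ := (Metric.closedBall 0 (n : ℝ)).indicator W

theorem norm_trunc_le (n : ℕ) (W : Space d → ℂ) (x : Space d) : ‖trunc n W x‖ ≤ ‖W x‖ :=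
  norm_indicator_le_norm_self _ _

theorem memLp_trunc {W : Space d → ℂ} (hW : MemLp W ⊤ volume) (n : ℕ) : MemLp (trunc n W) ⊤ volume :=
  hW.indicator Metric.isClosed_closedBall.measurableSet

theorem integrable_trunc {W : Space d → ℂ} (hW : MemLp W ⊤ volume) (n : ℕ) :
    Integrable (trunc n W) volume := by
  rw [← memLp_one_iff_integrable, trunc,
    memLp_indicator_iff_restrict Metric.isClosed_closedBall.measurableSet]
  have : IsFiniteMeasure (volume.restrict (Metric.closedBall (0 : Space d) n)) :=
    ⟨by simpa using measure_closedBall_lt_top⟩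
  exact (hW.restrict _).mono_exponent le_top

theorem tendsto_trunc (W : Space d → ℂ) (x : Space d) :
    Tendsto (fun n => trunc n W x) atTop (𝓝 (W x)) := by
  refine tendsto_const_nhds.congr' ?_
  obtain ⟨N, hN⟩ := exists_nat_ge ‖x‖
  filter_upwards [eventually_ge_atTop N] with n hn
  rw [trunc, Set.indicator_of_mem]
  simpa using hN.trans (by exact_mod_cast hn)

theorem memLp_mul_top {w v : Space d → ℂ} (hw : MemLp w ⊤ volume) (hv : MemLp v ⊤ volume) :
    MemLp (fun x => w x * v x) ⊤ volume := by
  refine ⟨hw.1.mul hv.1, ?_⟩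
  refine lt_of_le_of_lt ?_ (ENNReal.mul_lt_top hw.2 hv.2)
  refine eLpNorm_le_mul_eLpNorm_of_ae_le_mul'' _ hv.1 ?_
  filter_upwards [ae_le_eLpNormEssSup (f := w) (μ := volume)] with x hx
  rw [enorm_mul]
  gcongr
  simpa using hx

/-- The product of two band-limited functions is approximated by products of functions with a
compactly supported spectrum. -/
theorem tendsto_fourierInv_trunc {m₁ m₂ M κ₁ κ₂ K W V : Space d → ℂ} (h₁ : HasKer m₁ κ₁)
    (c₁ : HasCompactSupport m₁) (h₂ : HasKer m₂ κ₂) (c₂ : HasCompactSupport m₂) (hM : HasKer M K)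
    (hW : MemLp W ⊤ volume) (hV : MemLp V ⊤ volume) (x : Space d) :
    Tendsto (fun n => 𝓕⁻ (fun η => M η * cv (fun ξ => m₁ ξ * 𝓕 (trunc n W) ξ)
      (fun ξ => m₂ ξ * 𝓕 (trunc n V) ξ) η) x) atTop
      (𝓝 (cv K (fun y => cv κ₁ W y * cv κ₂ V y) x)) := by
  have s1 := fun n => h₁.spec_mul_fourier c₁ (integrable_trunc hW n)
  have s2 := fun n => h₂.spec_mul_fourier c₂ (integrable_trunc hV n)
  have e : ∀ n, 𝓕⁻ (fun η => M η * cv (fun ξ => m₁ ξ * 𝓕 (trunc n W) ξ)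
      (fun ξ => m₂ ξ * 𝓕 (trunc n V) ξ) η) =
      cv K (fun y => cv κ₁ (trunc n W) y * cv κ₂ (trunc n V) y) := by
    intro n
    rw [← hM.cv_fourierInv ((s1 n).cv (s2 n))]
    congr 1
    ext y
    rw [(s1 n).fourierInv_cv (s2 n), h₁.cv_eq_fourierInv c₁ (integrable_trunc hW n)
      (memLp_trunc hW n), h₂.cv_eq_fourierInv c₂ (integrable_trunc hV n) (memLp_trunc hV n)]
  simp only [e]
  obtain ⟨B, hB⟩ : ∃ B : ℝ, ∀ n y, ‖cv κ₁ (trunc n W) y * cv κ₂ (trunc n V) y‖ ≤ B := by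
    have hf1 : eLpNorm κ₁ 1 volume * eLpNorm W ⊤ volume ≠ ⊤ :=
      (ENNReal.mul_lt_top (memLp_one_iff_integrable.2 h₁.1).2 hW.2).ne
    have hf2 : eLpNorm κ₂ 1 volume * eLpNorm V ⊤ volume ≠ ⊤ :=
      (ENNReal.mul_lt_top (memLp_one_iff_integrable.2 h₂.1).2 hV.2).ne
    refine ⟨((eLpNorm κ₁ 1 volume * eLpNorm W ⊤ volume) *
      (eLpNorm κ₂ 1 volume * eLpNorm V ⊤ volume)).toReal, fun n y => ?_⟩
    rw [← toReal_enorm, enorm_mul]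
    refine ENNReal.toReal_mono (ENNReal.mul_ne_top hf1 hf2) (mul_le_mul' ?_ ?_)
    · refine (enorm_cv_le h₁.aesm y).trans ?_
      gcongr 1
      exact eLpNorm_mono (norm_trunc_le n W)
    · refine (enorm_cv_le h₂.aesm y).trans ?_
      gcongr 1
      exact eLpNorm_mono (norm_trunc_le n V)
  have hB0 : 0 ≤ B := (norm_nonneg _).trans (hB 0 0)
  refine tendsto_cv (g := fun _ => (B : ℂ)) hM.1 (memLp_top_const _)
    (fun n => (aestronglyMeasurable_cv h₁.aesm (memLp_trunc hW n).1).mul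
      (aestronglyMeasurable_cv h₂.aesm (memLp_trunc hV n).1)) (fun n y => ?_) (fun y => ?_) x
  · rw [Complex.norm_real, Real.norm_of_nonneg hB0]
    exact hB n y
  · exact (tendsto_cv h₁.1 hW (fun n => (memLp_trunc hW n).1) (fun n => norm_trunc_le n W)
      (tendsto_trunc W) y).mul (tendsto_cv h₂.1 hV (fun n => (memLp_trunc hV n).1)
      (fun n => norm_trunc_le n V) (tendsto_trunc V) y)

/-- The bilinear estimate: the operator `(u, v) ↦ ρ(D) e^{AΛ}(e^{-AΛ} u · e^{-AΛ} v)` is bounded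
uniformly in `A ≥ 0` on frequency-localized functions. Here `u = θ₁(D) W` and `v = θ₂(D) V` with
bounded `W` and `V`, and `θ = 1` on the support of `θ₁`. The bounded functions are truncated in
space, which gives them a Fourier transform, and the estimate passes to the limit by Fatou's lemma. -/
theorem exists_bilinear (d : ℕ) {p q : ℝ} (hp : 1 < p) (hq : 1 < q) :
    ∃ C : ℝ≥0, ∀ {A : ℝ} (_ : 0 ≤ A) {q' : ℝ} (_ : q.HolderConjugate q')
      {θ₁ k₁ κ₁ θ₂ k₂ κ₂ ρ kρ K θ kθ W V : Space d → ℂ}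
      (_ : HasKer θ₁ k₁) (_ : HasCompactSupport θ₁)
      (_ : HasKer (fun η => gevreySymbol (-A) η * θ₁ η) κ₁)
      (_ : HasKer θ₂ k₂) (_ : HasCompactSupport θ₂)
      (_ : HasKer (fun η => gevreySymbol (-A) η * θ₂ η) κ₂)
      (_ : HasKer ρ kρ) (_ : HasKer (fun η => gevreySymbol A η * ρ η) K)
      (_ : HasKer θ kθ) (_ : ∀ η, θ η * θ₁ η = θ₁ η)
      (_ : MemLp W ⊤ volume) (_ : MemLp V ⊤ volume),
      eLpNorm (cv K (fun y => cv κ₁ W y * cv κ₂ V y)) (ENNReal.ofReal p) volume ≤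
      C * (eLpNorm kρ 1 volume * eLpNorm kθ (ENNReal.ofReal q') volume *
        (eLpNorm k₁ 1 volume * eLpNorm k₂ 1 volume)) *
        (eLpNorm W (ENNReal.ofReal q) volume * eLpNorm V (ENNReal.ofReal p) volume) := by
  obtain ⟨C, hC⟩ := exists_bilinear_spec d hp hq
  refine ⟨C, fun {A} hA {q'} hqq {θ₁ k₁ κ₁ θ₂ k₂ κ₂ ρ kρ K θ kθ W V} h₁ c₁ h₁' h₂ c₂ h₂' hρ hK hθ
    hθθ hW hV => ?_⟩
  have c₁' : HasCompactSupport (fun η => gevreySymbol (-A) η * θ₁ η) := c₁.mul_left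
  have c₂' : HasCompactSupport (fun η => gevreySymbol (-A) η * θ₂ η) := c₂.mul_left
  have s1 := fun n => h₁.spec_mul_fourier c₁ (integrable_trunc hW n)
  have s2 := fun n => h₂.spec_mul_fourier c₂ (integrable_trunc hV n)
  have hlim := tendsto_fourierInv_trunc h₁' c₁' h₂' c₂' hK hW hV
  have hform : ∀ n, (fun η => gevreySymbol A η * ρ η *
      cv (fun ξ => gevreySymbol (-A) ξ * θ₁ ξ * 𝓕 (trunc n W) ξ)
        (fun ξ => gevreySymbol (-A) ξ * θ₂ ξ * 𝓕 (trunc n V) ξ) η) =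
      fun η => ρ η * (gevreySymbol A η *
        cv (fun ξ => gevreySymbol (-A) ξ * (θ₁ ξ * 𝓕 (trunc n W) ξ))
        (fun ξ => gevreySymbol (-A) ξ * (θ₂ ξ * 𝓕 (trunc n V) ξ)) η) := by
    intro n
    ext η
    simp only [mul_assoc]
    ring
  simp only [hform] at hlim
  have hsp : ∀ n, Spec (fun η => ρ η * (gevreySymbol A η *
        cv (fun ξ => gevreySymbol (-A) ξ * (θ₁ ξ * 𝓕 (trunc n W) ξ))
        (fun ξ => gevreySymbol (-A) ξ * (θ₂ ξ * 𝓕 (trunc n V) ξ)) η)) := fun n =>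
    ((((s1 n).mul_cont (continuous_gevreySymbol _)).cv
      ((s2 n).mul_cont (continuous_gevreySymbol _))).mul_cont
      (continuous_gevreySymbol A)).mul_cont hρ.continuous
  refine (Lp.eLpNorm_lim_le_liminf_eLpNorm
    (fun n => (hsp n).continuous_fourierInv.aestronglyMeasurable) _ (ae_of_all _ hlim)).trans ?_
  refine liminf_le_of_le (by isBoundedDefault) fun b hb => ?_
  obtain ⟨n, hn⟩ := hb.exists
  refine hn.trans ((hC hA hqq (s1 n) (s2 n) hρ hθ fun η => by rw [← mul_assoc, hθθ]).trans ?_)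
  rw [← h₁.cv_eq_fourierInv c₁ (integrable_trunc hW n) (memLp_trunc hW n),
    ← h₂.cv_eq_fourierInv c₂ (integrable_trunc hV n) (memLp_trunc hV n)]
  have b1 : eLpNorm (cv k₁ (trunc n W)) (ENNReal.ofReal q) volume ≤
      eLpNorm k₁ 1 volume * eLpNorm W (ENNReal.ofReal q) volume :=
    (eLpNorm_cv_le h₁.aesm (memLp_trunc hW n).1 hq.le).trans
      (mul_le_mul_right (eLpNorm_mono (norm_trunc_le n W)) _)
  have b2 : eLpNorm (cv k₂ (trunc n V)) (ENNReal.ofReal p) volume ≤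
      eLpNorm k₂ 1 volume * eLpNorm V (ENNReal.ofReal p) volume :=
    (eLpNorm_cv_le h₂.aesm (memLp_trunc hV n).1 hp.le).trans
      (mul_le_mul_right (eLpNorm_mono (norm_trunc_le n V)) _)
  refine (mul_le_mul_right (mul_le_mul' b1 b2) _).trans_eq ?_
  ring

/-! ### Tempered distributions given by functions -/

theorem RepresentedBy.locallyIntegrable {u : 𝓢'(Space d, ℂ)} {w : Space d → ℂ}
    (h : RepresentedBy u w) : LocallyIntegrable w volume := by
  rw [MeasureTheory.locallyIntegrable_iff]
  intro k hk
  obtain ⟨R, hR⟩ := hk.isBounded.subset_closedBall 0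
  obtain ⟨θ, h1, h2, h3⟩ := exists_smooth_eq_one (d := d) R
  have hi := ((h.2 (h2.toSchwartzMap h1)).1).integrableOn (s := k)
  refine hi.congr_fun (fun x hx => ?_) hk.measurableSet
  simp [h3 x (by simpa using hR hx)]

theorem RepresentedBy.ae_eq {u : 𝓢'(Space d, ℂ)} {w w' : Space d → ℂ} (h : RepresentedBy u w)
    (h' : RepresentedBy u w') : w =ᵐ[volume] w' := by
  have hae := ae_eq_zero_of_integral_contDiff_smul_eq_zero
    (h.locallyIntegrable.sub h'.locallyIntegrable) (fun ψ hψ hc => by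
      have hc' : HasCompactSupport (fun x => (ψ x : ℂ)) := hc.comp_left (g := ((↑) : ℝ → ℂ)) rfl
      have hg' : ContDiff ℝ ∞ (fun x => (ψ x : ℂ)) := Complex.ofRealCLM.contDiff.comp hψ
      have e1 := h.2 (hc'.toSchwartzMap hg')
      have e2 := h'.2 (hc'.toSchwartzMap hg')
      have e3 : ∫ x, (hc'.toSchwartzMap hg') x * (w x - w' x) = 0 := by
        simp_rw [mul_sub]
        rw [integral_sub e1.1 e2.1, ← e1.2, ← e2.2, sub_self]
      rw [← e3]
      refine integral_congr_ae (ae_of_all _ fun y => ?_)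
      simp)
  filter_upwards [hae] with x hx using sub_eq_zero.1 hx

theorem RepresentedBy.congr_ae {u : 𝓢'(Space d, ℂ)} {w w' : Space d → ℂ} (h : RepresentedBy u w)
    (e : w =ᵐ[volume] w') : RepresentedBy u w' := by
  refine ⟨h.1.congr e, fun φ => ?_⟩
  have e' : (fun x => φ x * w x) =ᵐ[volume] fun x => φ x * w' x := by
    filter_upwards [e] with x hx
    rw [hx]
  exact ⟨(h.2 φ).1.congr e', (h.2 φ).2.trans (integral_congr_ae e')⟩

theorem RepresentedBy.eq_of_ae {u u' : 𝓢'(Space d, ℂ)} {w w' : Space d → ℂ}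
    (h : RepresentedBy u w) (h' : RepresentedBy u' w') (e : w =ᵐ[volume] w') : u = u' := by
  ext φ
  rw [(h'.2 φ).2, ((h.congr_ae e).2 φ).2]

theorem lpNorm_eq {u : 𝓢'(Space d, ℂ)} {w : Space d → ℂ} (h : RepresentedBy u w) (p : ℝ≥0∞) :
    lpNorm p u = eLpNorm w p volume := by
  refine le_antisymm (iInf₂_le w h) (le_iInf₂ fun w' h' => ?_)
  exact (eLpNorm_congr_ae (h.ae_eq h')).le

theorem exists_representedBy_of_lpNorm_lt_top {u : 𝓢'(Space d, ℂ)} {p : ℝ≥0∞}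
    (h : lpNorm p u < ⊤) : ∃ w, RepresentedBy u w ∧ eLpNorm w p volume < ⊤ := by
  simp only [lpNorm, iInf_lt_iff] at h
  obtain ⟨w, hw, h⟩ := h
  exact ⟨w, hw, h⟩

/-- The tempered distribution `u` is the bounded function `w`. -/
def BddRep (u : 𝓢'(Space d, ℂ)) (w : Space d → ℂ) : Prop :=
  RepresentedBy u w ∧ MemLp w ⊤ volume

theorem integrable_schwartz_mul {w : Space d → ℂ} (hw : MemLp w ⊤ volume) (φ : 𝓢(Space d, ℂ)) :
    Integrable (fun x => φ x * w x) volume :=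
  φ.integrable.mul_bdd (c := (eLpNorm w ⊤ volume).toReal) hw.1 (ae_norm_le_of_memLp_top hw)

theorem bddRep_of {u : 𝓢'(Space d, ℂ)} {w : Space d → ℂ} (hw : MemLp w ⊤ volume)
    (h : ∀ φ : 𝓢(Space d, ℂ), u φ = ∫ x, φ x * w x) : BddRep u w :=
  ⟨⟨hw.1, fun φ => ⟨integrable_schwartz_mul hw φ, h φ⟩⟩, hw⟩

theorem BddRep.apply {u : 𝓢'(Space d, ℂ)} {w : Space d → ℂ} (h : BddRep u w) (φ : 𝓢(Space d, ℂ)) :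
    u φ = ∫ x, φ x * w x := (h.1.2 φ).2

theorem BddRep.congr_ae {u : 𝓢'(Space d, ℂ)} {w w' : Space d → ℂ} (h : BddRep u w)
    (e : w =ᵐ[volume] w') : BddRep u w' := ⟨h.1.congr_ae e, (memLp_congr_ae e).1 h.2⟩

theorem BddRep.add {u u' : 𝓢'(Space d, ℂ)} {w w' : Space d → ℂ} (h : BddRep u w)
    (h' : BddRep u' w') : BddRep (u + u') (fun x => w x + w' x) := by
  refine bddRep_of (h.2.add h'.2) fun φ => ?_
  simp_rw [mul_add]
  rw [integral_add (h.1.2 φ).1 (h'.1.2 φ).1, ← h.apply, ← h'.apply]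
  rfl

theorem BddRep.sub {u u' : 𝓢'(Space d, ℂ)} {w w' : Space d → ℂ} (h : BddRep u w)
    (h' : BddRep u' w') : BddRep (u - u') (fun x => w x - w' x) := by
  refine bddRep_of (h.2.sub h'.2) fun φ => ?_
  simp_rw [mul_sub]
  rw [integral_sub (h.1.2 φ).1 (h'.1.2 φ).1, ← h.apply, ← h'.apply]
  rfl

theorem BddRep.zero : BddRep (0 : 𝓢'(Space d, ℂ)) (fun _ => 0) :=
  bddRep_of (memLp_top_const _) fun φ => by simp

theorem BddRep.sum {ι : Type*} (s : Finset ι) {u : ι → 𝓢'(Space d, ℂ)} {w : ι → Space d → ℂ}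
    (h : ∀ i ∈ s, BddRep (u i) (w i)) : BddRep (∑ i ∈ s, u i) (fun x => ∑ i ∈ s, w i x) := by
  classical
  induction s using Finset.induction_on with
  | empty => simpa using BddRep.zero
  | insert i s hi ih =>
    simp only [Finset.sum_insert hi]
    exact (h i (Finset.mem_insert_self i s)).add
      (ih fun j hj => h j (Finset.mem_insert_of_mem hj))

theorem exists_bddRep {w : Space d → ℂ} (hw : MemLp w ⊤ volume) :
    ∃ u : 𝓢'(Space d, ℂ), BddRep u w := by
  refine ⟨(hw.toLp w : Lp ℂ ⊤ (volume : Measure (Space d))), bddRep_of hw fun φ => ?_⟩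
  rw [Lp.toTemperedDistribution_apply]
  refine integral_congr_ae ?_
  filter_upwards [hw.coeFn_toLp] with x hx
  rw [hx, smul_eq_mul]

theorem BddRep.eq_of_ae {u u' : 𝓢'(Space d, ℂ)} {w w' : Space d → ℂ}
    (h : BddRep u w) (h' : BddRep u' w') (e : w =ᵐ[volume] w') : u = u' := h.1.eq_of_ae h'.1 e

/-! ### Smooth compactly supported symbols -/

/-- A smooth compactly supported symbol. -/
structure Bump (θ : Space d → ℂ) : Prop where
  smooth : ContDiff ℝ ∞ θ
  cpt : HasCompactSupport θ

theorem Bump.tg {θ : Space d → ℂ} (h : Bump θ) : θ.HasTemperateGrowth :=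
  h.cpt.hasTemperateGrowth h.smooth

theorem Bump.mul {θ θ' : Space d → ℂ} (h : Bump θ) (h' : Bump θ') : Bump (fun η => θ η * θ' η) :=
  ⟨h.smooth.mul h'.smooth, h.cpt.mul_right⟩

theorem Bump.sub {θ θ' : Space d → ℂ} (h : Bump θ) (h' : Bump θ') : Bump (fun η => θ η - θ' η) :=
  ⟨h.smooth.sub h'.smooth, h.cpt.sub h'.cpt⟩

theorem Bump.hasKer {θ : Space d → ℂ} (h : Bump θ) : ∃ k, HasKer θ k := by
  obtain ⟨k, hk⟩ := exists_hasKer_of_smooth h.smooth h.cpt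
  exact ⟨k, hk⟩

theorem Bump.comp_smul {θ : Space d → ℂ} (h : Bump θ) {c : ℝ} (hc : c ≠ 0) :
    Bump (fun η => θ (c • η)) :=
  ⟨h.smooth.comp (contDiff_const_smul c), h.cpt.comp_smul hc⟩

theorem Bump.exists_eq_one {θ : Space d → ℂ} (h : Bump θ) :
    ∃ θ', Bump θ' ∧ ∀ η, θ' η * θ η = θ η := by
  obtain ⟨R, hR⟩ := h.cpt.exists_norm_le
  obtain ⟨θ', h1, h2, h3⟩ := exists_smooth_eq_one (d := d) R
  refine ⟨θ', ⟨h1, h2⟩, fun η => ?_⟩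
  by_cases h0 : θ η = 0
  · simp [h0]
  · rw [h3 η (hR η h0), one_mul]

/-- The operator `e^{-AΛ₁}`, `A ≥ 0`, does not increase the `L¹` norm of a kernel. -/
theorem exists_hasKer_gevrey_neg {m k : Space d → ℂ} (h : HasKer m k) {A : ℝ} (hA : 0 ≤ A) :
    ∃ κ, HasKer (fun η => gevreySymbol (-A) η * m η) κ ∧
      eLpNorm κ 1 volume ≤ eLpNorm k 1 volume := by
  obtain ⟨κ, h1, h2⟩ := exists_hasKer_mul_exp_neg h hA Finset.univ
  exact ⟨κ, by simpa only [gevreySymbol, mul_comm] using h1, h2⟩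

/-- The symbol `e^{A|η|₁}` is not smooth, but its localization to a compact set still has an integrable
kernel. -/
theorem Bump.hasKer_gevrey {θ : Space d → ℂ} (h : Bump θ) (A : ℝ) :
    ∃ κ, HasKer (fun η => gevreySymbol A η * θ η) κ := by
  rcases le_total 0 A with hA | hA
  · obtain ⟨κ, h1⟩ := exists_hasKer_mul_exp hA Finset.univ h.smooth h.cpt
    exact ⟨κ, by simpa only [gevreySymbol, mul_comm] using h1⟩
  · obtain ⟨k, hk⟩ := h.hasKer
    obtain ⟨κ, h1, -⟩ := exists_hasKer_gevrey_neg hk (neg_nonneg.2 hA)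
    exact ⟨κ, by simpa only [neg_neg] using h1⟩

/-- The Fourier multiplier on tempered distributions with symbol `m`, a function of Mathlib's
frequency variable. -/
abbrev fm (m : Space d → ℂ) : 𝓢'(Space d, ℂ) →L[ℂ] 𝓢'(Space d, ℂ) :=
  TemperedDistribution.fourierMultiplierCLM ℂ m

theorem fm_fm {m m' : Space d → ℂ} (h : m.HasTemperateGrowth) (h' : m'.HasTemperateGrowth)
    (u : 𝓢'(Space d, ℂ)) : fm m (fm m' u) = fm (fun η => m η * m' η) u := by
  rw [fm, fm, TemperedDistribution.fourierMultiplierCLM_fourierMultiplierCLM_apply h' h, mul_comm]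
  rfl

theorem fm_sub {m m' : Space d → ℂ} (h : m.HasTemperateGrowth) (h' : m'.HasTemperateGrowth)
    (u : 𝓢'(Space d, ℂ)) : fm (fun η => m η - m' η) u = fm m u - fm m' u := by
  rw [fm, fm, fm, TemperedDistribution.fourierMultiplierCLM_apply,
    TemperedDistribution.fourierMultiplierCLM_apply,
    TemperedDistribution.fourierMultiplierCLM_apply]
  have := TemperedDistribution.smulLeftCLM_sub (F := ℂ) h h'
  change 𝓕⁻ (TemperedDistribution.smulLeftCLM ℂ (m - m') (𝓕 u)) = _
  rw [this]
  simp [sub_eq_add_neg, FourierTransform.fourierInv_add, FourierTransform.fourierInv_neg]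

/-- On bounded functions `θ(D)` is convolution with the kernel of `θ`. -/
theorem BddRep.fm {u : 𝓢'(Space d, ℂ)} {w θ k : Space d → ℂ} (h : BddRep u w)
    (hθ : θ.HasTemperateGrowth) (hk : HasKer θ k) : BddRep (fm θ u) (cv k w) := by
  refine bddRep_of (memLp_cv_top hk.1 h.2) fun φ => ?_
  rw [TemperedDistribution.fourierMultiplierCLM_apply_apply, h.apply,
    (integral_mul_cv hk.1 h.2 φ).2]
  refine integral_congr_ae (ae_of_all _ fun x => ?_)
  simp only
  congr 1
  rw [← hk.transpose, SchwartzMap.fourier_coe]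
  refine congrArg (fun g : Space d → ℂ => 𝓕 g x) (funext fun η => ?_)
  simp [hθ]

/-! ### Images under the multiplier `e^{a Λ₁}` -/

/-- All frequency-localizations of `u` are bounded functions. -/
def BandBdd (u : 𝓢'(Space d, ℂ)) : Prop := ∀ θ, Bump θ → ∃ w, BddRep (fm θ u) w

/-- `v` is the image of `u` under the multiplier with symbol `e^{A |η|_1}`, expressed by means of
integrable kernels on each compact set of frequencies. -/
def GevreyRel (A : ℝ) (u v : 𝓢'(Space d, ℂ)) : Prop :=
  ∀ θ θ₁ K w : Space d → ℂ, Bump θ → Bump θ₁ → (∀ η, θ η * θ₁ η = θ₁ η) →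
    HasKer (fun η => gevreySymbol A η * θ₁ η) K → BddRep (fm θ u) w → BddRep (fm θ₁ v) (cv K w)

theorem gevreySymbol_smul (a : ℝ) (η : Space d) :
    gevreySymbol a ((2 * Real.pi) • η) = gevreySymbol (2 * Real.pi * a) η := by
  simp only [gevreySymbol, PiLp.smul_apply, smul_eq_mul, abs_mul, ← Finset.mul_sum]
  rw [abs_of_pos two_pos, abs_of_pos Real.pi_pos]
  congr 2
  ring

theorem gevreySymbol_mul_neg (A : ℝ) (η : Space d) :
    gevreySymbol (-A) η * gevreySymbol A η = 1 := by
  simp only [gevreySymbol]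
  rw [← Complex.ofReal_mul, ← Real.exp_add]
  simp

/-- The transpose of a multiplier, applied to a test function with spectrum in `{θ = 1}`. -/
theorem transposeMul_eq {a : ℝ} {θ K : Space d → ℂ} (φ : 𝓢(Space d, ℂ))
    (hK : HasKer (fun η => gevreySymbol (2 * Real.pi * a) η * θ η) K)
    (hθ : ∀ η, θ η * (𝓕⁻ φ : 𝓢(Space d, ℂ)) η = (𝓕⁻ φ : 𝓢(Space d, ℂ)) η) (x : Space d) :
    transposeMul (gevreySymbol a) φ x = ∫ y, K y * φ (x + y) := by
  rw [← hK.transpose, transposeMul]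
  simp only [gevreySymbol_smul, mul_assoc, hθ]

theorem IsMultiplierImage.bandBdd {m : Space d → ℂ} {u v : 𝓢'(Space d, ℂ)}
    (h : IsMultiplierImage m u v) : BandBdd u := by
  intro θ hθ
  have h2 := (hθ.comp_smul (inv_ne_zero Real.two_pi_pos.ne'))
  obtain ⟨w, h3, h4, -⟩ := h _ h2.smooth h2.cpt
  refine ⟨w, ?_, h3.1, h4⟩
  convert h3 using 2
  rw [smoothMul]
  congr 1
  ext η
  rw [smul_smul, inv_mul_cancel₀ Real.two_pi_pos.ne', one_smul]

/-- A relation tested against band-limited test functions is one between functions. The factor `2π`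
comes from the normalization of Mathlib's Fourier transform. -/
theorem IsMultiplierImage.gevreyRel {a : ℝ} {u v : 𝓢'(Space d, ℂ)}
    (h : IsMultiplierImage (gevreySymbol a) u v) : GevreyRel (2 * Real.pi * a) u v := by
  intro θ θ₁ K w hθ hθ₁ hθθ hK hw
  have h2 := (hθ.comp_smul (inv_ne_zero Real.two_pi_pos.ne'))
  obtain ⟨w', h3, -, h5⟩ := h _ h2.smooth h2.cpt
  have e1 : smoothMul (fun η => θ ((2 * Real.pi)⁻¹ • η)) u = fm θ u := by
    rw [smoothMul, fm]
    congr 2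
    ext η
    rw [smul_smul, inv_mul_cancel₀ Real.two_pi_pos.ne', one_smul]
  rw [e1] at h3
  have hae : w' =ᵐ[volume] w := h3.ae_eq hw.1
  refine bddRep_of (memLp_cv_top hK.1 hw.2) fun φ => ?_
  rw [TemperedDistribution.fourierMultiplierCLM_apply_apply]
  -- the band-limited test function `θ₁(-D) φ`
  set ψ : 𝓢(Space d, ℂ) := 𝓕 (SchwartzMap.smulLeftCLM ℂ θ₁ (𝓕⁻ φ)) with hψ
  have e2 : ∀ η, (𝓕⁻ ψ : 𝓢(Space d, ℂ)) η = θ₁ η * (𝓕⁻ φ : 𝓢(Space d, ℂ)) η := by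
    intro η
    rw [hψ, FourierTransform.fourierInv_fourier_eq, SchwartzMap.smulLeftCLM_apply_apply hθ₁.tg,
      smul_eq_mul]
  have hone : ∀ η ∈ tsupport θ₁, θ η = 1 := by
    have hc : IsClosed {η | θ η = 1} := isClosed_eq hθ.smooth.continuous continuous_const
    refine fun η hη => (closure_minimal (fun η hη => ?_) hc : tsupport θ₁ ⊆ _) hη
    exact mul_right_cancel₀ (hη : θ₁ η ≠ 0) (by rw [hθθ, one_mul])
  have h6 := (h5 ψ fun η hη => by
    rw [smul_smul, inv_mul_cancel₀ Real.two_pi_pos.ne', one_smul]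
    refine hone η (closure_mono (fun η hη => ?_) hη)
    simp only [Function.mem_support, e2] at hη ⊢
    exact left_ne_zero_of_mul hη).2
  rw [h6, (integral_mul_cv hK.1 hw.2 φ).2]
  refine integral_congr_ae ?_
  filter_upwards [hae] with x hx
  rw [hx, ← hK.transpose, transposeMul]
  refine congrArg (fun g => g * w x) (congrArg (fun g : Space d → ℂ => 𝓕 g x) (funext fun η => ?_))
  rw [gevreySymbol_smul, e2]
  ring

/-- The converse of `IsMultiplierImage.gevreyRel`. -/
theorem GevreyRel.isMultiplierImage {a : ℝ} {u v : 𝓢'(Space d, ℂ)} (hu : BandBdd u)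
    (h : GevreyRel (2 * Real.pi * a) u v) : IsMultiplierImage (gevreySymbol a) u v := by
  intro θ' hs hc
  set θ : Space d → ℂ := fun η => θ' ((2 * Real.pi) • η) with hθ'
  have hθ : Bump θ := Bump.comp_smul ⟨hs, hc⟩ Real.two_pi_pos.ne'
  obtain ⟨w, hw⟩ := hu θ hθ
  refine ⟨w, hw.1, hw.2.2, fun φ hφ => ?_⟩
  have hφ' : ∀ η, θ η * (𝓕⁻ φ : 𝓢(Space d, ℂ)) η = (𝓕⁻ φ : 𝓢(Space d, ℂ)) η := by
    intro η
    by_cases h0 : (𝓕⁻ φ : 𝓢(Space d, ℂ)) η = 0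
    · simp [h0]
    · rw [show θ η = 1 from hφ η (subset_tsupport _ h0), one_mul]
  obtain ⟨K, hK⟩ := hθ.hasKer_gevrey (2 * Real.pi * a)
  obtain ⟨k, hk⟩ := hθ.hasKer
  obtain ⟨θ₂, hθ₂, h2⟩ := hθ.exists_eq_one
  obtain ⟨w₂, hw₂⟩ := hu θ₂ hθ₂
  obtain ⟨K₂, hK₂⟩ := (hθ.mul hθ).hasKer_gevrey (2 * Real.pi * a)
  -- The symbol `θ²` takes the place of `θ`: one factor `θ` produces `w`, the other one `K`.
  have e1 := h θ₂ _ K₂ w₂ hθ₂ (hθ.mul hθ) (fun η => by rw [← mul_assoc, h2]) hK₂ hw₂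
  have e2 : BddRep (fm θ u) (cv k w₂) := by
    have := hw₂.fm hθ.tg hk
    rw [fm_fm hθ.tg hθ₂.tg] at this
    simpa only [mul_comm, h2] using this
  have e3 : cv K₂ w₂ = cv K w := by
    rw [cv_congr_ae (hw.1.ae_eq e2.1), cv_cv hK hk (by simpa only [mul_assoc] using hK₂) hw₂.2]
  rw [e3] at e1
  have e4 : v φ = fm (fun η => θ η * θ η) v φ := by
    rw [TemperedDistribution.fourierMultiplierCLM_apply_apply]
    congr 1
    have : SchwartzMap.smulLeftCLM ℂ (fun η => θ η * θ η) (𝓕⁻ φ) = 𝓕⁻ φ := by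
      ext η
      rw [SchwartzMap.smulLeftCLM_apply_apply (hθ.mul hθ).tg, smul_eq_mul, mul_assoc, hφ', hφ']
    rw [this, FourierTransform.fourier_fourierInv_eq]
  simp only [transposeMul_eq φ hK hφ']
  have e5 := integral_mul_cv hK.1 hw.2 φ
  refine ⟨e5.1, ?_⟩
  rw [← e5.2, e4, e1.apply]

theorem GevreyRel.bandBdd {A : ℝ} {u v : 𝓢'(Space d, ℂ)} (h : GevreyRel A u v) (hu : BandBdd u) :
    BandBdd v := by
  intro θ hθ
  obtain ⟨θ₂, hθ₂, h2⟩ := hθ.exists_eq_one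
  obtain ⟨w₂, hw₂⟩ := hu θ₂ hθ₂
  obtain ⟨K, hK⟩ := hθ.hasKer_gevrey A
  exact ⟨_, h θ₂ θ K w₂ hθ₂ hθ h2 hK hw₂⟩

/-- If `v = e^{AΛ₁} u` then `u = e^{-AΛ₁} v`, because the symbols are inverse to each other on every
compact set of frequencies. -/
theorem GevreyRel.symm {A : ℝ} {u v : 𝓢'(Space d, ℂ)} (h : GevreyRel A u v) (hu : BandBdd u) :
    GevreyRel (-A) v u := by
  intro θ θ₁ K w hθ hθ₁ hθθ hK hw
  obtain ⟨θ₂, hθ₂, h2⟩ := hθ.exists_eq_one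
  obtain ⟨w₂, hw₂⟩ := hu θ₂ hθ₂
  obtain ⟨K₂, hK₂⟩ := hθ.hasKer_gevrey A
  obtain ⟨k₁, hk₁⟩ := hθ₁.hasKer
  have e1 := h θ₂ θ K₂ w₂ hθ₂ hθ h2 hK₂ hw₂
  have e2 : cv K w = cv k₁ w₂ := by
    rw [cv_congr_ae (hw.1.ae_eq e1.1)]
    refine cv_cv hK hK₂ ?_ hw₂.2
    convert hk₁ using 2 with η
    calc _ = gevreySymbol (-A) η * gevreySymbol A η * (θ η * θ₁ η) := by ring
      _ = _ := by rw [gevreySymbol_mul_neg, one_mul, hθθ]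
  have e3 := hw₂.fm hθ₁.tg hk₁
  rw [fm_fm hθ₁.tg hθ₂.tg] at e3
  rw [e2]
  have e4 : (fun η => θ₁ η * θ₂ η) = θ₁ := by
    ext η
    rw [← hθθ, mul_comm, ← mul_assoc, h2]
  rwa [e4] at e3

/-! ### Sequence norms -/

theorem seqNorm_top (a : ℤ → ℝ≥0∞) : seqNorm ⊤ a = ⨆ j, a j := if_pos rfl

theorem seqNorm_of_ne_top {r : ℝ≥0∞} (hr : r ≠ ⊤) (a : ℤ → ℝ≥0∞) :
    seqNorm r a = (∑' j, a j ^ r.toReal) ^ (1 / r.toReal) := if_neg hr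

theorem seqNorm_one (a : ℤ → ℝ≥0∞) : seqNorm 1 a = ∑' j, a j := by
  simp [seqNorm_of_ne_top]

theorem toReal_pos_of_one_le {r : ℝ≥0∞} (h1 : 1 ≤ r) (hr : r ≠ ⊤) : 0 < r.toReal :=
  ENNReal.toReal_pos (zero_lt_one.trans_le h1).ne' hr

theorem seqNorm_mono {r : ℝ≥0∞} {a b : ℤ → ℝ≥0∞} (h : ∀ j, a j ≤ b j) :
    seqNorm r a ≤ seqNorm r b := by
  rcases eq_or_ne r ⊤ with rfl | hr
  · simp only [seqNorm_top]
    exact iSup_mono h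
  · simp only [seqNorm_of_ne_top hr]
    gcongr with j
    exact h j

theorem le_seqNorm {r : ℝ≥0∞} (hr1 : 1 ≤ r) (a : ℤ → ℝ≥0∞) (j : ℤ) : a j ≤ seqNorm r a := by
  rcases eq_or_ne r ⊤ with rfl | hr
  · rw [seqNorm_top]
    exact le_iSup a j
  · have h0 := toReal_pos_of_one_le hr1 hr
    rw [seqNorm_of_ne_top hr, one_div, ENNReal.le_rpow_inv_iff h0]
    exact ENNReal.le_tsum j

theorem seqNorm_shift (r : ℝ≥0∞) (a : ℤ → ℝ≥0∞) (i : ℤ) :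
    seqNorm r (fun j => a (j + i)) = seqNorm r a := by
  rcases eq_or_ne r ⊤ with rfl | hr
  · simp only [seqNorm_top]
    exact (Equiv.addRight i).iSup_comp (g := a)
  · simp only [seqNorm_of_ne_top hr]
    congr 1
    exact (Equiv.addRight i).tsum_eq (fun j => a j ^ r.toReal)

theorem seqNorm_const_mul {r : ℝ≥0∞} (hr1 : 1 ≤ r) (c : ℝ≥0∞) (a : ℤ → ℝ≥0∞) :
    seqNorm r (fun j => c * a j) = c * seqNorm r a := by
  rcases eq_or_ne r ⊤ with rfl | hr
  · simp only [seqNorm_top]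
    exact (ENNReal.mul_iSup _ _).symm
  · have h0 := toReal_pos_of_one_le hr1 hr
    simp only [seqNorm_of_ne_top hr]
    simp_rw [ENNReal.mul_rpow_of_nonneg _ _ h0.le]
    rw [ENNReal.tsum_mul_left, ENNReal.mul_rpow_of_nonneg _ _ (by positivity), ← ENNReal.rpow_mul,
      mul_one_div_cancel h0.ne', ENNReal.rpow_one]

theorem seqNorm_add_le {r : ℝ≥0∞} (hr1 : 1 ≤ r) (a b : ℤ → ℝ≥0∞) :
    seqNorm r (fun j => a j + b j) ≤ seqNorm r a + seqNorm r b := by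
  rcases eq_or_ne r ⊤ with rfl | hr
  · simp only [seqNorm_top]
    exact iSup_le fun j => add_le_add (le_iSup a j) (le_iSup b j)
  · simp only [seqNorm_of_ne_top hr, ← lintegral_count]
    exact ENNReal.lintegral_Lp_add_le (measurable_of_countable a).aemeasurable
      (measurable_of_countable b).aemeasurable
      (by simpa using (ENNReal.toReal_le_toReal (by simp) hr).2 hr1)

theorem seqNorm_zero {r : ℝ≥0∞} (hr1 : 1 ≤ r) : seqNorm r (fun _ => 0) = 0 := by
  simpa using seqNorm_const_mul hr1 0 (fun _ => 0)

theorem seqNorm_sum_le {ι : Type*} {r : ℝ≥0∞} (hr1 : 1 ≤ r) (s : Finset ι)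
    (u : ι → ℤ → ℝ≥0∞) :
    seqNorm r (fun j => ∑ n ∈ s, u n j) ≤ ∑ n ∈ s, seqNorm r (u n) := by
  classical
  induction s using Finset.induction_on with
  | empty => simp [seqNorm_zero hr1]
  | insert i s hi ih =>
    simp only [Finset.sum_insert hi]
    exact (seqNorm_add_le hr1 _ _).trans (by gcongr)

/-- Minkowski's inequality for infinite sums. -/
theorem seqNorm_tsum_le {ι : Type*} {r : ℝ≥0∞} (hr1 : 1 ≤ r) (u : ι → ℤ → ℝ≥0∞) :
    seqNorm r (fun j => ∑' n, u n j) ≤ ∑' n, seqNorm r (u n) := by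
  have hfin : ∀ s : Finset ι, seqNorm r (fun j => ∑ n ∈ s, u n j) ≤ ∑' n, seqNorm r (u n) :=
    fun s => (seqNorm_sum_le hr1 s u).trans (ENNReal.sum_le_tsum s)
  rcases eq_or_ne r ⊤ with rfl | hr
  · rw [seqNorm_top]
    refine iSup_le fun j => ?_
    rw [ENNReal.tsum_eq_iSup_sum]
    exact iSup_le fun s => (le_seqNorm hr1 (fun j => ∑ n ∈ s, u n j) j).trans (hfin s)
  · have h0 := toReal_pos_of_one_le hr1 hr
    simp only [seqNorm_of_ne_top hr, one_div] at hfin ⊢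
    rw [ENNReal.rpow_inv_le_iff h0, ENNReal.tsum_eq_iSup_sum]
    refine iSup_le fun J => ?_
    have hl : Tendsto (fun s : Finset ι => ∑ j ∈ J, (∑ n ∈ s, u n j) ^ r.toReal) atTop
        (𝓝 (∑ j ∈ J, (∑' n, u n j) ^ r.toReal)) :=
      tendsto_finsetSum _ fun j _ =>
        (ENNReal.continuous_rpow_const.tendsto _).comp ENNReal.summable.hasSum
    refine le_of_tendsto' hl fun s => ?_
    have := hfin s
    rw [ENNReal.rpow_inv_le_iff h0] at this
    exact (ENNReal.sum_le_tsum J).trans this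

/-- Hölder's inequality for sequences. -/
theorem seqNorm_mul_le {r r₁ r₂ : ℝ≥0∞} (hr1 : 1 ≤ r) (hr₁ : 1 ≤ r₁) (hr₂ : 1 ≤ r₂)
    (h : r⁻¹ = r₁⁻¹ + r₂⁻¹) (a b : ℤ → ℝ≥0∞) :
    seqNorm r (fun j => a j * b j) ≤ seqNorm r₁ a * seqNorm r₂ b := by
  rcases eq_or_ne r₁ ⊤ with rfl | h1
  · have : r = r₂ := by simpa using h
    subst this
    rw [← seqNorm_const_mul hr1]
    exact seqNorm_mono fun j => by gcongr; exact le_seqNorm le_top a j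
  rcases eq_or_ne r₂ ⊤ with rfl | h2
  · have : r = r₁ := by simpa using h
    subst this
    rw [mul_comm, ← seqNorm_const_mul hr1]
    exact seqNorm_mono fun j => by rw [mul_comm]; gcongr; exact le_seqNorm le_top b j
  have hr : r ≠ ⊤ := by
    rintro rfl
    rw [ENNReal.inv_top] at h
    exact h1 (ENNReal.inv_eq_zero.1 (add_eq_zero.1 h.symm).1)
  have p1 := toReal_pos_of_one_le hr₁ h1
  have p2 := toReal_pos_of_one_le hr₂ h2
  have p0 := toReal_pos_of_one_le hr1 hr
  have h' : 1 / r.toReal = 1 / r₁.toReal + 1 / r₂.toReal := by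
    have := congrArg ENNReal.toReal h
    rw [ENNReal.toReal_add (ENNReal.inv_ne_top.2 (zero_lt_one.trans_le hr₁).ne')
      (ENNReal.inv_ne_top.2 (zero_lt_one.trans_le hr₂).ne')] at this
    simpa [ENNReal.toReal_inv] using this
  have hlt : r.toReal < r₁.toReal := by
    have : 0 < 1 / r₂.toReal := by positivity
    exact (one_div_lt_one_div p1 p0).1 (by linarith)
  simp only [seqNorm_of_ne_top h1, seqNorm_of_ne_top h2, seqNorm_of_ne_top hr, ← lintegral_count]
  exact ENNReal.lintegral_Lp_mul_le_Lq_mul_Lr p0 hlt h' _ (measurable_of_countable a).aemeasurable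
    (measurable_of_countable b).aemeasurable

/-! ### Operators with integrable kernels -/

/-- An integrable kernel of the symbol `m` (and `0` if there is none). -/
def ker (m : Space d → ℂ) : Space d → ℂ :=
  open Classical in if h : ∃ k, HasKer m k then h.choose else 0

theorem hasKer_ker {m : Space d → ℂ} (h : ∃ k, HasKer m k) : HasKer m (ker m) := by
  rw [ker, dif_pos h]
  exact h.choose_spec

/-- The operator `m(D)` on bounded functions, for a symbol `m` with an integrable kernel. -/
def op (m w : Space d → ℂ) : Space d → ℂ := cv (ker m) w

theorem op_congr_ae {m w w' : Space d → ℂ} (h : w =ᵐ[volume] w') : op m w = op m w' := cv_congr_ae h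

theorem op_op {m m' w : Space d → ℂ} (h : ∃ k, HasKer m k) (h' : ∃ k, HasKer m' k)
    (h'' : ∃ k, HasKer (fun η => m η * m' η) k) (hw : MemLp w ⊤ volume) :
    op m (op m' w) = op (fun η => m η * m' η) w :=
  cv_cv (hasKer_ker h) (hasKer_ker h') (hasKer_ker h'') hw

theorem memLp_op {m w : Space d → ℂ} (h : ∃ k, HasKer m k) (hw : MemLp w ⊤ volume) :
    MemLp (op m w) ⊤ volume := memLp_cv_top (hasKer_ker h).1 hw

theorem op_eq_cv {m k w : Space d → ℂ} (h : HasKer m k) : op m w = cv k w :=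
  cv_congr_ae_left ((hasKer_ker ⟨k, h⟩).unique h)

theorem op_zero_symbol (w : Space d → ℂ) : op (fun _ => 0) w = fun _ => 0 := by
  have : HasKer (fun _ : Space d => (0 : ℂ)) (fun _ => 0) :=
    ⟨integrable_zero _ _ _, fun η => by simp [Real.fourier_eq]⟩
  rw [op_eq_cv this]
  ext x
  simp [cv]

theorem op_sub_left {m m' w : Space d → ℂ} (h : ∃ k, HasKer m k) (h' : ∃ k, HasKer m' k)
    (hw : MemLp w ⊤ volume) (x : Space d) :
    op (fun η => m η - m' η) w x = op m w x - op m' w x := by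
  rw [op_eq_cv ((hasKer_ker h).sub (hasKer_ker h'))]
  simp only [op, cv, sub_mul]
  exact integral_sub (cv_integrable (hasKer_ker h).1 hw x) (cv_integrable (hasKer_ker h').1 hw x)

theorem op_sum {ι : Type*} {m : Space d → ℂ} (h : ∃ k, HasKer m k) (s : Finset ι)
    {w : ι → Space d → ℂ} (hw : ∀ i ∈ s, MemLp (w i) ⊤ volume) (x : Space d) :
    op m (fun y => ∑ i ∈ s, w i y) x = ∑ i ∈ s, op m (w i) x := by
  simp only [op, cv, Finset.mul_sum]
  exact integral_finsetSum _ fun i hi => cv_integrable (hasKer_ker h).1 (hw i hi) x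

theorem eLpNorm_op_top_le {m w : Space d → ℂ} (h : ∃ k, HasKer m k) :
    eLpNorm (op m w) ⊤ volume ≤ eLpNorm (ker m) 1 volume * eLpNorm w ⊤ volume :=
  eLpNorm_cv_top_le (hasKer_ker h).aesm

theorem eLpNorm_op_le {m w : Space d → ℂ} (h : ∃ k, HasKer m k)
    (hw : AEStronglyMeasurable w volume) {p : ℝ} (hp : 1 ≤ p) :
    eLpNorm (op m w) (ENNReal.ofReal p) volume ≤
      eLpNorm (ker m) 1 volume * eLpNorm w (ENNReal.ofReal p) volume :=
  eLpNorm_cv_le (hasKer_ker h).aesm hw hp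

theorem eLpNorm_op_top_le_holder {m w : Space d → ℂ} (h : ∃ k, HasKer m k)
    (hw : AEStronglyMeasurable w volume) {p q : ℝ} (hpq : p.HolderConjugate q) :
    eLpNorm (op m w) ⊤ volume ≤
      eLpNorm (ker m) (ENNReal.ofReal q) volume * eLpNorm w (ENNReal.ofReal p) volume := by
  rw [eLpNorm_exponent_top]
  exact eLpNormEssSup_le_of_ae_enorm_bound
    (ae_of_all _ fun x => enorm_cv_le_holder (hasKer_ker h).aesm hw hpq x)

theorem BddRep.op {u : 𝓢'(Space d, ℂ)} {w θ : Space d → ℂ} (h : BddRep u w) (hθ : Bump θ) :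
    BddRep (GevreyBesov.fm θ u) (GevreyBesov.op θ w) := h.fm hθ.tg (hasKer_ker hθ.hasKer)

/-- The kernel of `e^{-AΛ₁} θ(D)` is bounded in `L¹`, uniformly in `A ≥ 0`. -/
theorem eLpNorm_ker_gevrey_neg_le {θ : Space d → ℂ} (h : Bump θ) {A : ℝ} (hA : 0 ≤ A) :
    eLpNorm (ker (fun η => gevreySymbol (-A) η * θ η)) 1 volume ≤ eLpNorm (ker θ) 1 volume := by
  obtain ⟨κ, h1, h2⟩ := exists_hasKer_gevrey_neg (hasKer_ker h.hasKer) hA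
  rwa [eLpNorm_congr_ae ((hasKer_ker ⟨κ, h1⟩).unique h1)]

/-- A product whose spectrum lies where `θ = 1` is unchanged by `θ(D)`. -/
theorem op_mul_eq_self {m₁ m₂ θ W V : Space d → ℂ} (h₁ : Bump m₁) (h₂ : Bump m₂) (hθ : Bump θ)
    (hW : MemLp W ⊤ volume) (hV : MemLp V ⊤ volume)
    (h0 : ∀ ξ ζ, θ (ξ + ζ) * (m₁ ξ * m₂ ζ) = m₁ ξ * m₂ ζ) :
    op θ (fun y => op m₁ W y * op m₂ V y) = fun y => op m₁ W y * op m₂ V y := by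
  ext x
  have k1 := hasKer_ker h₁.hasKer
  have k2 := hasKer_ker h₂.hasKer
  refine tendsto_nhds_unique (tendsto_fourierInv_trunc k1 h₁.cpt k2 h₂.cpt
    (hasKer_ker hθ.hasKer) hW hV x) ?_
  have s1 := fun n => k1.spec_mul_fourier h₁.cpt (integrable_trunc hW n)
  have s2 := fun n => k2.spec_mul_fourier h₂.cpt (integrable_trunc hV n)
  refine ((tendsto_cv k1.1 hW (fun n => (memLp_trunc hW n).1) (fun n => norm_trunc_le n W)
      (tendsto_trunc W) x).mul (tendsto_cv k2.1 hV (fun n => (memLp_trunc hV n).1)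
      (fun n => norm_trunc_le n V) (tendsto_trunc V) x)).congr fun n => ?_
  rw [k1.cv_eq_fourierInv h₁.cpt (integrable_trunc hW n) (memLp_trunc hW n),
    k2.cv_eq_fourierInv h₂.cpt (integrable_trunc hV n) (memLp_trunc hV n),
    ← (s1 n).fourierInv_cv (s2 n)]
  refine congrArg (fun g : Space d → ℂ => 𝓕⁻ g x) (funext fun η => ?_)
  rw [cv, ← integral_const_mul]
  refine integral_congr_ae (ae_of_all _ fun ξ => ?_)
  have := h0 ξ (η - ξ)
  rw [add_sub_cancel] at this
  simp only
  linear_combination -(𝓕 (trunc n W) ξ * 𝓕 (trunc n V) (η - ξ)) * this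

/-! ### Absolutely convergent series of bounded functions -/

theorem ae_summable_of_tsum_ne_top {ι : Type*} [Countable ι] {z : ι → Space d → ℂ}
    (hs : ∑' j, eLpNorm (z j) ⊤ volume ≠ ⊤) :
    ∀ᵐ x, Summable (fun j => ‖z j x‖) ∧ ∀ j, ‖z j x‖ₑ ≤ eLpNorm (z j) ⊤ volume := by
  have h : ∀ᵐ x, ∀ j, ‖z j x‖ₑ ≤ eLpNorm (z j) ⊤ volume := by
    rw [ae_all_iff]
    intro j
    simpa using ae_le_eLpNormEssSup (f := z j) (μ := volume)
  filter_upwards [h] with x hx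
  refine ⟨?_, hx⟩
  have h1 : ∑' j, ‖z j x‖ₑ ≠ ⊤ := ((ENNReal.tsum_le_tsum hx).trans_lt hs.lt_top).ne
  exact NNReal.summable_coe.2 (ENNReal.tsum_coe_ne_top_iff_summable.1 h1)

theorem aestronglyMeasurable_tsum {z : ℤ → Space d → ℂ}
    (hz : ∀ j, AEStronglyMeasurable (z j) volume) (hs : ∀ᵐ x, Summable (fun j => z j x)) :
    AEStronglyMeasurable (fun x => ∑' j, z j x) volume := by
  refine aestronglyMeasurable_of_tendsto_ae atTop
    (f := fun (s : Finset ℤ) x => ∑ j ∈ s, z j x) (fun s => ?_) ?_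
  · exact Finset.aestronglyMeasurable_fun_sum s fun j _ => hz j
  · filter_upwards [hs] with x hx using hx.hasSum

theorem eLpNorm_top_tsum_le {ι : Type*} [Countable ι] {z : ι → Space d → ℂ} :
    eLpNorm (fun x => ∑' j, z j x) ⊤ volume ≤ ∑' j, eLpNorm (z j) ⊤ volume := by
  by_cases hs : ∑' j, eLpNorm (z j) ⊤ volume = ⊤
  · rw [hs]
    exact le_top
  rw [eLpNorm_exponent_top]
  refine eLpNormEssSup_le_of_ae_enorm_bound ?_
  filter_upwards [ae_summable_of_tsum_ne_top hs] with x hx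
  exact enorm_tsum_le_tsum_enorm.trans (ENNReal.tsum_le_tsum hx.2)

theorem memLp_tsum {z : ℤ → Space d → ℂ} (hz : ∀ j, MemLp (z j) ⊤ volume)
    (hs : ∑' j, eLpNorm (z j) ⊤ volume ≠ ⊤) : MemLp (fun x => ∑' j, z j x) ⊤ volume :=
  ⟨aestronglyMeasurable_tsum (fun j => (hz j).1) (by
    filter_upwards [ae_summable_of_tsum_ne_top hs] with x hx using hx.1.of_norm),
    eLpNorm_top_tsum_le.trans_lt hs.lt_top⟩

theorem eLpNorm_tsum_le {z : ℤ → Space d → ℂ} (hz : ∀ j, AEStronglyMeasurable (z j) volume)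
    (hs : ∀ᵐ x, Summable (fun j => z j x)) {p : ℝ≥0∞} (hp : 1 ≤ p) :
    eLpNorm (fun x => ∑' j, z j x) p volume ≤ ∑' j, eLpNorm (z j) p volume := by
  have hl : ∀ᵐ x, Tendsto (fun n : ℕ => ∑ j ∈ Finset.Icc (-(n : ℤ)) n, z j x) atTop
      (𝓝 (∑' j, z j x)) := by
    filter_upwards [hs] with x hx
    exact hx.hasSum.comp Finset.tendsto_Icc_neg
  refine (Lp.eLpNorm_lim_le_liminf_eLpNorm
    (fun n => Finset.aestronglyMeasurable_fun_sum _ fun j _ => hz j) _ hl).trans ?_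
  refine liminf_le_of_le (by isBoundedDefault) fun b hb => ?_
  obtain ⟨n, hn⟩ := hb.exists
  refine hn.trans ?_
  have := eLpNorm_sum_le (p := p) (s := Finset.Icc (-(n : ℤ)) n) (fun j _ => hz j) hp
  refine le_trans (le_of_eq ?_) (this.trans (ENNReal.sum_le_tsum _))
  congr 1
  ext x
  simp

theorem cv_tsum {ι : Type*} [Countable ι] {k : Space d → ℂ} {z : ι → Space d → ℂ}
    (hk : Integrable k volume) (hz : ∀ j, MemLp (z j) ⊤ volume)
    (hs : ∑' j, eLpNorm (z j) ⊤ volume ≠ ⊤) (x : Space d) :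
    cv k (fun y => ∑' j, z j y) x = ∑' j, cv k (z j) x := by
  have h1 := hasSum_integral_of_summable_integral_norm (μ := (volume : Measure (Space d)))
    (F := fun j y => k y * z j (x - y)) (fun j => cv_integrable hk (hz j) x) (by
      have h2 : Summable (fun j => (∫ y, ‖k y‖) * (eLpNorm (z j) ⊤ volume).toReal) :=
        (ENNReal.summable_toReal hs).mul_left _
      refine Summable.of_nonneg_of_le (fun j => integral_nonneg fun _ => norm_nonneg _)
        (fun j => ?_) h2
      rw [← integral_mul_const]
      refine integral_mono_ae (cv_integrable hk (hz j) x).norm (hk.norm.mul_const _) ?_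
      have := (quasiMeasurePreserving_sub_left_of_right_invariant volume x).ae
        (ae_norm_le_of_memLp_top (hz j))
      filter_upwards [this] with y hy
      simp only [norm_mul]
      gcongr)
  refine Eq.trans ?_ h1.tsum_eq.symm
  simp only [cv, tsum_mul_left]

theorem op_tsum {m : Space d → ℂ} {z : ℤ → Space d → ℂ} (h : ∃ k, HasKer m k)
    (hz : ∀ j, MemLp (z j) ⊤ volume) (hs : ∑' j, eLpNorm (z j) ⊤ volume ≠ ⊤) (x : Space d) :
    op m (fun y => ∑' j, z j y) x = ∑' j, op m (z j) x := cv_tsum (hasKer_ker h).1 hz hs x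

/-- An absolutely convergent series of bounded functions converges in the tempered
distributions. -/
theorem hasSum_of_bddRep {U : ℤ → 𝓢'(Space d, ℂ)} {z : ℤ → Space d → ℂ}
    (h : ∀ j, BddRep (U j) (z j)) (hs : ∑' j, eLpNorm (z j) ⊤ volume ≠ ⊤) :
    ∃ u, HasSum U u ∧ BddRep u (fun x => ∑' j, z j x) := by
  obtain ⟨u, hu⟩ := exists_bddRep (memLp_tsum (fun j => (h j).2) hs)
  refine ⟨u, ?_, hu⟩
  rw [HasSum, PointwiseConvergenceCLM.tendsto_iff_forall_tendsto]
  intro φ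
  have h1 := hasSum_integral_of_summable_integral_norm (μ := (volume : Measure (Space d)))
    (F := fun j y => φ y * z j y) (fun j => ((h j).1.2 φ).1) (by
      have h2 : Summable (fun j => (∫ y, ‖φ y‖) * (eLpNorm (z j) ⊤ volume).toReal) :=
        (ENNReal.summable_toReal hs).mul_left _
      refine Summable.of_nonneg_of_le (fun j => integral_nonneg fun _ => norm_nonneg _)
        (fun j => ?_) h2
      rw [← integral_mul_const]
      refine integral_mono_ae ((h j).1.2 φ).1.norm (φ.integrable.norm.mul_const _) ?_
      filter_upwards [ae_norm_le_of_memLp_top (h j).2] with y hy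
      simp only [norm_mul]
      gcongr)
  have e1 : ∫ y, ∑' j, φ y * z j y = u φ := by
    rw [hu.apply]
    simp only [tsum_mul_left]
  rw [e1] at h1
  refine h1.congr fun s => ?_
  simp only [← (h _).apply]
  simp

theorem tendsto_Icc_neg_natCast_prod :
    Tendsto (fun N : ℕ × ℕ => Finset.Icc (-(N.1 : ℤ)) (N.2 : ℤ)) atTop atTop := by
  rw [tendsto_atTop]
  intro s
  obtain ⟨B, hB⟩ : ∃ B : ℕ, ∀ j ∈ s, j.natAbs ≤ B :=
    ⟨s.sup Int.natAbs, fun j hj => Finset.le_sup (f := Int.natAbs) hj⟩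
  filter_upwards [eventually_ge_atTop ((B, B) : ℕ × ℕ)] with N hN j hj
  have h1 := hB j hj
  have h2 : B ≤ N.1 := hN.1
  have h3 : B ≤ N.2 := hN.2
  rw [Finset.mem_Icc]
  omega

theorem seriesConvergesTo_of_hasSum {U : ℤ → 𝓢'(Space d, ℂ)} {u : 𝓢'(Space d, ℂ)}
    (h : HasSum U u) : SeriesConvergesTo U u :=
  Tendsto.comp (g := fun s : Finset ℤ => ∑ j ∈ s, U j) h tendsto_Icc_neg_natCast_prod

theorem SeriesConvergesTo.map {U : ℤ → 𝓢'(Space d, ℂ)} {u : 𝓢'(Space d, ℂ)}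
    (h : SeriesConvergesTo U u) (L : 𝓢'(Space d, ℂ) →L[ℂ] 𝓢'(Space d, ℂ)) :
    SeriesConvergesTo (fun j => L (U j)) (L u) := by
  have := (L.continuous.tendsto u).comp h
  refine this.congr fun N => ?_
  simp

/-- The frequency localization of a convergent series, if it converges absolutely. -/
theorem SeriesConvergesTo.bddRep {W : ℤ → 𝓢'(Space d, ℂ)} {T : 𝓢'(Space d, ℂ)}
    {w : ℤ → Space d → ℂ} (h : SeriesConvergesTo W T) (hw : ∀ j, BddRep (W j) (w j))
    {θ : Space d → ℂ} (hθ : Bump θ) (hs : ∑' j, eLpNorm (op θ (w j)) ⊤ volume ≠ ⊤) :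
    BddRep (fm θ T) (fun x => ∑' j, op θ (w j) x) := by
  obtain ⟨u, h1, h2⟩ := hasSum_of_bddRep (fun j => (hw j).op hθ) hs
  have := tendsto_nhds_unique (h.map (fm θ)) (seriesConvergesTo_of_hasSum h1)
  rwa [this]

/-! ### Dyadic symbols -/

/-- The symbol of `Ṡ_j`, as a function of Mathlib's frequency variable. -/
def lowSym (χ : Space d → ℝ) (j : ℤ) (η : Space d) : ℂ :=
  (χ ((2 : ℝ) ^ (-j) • ((2 * Real.pi) • η)) : ℂ)

/-- The symbol of `Δ̇_j`, as a function of Mathlib's frequency variable. -/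
def blockSym (χ : Space d → ℝ) (j : ℤ) (η : Space d) : ℂ := lowSym χ (j + 1) η - lowSym χ j η

/-- The symbol of a fattened dyadic block: it is `1` on the spectrum of `Δ̇_j u` and on that of
`Ṡ_{j-1} u Δ̇_j v`. -/
def annSym (χ : Space d → ℝ) (j : ℤ) (η : Space d) : ℂ := lowSym χ (j + 3) η - lowSym χ (j - 5) η

theorem lowFreq_eq (χ : Space d → ℝ) (j : ℤ) : lowFreq χ j = fm (lowSym χ j) := rfl

theorem block_eq (χ : Space d → ℝ) (j : ℤ) : block χ j = fm (blockSym χ j) := by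
  rw [block, smoothMul, fm]
  congr 1
  ext η
  rw [blockSym, lowSym, lowSym, Complex.ofReal_sub, smul_smul (1 / 2 : ℝ)]
  have : (1 / 2 : ℝ) * 2 ^ (-j) = 2 ^ (-(j + 1)) := by
    rw [neg_add, zpow_add₀ two_ne_zero, mul_comm]
    norm_num
  rw [this]

theorem lowSym_scale (χ : Space d → ℝ) (j i : ℤ) (η : Space d) :
    lowSym χ (j + i) η = lowSym χ i ((2 : ℝ) ^ (-j) • η) := by
  rw [lowSym, lowSym, smul_comm (2 * Real.pi) ((2 : ℝ) ^ (-j)) η, smul_smul ((2 : ℝ) ^ (-i)),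
    ← zpow_add₀ two_ne_zero, neg_add, add_comm (-j)]

theorem lowSym_scale' (χ : Space d → ℝ) (j : ℤ) :
    lowSym χ j = fun η => lowSym χ 0 ((2 : ℝ) ^ (-j) • η) := by
  ext η
  rw [← lowSym_scale, add_zero]

theorem blockSym_scale (χ : Space d → ℝ) (j : ℤ) :
    blockSym χ j = fun η => blockSym χ 0 ((2 : ℝ) ^ (-j) • η) := by
  ext η
  rw [blockSym, blockSym, ← lowSym_scale, ← lowSym_scale, zero_add, add_zero]

theorem annSym_scale (χ : Space d → ℝ) (j : ℤ) :
    annSym χ j = fun η => annSym χ 0 ((2 : ℝ) ^ (-j) • η) := by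
  ext η
  rw [annSym, annSym, ← lowSym_scale, ← lowSym_scale]
  congr 2

section

variable {χ : Space d → ℝ}

theorem norm_dyadic (j : ℤ) (η : Space d) :
    ‖(2 : ℝ) ^ (-j) • ((2 * Real.pi) • η)‖ = (2 * Real.pi * ‖η‖) / 2 ^ j := by
  rw [norm_smul, norm_smul, Real.norm_of_nonneg (by positivity),
    Real.norm_of_nonneg (by positivity), zpow_neg]
  ring

theorem lowSym_eq_one (hχ : IsCutoff χ) {j : ℤ} {η : Space d}
    (h : 2 * Real.pi * ‖η‖ ≤ 3 / 4 * 2 ^ j) : lowSym χ j η = 1 := by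
  rw [lowSym, hχ.eq_one _ (by
    rw [mem_closedBall_zero_iff, norm_dyadic, div_le_iff₀ (by positivity)]
    exact h), Complex.ofReal_one]

theorem lowSym_eq_zero (hχ : IsCutoff χ) {j : ℤ} {η : Space d}
    (h : 4 / 3 * 2 ^ j < 2 * Real.pi * ‖η‖) : lowSym χ j η = 0 := by
  rw [lowSym, image_eq_zero_of_notMem_tsupport (f := χ), Complex.ofReal_zero]
  intro hn
  have := hχ.support hn
  rw [mem_closedBall_zero_iff, norm_dyadic, div_le_iff₀ (by positivity)] at this
  linarith

theorem lowSym_mul_lowSym (hχ : IsCutoff χ) {i j : ℤ} (h : i < j) (η : Space d) :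
    lowSym χ j η * lowSym χ i η = lowSym χ i η := by
  by_cases h0 : 4 / 3 * 2 ^ i < 2 * Real.pi * ‖η‖
  · simp [lowSym_eq_zero hχ h0]
  · rw [lowSym_eq_one hχ, one_mul]
    have h1 : (2 : ℝ) ^ (i + 1) ≤ 2 ^ j := zpow_le_zpow_right₀ one_le_two (by omega)
    rw [zpow_add_one₀ two_ne_zero] at h1
    have h2 : (0 : ℝ) < 2 ^ i := by positivity
    linarith

theorem lowSym_mul_lowSym' (hχ : IsCutoff χ) {i j : ℤ} (h : i < j) (η : Space d) :
    lowSym χ i η * lowSym χ j η = lowSym χ i η := by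
  rw [mul_comm, lowSym_mul_lowSym hχ h]

theorem bump_lowSym (hχ : IsCutoff χ) (j : ℤ) : Bump (lowSym χ j) := by
  have hc : HasCompactSupport (fun ξ => (χ ξ : ℂ)) := HasCompactSupport.comp_left
    (g := ((↑) : ℝ → ℂ)) ((isCompact_closedBall _ _).of_isClosed_subset (isClosed_tsupport _)
      hχ.support) rfl
  have h1 : Bump (fun ξ => (χ ξ : ℂ)) := ⟨Complex.ofRealCLM.contDiff.comp hχ.smooth, hc⟩
  exact (h1.comp_smul (c := (2 : ℝ) ^ (-j)) (by positivity)).comp_smul Real.two_pi_pos.ne'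

theorem bump_blockSym (hχ : IsCutoff χ) (j : ℤ) : Bump (blockSym χ j) :=
  (bump_lowSym hχ _).sub (bump_lowSym hχ _)

theorem bump_annSym (hχ : IsCutoff χ) (j : ℤ) : Bump (annSym χ j) :=
  (bump_lowSym hχ _).sub (bump_lowSym hχ _)

theorem annSym_mul_blockSym (hχ : IsCutoff χ) (j : ℤ) (η : Space d) :
    annSym χ j η * blockSym χ j η = blockSym χ j η := by
  rw [annSym, blockSym]
  linear_combination lowSym_mul_lowSym hχ (show j + 1 < j + 3 by omega) η -
    lowSym_mul_lowSym hχ (show j < j + 3 by omega) η -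
    lowSym_mul_lowSym' hχ (show j - 5 < j + 1 by omega) η +
    lowSym_mul_lowSym' hχ (show j - 5 < j by omega) η

theorem lowSym_mul_blockSym (hχ : IsCutoff χ) {i j : ℤ} (h : j + 1 < i) (η : Space d) :
    lowSym χ i η * blockSym χ j η = blockSym χ j η := by
  rw [blockSym]
  linear_combination lowSym_mul_lowSym hχ h η - lowSym_mul_lowSym hχ (show j < i by omega) η

theorem lowSym_mul_annSym (hχ : IsCutoff χ) {i j : ℤ} (h : j + 3 < i) (η : Space d) :
    lowSym χ i η * annSym χ j η = annSym χ j η := by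
  rw [annSym]
  linear_combination lowSym_mul_lowSym hχ h η - lowSym_mul_lowSym hχ (show j - 5 < i by omega) η

theorem blockSym_mul_lowSym_eq_zero (hχ : IsCutoff χ) {k i : ℤ} (h : i < k) (η : Space d) :
    blockSym χ k η * lowSym χ i η = 0 := by
  rw [blockSym]
  linear_combination lowSym_mul_lowSym hχ (show i < k + 1 by omega) η - lowSym_mul_lowSym hχ h η

theorem blockSym_mul_annSym_eq_zero (hχ : IsCutoff χ) {k j : ℤ} (h : j < k - 3 ∨ k + 6 < j)
    (η : Space d) : blockSym χ k η * annSym χ j η = 0 := by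
  rw [blockSym, annSym]
  rcases h with h | h
  · linear_combination lowSym_mul_lowSym hχ (show j + 3 < k + 1 by omega) η -
      lowSym_mul_lowSym hχ (show j + 3 < k by omega) η -
      lowSym_mul_lowSym hχ (show j - 5 < k + 1 by omega) η +
      lowSym_mul_lowSym hχ (show j - 5 < k by omega) η
  · linear_combination lowSym_mul_lowSym' hχ (show k + 1 < j + 3 by omega) η -
      lowSym_mul_lowSym' hχ (show k < j + 3 by omega) η -
      lowSym_mul_lowSym' hχ (show k + 1 < j - 5 by omega) η +
      lowSym_mul_lowSym' hχ (show k < j - 5 by omega) η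

theorem lowSym_mul_annSym_eq_zero (hχ : IsCutoff χ) {k j : ℤ} (h : k + 5 < j)
    (η : Space d) : lowSym χ k η * annSym χ j η = 0 := by
  rw [annSym]
  linear_combination lowSym_mul_lowSym' hχ (show k < j + 3 by omega) η -
    lowSym_mul_lowSym' hχ (show k < j - 5 by omega) η

theorem lowSym_ne_zero (hχ : IsCutoff χ) {j : ℤ} {η : Space d} (h : lowSym χ j η ≠ 0) :
    2 * Real.pi * ‖η‖ ≤ 4 / 3 * 2 ^ j := not_lt.1 fun h' => h (lowSym_eq_zero hχ h')

theorem blockSym_ne_zero (hχ : IsCutoff χ) {j : ℤ} {η : Space d} (h : blockSym χ j η ≠ 0) :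
    3 / 4 * 2 ^ j < 2 * Real.pi * ‖η‖ ∧ 2 * Real.pi * ‖η‖ ≤ 8 / 3 * 2 ^ j := by
  have hp : (0 : ℝ) < 2 ^ j := by positivity
  have e : (2 : ℝ) ^ (j + 1) = 2 ^ j * 2 := zpow_add_one₀ two_ne_zero j
  constructor
  · by_contra! hn
    refine h ?_
    rw [blockSym, lowSym_eq_one hχ hn, lowSym_eq_one hχ (by linarith), sub_self]
  · by_contra! hn
    refine h ?_
    rw [blockSym, lowSym_eq_zero hχ (by linarith), lowSym_eq_zero hχ (by linarith), sub_self]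

/-- The spectrum of `Ṡ_{j-1} u Δ̇_j v` is contained in an annulus of size `2^j`. -/
theorem annSym_add (hχ : IsCutoff χ) (j : ℤ) (ξ ζ : Space d) :
    annSym χ j (ξ + ζ) * (lowSym χ (j - 1) ξ * blockSym χ j ζ) =
      lowSym χ (j - 1) ξ * blockSym χ j ζ := by
  by_cases h1 : lowSym χ (j - 1) ξ = 0
  · simp [h1]
  by_cases h2 : blockSym χ j ζ = 0
  · simp [h2]
  have a1 := lowSym_ne_zero hχ h1
  have a2 := blockSym_ne_zero hχ h2
  have hp : (0 : ℝ) < 2 ^ j := by positivity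
  rw [zpow_sub_one₀ two_ne_zero] at a1
  have e3 : (2 : ℝ) ^ (j + 3) = 2 ^ j * 8 := by
    rw [zpow_add₀ two_ne_zero]
    norm_num
  have e5 : (2 : ℝ) ^ (j - 5) = 2 ^ j / 32 := by
    rw [zpow_sub₀ two_ne_zero]
    norm_num
  have n1 := mul_le_mul_of_nonneg_left (norm_add_le ξ ζ) Real.two_pi_pos.le
  have n2 := mul_le_mul_of_nonneg_left (norm_sub_le (ξ + ζ) ξ) Real.two_pi_pos.le
  rw [add_sub_cancel_left] at n2
  rw [annSym, lowSym_eq_one hχ (by rw [e3]; linarith), lowSym_eq_zero hχ (by rw [e5]; linarith),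
    sub_zero, one_mul]

/-- The spectrum of `Δ̇_j u Δ̇_{j'} v`, `|j' - j| ≤ 1`, is contained in a ball of size `2^j`. -/
theorem lowSym_add (hχ : IsCutoff χ) {j j' : ℤ} (hj : j' ≤ j + 1) (ξ ζ : Space d) :
    lowSym χ (j + 4) (ξ + ζ) * (blockSym χ j ξ * blockSym χ j' ζ) =
      blockSym χ j ξ * blockSym χ j' ζ := by
  by_cases h1 : blockSym χ j ξ = 0
  · simp [h1]
  by_cases h2 : blockSym χ j' ζ = 0
  · simp [h2]
  have a1 := blockSym_ne_zero hχ h1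
  have a2 := blockSym_ne_zero hχ h2
  have hp : (0 : ℝ) < 2 ^ j := by positivity
  have e3 : (2 : ℝ) ^ (j + 4) = 2 ^ j * 16 := by
    rw [zpow_add₀ two_ne_zero]
    norm_num
  have e5 : (2 : ℝ) ^ j' ≤ 2 ^ j * 2 := by
    rw [← zpow_add_one₀ two_ne_zero]
    exact zpow_le_zpow_right₀ one_le_two hj
  have n1 := mul_le_mul_of_nonneg_left (norm_add_le ξ ζ) Real.two_pi_pos.le
  rw [lowSym_eq_one hχ (by rw [e3]; linarith), one_mul]

/-! ### Norms of dyadic kernels -/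

theorem HasKer.const_mul {m k : Space d → ℂ} (h : HasKer m k) (c : ℂ) :
    HasKer (fun η => c * m η) (fun x => c * k x) := by
  refine ⟨h.1.const_mul c, fun η => ?_⟩
  change _ = c * m η
  rw [← h.2, Real.fourier_eq, Real.fourier_eq, ← integral_const_mul]
  refine integral_congr_ae (ae_of_all _ fun x => ?_)
  simp only [Circle.smul_def, smul_eq_mul]
  ring

theorem eLpNorm_ker_const_mul {m : Space d → ℂ} (h : ∃ k, HasKer m k) (c : ℂ) (p : ℝ≥0∞) :
    eLpNorm (ker (fun η => c * m η)) p volume = ‖c‖ₑ * eLpNorm (ker m) p volume := by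
  have h1 := (hasKer_ker h).const_mul c
  rw [eLpNorm_congr_ae ((hasKer_ker ⟨_, h1⟩).unique h1)]
  exact eLpNorm_const_smul c (ker m) p volume

theorem eLpNorm_ker_one_ne_top {m : Space d → ℂ} (h : ∃ k, HasKer m k) :
    eLpNorm (ker m) 1 volume ≠ ⊤ := (memLp_one_iff_integrable.2 (hasKer_ker h).1).2.ne

theorem eLpNorm_ker_ne_top {m : Space d → ℂ} (h : Bump m) (p : ℝ≥0∞) :
    eLpNorm (ker m) p volume ≠ ⊤ := by
  obtain ⟨k, hk⟩ := exists_hasKer_of_smooth h.smooth h.cpt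
  rw [eLpNorm_congr_ae ((hasKer_ker ⟨_, hk⟩).unique hk)]
  exact (k.memLp p volume).2.ne

theorem eLpNorm_ker_one_dilate {m : Space d → ℂ} (h : ∃ k, HasKer m k) (j : ℤ) :
    eLpNorm (ker (fun η => m ((2 : ℝ) ^ (-j) • η))) 1 volume = eLpNorm (ker m) 1 volume := by
  have hc : (0 : ℝ) < 2 ^ (-j) := by positivity
  have h1 := (hasKer_ker h).dilate hc
  rw [eLpNorm_congr_ae ((hasKer_ker ⟨_, h1⟩).unique h1), eLpNorm_one_dilate hc]

/-- The Bernstein factor `2^{jd/q}`: the `L^{q'}` norm of the kernel of a dyadic symbol. -/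
theorem eLpNorm_ker_dilate {m : Space d → ℂ} (h : ∃ k, HasKer m k) (j : ℤ) {q q' : ℝ}
    (hq : q.HolderConjugate q') :
    eLpNorm (ker (fun η => m ((2 : ℝ) ^ (-j) • η))) (ENNReal.ofReal q') volume =
      2 ^ ((j : ℝ) * (d / q)) * eLpNorm (ker m) (ENNReal.ofReal q') volume := by
  have hc : (0 : ℝ) < 2 ^ (-j) := by positivity
  have h1 := (hasKer_ker h).dilate hc
  rw [eLpNorm_congr_ae ((hasKer_ker ⟨_, h1⟩).unique h1), eLpNorm_dilate hc hq.symm.lt.le]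
  congr 1
  have e : (1 - 1 / q' : ℝ) = 1 / q := by
    have := hq.inv_add_inv_eq_one
    rw [one_div, one_div]
    linarith
  rw [e, ← Real.rpow_intCast, ← Real.rpow_mul two_pos.le, ← ENNReal.ofReal_rpow_of_pos two_pos]
  congr 1
  · simp
  · push_cast
    ring

theorem eLpNorm_ker_lowSym (hχ : IsCutoff χ) (j : ℤ) :
    eLpNorm (ker (lowSym χ j)) 1 volume = eLpNorm (ker (lowSym χ 0)) 1 volume := by
  rw [lowSym_scale' χ j, eLpNorm_ker_one_dilate (bump_lowSym hχ 0).hasKer]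

theorem eLpNorm_ker_blockSym (hχ : IsCutoff χ) (j : ℤ) :
    eLpNorm (ker (blockSym χ j)) 1 volume = eLpNorm (ker (blockSym χ 0)) 1 volume := by
  rw [blockSym_scale χ j, eLpNorm_ker_one_dilate (bump_blockSym hχ 0).hasKer]

theorem eLpNorm_ker_annSym (hχ : IsCutoff χ) (j : ℤ) :
    eLpNorm (ker (annSym χ j)) 1 volume = eLpNorm (ker (annSym χ 0)) 1 volume := by
  rw [annSym_scale χ j, eLpNorm_ker_one_dilate (bump_annSym hχ 0).hasKer]

/-- Bernstein's inequality for a dyadic block. -/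
theorem eLpNorm_op_annSym_top_le (hχ : IsCutoff χ) (j : ℤ) {q q' : ℝ} (hq : q.HolderConjugate q')
    {w : Space d → ℂ} (hw : AEStronglyMeasurable w volume) :
    eLpNorm (op (annSym χ j) w) ⊤ volume ≤ eLpNorm (ker (annSym χ 0)) (ENNReal.ofReal q') volume *
      (2 ^ ((j : ℝ) * (d / q)) * eLpNorm w (ENNReal.ofReal q) volume) := by
  refine (eLpNorm_op_top_le_holder (bump_annSym hχ j).hasKer hw hq).trans_eq ?_
  rw [annSym_scale χ j, eLpNorm_ker_dilate (bump_annSym hχ 0).hasKer j hq]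
  ring

/-- Bernstein's inequality for low frequencies. -/
theorem eLpNorm_op_lowSym_top_le (hχ : IsCutoff χ) (j : ℤ) {q q' : ℝ} (hq : q.HolderConjugate q')
    {w : Space d → ℂ} (hw : AEStronglyMeasurable w volume) :
    eLpNorm (op (lowSym χ j) w) ⊤ volume ≤ eLpNorm (ker (lowSym χ 0)) (ENNReal.ofReal q') volume *
      (2 ^ ((j : ℝ) * (d / q)) * eLpNorm w (ENNReal.ofReal q) volume) := by
  refine (eLpNorm_op_top_le_holder (bump_lowSym hχ j).hasKer hw hq).trans_eq ?_
  rw [lowSym_scale' χ j, eLpNorm_ker_dilate (bump_lowSym hχ 0).hasKer j hq]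
  ring

/-- The bilinear estimate for dyadic blocks, uniform in `A ≥ 0`: the product of `e^{-AΛ₁} W` and
`e^{-AΛ₁} V`, localized at frequencies `2^l` and `2^m`, after application of `e^{AΛ₁} Δ̇_k`. -/
theorem exists_bilinear_dyadic (hχ : IsCutoff χ) {p q : ℝ} (hp : 1 < p) (hq : 1 < q) :
    ∃ C : ℝ≥0, ∀ A : ℝ, 0 ≤ A → ∀ k l m : ℤ, ∀ W V : Space d → ℂ, MemLp W ⊤ volume →
      MemLp V ⊤ volume →
      eLpNorm (op (fun η => gevreySymbol A η * blockSym χ k η) (fun y =>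
        op (fun η => gevreySymbol (-A) η * annSym χ l η) W y *
        op (fun η => gevreySymbol (-A) η * annSym χ m η) V y)) (ENNReal.ofReal p) volume ≤
      C * (2 ^ ((l : ℝ) * (d / q)) * eLpNorm W (ENNReal.ofReal q) volume *
        eLpNorm V (ENNReal.ofReal p) volume) := by
  obtain ⟨C, hC⟩ := exists_bilinear d hp hq
  have hqq := Real.HolderConjugate.conjExponent hq
  set q' := q.conjExponent
  set a := eLpNorm (ker (blockSym χ 0)) 1 volume
  set b := eLpNorm (ker (lowSym χ 4)) (ENNReal.ofReal q') volume
  set c := eLpNorm (ker (annSym χ 0)) 1 volume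
  have hne : (C : ℝ≥0∞) * (a * b * (c * c)) ≠ ⊤ := by
    have h1 : a ≠ ⊤ := eLpNorm_ker_one_ne_top (bump_blockSym hχ 0).hasKer
    have h2 : b ≠ ⊤ := eLpNorm_ker_ne_top (bump_lowSym hχ 4) _
    have h3 : c ≠ ⊤ := eLpNorm_ker_one_ne_top (bump_annSym hχ 0).hasKer
    finiteness
  refine ⟨(C * (a * b * (c * c))).toNNReal, fun A hA k l m W V hW hV => ?_⟩
  refine (hC hA hqq (hasKer_ker (bump_annSym hχ l).hasKer) (bump_annSym hχ l).cpt
    (hasKer_ker ((bump_annSym hχ l).hasKer_gevrey _)) (hasKer_ker (bump_annSym hχ m).hasKer)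
    (bump_annSym hχ m).cpt (hasKer_ker ((bump_annSym hχ m).hasKer_gevrey _))
    (hasKer_ker (bump_blockSym hχ k).hasKer) (hasKer_ker ((bump_blockSym hχ k).hasKer_gevrey _))
    (hasKer_ker (bump_lowSym hχ (l + 4)).hasKer)
    (fun η => lowSym_mul_annSym hχ (by omega) η) hW hV).trans_eq ?_
  -- `Ṡ_{l+4}` is the identity on the spectrum of the first factor
  have e : lowSym χ (l + 4) = fun η => lowSym χ 4 ((2 : ℝ) ^ (-l) • η) :=
    funext fun η => lowSym_scale χ l 4 η
  rw [ENNReal.coe_toNNReal hne, eLpNorm_ker_blockSym hχ k, eLpNorm_ker_annSym hχ l,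
    eLpNorm_ker_annSym hχ m, e, eLpNorm_ker_dilate (bump_lowSym hχ 4).hasKer l hqq]
  ring

end

section

variable {χ : Space d → ℝ}

/-! ### Series of high frequencies -/

theorem tsum_geometric_ne_top {ε : ℝ} (hε : 0 < ε) (n : ℤ) :
    ∑' j : ℤ, (if n ≤ j then (2 : ℝ≥0∞) ^ (-(j : ℝ) * ε) else 0) ≠ ⊤ := by
  have hinj : Function.Injective (fun i : ℕ => n + (i : ℤ)) := fun a b h => by simpa using h
  rw [← hinj.tsum_eq (f := fun j : ℤ => if n ≤ j then (2 : ℝ≥0∞) ^ (-(j : ℝ) * ε) else 0)]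
  · have h2 : (2 : ℝ≥0∞) ≠ 0 := two_ne_zero
    have e : ∀ i : ℕ, (if n ≤ n + (i : ℤ) then (2 : ℝ≥0∞) ^ (-((n + (i : ℤ) : ℤ) : ℝ) * ε) else 0) =
        2 ^ (-(n : ℝ) * ε) * (2 ^ (-ε)) ^ i := by
      intro i
      rw [if_pos (by omega), ← ENNReal.rpow_natCast, ← ENNReal.rpow_mul,
        ← ENNReal.rpow_add _ _ h2 (by simp)]
      congr 1
      push_cast
      ring
    simp only [e]
    rw [ENNReal.tsum_mul_left, ENNReal.tsum_geometric]
    refine ENNReal.mul_ne_top (ENNReal.rpow_ne_top_of_ne_zero h2 (by simp)) ?_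
    rw [ENNReal.inv_ne_top]
    refine (tsub_pos_of_lt ?_).ne'
    exact ENNReal.rpow_lt_one_of_one_lt_of_neg (by norm_num) (by linarith)
  · intro j hj
    have : n ≤ j := by
      by_contra hn
      simp [hn] at hj
    exact ⟨(j - n).toNat, by simp only; omega⟩

/-- The symbol `|η|^{-2m}` is smooth on an annulus. -/
theorem contDiff_annSym_mul_inv (hχ : IsCutoff χ) (m : ℕ) :
    ContDiff ℝ ∞ (fun η => annSym χ 0 η * ((((‖η‖ ^ 2) ^ m)⁻¹ : ℝ) : ℂ)) := by
  rw [contDiff_iff_contDiffAt]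
  intro η
  by_cases h0 : η = 0
  · subst h0
    refine (contDiffAt_const (c := (0 : ℂ))).congr_of_eventuallyEq ?_
    have hr : (0 : ℝ) < 3 / 4 * 2 ^ (-5 : ℤ) / (2 * Real.pi) := by positivity
    filter_upwards [Metric.ball_mem_nhds (0 : Space d) hr] with η hη
    rw [mem_ball_zero_iff, lt_div_iff₀ Real.two_pi_pos] at hη
    have h5 : (2 : ℝ) ^ (-5 : ℤ) = 1 / 32 := by norm_num
    rw [h5] at hη
    rw [annSym, lowSym_eq_one hχ (by norm_num; linarith), lowSym_eq_one hχ (by norm_num; linarith),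
      sub_self, zero_mul]
  · refine (bump_annSym hχ 0).smooth.contDiffAt.mul ?_
    refine Complex.ofRealCLM.contDiff.contDiffAt.comp η ?_
    exact ((contDiff_norm_sq ℝ).pow m).contDiffAt.inv (by positivity)

theorem BddRep.const_smul {u : 𝓢'(Space d, ℂ)} {w : Space d → ℂ} (h : BddRep u w) (c : ℂ) :
    BddRep (c • u) (fun x => c * w x) := by
  refine bddRep_of (h.2.const_mul c) fun φ => ?_
  change c • u φ = _
  rw [h.apply, smul_eq_mul, ← integral_const_mul]
  refine integral_congr_ae (ae_of_all _ fun x => ?_)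
  simp only
  ring

/-- A series of functions with dyadic spectra and polynomially bounded sup norms converges in the
tempered distributions: it is a power of the Laplacian of an absolutely convergent series. -/
theorem exists_hasSum_of_annular (hχ : IsCutoff χ) {V : ℤ → 𝓢'(Space d, ℂ)}
    {v : ℤ → Space d → ℂ} (hV : ∀ j, BddRep (V j) (v j))
    (hfm : ∀ j, fm (annSym χ j) (V j) = V j) (m : ℕ)
    (hs : ∑' j : ℤ, (2 : ℝ≥0∞) ^ (-(j : ℝ) * (2 * m)) * eLpNorm (v j) ⊤ volume ≠ ⊤) :
    ∃ U, HasSum V U := by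
  -- The symbol `c j * μ j` is that of `|η|^{-2m}` on the `j`-th annulus, of size `2^{-2mj}`, and `P`
  -- is the symbol `|η|^{2m}`, up to a constant that of a power of the Laplacian.
  set μ : ℤ → Space d → ℂ := fun j η => annSym χ 0 ((2 : ℝ) ^ (-j) • η) *
    ((((‖(2 : ℝ) ^ (-j) • η‖ ^ 2) ^ m)⁻¹ : ℝ) : ℂ) with hμ
  have hμ0 : Bump (fun η => annSym χ 0 η * ((((‖η‖ ^ 2) ^ m)⁻¹ : ℝ) : ℂ)) :=
    ⟨contDiff_annSym_mul_inv hχ m, (bump_annSym hχ 0).cpt.mul_right⟩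
  have hμj : ∀ j, Bump (μ j) := fun j => hμ0.comp_smul (c := (2 : ℝ) ^ (-j)) (by positivity)
  set c : ℤ → ℂ := fun j => (((2 : ℝ) ^ (-j)) ^ (2 * m) : ℝ) with hc
  set P : Space d → ℂ := fun η => (((‖η‖ ^ 2) ^ m : ℝ) : ℂ) with hP
  have hPt : P.HasTemperateGrowth := by
    have : Function.HasTemperateGrowth (fun η : Space d => ‖η‖ ^ 2) := by fun_prop
    have h2 : Function.HasTemperateGrowth (fun η : Space d => (‖η‖ ^ 2) ^ m) := by fun_prop
    exact (Complex.ofRealCLM.hasTemperateGrowth).comp h2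
  have hcμ : ∀ j η, P η * (c j * μ j η) = annSym χ j η := by
    intro j η
    rw [annSym_scale χ j]
    simp only [hP, hc, hμ]
    by_cases h0 : η = 0
    · have : annSym χ 0 (0 : Space d) = 0 := by
        rw [annSym, lowSym_eq_one hχ (by simp), lowSym_eq_one hχ (by simp),
          sub_self]
      simp [h0, this]
    · have h1 : ‖η‖ ≠ 0 := by simpa using h0
      have h2 : (2 : ℝ) ^ (-j) ≠ 0 := by positivity
      have e : (‖η‖ ^ 2) ^ m * (((2 : ℝ) ^ (-j)) ^ (2 * m) *
          ((‖(2 : ℝ) ^ (-j) • η‖ ^ 2) ^ m)⁻¹) = 1 := by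
        rw [norm_smul, Real.norm_of_nonneg (by positivity), mul_pow, mul_pow, ← pow_mul]
        field_simp
        rw [pow_mul]
      have e' := congrArg (fun t : ℝ => (t : ℂ)) e
      simp only [Complex.ofReal_mul, Complex.ofReal_one] at e'
      linear_combination annSym χ 0 ((2 : ℝ) ^ (-j) • η) * e'
  have hU : ∀ j, BddRep (fm (fun η => c j * μ j η) (V j)) (op (fun η => c j * μ j η) (v j)) := by
    intro j
    refine (hV j).op ⟨contDiff_const.mul (hμj j).smooth, (hμj j).cpt.mul_left⟩
  have hbump : ∀ j, Bump (fun η => c j * μ j η) := fun j =>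
    ⟨contDiff_const.mul (hμj j).smooth, (hμj j).cpt.mul_left⟩
  obtain ⟨U, h1, -⟩ := hasSum_of_bddRep hU (by
    refine ne_top_of_le_ne_top (ENNReal.mul_ne_top (eLpNorm_ker_one_ne_top hμ0.hasKer) hs) ?_
    rw [← ENNReal.tsum_mul_left]
    refine ENNReal.tsum_le_tsum fun j => (eLpNorm_op_top_le (hbump j).hasKer).trans_eq ?_
    rw [eLpNorm_ker_const_mul (hμj j).hasKer, eLpNorm_ker_one_dilate hμ0.hasKer j]
    have e : ‖c j‖ₑ = (2 : ℝ≥0∞) ^ (-(j : ℝ) * (2 * m)) := by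
      rw [hc]
      simp only
      rw [← ofReal_norm, Complex.norm_real, Real.norm_of_nonneg (by positivity)]
      have : (((2 : ℝ) ^ (-j)) ^ (2 * m) : ℝ) = 2 ^ (-(j : ℝ) * (2 * m) : ℝ) := by
        rw [← zpow_natCast, ← zpow_mul, ← Real.rpow_intCast]
        congr 1
        push_cast
        ring
      rw [this, ← ENNReal.ofReal_rpow_of_pos two_pos]
      simp
    rw [e]
    ring)
  refine ⟨fm P U, ?_⟩
  have h2 := (fm P).hasSum h1
  have e : (fun j => fm P (fm (fun η => c j * μ j η) (V j))) = V := by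
    ext1 j
    rw [fm_fm hPt (hbump j).tg]
    simp only [hcμ, hfm]
  exact e ▸ h2

/-! ### Low frequencies of a tempered distribution -/

/-- Every compact set of frequencies lies where `Ṡ_k` is the identity, for large `k`. -/
theorem Bump.exists_lowSym (hχ : IsCutoff χ) {θ : Space d → ℂ} (h : Bump θ) :
    ∃ N : ℤ, ∀ k ≥ N, ∀ η, lowSym χ k η * θ η = θ η := by
  obtain ⟨R, hR⟩ := h.cpt.exists_norm_le
  obtain ⟨n, hn⟩ := pow_unbounded_of_one_lt (2 * Real.pi * R * (4 / 3)) (one_lt_two (α := ℝ))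
  refine ⟨n, fun k hk η => ?_⟩
  by_cases h0 : θ η = 0
  · simp [h0]
  rw [lowSym_eq_one hχ, one_mul]
  have h1 : (2 : ℝ) ^ n ≤ 2 ^ k := by
    rw [← zpow_natCast]
    exact zpow_le_zpow_right₀ one_le_two hk
  have := mul_le_mul_of_nonneg_left (hR η h0) Real.two_pi_pos.le
  linarith

theorem lowFreq_add_block (hχ : IsCutoff χ) (j : ℤ) (T : 𝓢'(Space d, ℂ)) :
    lowFreq χ (j + 1) T = lowFreq χ j T + block χ j T := by
  rw [block_eq, lowFreq_eq, lowFreq_eq]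
  have := fm_sub (bump_lowSym hχ (j + 1)).tg (bump_lowSym hχ j).tg T
  have e : blockSym χ j = fun η => lowSym χ (j + 1) η - lowSym χ j η := rfl
  rw [e, this]
  abel

/-- The low-frequency parts of an element of `𝒮'_h` are bounded functions: those of very low frequency
by definition, the others by addition of finitely many blocks. -/
theorem MemSh.exists_bddRep (hχ : IsCutoff χ) {T : 𝓢'(Space d, ℂ)} (hT : MemSh χ T)
    (hb : ∀ k, ∃ b, BddRep (block χ k T) b) (k : ℤ) : ∃ t, BddRep (lowFreq χ k T) t := by
  obtain ⟨N, hN⟩ := eventually_atBot.1 (hT.eventually (gt_mem_nhds ENNReal.zero_lt_top))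
  have h1 : ∀ j ≤ N, ∃ t, BddRep (lowFreq χ j T) t := by
    intro j hj
    obtain ⟨w, h1, h2⟩ := exists_representedBy_of_lpNorm_lt_top (hN j hj)
    exact ⟨w, h1, h1.1, h2⟩
  rcases le_total k N with h | h
  · exact h1 k h
  · induction k, h using Int.leInduction with
    | base => exact h1 N le_rfl
    | succ j hj ih =>
      obtain ⟨t, ht⟩ := ih
      obtain ⟨b, hb⟩ := hb j
      exact ⟨_, by rw [lowFreq_add_block hχ]; exact ht.add hb⟩

theorem fm_lowFreq (hχ : IsCutoff χ) {θ : Space d → ℂ} (hθ : Bump θ) {k : ℤ}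
    (h : ∀ η, lowSym χ k η * θ η = θ η) (T : 𝓢'(Space d, ℂ)) :
    fm θ (lowFreq χ k T) = fm θ T := by
  rw [lowFreq_eq, fm_fm hθ.tg (bump_lowSym hχ k).tg]
  simp only [mul_comm (θ _), h]

theorem bandBdd_of_lowFreq (hχ : IsCutoff χ) {T : 𝓢'(Space d, ℂ)}
    (h : ∀ k, ∃ t, BddRep (lowFreq χ k T) t) : BandBdd T := by
  intro θ hθ
  obtain ⟨N, hN⟩ := hθ.exists_lowSym hχ
  obtain ⟨t, ht⟩ := h N
  have := ht.op hθ
  rw [fm_lowFreq hχ hθ (hN N le_rfl)] at this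
  exact ⟨_, this⟩

theorem op_gevrey_op {A : ℝ} {θ θ' w : Space d → ℂ} (hθ : Bump θ) (hθ' : Bump θ')
    (h : ∀ η, θ' η * θ η = θ η) (hw : MemLp w ⊤ volume) :
    op (fun η => gevreySymbol A η * θ η) (op θ' w) = op (fun η => gevreySymbol A η * θ η) w := by
  have e : (fun η => gevreySymbol A η * θ η * θ' η) = fun η => gevreySymbol A η * θ η := by
    ext η
    rw [mul_assoc, mul_comm (θ η), h]
  rw [op_op (hθ.hasKer_gevrey A) hθ'.hasKer (by rw [e]; exact hθ.hasKer_gevrey A) hw, e]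

theorem op_op_gevrey {A : ℝ} {θ θ' w : Space d → ℂ} (hθ : Bump θ) (hθ' : Bump θ')
    (hw : MemLp w ⊤ volume) :
    op θ' (op (fun η => gevreySymbol A η * θ η) w) =
      op (fun η => gevreySymbol A η * (θ' η * θ η)) w := by
  have e : (fun η => θ' η * (gevreySymbol A η * θ η)) =
      fun η => gevreySymbol A η * (θ' η * θ η) := by
    ext η
    ring
  rw [op_op hθ'.hasKer (hθ.hasKer_gevrey A) (by rw [e]; exact (hθ'.mul hθ).hasKer_gevrey A) hw, e]

theorem op_gevrey_op' {A : ℝ} {θ θ' w : Space d → ℂ} (hθ : Bump θ) (hθ' : Bump θ')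
    (hw : MemLp w ⊤ volume) :
    op (fun η => gevreySymbol A η * θ η) (op θ' w) =
      op (fun η => gevreySymbol A η * (θ η * θ' η)) w := by
  have e : (fun η => gevreySymbol A η * θ η * θ' η) =
      fun η => gevreySymbol A η * (θ η * θ' η) := by
    ext η
    ring
  rw [op_op (hθ.hasKer_gevrey A) hθ'.hasKer (by rw [e]; exact (hθ.mul hθ').hasKer_gevrey A) hw, e]

end

section

variable {χ : Space d → ℝ}

/-! ### Existence of the image under `e^{a Λ₁}` -/

theorem two_rpow_ne_top (x : ℝ) : (2 : ℝ≥0∞) ^ x ≠ ⊤ :=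
  ENNReal.rpow_ne_top_of_ne_zero two_ne_zero (by simp)

theorem two_rpow_add (x y : ℝ) : (2 : ℝ≥0∞) ^ (x + y) = 2 ^ x * 2 ^ y :=
  ENNReal.rpow_add _ _ two_ne_zero (by simp)

theorem le_two_rpow_mul {x : ℝ} {a b : ℝ≥0∞} (h : 2 ^ x * a ≤ b) : a ≤ 2 ^ (-x) * b := by
  calc a = 2 ^ (-x) * (2 ^ x * a) := by
        rw [← mul_assoc, ← two_rpow_add, neg_add_cancel, ENNReal.rpow_zero, one_mul]
    _ ≤ _ := by gcongr

/-- A series of bounded functions, whose spectra are dyadic annuli tending to infinity, converges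
in the tempered distributions if the sup norms grow at most exponentially in the index. -/
theorem exists_hasSum_of_growth (hχ : IsCutoff χ) {V : ℤ → 𝓢'(Space d, ℂ)}
    {v : ℤ → Space d → ℂ} (hV : ∀ j, BddRep (V j) (v j)) (h0 : ∀ j < 0, V j = 0)
    (hfm : ∀ j, fm (annSym χ j) (V j) = V j) (α : ℝ) {B : ℝ≥0∞} (hB : B ≠ ⊤)
    (hs : ∀ j : ℤ, 0 ≤ j → eLpNorm (v j) ⊤ volume ≤ B * 2 ^ ((j : ℝ) * α)) :
    ∃ U, HasSum V U := by
  obtain ⟨m, hm⟩ := exists_nat_ge (α + 1)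
  refine exists_hasSum_of_annular hχ hV hfm m ?_
  refine ne_top_of_le_ne_top (ENNReal.mul_ne_top hB (tsum_geometric_ne_top one_pos 0)) ?_
  rw [← ENNReal.tsum_mul_left]
  refine ENNReal.tsum_le_tsum fun j => ?_
  split_ifs with hj
  · refine (mul_le_mul_right (hs j hj) _).trans ?_
    rw [mul_left_comm, ← two_rpow_add]
    gcongr
    · norm_num
    · have h1 : (0 : ℝ) ≤ j := by exact_mod_cast hj
      have h2 : (0 : ℝ) ≤ m := by positivity
      nlinarith
  · have : v j =ᵐ[volume] fun _ => 0 :=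
      (hV j).1.ae_eq (by rw [h0 j (by omega)]; exact BddRep.zero.1)
    rw [eLpNorm_congr_ae this, eLpNorm_zero', mul_zero, mul_zero]

section

variable {A : ℝ} {T : 𝓢'(Space d, ℂ)} {t : ℤ → Space d → ℂ}

/-- If `Ṡ_i` is the identity on the support of `θ`, then `θ(D) T` can be computed from `Ṡ_i T`. -/
theorem bddRep_fm_of_lowFreq (hχ : IsCutoff χ) (ht : ∀ k, BddRep (lowFreq χ k T) (t k)) {θ : Space d → ℂ}
    (hθ : Bump θ) {i : ℤ} (hi : ∀ η, lowSym χ i η * θ η = θ η) : BddRep (fm θ T) (op θ (t i)) := by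
  have := (ht i).op hθ
  rwa [fm_lowFreq hχ hθ hi] at this

theorem low_ae_eq (hχ : IsCutoff χ) (ht : ∀ k, BddRep (lowFreq χ k T) (t k)) {i j : ℤ}
    (h : i < j) : t i =ᵐ[volume] op (lowSym χ i) (t j) :=
  (ht i).1.ae_eq (bddRep_fm_of_lowFreq hχ ht (bump_lowSym hχ i)
    (fun η => lowSym_mul_lowSym hχ h η)).1

theorem op_gevrey_low_eq_of_lt (hχ : IsCutoff χ) (ht : ∀ k, BddRep (lowFreq χ k T) (t k))
    {θ : Space d → ℂ} (hθ : Bump θ) {i j : ℤ} (hij : i < j)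
    (hi : ∀ η, lowSym χ i η * θ η = θ η) :
    op (fun η => gevreySymbol A η * θ η) (t i) = op (fun η => gevreySymbol A η * θ η) (t j) := by
  rw [op_congr_ae (low_ae_eq hχ ht hij), op_gevrey_op hθ (bump_lowSym hχ i) hi (ht j).2]

/-- The function `e^{AΛ₁} θ(D) T` does not depend on the low-frequency part of `T` from which it is
computed. -/
theorem op_gevrey_low_eq (hχ : IsCutoff χ) (ht : ∀ k, BddRep (lowFreq χ k T) (t k))
    {θ : Space d → ℂ} (hθ : Bump θ) {i j : ℤ} (hi : ∀ η, lowSym χ i η * θ η = θ η)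
    (hj : ∀ η, lowSym χ j η * θ η = θ η) :
    op (fun η => gevreySymbol A η * θ η) (t i) = op (fun η => gevreySymbol A η * θ η) (t j) := by
  rw [op_gevrey_low_eq_of_lt hχ ht hθ (show i < max i j + 1 by omega) hi,
    op_gevrey_low_eq_of_lt hχ ht hθ (show j < max i j + 1 by omega) hj]

/-- `e^{AΛ₁} Ṡ_{k+1} T = e^{AΛ₁} Ṡ_k T + e^{AΛ₁} Δ̇_k T`, at every point. -/
theorem op_gevrey_low_succ (hχ : IsCutoff χ) (ht : ∀ k, BddRep (lowFreq χ k T) (t k)) (k : ℤ)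
    (x : Space d) :
    op (fun η => gevreySymbol A η * lowSym χ (k + 1) η) (t (k + 1 + 1)) x =
      op (fun η => gevreySymbol A η * lowSym χ k η) (t (k + 1)) x +
        op (fun η => gevreySymbol A η * blockSym χ k η) (t (k + 2)) x := by
  have hXg := fun k => (bump_lowSym hχ k).hasKer_gevrey A
  have e1 : op (fun η => gevreySymbol A η * lowSym χ k η) (t (k + 1)) =
      op (fun η => gevreySymbol A η * lowSym χ k η) (t (k + 2)) :=
    op_gevrey_low_eq hχ ht (bump_lowSym hχ k) (fun η => lowSym_mul_lowSym hχ (by omega) η)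
      (fun η => lowSym_mul_lowSym hχ (by omega) η)
  have e2 : op (fun η => gevreySymbol A η * blockSym χ k η) (t (k + 2)) =
      op (fun η => gevreySymbol A η * lowSym χ (k + 1) η -
        gevreySymbol A η * lowSym χ k η) (t (k + 2)) := by
    simp only [blockSym, mul_sub]
  rw [e1, e2, op_sub_left (hXg _) (hXg _) (ht _).2]
  simp only [show k + 1 + 1 = k + 2 by ring]
  ring

/-- If the functions `e^{AΛ₁} Δ̇_k T` have a finite Besov norm, then `e^{AΛ₁} T` exists as a tempered
distribution: it is `e^{AΛ₁} Ṡ_0 T` plus the sum of the blocks with `k ≥ 0`, whose sup norms grow at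
most exponentially in `k` by Bernstein's inequality. -/
theorem exists_gevreyRel (hχ : IsCutoff χ) {p : ℝ} (hp : 1 < p) {r : ℝ≥0∞} (hr : 1 ≤ r) {σ : ℝ}
    (ht : ∀ k, BddRep (lowFreq χ k T) (t k))
    (hfin : seqNorm r (fun k => 2 ^ ((k : ℝ) * σ) *
      eLpNorm (op (fun η => gevreySymbol A η * blockSym χ k η) (t (k + 2)))
        (ENNReal.ofReal p) volume) < ⊤) :
    ∃ H, GevreyRel A T H := by
  set gl : ℤ → Space d → ℂ := fun k => op (fun η => gevreySymbol A η * lowSym χ k η) (t (k + 1))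
    with hgl
  set h : ℤ → Space d → ℂ := fun k => op (fun η => gevreySymbol A η * blockSym χ k η) (t (k + 2))
    with hh
  have hXg := fun k => (bump_lowSym hχ k).hasKer_gevrey A
  have hBg := fun k => (bump_blockSym hχ k).hasKer_gevrey A
  have mgl : ∀ k, MemLp (gl k) ⊤ volume := fun k => memLp_op (hXg k) (ht _).2
  have mh : ∀ k, MemLp (h k) ⊤ volume := fun k => memLp_op (hBg k) (ht _).2
  have hsub : ∀ k x, gl (k + 1) x = gl k x + h k x := op_gevrey_low_succ hχ ht
  choose D hD using fun k => exists_bddRep (mgl k)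
  choose V' hV' using fun k => exists_bddRep (mh k)
  set V : ℤ → 𝓢'(Space d, ℂ) := fun j => if 0 ≤ j then V' j else 0 with hVdef
  set v : ℤ → Space d → ℂ := fun j => if 0 ≤ j then h j else fun _ => 0 with hvdef
  have hV : ∀ j, BddRep (V j) (v j) := by
    intro j
    simp only [hVdef, hvdef]
    split_ifs
    · exact hV' j
    · exact BddRep.zero
  have hopann : ∀ j, op (annSym χ j) (h j) = h j := by
    intro j
    rw [hh]
    simp only
    rw [op_op_gevrey (bump_blockSym hχ j) (bump_annSym hχ j) (ht _).2]
    simp only [annSym_mul_blockSym hχ]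
  have hfm : ∀ j, fm (annSym χ j) (V j) = V j := by
    intro j
    simp only [hVdef]
    split_ifs
    · refine ((hV' j).op (bump_annSym hχ j)).eq_of_ae (hV' j) ?_
      rw [hopann]
    · simp
  have hpp := Real.HolderConjugate.conjExponent hp
  obtain ⟨U, hU⟩ := exists_hasSum_of_growth hχ hV (fun j hj => if_neg (by omega)) hfm (d / p - σ)
    (ENNReal.mul_ne_top (eLpNorm_ker_ne_top (bump_annSym hχ 0)
      (ENNReal.ofReal p.conjExponent)) hfin.ne) (by
    intro j hj
    simp only [hvdef, if_pos hj]
    rw [← hopann]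
    refine (eLpNorm_op_annSym_top_le hχ j hpp (mh j).1).trans ?_
    rw [mul_assoc]
    refine mul_le_mul_right ?_ _
    have h1 := le_two_rpow_mul (le_seqNorm hr (fun k : ℤ => 2 ^ ((k : ℝ) * σ) *
      eLpNorm (h k) (ENNReal.ofReal p) volume) j)
    refine (mul_le_mul_right h1 _).trans_eq ?_
    rw [mul_sub, sub_eq_add_neg, two_rpow_add]
    ring)
  have hDsucc : ∀ n : ℕ, D n = D 0 + ∑ i ∈ Finset.range n, V i := by
    intro n
    induction n with
    | zero => simp
    | succ n ih =>
      rw [Finset.sum_range_succ, ← add_assoc, ← ih]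
      have e : V (n : ℤ) = V' n := if_pos (by omega)
      rw [e]
      refine (hD _).eq_of_ae ((hD _).add (hV' _)) (ae_of_all _ fun x => ?_)
      push_cast
      exact hsub n x
  -- the distributions `D n = e^{AΛ₁} Ṡ_n T` converge
  have hlim : Tendsto (fun n : ℕ => D n) atTop (𝓝 (D 0 + U)) := by
    have hinj : Function.Injective (fun i : ℕ => (i : ℤ)) := Nat.cast_injective
    have h1 := (hinj.hasSum_iff (f := V) (a := U) (fun x hx => by
      have : ¬ 0 ≤ x := fun h0 => hx ⟨x.toNat, by simp [h0]⟩
      simp only [hVdef, if_neg this])).2 hU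
    have h2 := h1.tendsto_sum_nat.const_add (D 0)
    refine h2.congr fun n => ?_
    rw [hDsucc n]
    rfl
  refine ⟨D 0 + U, fun θ θ₁ K w hθ hθ₁ hθθ hK hw => ?_⟩
  obtain ⟨N, hN⟩ := hθ₁.exists_lowSym hχ
  obtain ⟨N', hN'⟩ := hθ.exists_lowSym hχ
  have hL := ((fm θ₁).continuous.tendsto _).comp hlim
  have e1 : cv K w = op (fun η => gevreySymbol A η * θ₁ η) (t (max N N')) := by
    have e2 := hw.1.ae_eq (bddRep_fm_of_lowFreq hχ ht hθ (hN' (max N N') (le_max_right _ _))).1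
    rw [← op_eq_cv hK, op_congr_ae e2, op_gevrey_op hθ₁ hθ hθθ (ht _).2]
  -- on a given compact set of frequencies the sequence `D n` is eventually constant
  have key : ∀ n : ℕ, N ≤ n → BddRep (fm θ₁ (D n)) (cv K w) := by
    intro n hn
    have h1 := (hD n).op hθ₁
    have e : op θ₁ (gl n) = cv K w := by
      rw [e1, hgl]
      simp only
      rw [op_op_gevrey (bump_lowSym hχ n) hθ₁ (ht _).2]
      have e3 : (fun η => gevreySymbol A η * (θ₁ η * lowSym χ n η)) =
          fun η => gevreySymbol A η * θ₁ η := by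
        ext η
        rw [mul_comm (θ₁ η), hN n hn]
      rw [e3]
      exact op_gevrey_low_eq hχ ht hθ₁ (hN _ (by omega)) (hN _ (le_max_left _ _))
    rwa [e] at h1
  have hev : ∀ᶠ n : ℕ in atTop, fm θ₁ (D n) = fm θ₁ (D N.toNat) := by
    filter_upwards [eventually_ge_atTop N.toNat] with n hn
    exact (key n (by omega)).eq_of_ae (key _ (by omega)) (ae_eq_refl _)
  have e4 : fm θ₁ (D 0 + U) = fm θ₁ (D N.toNat) :=
    tendsto_nhds_unique hL (tendsto_const_nhds.congr' (hev.mono fun n hn => hn.symm))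
  rw [e4]
  exact key _ (by omega)

theorem GevreyRel.bddRep_block (hχ : IsCutoff χ) (ht : ∀ k, BddRep (lowFreq χ k T) (t k))
    {H : 𝓢'(Space d, ℂ)} (hH : GevreyRel A T H) (k : ℤ) :
    BddRep (block χ k H) (op (fun η => gevreySymbol A η * blockSym χ k η) (t (k + 2))) := by
  rw [block_eq]
  refine hH (lowSym χ (k + 2)) _ _ _ (bump_lowSym hχ _) (bump_blockSym hχ k)
    (fun η => lowSym_mul_blockSym hχ (by omega) η) (hasKer_ker ((bump_blockSym hχ k).hasKer_gevrey A))
    ?_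
  exact ht _

theorem GevreyRel.bddRep_lowFreq (hχ : IsCutoff χ) (ht : ∀ k, BddRep (lowFreq χ k T) (t k))
    {H : 𝓢'(Space d, ℂ)} (hH : GevreyRel A T H) (k : ℤ) :
    BddRep (lowFreq χ k H) (op (fun η => gevreySymbol A η * lowSym χ k η) (t (k + 1))) := by
  rw [lowFreq_eq]
  refine hH (lowSym χ (k + 1)) _ _ _ (bump_lowSym hχ _) (bump_lowSym hχ k)
    (fun η => lowSym_mul_lowSym hχ (by omega) η) (hasKer_ker ((bump_lowSym hχ k).hasKer_gevrey A))
    ?_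
  exact ht _

theorem lpNorm_lowFreq (ht : ∀ k, BddRep (lowFreq χ k T) (t k)) (k : ℤ) :
    lpNorm ⊤ (lowFreq χ k T) = eLpNorm (t k) ⊤ volume := lpNorm_eq (ht k).1 _

/-- The operator `e^{AΛ₁}` is bounded at low frequencies: there its symbol can be replaced by the fixed
symbol `e^{A|η|₁}` cut off by `lowSym χ 2`, which has an integrable kernel. -/
theorem GevreyRel.memSh (hχ : IsCutoff χ) (ht : ∀ k, BddRep (lowFreq χ k T) (t k))
    {H : 𝓢'(Space d, ℂ)} (hH : GevreyRel A T H) (hT : MemSh χ T) : MemSh χ H := by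
  have hk := (bump_lowSym hχ 2).hasKer_gevrey A
  have h1 : Tendsto (fun j : ℤ => eLpNorm (ker (fun η => gevreySymbol A η * lowSym χ 2 η)) 1 volume *
      lpNorm ⊤ (lowFreq χ j T)) atBot (𝓝 0) := by
    have := ENNReal.Tendsto.const_mul hT (Or.inr (eLpNorm_ker_one_ne_top hk))
    rwa [mul_zero] at this
  refine tendsto_of_tendsto_of_tendsto_of_le_of_le' tendsto_const_nhds h1
    (Eventually.of_forall fun _ => zero_le) ?_
  filter_upwards [eventually_le_atBot 0] with j hj
  rw [lpNorm_eq (hH.bddRep_lowFreq hχ ht j).1, lpNorm_lowFreq ht]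
  have e : op (fun η => gevreySymbol A η * lowSym χ j η) (t (j + 1)) =
      op (fun η => gevreySymbol A η * lowSym χ 2 η) (t j) := by
    rw [op_congr_ae (low_ae_eq hχ ht (show j < j + 1 by omega)),
      op_gevrey_op' (bump_lowSym hχ 2) (bump_lowSym hχ j) (ht _).2]
    simp only [lowSym_mul_lowSym hχ (show j < 2 by omega)]
  rw [e]
  exact eLpNorm_op_top_le hk

end

/-- The image of a series under `e^{aΛ₁}`, estimated through the images of its terms. -/
theorem exists_gevreyImage_of_series (hχ : IsCutoff χ) {p : ℝ} (hp : 1 < p) {r : ℝ≥0∞} (hr : 1 ≤ r)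
    {σ a : ℝ} {T : 𝓢'(Space d, ℂ)} {W : ℤ → 𝓢'(Space d, ℂ)} {w : ℤ → Space d → ℂ}
    (hT : MemSh χ T) (hWT : SeriesConvergesTo W T) (hw : ∀ j, BddRep (W j) (w j))
    (hs : ∀ k, ∑' j, eLpNorm (op (blockSym χ k) (w j)) ⊤ volume ≠ ⊤)
    (hfin : seqNorm r (fun k => 2 ^ ((k : ℝ) * σ) * ∑' j,
      eLpNorm (op (fun η => gevreySymbol (2 * Real.pi * a) η * blockSym χ k η) (w j))
        (ENNReal.ofReal p) volume) < ⊤) :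
    ∃ H, IsMultiplierImage (gevreySymbol a) T H ∧ MemSh χ H ∧
      besovNorm χ σ (ENNReal.ofReal p) r H ≤ seqNorm r (fun k => 2 ^ ((k : ℝ) * σ) * ∑' j,
      eLpNorm (op (fun η => gevreySymbol (2 * Real.pi * a) η * blockSym χ k η) (w j))
        (ENNReal.ofReal p) volume) := by
  set A := 2 * Real.pi * a
  have hb : ∀ k, BddRep (block χ k T) (fun x => ∑' j, op (blockSym χ k) (w j) x) := fun k => by
    rw [block_eq]
    exact hWT.bddRep hw (bump_blockSym hχ k) (hs k)
  choose t ht using hT.exists_bddRep hχ (fun k => ⟨_, hb k⟩)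
  -- The operator with symbol `e^{A|η|₁} annSym χ k`, which acts as `e^{AΛ₁}` on the `k`-th block, is
  -- bounded on `L^∞` and may be applied term by term.
  have hest : ∀ k, eLpNorm (op (fun η => gevreySymbol A η * blockSym χ k η) (t (k + 2)))
      (ENNReal.ofReal p) volume ≤ ∑' j, eLpNorm (op (fun η => gevreySymbol A η * blockSym χ k η)
        (w j)) (ENNReal.ofReal p) volume := by
    intro k
    have hBk := bump_blockSym hχ k
    have hAk := bump_annSym hχ k
    have e0 : ∀ v, MemLp v ⊤ volume → op (fun η => gevreySymbol A η * annSym χ k η)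
        (op (blockSym χ k) v) = op (fun η => gevreySymbol A η * blockSym χ k η) v := by
      intro v hv
      rw [op_gevrey_op' hAk hBk hv]
      simp only [annSym_mul_blockSym hχ]
    have e1 := (hb k).1.ae_eq (by
      rw [block_eq]
      exact (bddRep_fm_of_lowFreq hχ ht hBk (i := k + 2)
        (fun η => lowSym_mul_blockSym hχ (by omega) η)).1)
    have hmem := fun j => memLp_op hBk.hasKer (hw j).2
    have e2 : op (fun η => gevreySymbol A η * blockSym χ k η) (t (k + 2)) =
        fun x => ∑' j, op (fun η => gevreySymbol A η * blockSym χ k η) (w j) x := by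
      ext x
      rw [← e0 _ (ht _).2, ← op_congr_ae e1, op_tsum (hAk.hasKer_gevrey A) hmem (hs k)]
      exact tsum_congr fun j => by rw [e0 _ (hw j).2]
    rw [e2]
    refine eLpNorm_tsum_le (fun j => (memLp_op (hBk.hasKer_gevrey A) (hw j).2).1) ?_
      (by simpa using hp.le)
    have h3 : ∑' j, eLpNorm (op (fun η => gevreySymbol A η * blockSym χ k η) (w j)) ⊤ volume
        ≠ ⊤ := by
      refine ne_top_of_le_ne_top (ENNReal.mul_ne_top
        (eLpNorm_ker_one_ne_top (hAk.hasKer_gevrey A)) (hs k)) ?_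
      rw [← ENNReal.tsum_mul_left]
      refine ENNReal.tsum_le_tsum fun j => ?_
      rw [← e0 _ (hw j).2]
      exact eLpNorm_op_top_le (hAk.hasKer_gevrey A)
    filter_upwards [ae_summable_of_tsum_ne_top h3] with x hx using hx.1.of_norm
  have hmono := seqNorm_mono (r := r) (fun k : ℤ => mul_le_mul_right (hest k)
    ((2 : ℝ≥0∞) ^ ((k : ℝ) * σ)))
  obtain ⟨H, hH⟩ := exists_gevreyRel hχ hp hr ht (hmono.trans_lt hfin)
  refine ⟨H, hH.isMultiplierImage (bandBdd_of_lowFreq hχ fun k => ⟨_, ht k⟩),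
    hH.memSh hχ ht hT, le_trans (le_of_eq ?_) hmono⟩
  rw [besovNorm]
  congr 1
  ext k
  rw [lpNorm_eq (hH.bddRep_block hχ ht k).1]

end

/-! ### Weighted sequences -/

/-- Young's inequality. -/
theorem seqNorm_conv_le {r : ℝ≥0∞} (hr : 1 ≤ r) (κ a : ℤ → ℝ≥0∞) :
    seqNorm r (fun k => ∑' m, κ m * a (k + m)) ≤ (∑' m, κ m) * seqNorm r a := by
  refine (seqNorm_tsum_le hr (fun m k => κ m * a (k + m))).trans_eq ?_
  rw [← ENNReal.tsum_mul_right]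
  refine tsum_congr fun m => ?_
  rw [seqNorm_const_mul hr, seqNorm_shift]

/-- Sums over a window of bounded width. -/
theorem seqNorm_weighted_window_le {r : ℝ≥0∞} (hr : 1 ≤ r) (τ : ℝ) (m n : ℤ) (z : ℤ → ℝ≥0∞) :
    seqNorm r (fun k => 2 ^ ((k : ℝ) * τ) * ∑ j ∈ Finset.Icc (k + m) (k + n), z j) ≤
      (∑ i ∈ Finset.Icc m n, 2 ^ (-(i : ℝ) * τ)) * seqNorm r (fun j => 2 ^ ((j : ℝ) * τ) * z j) := by
  have e : ∀ k : ℤ, 2 ^ ((k : ℝ) * τ) * ∑ j ∈ Finset.Icc (k + m) (k + n), z j =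
      ∑ i ∈ Finset.Icc m n, 2 ^ (-(i : ℝ) * τ) *
        (2 ^ (((k + i : ℤ) : ℝ) * τ) * z (k + i)) := by
    intro k
    rw [Finset.mul_sum, ← Finset.image_add_left_Icc, Finset.sum_image (by simp)]
    refine Finset.sum_congr rfl fun i _ => ?_
    rw [← mul_assoc, ← two_rpow_add]
    congr 2
    push_cast
    ring
  simp only [e]
  refine (seqNorm_sum_le hr _ _).trans_eq ?_
  rw [Finset.sum_mul]
  refine Finset.sum_congr rfl fun i _ => ?_
  rw [seqNorm_const_mul hr,
    seqNorm_shift r (fun j : ℤ => (2 : ℝ≥0∞) ^ ((j : ℝ) * τ) * z j) i]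

/-- Sums over high frequencies, for a positive weight. -/
theorem seqNorm_weighted_tail_le {r : ℝ≥0∞} (hr : 1 ≤ r) (τ : ℝ) (n : ℤ) (z : ℤ → ℝ≥0∞) :
    seqNorm r (fun k => 2 ^ ((k : ℝ) * τ) * ∑' j, if k + n ≤ j then z j else 0) ≤
      (∑' i : ℤ, if n ≤ i then (2 : ℝ≥0∞) ^ (-(i : ℝ) * τ) else 0) *
        seqNorm r (fun j => 2 ^ ((j : ℝ) * τ) * z j) := by
  refine le_trans (le_of_eq ?_) (seqNorm_conv_le hr _ _)
  congr 1
  ext k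
  rw [← ENNReal.tsum_mul_left, ← (Equiv.addLeft k).tsum_eq]
  refine tsum_congr fun i => ?_
  simp only [Equiv.coe_addLeft, add_le_add_iff_left]
  split_ifs
  · rw [← mul_assoc, ← two_rpow_add]
    congr 2
    push_cast
    ring
  · simp

/-- Sums over low frequencies, for a negative weight. -/
theorem seqNorm_weighted_head_le {r : ℝ≥0∞} (hr : 1 ≤ r) (σ β : ℝ) (x : ℤ → ℝ≥0∞) :
    seqNorm r (fun j => 2 ^ (-(j : ℝ) * σ) *
      ∑' l : ℤ, if l < j - 1 then 2 ^ ((l : ℝ) * β) * x l else 0) ≤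
      (∑' i : ℤ, if 2 ≤ i then (2 : ℝ≥0∞) ^ (-(i : ℝ) * σ) else 0) *
        seqNorm r (fun l => 2 ^ ((l : ℝ) * (β - σ)) * x l) := by
  have h := seqNorm_conv_le hr
    (fun i : ℤ => if 2 ≤ -i then (2 : ℝ≥0∞) ^ ((i : ℝ) * σ) else 0)
    (fun l => 2 ^ ((l : ℝ) * (β - σ)) * x l)
  have e2 : ∑' i : ℤ, (if 2 ≤ -i then (2 : ℝ≥0∞) ^ ((i : ℝ) * σ) else 0) =
      ∑' i : ℤ, if 2 ≤ i then (2 : ℝ≥0∞) ^ (-(i : ℝ) * σ) else 0 := by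
    rw [← (Equiv.neg ℤ).tsum_eq]
    refine tsum_congr fun i => ?_
    simp
  rw [e2] at h
  refine le_trans (le_of_eq ?_) h
  congr 1
  ext j
  rw [← ENNReal.tsum_mul_left, ← (Equiv.addLeft j).tsum_eq]
  refine tsum_congr fun i => ?_
  simp only [Equiv.coe_addLeft, show (j + i < j - 1) ↔ (2 ≤ -i) by omega]
  split_ifs
  · rw [← mul_assoc, ← mul_assoc, ← two_rpow_add, ← two_rpow_add]
    congr 2
    push_cast
    ring
  · simp

/-- The sequence inequality behind the estimate of the paraproduct. If `σ > 0`, the sum over `l` is a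
convolution with a geometric sequence; if `σ = 0` and `r₁ = 1`, it is bounded in `j`. The first
conclusion says that the sum over `l` is finite. The window `-3 ≤ j - k ≤ 6` contains all `j` for
which the spectrum of `Ṡ_{j-1} f Δ̇_j g`, as localized by `annSym χ j`, meets that of the block `k`. -/
theorem exists_seqNorm_para_le {r r₁ r₂ : ℝ≥0∞} (hr : 1 ≤ r) (hr₁ : 1 ≤ r₁) (hr₂ : 1 ≤ r₂)
    {s σ : ℝ} (β : ℝ) (h : (0 < σ ∧ r⁻¹ = r₁⁻¹ + r₂⁻¹) ∨ (σ = 0 ∧ r₁ = 1 ∧ r = r₂)) :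
    ∃ K : ℝ≥0∞, K ≠ ⊤ ∧ ∀ x y : ℤ → ℝ≥0∞,
      (∀ j : ℤ, 2 ^ (-(j : ℝ) * σ) * (∑' l : ℤ, if l < j - 1 then 2 ^ ((l : ℝ) * β) * x l else 0) ≤
        K * seqNorm r₁ (fun l => 2 ^ ((l : ℝ) * (β - σ)) * x l)) ∧
      seqNorm r (fun k => 2 ^ ((k : ℝ) * (s - σ)) * ∑ j ∈ Finset.Icc (k + (-3)) (k + 6),
        (∑' l : ℤ, if l < j - 1 then 2 ^ ((l : ℝ) * β) * x l else 0) * y j) ≤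
      K * (seqNorm r₁ (fun l => 2 ^ ((l : ℝ) * (β - σ)) * x l) *
        seqNorm r₂ (fun j => 2 ^ ((j : ℝ) * s) * y j)) := by
  obtain ⟨ρ, K, hρ, hK, hρr, hρK⟩ : ∃ (ρ K : ℝ≥0∞), 1 ≤ ρ ∧ K ≠ ⊤ ∧ r⁻¹ = ρ⁻¹ + r₂⁻¹ ∧
      ∀ x : ℤ → ℝ≥0∞, seqNorm ρ (fun j => 2 ^ (-(j : ℝ) * σ) *
      ∑' l : ℤ, if l < j - 1 then 2 ^ ((l : ℝ) * β) * x l else 0) ≤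
        K * seqNorm r₁ (fun l => 2 ^ ((l : ℝ) * (β - σ)) * x l) := by
    rcases h with ⟨h1, h2⟩ | ⟨rfl, rfl, rfl⟩
    · exact ⟨r₁, _, hr₁, tsum_geometric_ne_top h1 2, h2, seqNorm_weighted_head_le hr₁ σ β⟩
    · refine ⟨⊤, 1, le_top, ENNReal.one_ne_top, by simp, fun x => ?_⟩
      rw [seqNorm_top, seqNorm_one, one_mul]
      refine iSup_le fun j => ?_
      rw [mul_zero, ENNReal.rpow_zero, one_mul, sub_zero]
      refine ENNReal.tsum_le_tsum fun l => ?_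
      split_ifs
      · exact le_rfl
      · exact zero_le
  have hM : ∑ i ∈ Finset.Icc (-3 : ℤ) 6, (2 : ℝ≥0∞) ^ (-(i : ℝ) * (s - σ)) ≠ ⊤ :=
    ENNReal.sum_ne_top.2 fun i _ => two_rpow_ne_top _
  have hM1 : 1 ≤ ∑ i ∈ Finset.Icc (-3 : ℤ) 6, (2 : ℝ≥0∞) ^ (-(i : ℝ) * (s - σ)) := by
    have := Finset.single_le_sum (f := fun i : ℤ => (2 : ℝ≥0∞) ^ (-(i : ℝ) * (s - σ)))
      (fun _ _ => zero_le) (show (0 : ℤ) ∈ Finset.Icc (-3 : ℤ) 6 by simp)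
    simpa using this
  refine ⟨_, ENNReal.mul_ne_top hM hK, fun x y => ⟨fun j => ?_, ?_⟩⟩
  · refine ((le_seqNorm hρ _ j).trans (hρK x)).trans ?_
    rw [mul_assoc]
    exact le_mul_of_one_le_left zero_le hM1
  · refine (seqNorm_weighted_window_le hr (s - σ) (-3) 6 (fun j =>
      (∑' l : ℤ, if l < j - 1 then 2 ^ ((l : ℝ) * β) * x l else 0) * y j)).trans ?_
    rw [mul_assoc]
    refine mul_le_mul_right ?_ _
    have e : ∀ j : ℤ, 2 ^ ((j : ℝ) * (s - σ)) *
        ((∑' l : ℤ, if l < j - 1 then 2 ^ ((l : ℝ) * β) * x l else 0) * y j) =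
        (2 ^ (-(j : ℝ) * σ) * ∑' l : ℤ, if l < j - 1 then 2 ^ ((l : ℝ) * β) * x l else 0) *
        (2 ^ ((j : ℝ) * s) * y j) := by
      intro j
      rw [show (j : ℝ) * (s - σ) = -(j : ℝ) * σ + j * s by ring, two_rpow_add]
      ring
    simp only [e]
    refine (seqNorm_mul_le hr hρ hr₂ hρr _ _).trans ?_
    rw [← mul_assoc]
    exact mul_le_mul_left (hρK x) _

/-- The sequence inequality behind the estimate of the remainder. The condition `s₁ + s₂ > 0` makes
the sum over the high frequencies `j ≥ k - 4` a convolution with a convergent geometric sequence. -/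
theorem exists_seqNorm_rem_le {r r₁ r₂ : ℝ≥0∞} (hr : 1 ≤ r) (hr₁ : 1 ≤ r₁) (hr₂ : 1 ≤ r₂)
    {s₁ s₂ : ℝ} (β : ℝ) (hs : 0 < s₁ + s₂) (h : r⁻¹ = r₁⁻¹ + r₂⁻¹) :
    ∃ K : ℝ≥0∞, K ≠ ⊤ ∧ ∀ x y : ℤ → ℝ≥0∞,
      seqNorm r (fun j => 2 ^ ((j : ℝ) * (s₁ + s₂)) *
        ∑ j' ∈ Finset.Icc (j - 1) (j + 1), 2 ^ ((j : ℝ) * β) * x j * y j') ≤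
      K * (seqNorm r₁ (fun l => 2 ^ ((l : ℝ) * (s₁ + β)) * x l) *
        seqNorm r₂ (fun j => 2 ^ ((j : ℝ) * s₂) * y j)) ∧
      seqNorm r (fun k => 2 ^ ((k : ℝ) * (s₁ + s₂)) * ∑' j : ℤ, if k + (-4) ≤ j then
        ∑ j' ∈ Finset.Icc (j - 1) (j + 1), 2 ^ ((j : ℝ) * β) * x j * y j' else 0) ≤
      K * (seqNorm r₁ (fun l => 2 ^ ((l : ℝ) * (s₁ + β)) * x l) *
        seqNorm r₂ (fun j => 2 ^ ((j : ℝ) * s₂) * y j)) := by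
  set M := ∑ i ∈ Finset.Icc (-1 : ℤ) 1, (2 : ℝ≥0∞) ^ (-(i : ℝ) * s₂)
  set G := ∑' i : ℤ, if -4 ≤ i then (2 : ℝ≥0∞) ^ (-(i : ℝ) * (s₁ + s₂)) else 0
  have hM : M ≠ ⊤ := ENNReal.sum_ne_top.2 fun i _ => two_rpow_ne_top _
  have hG : G ≠ ⊤ := tsum_geometric_ne_top hs (-4)
  have hG1 : 1 ≤ G := by
    have := ENNReal.le_tsum (f := fun i : ℤ => if -4 ≤ i then
      (2 : ℝ≥0∞) ^ (-(i : ℝ) * (s₁ + s₂)) else 0) 0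
    simpa only [neg_nonpos, Nat.ofNat_nonneg, if_true, Int.cast_zero, neg_zero, zero_mul,
      ENNReal.rpow_zero] using this
  refine ⟨G * M, ENNReal.mul_ne_top hG hM, fun x y => ?_⟩
  have key : seqNorm r (fun j => 2 ^ ((j : ℝ) * (s₁ + s₂)) *
        ∑ j' ∈ Finset.Icc (j - 1) (j + 1), 2 ^ ((j : ℝ) * β) * x j * y j') ≤
      M * (seqNorm r₁ (fun l => 2 ^ ((l : ℝ) * (s₁ + β)) * x l) *
        seqNorm r₂ (fun j => 2 ^ ((j : ℝ) * s₂) * y j)) := by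
    have e : ∀ j : ℤ, 2 ^ ((j : ℝ) * (s₁ + s₂)) *
        ∑ j' ∈ Finset.Icc (j - 1) (j + 1), 2 ^ ((j : ℝ) * β) * x j * y j' =
        (2 ^ ((j : ℝ) * (s₁ + β)) * x j) *
          (2 ^ ((j : ℝ) * s₂) * ∑ j' ∈ Finset.Icc (j + (-1)) (j + 1), y j') := by
      intro j
      rw [← Finset.mul_sum, ← sub_eq_add_neg,
        show (j : ℝ) * (s₁ + s₂) = j * s₁ + j * s₂ by ring,
        show (j : ℝ) * (s₁ + β) = j * s₁ + j * β by ring, two_rpow_add, two_rpow_add]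
      ring
    simp only [e]
    refine (seqNorm_mul_le hr hr₁ hr₂ h _ _).trans ?_
    rw [mul_left_comm]
    exact mul_le_mul_right (seqNorm_weighted_window_le hr₂ s₂ (-1) 1 y) _
  refine ⟨key.trans ?_, ?_⟩
  · rw [mul_assoc G]
    exact le_mul_of_one_le_left zero_le hG1
  · refine (seqNorm_weighted_tail_le hr (s₁ + s₂) (-4) _).trans ?_
    rw [mul_assoc G]
    exact mul_le_mul_right key _

/-- The tails at `-∞` of a convergent series tend to `0`. -/
theorem tendsto_tsum_lt_atBot {a : ℤ → ℝ≥0∞} {n₀ : ℤ}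
    (h : ∑' j, (if j < n₀ then a j else 0) ≠ ⊤) :
    Tendsto (fun n : ℤ => ∑' j, if j < n then a j else 0) atBot (𝓝 0) := by
  rw [ENNReal.tendsto_nhds_zero]
  intro ε hε
  have h1 := ENNReal.tendsto_tsum_compl_atTop_zero h
  rw [ENNReal.tendsto_nhds_zero] at h1
  obtain ⟨s, hs⟩ := (h1 ε hε).exists
  obtain ⟨b, hb⟩ : ∃ b : ℤ, ∀ j ∈ s, b ≤ j := by
    obtain ⟨b, hb⟩ := s.bddBelow
    exact ⟨b, fun j hj => hb hj⟩
  filter_upwards [eventually_le_atBot (min b n₀)] with n hn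
  refine le_trans ?_ hs
  refine le_of_le_of_eq (ENNReal.tsum_le_tsum fun j => ?_)
    (tsum_subtype {x : ℤ | x ∉ s} (fun j => if j < n₀ then a j else 0)).symm
  split_ifs with hj
  · have hjs : j ∈ {x : ℤ | x ∉ s} := fun hj' => by
      have := hb j hj'
      omega
    rw [Set.indicator_of_mem hjs, if_pos (by omega)]
  · exact zero_le

section

variable {χ : Space d → ℝ}

/-! ### Littlewood-Paley pieces of a function with a Gevrey image -/

/-- The Littlewood-Paley pieces, as functions, of a distribution `f` with `F = e^{AΛ₁} f`: the
functions `s k`, `b k` are `Ṡ_k f`, `Δ̇_k f`, and `B k` is `Δ̇_k F`. The identities hold at every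
point and not only almost everywhere. -/
structure Profile (χ : Space d → ℝ) (A : ℝ) (f F : 𝓢'(Space d, ℂ)) (s b B : ℤ → Space d → ℂ) :
    Prop where
  low : ∀ k, BddRep (lowFreq χ k f) (s k)
  blk : ∀ k, BddRep (block χ k f) (b k)
  image : ∀ k, BddRep (block χ k F) (B k)
  succ : ∀ k x, s (k + 1) x = s k x + b k x
  low_eq : ∀ i j, i < j → op (lowSym χ i) (s j) = s i
  blk_eq_op : ∀ k, op (blockSym χ k) (s (k + 2)) = b k
  blk_eq : ∀ k, b k = op (fun η => gevreySymbol (-A) η * annSym χ k η) (B k)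
  tendsto : Tendsto (fun k => eLpNorm (s k) ⊤ volume) atBot (𝓝 0)

/-- All the pieces of `f` are computed from the low-frequency parts of `F`, by means of the bounded
operators `e^{-AΛ₁} Ṡ_k` and `e^{-AΛ₁} Δ̇_k`. -/
theorem exists_profile (hχ : IsCutoff χ) {A : ℝ} (hA : 0 ≤ A) {f F : 𝓢'(Space d, ℂ)}
    (h : GevreyRel A f F) (hf : BandBdd f) (hF : MemSh χ F) :
    ∃ s b B, Profile χ A f F s b B := by
  have hs := h.symm hf
  choose S hS using fun k => h.bandBdd hf (lowSym χ k) (bump_lowSym hχ k)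
  have hS' : ∀ k, BddRep (lowFreq χ k F) (S k) := hS
  refine ⟨fun k => op (fun η => gevreySymbol (-A) η * lowSym χ k η) (S (k + 1)),
    fun k => op (fun η => gevreySymbol (-A) η * blockSym χ k η) (S (k + 2)),
    fun k => op (blockSym χ k) (S (k + 2)), hs.bddRep_lowFreq hχ hS', hs.bddRep_block hχ hS',
    fun k => ?_, op_gevrey_low_succ hχ hS', fun i j hij => ?_, fun k => ?_, fun k => ?_, ?_⟩
  · rw [block_eq]
    exact bddRep_fm_of_lowFreq hχ hS' (bump_blockSym hχ k)
      fun η => lowSym_mul_blockSym hχ (by omega) η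
  · rw [op_op_gevrey (bump_lowSym hχ j) (bump_lowSym hχ i) (hS _).2]
    simp only [lowSym_mul_lowSym' hχ hij]
    exact op_gevrey_low_eq hχ hS' (bump_lowSym hχ i)
      (fun η => lowSym_mul_lowSym hχ (by omega) η) (fun η => lowSym_mul_lowSym hχ (by omega) η)
  · rw [op_op_gevrey (bump_lowSym hχ _) (bump_blockSym hχ k) (hS _).2]
    simp only [mul_comm (blockSym χ k _), lowSym_mul_blockSym hχ (show k + 1 < k + 2 by omega)]
    exact op_gevrey_low_eq hχ hS' (bump_blockSym hχ k)
      (fun η => lowSym_mul_blockSym hχ (by omega) η)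
      (fun η => lowSym_mul_blockSym hχ (by omega) η)
  · rw [op_gevrey_op' (bump_annSym hχ k) (bump_blockSym hχ k) (hS _).2]
    simp only [annSym_mul_blockSym hχ]
  · have h1 : Tendsto (fun j : ℤ => eLpNorm (ker (lowSym χ 0)) 1 volume *
        lpNorm ⊤ (lowFreq χ (j + 1) F)) atBot (𝓝 0) := by
      have := ENNReal.Tendsto.const_mul (hF.comp (tendsto_atBot_add_const_right _ (1 : ℤ)
        tendsto_id)) (Or.inr (eLpNorm_ker_one_ne_top (bump_lowSym hχ 0).hasKer))
      rwa [mul_zero] at this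
    refine tendsto_of_tendsto_of_tendsto_of_le_of_le tendsto_const_nhds h1 (fun _ => zero_le)
      fun j => ?_
    simp only
    rw [lpNorm_lowFreq hS', ← eLpNorm_ker_lowSym hχ j]
    exact (eLpNorm_op_top_le ((bump_lowSym hχ j).hasKer_gevrey _)).trans
      (mul_le_mul_left (eLpNorm_ker_gevrey_neg_le (bump_lowSym hχ j) hA) _)

theorem Profile.lpNorm_block {A : ℝ} {f F : 𝓢'(Space d, ℂ)} {s b B : ℤ → Space d → ℂ}
    (h : Profile χ A f F s b B) (p : ℝ≥0∞) (k : ℤ) :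
    lpNorm p (block χ k F) = eLpNorm (B k) p volume := lpNorm_eq (h.image k).1 p

/-- The blocks of `f` are controlled by those of `F`, uniformly in `A ≥ 0`. -/
theorem exists_profile_bound (hχ : IsCutoff χ) {q : ℝ} (hq : 1 < q) :
    ∃ K : ℝ≥0∞, K ≠ ⊤ ∧ ∀ {A : ℝ} (_ : 0 ≤ A) {f F : 𝓢'(Space d, ℂ)} {s b B : ℤ → Space d → ℂ}
      (_ : Profile χ A f F s b B) (k : ℤ),
      eLpNorm (b k) ⊤ volume ≤
        K * (2 ^ ((k : ℝ) * (d / q)) * eLpNorm (B k) (ENNReal.ofReal q) volume) ∧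
      eLpNorm (b k) (ENNReal.ofReal q) volume ≤ K * eLpNorm (B k) (ENNReal.ofReal q) volume := by
  have hqq := Real.HolderConjugate.conjExponent hq
  set N := eLpNorm (ker (annSym χ 0)) 1 volume
  set M := eLpNorm (ker (annSym χ 0)) (ENNReal.ofReal q.conjExponent) volume
  have hN : N ≠ ⊤ := eLpNorm_ker_one_ne_top (bump_annSym hχ 0).hasKer
  have hM : M ≠ ⊤ := eLpNorm_ker_ne_top (bump_annSym hχ 0) _
  refine ⟨N + M * N, by finiteness, fun {A} hA {f F s b B} h k => ?_⟩
  have h2 : eLpNorm (b k) (ENNReal.ofReal q) volume ≤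
      N * eLpNorm (B k) (ENNReal.ofReal q) volume := by
    rw [h.blk_eq]
    refine (eLpNorm_op_le ((bump_annSym hχ k).hasKer_gevrey _) (h.image k).2.1 hq.le).trans ?_
    refine mul_le_mul_left ((eLpNorm_ker_gevrey_neg_le (bump_annSym hχ k) hA).trans_eq ?_) _
    exact eLpNorm_ker_annSym hχ k
  refine ⟨?_, h2.trans (mul_le_mul_left le_self_add _)⟩
  have e : op (annSym χ k) (b k) = b k := by
    rw [← h.blk_eq_op, op_op (bump_annSym hχ k).hasKer (bump_blockSym hχ k).hasKer
      ((bump_annSym hχ k).mul (bump_blockSym hχ k)).hasKer (h.low _).2]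
    simp only [annSym_mul_blockSym hχ]
  rw [← e]
  refine (eLpNorm_op_annSym_top_le hχ k hqq (h.blk k).2.1).trans ?_
  refine (mul_le_mul_right (mul_le_mul_right h2 _) _).trans ?_
  calc _ = M * N * (2 ^ ((k : ℝ) * (d / q)) * eLpNorm (B k) (ENNReal.ofReal q) volume) := by ring
    _ ≤ _ := mul_le_mul_left le_add_self _

/-- Hölder's inequality `L^∞ · L^p ⊆ L^p`. -/
theorem eLpNorm_top_mul_le {p : ℝ≥0∞} {w v : Space d → ℂ} (hv : AEStronglyMeasurable v volume) :
    eLpNorm (fun x => w x * v x) p volume ≤ eLpNorm w ⊤ volume * eLpNorm v p volume := by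
  refine eLpNorm_le_mul_eLpNorm_of_ae_le_mul'' _ hv ?_
  filter_upwards [ae_le_eLpNormEssSup (f := w) (μ := volume)] with x hx
  rw [enorm_mul]
  gcongr
  simpa using hx

/-- The low-frequency parts are sums of blocks, because `Ṡ_k f` tends to `0` uniformly as `k → -∞`. -/
theorem Profile.ae_eq_tsum {A : ℝ} {f F : 𝓢'(Space d, ℂ)} {s b B : ℤ → Space d → ℂ}
    (h : Profile χ A f F s b B) (n : ℤ)
    (hs : ∑' l, (if l < n then eLpNorm (b l) ⊤ volume else 0) ≠ ⊤) :
    s n =ᵐ[volume] fun x => ∑' l, if l < n then b l x else 0 := by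
  have hs' : ∑' l, eLpNorm (fun x => if l < n then b l x else 0) ⊤ volume ≠ ⊤ := by
    refine ne_top_of_le_ne_top hs (ENNReal.tsum_le_tsum fun l => ?_)
    split_ifs
    · exact le_rfl
    · exact eLpNorm_zero'.le
  have h1 : ∀ᵐ x, ∀ k, ‖s k x‖ₑ ≤ eLpNorm (s k) ⊤ volume := by
    rw [ae_all_iff]
    intro k
    simpa using ae_le_eLpNormEssSup (f := s k) (μ := volume)
  filter_upwards [h1, ae_summable_of_tsum_ne_top hs'] with x hx hx2
  have h2 : Tendsto (fun M : ℕ => s (n - M) x) atTop (𝓝 0) := by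
    rw [tendsto_zero_iff_enorm_tendsto_zero]
    have h3 := h.tendsto.comp (tendsto_atBot_add_const_left atTop n
      (tendsto_neg_atTop_atBot.comp (tendsto_natCast_atTop_atTop (R := ℤ))))
    exact tendsto_of_tendsto_of_tendsto_of_le_of_le tendsto_const_nhds h3 (fun _ => zero_le)
      fun M => hx _
  have hinj : Function.Injective (fun i : ℕ => n - 1 - (i : ℤ)) := fun a b h => by simpa using h
  have h3 := hx2.1.of_norm.hasSum
  have h4 := (hinj.hasSum_iff (f := fun l => if l < n then b l x else 0)
    (a := ∑' l, if l < n then b l x else 0) (fun l hl => by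
      rw [if_neg]
      intro hln
      exact hl ⟨(n - 1 - l).toNat, by simp only; omega⟩)).2 h3
  refine tendsto_nhds_unique (f := fun M : ℕ => s n x - s (n - M) x) (l := atTop) ?_
    (h4.tendsto_sum_nat.congr fun M => ?_)
  · simpa using h2.const_sub (s n x)
  · induction M with
    | zero => simp
    | succ M ih =>
      rw [Finset.sum_range_succ, ih]
      have := h.succ (n - 1 - M) x
      rw [show n - 1 - (M : ℤ) + 1 = n - M by ring] at this
      simp only [Function.comp]
      rw [if_pos (by omega), this]
      push_cast
      rw [show n - ((M : ℤ) + 1) = n - 1 - M by ring]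
      ring

end

section

variable {χ : Space d → ℝ}

/-! ### Convergence of the paraproduct -/

/-- Uniform convergence implies convergence in the tempered distributions. -/
theorem tendsto_zero_of_bddRep {ι : Type*} {l : Filter ι} {U : ι → 𝓢'(Space d, ℂ)}
    {v : ι → Space d → ℂ} (h : ∀ i, BddRep (U i) (v i))
    (hv : Tendsto (fun i => eLpNorm (v i) ⊤ volume) l (𝓝 0)) : Tendsto U l (𝓝 0) := by
  rw [PointwiseConvergenceCLM.tendsto_iff_forall_tendsto]
  intro φ
  have h1 : Tendsto (fun i => (∫ y, ‖φ y‖) * (eLpNorm (v i) ⊤ volume).toReal) l (𝓝 0) := by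
    have := ((ENNReal.tendsto_toReal ENNReal.zero_ne_top).comp hv).const_mul (∫ y, ‖φ y‖)
    simpa using this
  refine squeeze_zero_norm (fun i => ?_) h1
  rw [(h i).apply, ← integral_mul_const]
  refine (norm_integral_le_integral_norm _).trans ?_
  refine integral_mono_ae ((h i).1.2 φ).1.norm (φ.integrable.norm.mul_const _) ?_
  filter_upwards [ae_norm_le_of_memLp_top (h i).2] with y hy
  simp only [norm_mul]
  gcongr

theorem sum_Ico_sub_int {M : Type*} [AddCommGroup M] (D : ℤ → M) {a b : ℤ} (h : a ≤ b) :
    ∑ j ∈ Finset.Ico a b, (D (j + 1) - D j) = D b - D a := by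
  induction b, h using Int.leInduction with
  | base => simp
  | succ b hb ih =>
    have e : Finset.Ico a (b + 1) = insert b (Finset.Ico a b) := by
      ext j
      simp only [Finset.mem_insert, Finset.mem_Ico]
      omega
    rw [e, Finset.sum_insert (by simp), ih]
    abel

theorem SeriesConvergesTo.add {U V : ℤ → 𝓢'(Space d, ℂ)} {u v : 𝓢'(Space d, ℂ)}
    (hU : SeriesConvergesTo U u) (hV : SeriesConvergesTo V v) :
    SeriesConvergesTo (fun j => U j + V j) (u + v) := by
  refine (Tendsto.add hU hV).congr fun N => ?_
  rw [Finset.sum_add_distrib]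

section

variable {A : ℝ} {f F g G : 𝓢'(Space d, ℂ)} {s b B u c C : ℤ → Space d → ℂ}

theorem Profile.op_annSym_mul (hχ : IsCutoff χ) (hf : Profile χ A f F s b B)
    (hg : Profile χ A g G u c C) (j : ℤ) :
    op (annSym χ j) (fun x => s (j - 1) x * c j x) = fun x => s (j - 1) x * c j x := by
  rw [← hf.low_eq (j - 1) j (by omega), ← hg.blk_eq_op j]
  exact op_mul_eq_self (bump_lowSym hχ _) (bump_blockSym hχ j) (bump_annSym hχ j) (hf.low _).2
    (hg.low _).2 (annSym_add hχ j)

theorem Profile.eLpNorm_low_le (hχ : IsCutoff χ) (hf : Profile χ A f F s b B) {i j : ℤ}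
    (h : i < j) :
    eLpNorm (s i) ⊤ volume ≤ eLpNorm (ker (lowSym χ 0)) 1 volume * eLpNorm (s j) ⊤ volume := by
  rw [← hf.low_eq i j h, ← eLpNorm_ker_lowSym hχ i]
  exact eLpNorm_op_top_le (bump_lowSym hχ i).hasKer

/-- Exponential growth of the blocks implies that of the low-frequency parts. The exponent
`max α 0 + 1` is not optimal; it is at least `1` so that a doubling absorbs the sum of two terms. -/
theorem Profile.eLpNorm_low_le_of_growth (hf : Profile χ A f F s b B) {α : ℝ} {K : ℝ≥0∞}
    (hb : ∀ j : ℤ, 0 ≤ j → eLpNorm (b j) ⊤ volume ≤ K * 2 ^ ((j : ℝ) * α)) {j : ℤ} (hj : 0 ≤ j) :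
    eLpNorm (s j) ⊤ volume ≤
      (eLpNorm (s 0) ⊤ volume + K) * 2 ^ ((j : ℝ) * (max α 0 + 1)) := by
  set γ := max α 0 + 1 with hγ
  have h1 : α ≤ γ := (le_max_left α 0).trans (by linarith)
  have h2 : 1 ≤ γ := by linarith [le_max_right α 0]
  induction j, hj using Int.leInduction with
  | base => simp
  | succ j hj ih =>
    have hj' : (0 : ℝ) ≤ j := by exact_mod_cast hj
    have e : s (j + 1) = s j + b j := funext fun x => hf.succ j x
    rw [e]
    refine (eLpNorm_add_le (hf.low j).2.1 (hf.blk j).2.1 le_top).trans ?_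
    have h3 : eLpNorm (b j) ⊤ volume ≤
        (eLpNorm (s 0) ⊤ volume + K) * 2 ^ ((j : ℝ) * γ) := by
      refine (hb j hj).trans ?_
      gcongr
      · exact le_add_self
      · norm_num
    refine (add_le_add ih h3).trans ?_
    rw [← mul_two, mul_assoc]
    gcongr
    rw [show ((j + 1 : ℤ) : ℝ) * γ = j * γ + γ by push_cast; ring, two_rpow_add]
    gcongr
    calc (2 : ℝ≥0∞) = 2 ^ (1 : ℝ) := by simp
      _ ≤ _ := by
        gcongr
        norm_num

/-- The paraproduct converges. Its low-frequency part is summed by parts, since neither of the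
factors `Ṡ_{j-1} f`, `Δ̇_j g` need be summable as `j → -∞`. -/
theorem exists_paraproduct (hχ : IsCutoff χ) (hf : Profile χ A f F s b B)
    (hg : Profile χ A g G u c C)
    (hb0 : ∑' l, (if l < 0 then eLpNorm (b l) ⊤ volume else 0) ≠ ⊤) {α β : ℝ} {K L : ℝ≥0∞}
    (hK : K ≠ ⊤) (hL : L ≠ ⊤)
    (hb : ∀ j : ℤ, 0 ≤ j → eLpNorm (b j) ⊤ volume ≤ K * 2 ^ ((j : ℝ) * α))
    (hc : ∀ j : ℤ, 0 ≤ j → eLpNorm (c j) ⊤ volume ≤ L * 2 ^ ((j : ℝ) * β)) :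
    ∃ (W : ℤ → 𝓢'(Space d, ℂ)) (T : 𝓢'(Space d, ℂ)),
      (∀ j, BddRep (W j) (fun x => s (j - 1) x * c j x)) ∧ SeriesConvergesTo W T ∧
        MemSh χ T := by
  set w : ℤ → Space d → ℂ := fun j x => s (j - 1) x * c j x with hw
  set δ : ℤ → Space d → ℂ := fun j x => s (j - 1) x * u j x with hδ
  set e : ℤ → Space d → ℂ := fun j x => b (j - 1) x * u (j + 1) x with he
  set N := eLpNorm (ker (lowSym χ 0)) 1 volume
  have hN : N ≠ ⊤ := eLpNorm_ker_one_ne_top (bump_lowSym hχ 0).hasKer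
  have mw : ∀ j, MemLp (w j) ⊤ volume := fun j => memLp_mul_top (hf.low _).2 (hg.blk _).2
  have mδ : ∀ j, MemLp (δ j) ⊤ volume := fun j => memLp_mul_top (hf.low _).2 (hg.low _).2
  have me : ∀ j, MemLp (e j) ⊤ volume := fun j => memLp_mul_top (hf.blk _).2 (hg.low _).2
  choose W hW using fun j => exists_bddRep (mw j)
  choose D hD using fun j => exists_bddRep (mδ j)
  choose E hE using fun j => exists_bddRep (me j)
  -- With `D j = Ṡ_{j-1} f Ṡ_j g` and `E j = Δ̇_{j-1} f Ṡ_{j+1} g`, the terms `W j = Ṡ_{j-1} f Δ̇_j g` are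
  -- `D (j + 1) - D j - E j`. The first two telescope, `D j` tends to `0` as `j → -∞`, and `E j` is
  -- summable because the blocks of `f` are.
  have hid : ∀ j, W j = D (j + 1) - D j - E j := by
    intro j
    refine (hW j).eq_of_ae (((hD _).sub (hD _)).sub (hE _)) (ae_of_all _ fun x => ?_)
    have h1 := hf.succ (j - 1) x
    rw [sub_add_cancel] at h1
    simp only [hw, hδ, he, add_sub_cancel_right, h1, hg.succ j x]
    ring
  have hebound : ∀ n j : ℤ, j < n → eLpNorm (e j) ⊤ volume ≤
      N * eLpNorm (u (n + 1)) ⊤ volume * eLpNorm (b (j - 1)) ⊤ volume := by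
    intro n j hj
    refine (eLpNorm_top_mul_le (hg.low _).2.1).trans ?_
    rw [mul_comm]
    exact mul_le_mul_left (hg.eLpNorm_low_le hχ (by omega)) _
  have hbn : ∀ n : ℤ, ∑' l, (if l < n then eLpNorm (b (l - 1)) ⊤ volume else 0) =
      ∑' l, (if l < n - 1 then eLpNorm (b l) ⊤ volume else 0) := by
    intro n
    rw [← (Equiv.subRight (1 : ℤ)).tsum_eq (fun l => if l < n - 1 then eLpNorm (b l) ⊤ volume else 0)]
    refine tsum_congr fun l => ?_
    simp
  have hbfin : ∀ n : ℤ, ∑' l, (if l < n then eLpNorm (b l) ⊤ volume else 0) ≠ ⊤ := by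
    intro n
    have h1 : ∑' l, (if l < n then eLpNorm (b l) ⊤ volume else 0) ≤
        ∑' l, ((if l < 0 then eLpNorm (b l) ⊤ volume else 0) +
          (if l ∈ Finset.Ico 0 n then eLpNorm (b l) ⊤ volume else 0)) := by
      refine ENNReal.tsum_le_tsum fun l => ?_
      by_cases h0 : l < 0
      · simp only [if_pos h0]
        split_ifs <;> simp
      · by_cases h2 : l < n
        · simp [h0, h2, not_lt.1 h0]
        · simp [h2]
    refine ne_top_of_le_ne_top ?_ h1
    rw [ENNReal.tsum_add]
    refine ENNReal.add_ne_top.2 ⟨hb0, ?_⟩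
    rw [tsum_eq_sum (s := Finset.Ico 0 n) (fun l hl => if_neg hl)]
    exact ENNReal.sum_ne_top.2 fun l hl => by
      rw [if_pos hl]
      exact (hf.blk l).2.2.ne
  set e' : ℤ → ℤ → Space d → ℂ := fun n j => if j < n then e j else fun _ => 0 with he'
  set E' : ℤ → ℤ → 𝓢'(Space d, ℂ) := fun n j => if j < n then E j else 0 with hE'
  have hE'rep : ∀ n j, BddRep (E' n j) (e' n j) := by
    intro n j
    simp only [he', hE']
    split_ifs
    · exact hE j
    · exact BddRep.zero
  have hesum : ∀ n, ∑' j, eLpNorm (e' n j) ⊤ volume ≤ N * eLpNorm (u (n + 1)) ⊤ volume *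
      ∑' l, (if l < n - 1 then eLpNorm (b l) ⊤ volume else 0) := by
    intro n
    rw [← hbn, ← ENNReal.tsum_mul_left]
    refine ENNReal.tsum_le_tsum fun j => ?_
    simp only [he']
    split_ifs with hj
    · exact hebound n j hj
    · rw [eLpNorm_zero', mul_zero]
  have hefin : ∀ n, ∑' j, eLpNorm (e' n j) ⊤ volume ≠ ⊤ := fun n =>
    ne_top_of_le_ne_top (ENNReal.mul_ne_top (ENNReal.mul_ne_top hN (hg.low _).2.2.ne) (hbfin _))
      (hesum n)
  choose Es hEs hEsrep using fun n => hasSum_of_bddRep (hE'rep n) (hefin n)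
  have hδbound : ∀ j, eLpNorm (δ j) ⊤ volume ≤
      eLpNorm (s (j - 1)) ⊤ volume * eLpNorm (u j) ⊤ volume :=
    fun j => eLpNorm_top_mul_le (hg.low _).2.1
  have hδ0 : Tendsto (fun j => eLpNorm (δ j) ⊤ volume) atBot (𝓝 0) := by
    have h1 := ENNReal.Tendsto.mul (hf.tendsto.comp (tendsto_atBot_add_const_right _ (-1 : ℤ)
      tendsto_id)) (Or.inr ENNReal.zero_ne_top) hg.tendsto (Or.inr ENNReal.zero_ne_top)
    rw [mul_zero] at h1
    exact tendsto_of_tendsto_of_tendsto_of_le_of_le tendsto_const_nhds h1 (fun _ => zero_le) hδbound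
  -- the low-frequency part of the paraproduct, for an arbitrary threshold `n`
  have hconv : ∀ n : ℤ, SeriesConvergesTo (fun j => if j < n then W j else 0) (D n - Es n) := by
    intro n
    have h1 : Tendsto (fun M : ℕ × ℕ => D (-(M.1 : ℤ))) atTop (𝓝 0) := by
      refine (tendsto_zero_of_bddRep hD hδ0).comp ?_
      rw [← prod_atTop_atTop_eq]
      exact tendsto_neg_atTop_atBot.comp (tendsto_natCast_atTop_atTop.comp tendsto_fst)
    have h2 := (h1.const_sub (D n)).sub (seriesConvergesTo_of_hasSum (hEs n))
    rw [sub_zero] at h2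
    refine h2.congr' ?_
    filter_upwards [eventually_ge_atTop ((n.natAbs, n.natAbs) : ℕ × ℕ)] with M hM
    have hM1 : n.natAbs ≤ M.1 := hM.1
    have hM2 : n.natAbs ≤ M.2 := hM.2
    have e1 : ∀ j, (if j < n then W j else 0) = (if j < n then (D (j + 1) - D j) else 0) - E' n j := by
      intro j
      simp only [hE']
      split_ifs
      · exact hid j
      · simp
    have e2 : Finset.filter (fun j => j < n) (Finset.Icc (-(M.1 : ℤ)) (M.2 : ℤ)) =
        Finset.Ico (-(M.1 : ℤ)) n := by
      ext j
      simp only [Finset.mem_filter, Finset.mem_Icc, Finset.mem_Ico]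
      omega
    have e3 : ∑ j ∈ Finset.Icc (-(M.1 : ℤ)) (M.2 : ℤ), (if j < n then (D (j + 1) - D j) else 0) =
        D n - D (-(M.1 : ℤ)) := by
      rw [← Finset.sum_filter, e2, sum_Ico_sub_int D (by omega)]
    rw [Finset.sum_congr rfl fun j _ => e1 j, Finset.sum_sub_distrib, e3]
  have hann : ∀ j, fm (annSym χ j) (W j) = W j := fun j =>
    ((hW j).op (bump_annSym hχ j)).eq_of_ae (hW j) (by
      rw [hw]
      simp only
      rw [hf.op_annSym_mul hχ hg])
  -- the high-frequency part
  obtain ⟨U, hU⟩ := exists_hasSum_of_growth hχ (V := fun j => if 0 ≤ j then W j else 0)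
    (v := fun j => if 0 ≤ j then w j else fun _ => 0) (fun j => by
      split_ifs
      · exact hW j
      · exact BddRep.zero) (fun j hj => if_neg (by omega)) (fun j => by
      split_ifs
      · exact hann j
      · simp) ((max α 0 + 1) + β)
    (B := N * (eLpNorm (s 0) ⊤ volume + K) * L) (by
      have := (hf.low 0).2.2.ne
      finiteness) (fun j hj => by
      simp only [if_pos hj]
      refine (eLpNorm_top_mul_le (hg.blk j).2.1).trans ?_
      refine (mul_le_mul' ((hf.eLpNorm_low_le hχ (show j - 1 < j by omega)).trans
        (mul_le_mul_right (hf.eLpNorm_low_le_of_growth hb hj) _)) (hc j hj)).trans_eq ?_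
      rw [show (j : ℝ) * (max α 0 + 1 + β) = j * (max α 0 + 1) + j * β by ring, two_rpow_add]
      ring)
  have hT : SeriesConvergesTo W (D 0 - Es 0 + U) := by
    have := (hconv 0).add (seriesConvergesTo_of_hasSum hU)
    refine this.congr fun M => Finset.sum_congr rfl fun j _ => ?_
    by_cases hj : j < 0
    · simp [hj, not_le.2 hj]
    · simp [hj, not_lt.1 hj]
  refine ⟨W, D 0 - Es 0 + U, hW, hT, ?_⟩
  set T := D 0 - Es 0 + U
  -- `Ṡ_k` annihilates the terms with `j > k + 5`, since their spectra lie outside the ball of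
  -- `Ṡ_k`. So `Ṡ_k T` is given by the low-frequency part with the threshold `n = k + 6`, and is small
  -- as `k → -∞`.
  have hlow : ∀ k, lowFreq χ k T = fm (lowSym χ k) (D (k + 6) - Es (k + 6)) := by
    intro k
    have h1 := hT.map (fm (lowSym χ k))
    have h2 := (hconv (k + 6)).map (fm (lowSym χ k))
    have e1 : (fun j => fm (lowSym χ k) (W j)) =
        fun j => fm (lowSym χ k) (if j < k + 6 then W j else 0) := by
      ext1 j
      split_ifs with hj
      · rfl
      · rw [← hann j, fm_fm (bump_lowSym hχ k).tg (bump_annSym hχ j).tg, map_zero]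
        simp only [lowSym_mul_annSym_eq_zero hχ (show k + 5 < j by omega)]
        have h0 : HasKer (fun _ : Space d => (0 : ℂ)) (ker fun _ => 0) :=
          hasKer_ker ⟨fun _ => 0, integrable_zero _ _ _, fun η => by simp [Real.fourier_eq]⟩
        have h3 := (hW j).op (θ := fun _ : Space d => (0 : ℂ))
          ⟨contDiff_const, HasCompactSupport.zero⟩
        rw [op_zero_symbol] at h3
        exact h3.eq_of_ae BddRep.zero (ae_eq_refl _)
    rw [e1] at h1
    exact tendsto_nhds_unique h1 h2
  have hbd : ∀ k : ℤ, lpNorm ⊤ (lowFreq χ k T) ≤ N * (eLpNorm (δ (k + 6)) ⊤ volume +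
      N * eLpNorm (u (k + 6 + 1)) ⊤ volume *
      ∑' l, (if l < k + 6 - 1 then eLpNorm (b l) ⊤ volume else 0)) := by
    intro k
    have h1 := ((hD (k + 6)).sub (hEsrep (k + 6))).op (bump_lowSym hχ k)
    rw [← hlow] at h1
    rw [lpNorm_eq h1.1]
    refine (eLpNorm_op_top_le (bump_lowSym hχ k).hasKer).trans ?_
    rw [eLpNorm_ker_lowSym hχ k]
    refine mul_le_mul_right ?_ _
    refine (eLpNorm_sub_le (hD _).2.1 (hEsrep _).2.1 le_top).trans ?_
    exact add_le_add le_rfl (eLpNorm_top_tsum_le.trans (hesum _))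
  refine tendsto_of_tendsto_of_tendsto_of_le_of_le tendsto_const_nhds ?_ (fun _ => zero_le) hbd
  have t1 : Tendsto (fun k : ℤ => k + 6) atBot atBot :=
    tendsto_atBot_add_const_right _ (6 : ℤ) tendsto_id
  have l1 := hδ0.comp t1
  have l2 := hg.tendsto.comp (tendsto_atBot_add_const_right _ (1 : ℤ) t1)
  have l3 := (tendsto_tsum_lt_atBot hb0).comp (tendsto_atBot_add_const_right _ (-1 : ℤ) t1)
  have l4 := ENNReal.Tendsto.const_mul (a := N) l2 (Or.inr hN)
  have l5 := ENNReal.Tendsto.mul l4 (Or.inr ENNReal.zero_ne_top) l3 (by simp)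
  have l6 := ENNReal.Tendsto.const_mul (a := N) (l1.add l5) (Or.inr hN)
  simpa [Function.comp_def, sub_eq_add_neg] using l6

end

end

section

variable {χ : Space d → ℝ}

/-! ### The estimate of the paraproduct -/

theorem op_const_zero (m : Space d → ℂ) : op m (fun _ => 0) = fun _ => 0 := by
  ext x
  simp [op, cv]

theorem isProduct_of_bddRep {u v P : 𝓢'(Space d, ℂ)} {w z : Space d → ℂ} (hu : BddRep u w)
    (hv : BddRep v z) (hP : BddRep P (fun x => w x * z x)) : IsProduct u v P :=
  ⟨w, z, hu.1, hv.1, hP.1⟩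

theorem IsProduct.bddRep {u v P : 𝓢'(Space d, ℂ)} {w z : Space d → ℂ} (h : IsProduct u v P)
    (hu : BddRep u w) (hv : BddRep v z) : BddRep P (fun x => w x * z x) := by
  obtain ⟨w', z', h1, h2, h3⟩ := h
  refine ⟨h3.congr_ae ?_, memLp_mul_top hu.2 hv.2⟩
  filter_upwards [h1.ae_eq hu.1, h2.ae_eq hv.1] with x hx hx'
  rw [hx, hx']

theorem le_two_rpow_mul_seqNorm {r : ℝ≥0∞} (hr : 1 ≤ r) (τ : ℝ) (x : ℤ → ℝ≥0∞) (j : ℤ) :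
    x j ≤ 2 ^ (-((j : ℝ) * τ)) * seqNorm r (fun k => 2 ^ ((k : ℝ) * τ) * x k) :=
  le_two_rpow_mul (le_seqNorm hr (fun k : ℤ => 2 ^ ((k : ℝ) * τ) * x k) j)

/-- The norm of `m(D)` of a series is at most the sum of the norms of `m(D)` of its terms. -/
theorem eLpNorm_op_tsum_le {m : Space d → ℂ} (h : ∃ k, HasKer m k) {w : Space d → ℂ}
    {z : ℤ → Space d → ℂ} (hz : ∀ j, MemLp (z j) ⊤ volume)
    (hs : ∑' j, eLpNorm (z j) ⊤ volume ≠ ⊤) (hw : w =ᵐ[volume] fun x => ∑' j, z j x) {p : ℝ≥0∞}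
    (hp : 1 ≤ p) : eLpNorm (op m w) p volume ≤ ∑' j, eLpNorm (op m (z j)) p volume := by
  rw [op_congr_ae hw, show op m (fun x => ∑' j, z j x) = fun x => ∑' j, op m (z j) x from
    funext fun x => op_tsum h hz hs x]
  refine eLpNorm_tsum_le (fun j => (memLp_op h (hz j)).1) ?_ hp
  have h3 : ∑' j, eLpNorm (op m (z j)) ⊤ volume ≠ ⊤ := by
    refine ne_top_of_le_ne_top (ENNReal.mul_ne_top (eLpNorm_ker_one_ne_top h) hs) ?_
    rw [← ENNReal.tsum_mul_left]
    exact ENNReal.tsum_le_tsum fun j => eLpNorm_op_top_le h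
  filter_upwards [ae_summable_of_tsum_ne_top h3] with x hx using hx.1.of_norm

section

variable {A : ℝ} {f F g G : 𝓢'(Space d, ℂ)} {s b B u c C : ℤ → Space d → ℂ}

/-- The block `k` of `e^{A'Λ₁}(Ṡ_{j-1} f Δ̇_j g)` vanishes unless `j` is close to `k`. -/
theorem Profile.op_blockSym_mul_eq_zero (hχ : IsCutoff χ) (hf : Profile χ A f F s b B)
    (hg : Profile χ A g G u c C) (A' : ℝ) {k j : ℤ} (h : j ∉ Finset.Icc (k + (-3)) (k + 6)) :
    op (fun η => gevreySymbol A' η * blockSym χ k η) (fun x => s (j - 1) x * c j x) =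
      fun _ => 0 := by
  rw [← hf.op_annSym_mul hχ hg j, op_gevrey_op' (bump_blockSym hχ k) (bump_annSym hχ j)
    (memLp_mul_top (hf.low _).2 (hg.blk _).2)]
  have h0 : j < k - 3 ∨ k + 6 < j := by
    rw [Finset.mem_Icc] at h
    omega
  simp only [blockSym_mul_annSym_eq_zero hχ h0, mul_zero]
  exact op_zero_symbol _

/-- The blocks of one term of the paraproduct. The function `Ṡ_{j-1} f` is expanded in blocks, and the
dyadic bilinear estimate `hCb` is applied to each `Δ̇_l f Δ̇_j g`. -/
theorem Profile.eLpNorm_op_para_le {Cb : ℝ≥0} {p q : ℝ} (hχ : IsCutoff χ) (hp : 1 < p)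
    (hCb : ∀ k l m : ℤ, ∀ W V : Space d → ℂ, MemLp W ⊤ volume → MemLp V ⊤ volume →
      eLpNorm (op (fun η => gevreySymbol A η * blockSym χ k η) (fun y =>
        op (fun η => gevreySymbol (-A) η * annSym χ l η) W y *
        op (fun η => gevreySymbol (-A) η * annSym χ m η) V y)) (ENNReal.ofReal p) volume ≤
      Cb * (2 ^ ((l : ℝ) * (d / q)) * eLpNorm W (ENNReal.ofReal q) volume *
        eLpNorm V (ENNReal.ofReal p) volume))
    (hf : Profile χ A f F s b B) (hg : Profile χ A g G u c C) (k j : ℤ)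
    (hb : ∑' l, (if l < j - 1 then eLpNorm (b l) ⊤ volume else 0) ≠ ⊤) :
    eLpNorm (op (fun η => gevreySymbol A η * blockSym χ k η) (fun x => s (j - 1) x * c j x))
      (ENNReal.ofReal p) volume ≤ Cb * ((∑' l : ℤ, if l < j - 1 then
        2 ^ ((l : ℝ) * (d / q)) * eLpNorm (B l) (ENNReal.ofReal q) volume else 0) *
          eLpNorm (C j) (ENNReal.ofReal p) volume) := by
  set z : ℤ → Space d → ℂ := fun l => if l < j - 1 then fun x => b l x * c j x else fun _ => 0
    with hz
  have mz : ∀ l, MemLp (z l) ⊤ volume := by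
    intro l
    simp only [hz]
    split_ifs
    · exact memLp_mul_top (hf.blk l).2 (hg.blk j).2
    · exact MemLp.zero
  have hsz : ∑' l, eLpNorm (z l) ⊤ volume ≠ ⊤ := by
    refine ne_top_of_le_ne_top (ENNReal.mul_ne_top hb (hg.blk j).2.2.ne) ?_
    rw [← ENNReal.tsum_mul_right]
    refine ENNReal.tsum_le_tsum fun l => ?_
    simp only [hz]
    split_ifs
    · exact eLpNorm_top_mul_le (hg.blk j).2.1
    · exact eLpNorm_zero'.le.trans zero_le
  have hw : (fun x => s (j - 1) x * c j x) =ᵐ[volume] fun x => ∑' l, z l x := by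
    filter_upwards [hf.ae_eq_tsum (j - 1) hb] with x hx
    rw [hx, ← tsum_mul_right]
    refine tsum_congr fun l => ?_
    simp only [hz]
    split_ifs <;> simp
  refine (eLpNorm_op_tsum_le ((bump_blockSym hχ k).hasKer_gevrey A) mz hsz hw
    (by simpa using hp.le)).trans ?_
  rw [← ENNReal.tsum_mul_right, ← ENNReal.tsum_mul_left]
  refine ENNReal.tsum_le_tsum fun l => ?_
  simp only [hz]
  split_ifs
  · rw [hf.blk_eq, hg.blk_eq]
    exact hCb k l j _ _ (hf.image l).2 (hg.image j).2
  · rw [op_const_zero]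
    exact eLpNorm_zero'.le.trans zero_le

end

theorem Profile.besovNorm_eq {A : ℝ} {f F : 𝓢'(Space d, ℂ)} {s b B : ℤ → Space d → ℂ}
    (h : Profile χ A f F s b B) (σ : ℝ) (p r : ℝ≥0∞) :
    besovNorm χ σ p r F = seqNorm r (fun k => 2 ^ ((k : ℝ) * σ) * eLpNorm (B k) p volume) := by
  rw [besovNorm]
  simp only [h.lpNorm_block]

/-- The estimate of the paraproduct for `e^{aΛ₁}`, with a constant that does not depend on `a ≥ 0`. -/
theorem exists_paraproduct_estimate (hχ : IsCutoff χ) {p q : ℝ} (hp : 1 < p) (hq : 1 < q)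
    {r r₁ r₂ : ℝ≥0∞} (hr : 1 ≤ r) (hr₁ : 1 ≤ r₁) (hr₂ : 1 ≤ r₂) {s σ : ℝ}
    (h : (0 < σ ∧ r⁻¹ = r₁⁻¹ + r₂⁻¹) ∨ (σ = 0 ∧ r₁ = 1 ∧ r = r₂)) :
    ∃ C : ℝ≥0, ∀ a : ℝ, 0 ≤ a → ∀ f g F G : 𝓢'(Space d, ℂ),
      IsMultiplierImage (gevreySymbol a) f F → IsMultiplierImage (gevreySymbol a) g G →
      MemBesov χ (d / q - σ) (ENNReal.ofReal q) r₁ F →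
      MemBesov χ s (ENNReal.ofReal p) r₂ G →
      ∃ T H : 𝓢'(Space d, ℂ), IsParaproduct χ f g T ∧
        IsMultiplierImage (gevreySymbol a) T H ∧ MemSh χ H ∧
        besovNorm χ (s - σ) (ENNReal.ofReal p) r H ≤
          C * besovNorm χ (d / q - σ) (ENNReal.ofReal q) r₁ F *
            besovNorm χ s (ENNReal.ofReal p) r₂ G := by
  obtain ⟨Cb, hCb⟩ := exists_bilinear_dyadic hχ hp hq
  obtain ⟨Ka, hKa, hKa'⟩ := exists_profile_bound hχ hq
  obtain ⟨Kb, hKb, hKb'⟩ := exists_profile_bound hχ hp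
  obtain ⟨K, hK, hK'⟩ := exists_seqNorm_para_le hr hr₁ hr₂ (s := s) (d / q) h
  refine ⟨(Cb * K).toNNReal, fun a ha f g F G hfF hgG hF hG => ?_⟩
  have hA : 0 ≤ 2 * Real.pi * a := by positivity
  obtain ⟨s', b, B, hf⟩ := exists_profile hχ hA hfF.gevreyRel hfF.bandBdd hF.1
  obtain ⟨u, c, D, hg⟩ := exists_profile hχ hA hgG.gevreyRel hgG.bandBdd hG.1
  have hFn := hF.2
  have hGn := hG.2
  rw [hf.besovNorm_eq] at hFn ⊢
  rw [hg.besovNorm_eq] at hGn ⊢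
  set x : ℤ → ℝ≥0∞ := fun l => eLpNorm (B l) (ENNReal.ofReal q) volume with hx
  set y : ℤ → ℝ≥0∞ := fun l => eLpNorm (D l) (ENNReal.ofReal p) volume with hy
  obtain ⟨hK1, hK2⟩ := hK' x y
  set X := seqNorm r₁ (fun l => 2 ^ ((l : ℝ) * (d / q - σ)) * x l) with hX
  set Y := seqNorm r₂ (fun j => 2 ^ ((j : ℝ) * s) * y j) with hY
  have hsum : ∀ j : ℤ, (∑' l : ℤ, if l < j - 1 then 2 ^ ((l : ℝ) * (d / q)) * x l else 0) ≠ ⊤ := by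
    intro j
    have h1 := hK1 j
    rw [neg_mul] at h1
    exact ne_top_of_le_ne_top (ENNReal.mul_ne_top (two_rpow_ne_top _)
      (ENNReal.mul_ne_top hK hFn.ne)) (le_two_rpow_mul h1)
  have hbs : ∀ j : ℤ, ∑' l, (if l < j - 1 then eLpNorm (b l) ⊤ volume else 0) ≠ ⊤ := by
    intro j
    refine ne_top_of_le_ne_top (ENNReal.mul_ne_top hKa (hsum j)) ?_
    rw [← ENNReal.tsum_mul_left]
    refine ENNReal.tsum_le_tsum fun l => ?_
    split_ifs
    · exact (hKa' hA hf l).1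
    · exact zero_le
  obtain ⟨W, T, hW, hWT, hT⟩ := exists_paraproduct hχ hf hg (by simpa using hbs 1)
    (α := σ) (β := d / p - s) (ENNReal.mul_ne_top hKa hFn.ne) (ENNReal.mul_ne_top hKb hGn.ne)
    (fun j _ => by
      refine (hKa' hA hf j).1.trans ?_
      rw [mul_assoc]
      refine mul_le_mul_right ?_ _
      refine (mul_le_mul_right (le_two_rpow_mul_seqNorm hr₁ (d / q - σ) x j) _).trans_eq ?_
      rw [← hX, ← mul_assoc, ← two_rpow_add, mul_comm X]
      congr 2
      ring)
    (fun j _ => by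
      refine (hKb' hA hg j).1.trans ?_
      rw [mul_assoc]
      refine mul_le_mul_right ?_ _
      refine (mul_le_mul_right (le_two_rpow_mul_seqNorm hr₂ s y j) _).trans_eq ?_
      rw [← hY, ← mul_assoc, ← two_rpow_add, mul_comm Y]
      congr 2
      ring)
  have hmain : seqNorm r (fun k => 2 ^ ((k : ℝ) * (s - σ)) * ∑' j,
      eLpNorm (op (fun η => gevreySymbol (2 * Real.pi * a) η * blockSym χ k η)
        (fun x => s' (j - 1) x * c j x)) (ENNReal.ofReal p) volume) ≤ Cb * (K * (X * Y)) := by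
    refine le_trans (seqNorm_mono fun k => ?_) ((seqNorm_const_mul hr Cb _).trans_le
      (mul_le_mul_right hK2 _))
    rw [mul_left_comm]
    refine mul_le_mul_right ?_ _
    rw [tsum_eq_sum (s := Finset.Icc (k + (-3)) (k + 6)) (fun j hj => by
      rw [hf.op_blockSym_mul_eq_zero hχ hg _ hj]
      exact eLpNorm_zero'), Finset.mul_sum]
    exact Finset.sum_le_sum fun j _ =>
      hf.eLpNorm_op_para_le hχ hp (hCb _ hA) hg k j (hbs j)
  have hfin : (Cb : ℝ≥0∞) * (K * (X * Y)) < ⊤ := by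
    have h1 := hFn.ne
    have h2 := hGn.ne
    finiteness
  -- the case `A' = 0` of the support condition is the one without `e^{aΛ₁}`
  have hone : ∀ k, (fun η => gevreySymbol 0 η * blockSym χ k η) = blockSym χ k := by
    intro k
    ext η
    simp [gevreySymbol]
  obtain ⟨H, h1, h2, h3⟩ := exists_gevreyImage_of_series hχ hp hr hT hWT hW (fun k => by
    rw [tsum_eq_sum (s := Finset.Icc (k + (-3)) (k + 6)) (fun j hj => by
      have := hf.op_blockSym_mul_eq_zero hχ hg 0 hj
      rw [hone] at this
      rw [this]
      exact eLpNorm_zero')]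
    exact ENNReal.sum_ne_top.2 fun j _ => (memLp_op (bump_blockSym hχ k).hasKer (hW j).2).2.ne)
    (hmain.trans_lt hfin)
  refine ⟨T, H, ⟨W, fun j => isProduct_of_bddRep (hf.low _) (hg.blk j) (hW j), hWT⟩, h1, h2,
    h3.trans (hmain.trans_eq ?_)⟩
  rw [ENNReal.coe_toNNReal (by finiteness)]
  ring

end

section

variable {χ : Space d → ℝ}

/-! ### The remainder -/

/-- A series of functions which converges absolutely in `L^p` converges in the tempered
distributions. -/
theorem exists_hasSum_of_lp {U : ℤ → 𝓢'(Space d, ℂ)} {z : ℤ → Space d → ℂ}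
    (h : ∀ j, BddRep (U j) (z j)) {p : ℝ≥0∞} (hp : 1 ≤ p)
    (hs : ∑' j, eLpNorm (z j) p volume ≠ ⊤) : ∃ u, HasSum U u := by
  have : Fact (1 ≤ p) := ⟨hp⟩
  have hz : ∀ j, MemLp (z j) p volume := fun j =>
    ⟨(h j).2.1, lt_top_iff_ne_top.2 (ENNReal.ne_top_of_tsum_ne_top hs j)⟩
  have h1 : Summable (fun j => (hz j).toLp (z j)) := by
    refine Summable.of_norm ?_
    simp only [Lp.norm_toLp]
    exact ENNReal.summable_toReal hs
  have h2 := (Lp.toTemperedDistributionCLM ℂ (volume : Measure (Space d)) p).hasSum h1.hasSum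
  have e : (fun j => Lp.toTemperedDistributionCLM ℂ (volume : Measure (Space d)) p
      ((hz j).toLp (z j))) = U := by
    ext j φ
    rw [(h j).apply, Lp.toTemperedDistributionCLM_apply, Lp.toTemperedDistribution_apply]
    refine integral_congr_ae ?_
    filter_upwards [(hz j).coeFn_toLp] with x hx
    rw [hx, smul_eq_mul]
  exact ⟨_, e ▸ h2⟩

section

variable {A : ℝ} {f F g G : 𝓢'(Space d, ℂ)} {s b B u c C : ℤ → Space d → ℂ}

theorem memLp_rem (hf : Profile χ A f F s b B) (hg : Profile χ A g G u c C) (j : ℤ) :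
    MemLp (fun x => ∑ j' ∈ Finset.Icc (j - 1) (j + 1), b j x * c j' x) ⊤ volume :=
  memLp_finsetSum _ fun j' _ => memLp_mul_top (hf.blk j).2 (hg.blk j').2

theorem Profile.op_lowSym_rem (hχ : IsCutoff χ) (hf : Profile χ A f F s b B)
    (hg : Profile χ A g G u c C) (j : ℤ) :
    op (lowSym χ (j + 4)) (fun x => ∑ j' ∈ Finset.Icc (j - 1) (j + 1), b j x * c j' x) =
      fun x => ∑ j' ∈ Finset.Icc (j - 1) (j + 1), b j x * c j' x := by
  ext x
  rw [op_sum (bump_lowSym hχ _).hasKer _ fun j' _ => memLp_mul_top (hf.blk j).2 (hg.blk j').2]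
  refine Finset.sum_congr rfl fun j' hj' => ?_
  rw [← hf.blk_eq_op j, ← hg.blk_eq_op j']
  exact congrFun (op_mul_eq_self (bump_blockSym hχ j) (bump_blockSym hχ j') (bump_lowSym hχ _)
    (hf.low _).2 (hg.low _).2 (lowSym_add hχ (Finset.mem_Icc.1 hj').2)) x

/-- The block `k` of the `j`-th term of the remainder vanishes if `j < k - 4`. -/
theorem Profile.op_blockSym_rem_eq_zero (hχ : IsCutoff χ) (hf : Profile χ A f F s b B)
    (hg : Profile χ A g G u c C) (A' : ℝ) {k j : ℤ} (h : ¬ k + (-4) ≤ j) :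
    op (fun η => gevreySymbol A' η * blockSym χ k η)
      (fun x => ∑ j' ∈ Finset.Icc (j - 1) (j + 1), b j x * c j' x) = fun _ => 0 := by
  rw [← hf.op_lowSym_rem hχ hg j, op_gevrey_op' (bump_blockSym hχ k) (bump_lowSym hχ _)
    (memLp_rem hf hg j)]
  simp only [blockSym_mul_lowSym_eq_zero hχ (show j + 4 < k by omega), mul_zero]
  exact op_zero_symbol _

/-- The blocks of one term of the remainder. -/
theorem Profile.eLpNorm_op_rem_le {Cb : ℝ≥0} {p q : ℝ} (hχ : IsCutoff χ) (hp : 1 < p)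
    (hCb : ∀ k l m : ℤ, ∀ W V : Space d → ℂ, MemLp W ⊤ volume → MemLp V ⊤ volume →
      eLpNorm (op (fun η => gevreySymbol A η * blockSym χ k η) (fun y =>
        op (fun η => gevreySymbol (-A) η * annSym χ l η) W y *
        op (fun η => gevreySymbol (-A) η * annSym χ m η) V y)) (ENNReal.ofReal p) volume ≤
      Cb * (2 ^ ((l : ℝ) * (d / q)) * eLpNorm W (ENNReal.ofReal q) volume *
        eLpNorm V (ENNReal.ofReal p) volume))
    (hf : Profile χ A f F s b B) (hg : Profile χ A g G u c C) (k j : ℤ) :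
    eLpNorm (op (fun η => gevreySymbol A η * blockSym χ k η)
      (fun x => ∑ j' ∈ Finset.Icc (j - 1) (j + 1), b j x * c j' x)) (ENNReal.ofReal p) volume ≤
      Cb * ∑ j' ∈ Finset.Icc (j - 1) (j + 1), 2 ^ ((j : ℝ) * (d / q)) *
        eLpNorm (B j) (ENNReal.ofReal q) volume * eLpNorm (C j') (ENNReal.ofReal p) volume := by
  have hK := (bump_blockSym hχ k).hasKer_gevrey A
  have hm := fun j' => memLp_mul_top (hf.blk j).2 (hg.blk j').2
  have e : op (fun η => gevreySymbol A η * blockSym χ k η)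
      (fun x => ∑ j' ∈ Finset.Icc (j - 1) (j + 1), b j x * c j' x) =
      ∑ j' ∈ Finset.Icc (j - 1) (j + 1), op (fun η => gevreySymbol A η * blockSym χ k η)
        (fun x => b j x * c j' x) := by
    ext x
    rw [op_sum hK _ fun j' _ => hm j', Finset.sum_apply]
  rw [e, Finset.mul_sum]
  refine (eLpNorm_sum_le (fun j' _ => (memLp_op hK (hm j')).1) (by simpa using hp.le)).trans ?_
  refine Finset.sum_le_sum fun j' _ => ?_
  rw [hf.blk_eq, hg.blk_eq]
  exact hCb k j j' _ _ (hf.image j).2 (hg.image j').2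

end

/-- Bounds for one term of the remainder, without the operator `e^{aΛ₁}`, in `L^p` and in `L^∞`. -/
theorem exists_rem_bound (hχ : IsCutoff χ) {p q : ℝ} (hp : 1 < p) (hq : 1 < q) :
    ∃ K : ℝ≥0∞, K ≠ ⊤ ∧ ∀ {A : ℝ} (_ : 0 ≤ A) {f F g G : 𝓢'(Space d, ℂ)}
      {s b B u c C : ℤ → Space d → ℂ} (_ : Profile χ A f F s b B) (_ : Profile χ A g G u c C)
      (j : ℤ),
      eLpNorm (fun x => ∑ j' ∈ Finset.Icc (j - 1) (j + 1), b j x * c j' x)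
        (ENNReal.ofReal p) volume ≤ K * ∑ j' ∈ Finset.Icc (j - 1) (j + 1),
          2 ^ ((j : ℝ) * (d / q)) * eLpNorm (B j) (ENNReal.ofReal q) volume *
            eLpNorm (C j') (ENNReal.ofReal p) volume ∧
      eLpNorm (fun x => ∑ j' ∈ Finset.Icc (j - 1) (j + 1), b j x * c j' x) ⊤ volume ≤
        K * (2 ^ ((j : ℝ) * (d / p)) * ∑ j' ∈ Finset.Icc (j - 1) (j + 1),
          2 ^ ((j : ℝ) * (d / q)) * eLpNorm (B j) (ENNReal.ofReal q) volume *
            eLpNorm (C j') (ENNReal.ofReal p) volume) := by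
  obtain ⟨Ka, hKa, hKa'⟩ := exists_profile_bound hχ hq
  obtain ⟨Kb, hKb, hKb'⟩ := exists_profile_bound hχ hp
  have h2 : (2 : ℝ≥0∞) ^ ((d : ℝ) / p) ≠ ⊤ := two_rpow_ne_top _
  refine ⟨Ka * Kb + Ka * Kb * 2 ^ ((d : ℝ) / p), by finiteness, ?_⟩
  intro A hA f F g G s b B u c C hf hg j
  have hfun : (fun x => ∑ j' ∈ Finset.Icc (j - 1) (j + 1), b j x * c j' x) =
      ∑ j' ∈ Finset.Icc (j - 1) (j + 1), fun x => b j x * c j' x := by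
    ext x
    rw [Finset.sum_apply]
  have hm := fun j' => (memLp_mul_top (hf.blk j).2 (hg.blk j').2).1
  constructor
  · rw [hfun]
    refine (eLpNorm_sum_le (fun j' _ => hm j') (by simpa using hp.le)).trans ?_
    rw [Finset.mul_sum]
    refine Finset.sum_le_sum fun j' _ => (eLpNorm_top_mul_le (hg.blk j').2.1).trans ?_
    refine (mul_le_mul' (hKa' hA hf j).1 (hKb' hA hg j').2).trans ?_
    calc _ = Ka * Kb * (2 ^ ((j : ℝ) * (d / q)) * eLpNorm (B j) (ENNReal.ofReal q) volume *
          eLpNorm (C j') (ENNReal.ofReal p) volume) := by ring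
      _ ≤ _ := mul_le_mul_left le_self_add _
  · rw [hfun]
    refine (eLpNorm_sum_le (fun j' _ => hm j') le_top).trans ?_
    rw [Finset.mul_sum, Finset.mul_sum]
    refine Finset.sum_le_sum fun j' hj' => (eLpNorm_top_mul_le (hg.blk j').2.1).trans ?_
    refine (mul_le_mul' (hKa' hA hf j).1 (hKb' hA hg j').1).trans ?_
    have h3 : (2 : ℝ≥0∞) ^ ((j' : ℝ) * (d / p)) ≤ 2 ^ ((d : ℝ) / p) * 2 ^ ((j : ℝ) * (d / p)) := by
      rw [← two_rpow_add]
      gcongr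
      · norm_num
      · have h4 : (j' : ℝ) ≤ j + 1 := by exact_mod_cast (Finset.mem_Icc.1 hj').2
        have h5 : (0 : ℝ) ≤ d / p := by positivity
        nlinarith
    calc _ = Ka * Kb * (2 ^ ((j' : ℝ) * (d / p)) * (2 ^ ((j : ℝ) * (d / q)) *
          eLpNorm (B j) (ENNReal.ofReal q) volume * eLpNorm (C j') (ENNReal.ofReal p) volume)) := by
          ring
      _ ≤ Ka * Kb * (2 ^ ((d : ℝ) / p) * 2 ^ ((j : ℝ) * (d / p)) * (2 ^ ((j : ℝ) * (d / q)) *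
          eLpNorm (B j) (ENNReal.ofReal q) volume * eLpNorm (C j') (ENNReal.ofReal p) volume)) := by
          gcongr
      _ = Ka * Kb * 2 ^ ((d : ℝ) / p) * (2 ^ ((j : ℝ) * (d / p)) * (2 ^ ((j : ℝ) * (d / q)) *
          eLpNorm (B j) (ENNReal.ofReal q) volume * eLpNorm (C j') (ENNReal.ofReal p) volume)) := by
          ring
      _ ≤ _ := mul_le_mul_left le_add_self _

/-- A series of functions with spectra in balls of size `2^j`, absolutely convergent in `L^∞` at
low and in `L^p` at high frequencies, converges to an element of `𝒮'_h`. -/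
theorem exists_memSh_of_series (hd : 1 ≤ d) (hχ : IsCutoff χ) {p : ℝ} (hp : 1 < p)
    {R : ℤ → 𝓢'(Space d, ℂ)} {ρ : ℤ → Space d → ℂ} (hR : ∀ j, BddRep (R j) (ρ j))
    (hneg : ∑' j, (if j < 0 then eLpNorm (ρ j) ⊤ volume else 0) ≠ ⊤)
    (hpos : ∀ n : ℤ, ∑' j, (if n ≤ j then eLpNorm (ρ j) (ENNReal.ofReal p) volume else 0) ≠ ⊤) :
    ∃ U, SeriesConvergesTo R U ∧ MemSh χ U := by
  have hsplit : ∃ U, SeriesConvergesTo R U := by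
    obtain ⟨U₁, h1, -⟩ := hasSum_of_bddRep (U := fun j => if j < 0 then R j else 0)
      (z := fun j => if j < 0 then ρ j else fun _ => 0) (fun j => by
        split_ifs
        · exact hR j
        · exact BddRep.zero) (by
        refine ne_top_of_le_ne_top hneg (ENNReal.tsum_le_tsum fun j => ?_)
        split_ifs
        · exact le_rfl
        · exact eLpNorm_zero'.le)
    obtain ⟨U₂, h2⟩ := exists_hasSum_of_lp (U := fun j => if 0 ≤ j then R j else 0)
      (z := fun j => if 0 ≤ j then ρ j else fun _ => 0) (fun j => by
        split_ifs
        · exact hR j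
        · exact BddRep.zero) (p := ENNReal.ofReal p) (by simpa using hp.le) (by
        refine ne_top_of_le_ne_top (hpos 0) (ENNReal.tsum_le_tsum fun j => ?_)
        split_ifs
        · exact le_rfl
        · exact eLpNorm_zero'.le)
    refine ⟨U₁ + U₂, ((seriesConvergesTo_of_hasSum h1).add (seriesConvergesTo_of_hasSum h2)).congr
      fun M => Finset.sum_congr rfl fun j _ => ?_⟩
    by_cases hj : j < 0
    · simp [hj, not_le.2 hj]
    · simp [hj, not_lt.1 hj]
  obtain ⟨U, hU⟩ := hsplit
  refine ⟨U, hU, ?_⟩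
  have hpp := Real.HolderConjugate.conjExponent hp
  set N := eLpNorm (ker (lowSym χ 0)) 1 volume
  set M := eLpNorm (ker (lowSym χ 0)) (ENNReal.ofReal p.conjExponent) volume
  have hN : N ≠ ⊤ := eLpNorm_ker_one_ne_top (bump_lowSym hχ 0).hasKer
  have hM : M ≠ ⊤ := eLpNorm_ker_ne_top (bump_lowSym hχ 0) _
  set P : ℤ → ℝ≥0∞ := fun n => ∑' j, (if j < n then eLpNorm (ρ j) ⊤ volume else 0) with hP
  set Q : ℤ → ℝ≥0∞ := fun n => ∑' j, (if n ≤ j then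
    eLpNorm (ρ j) (ENNReal.ofReal p) volume else 0) with hQ
  have hbound : ∀ n k : ℤ, ∑' j, eLpNorm (op (lowSym χ k) (ρ j)) ⊤ volume ≤
      N * P n + M * (2 ^ ((k : ℝ) * (d / p)) * Q n) := by
    intro n k
    rw [hP, hQ, ← ENNReal.tsum_mul_left, ← ENNReal.tsum_mul_left, ← ENNReal.tsum_mul_left,
      ← ENNReal.tsum_add]
    refine ENNReal.tsum_le_tsum fun j => ?_
    by_cases hj : j < n
    · rw [if_pos hj, if_neg (not_le.2 hj), mul_zero, mul_zero, add_zero]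
      refine (eLpNorm_op_top_le (bump_lowSym hχ k).hasKer).trans_eq ?_
      rw [eLpNorm_ker_lowSym hχ k]
    · rw [if_neg hj, if_pos (not_lt.1 hj), mul_zero, zero_add]
      exact eLpNorm_op_lowSym_top_le hχ k hpp (hR j).2.1
  have hfin : ∀ k, ∑' j, eLpNorm (op (lowSym χ k) (ρ j)) ⊤ volume ≠ ⊤ := fun k =>
    ne_top_of_le_ne_top (ENNReal.add_ne_top.2 ⟨ENNReal.mul_ne_top hN hneg,
      ENNReal.mul_ne_top hM (ENNReal.mul_ne_top (two_rpow_ne_top _) (hpos 0))⟩) (hbound 0 k)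
  have hle : ∀ n k : ℤ, lpNorm ⊤ (lowFreq χ k U) ≤
      N * P n + M * (2 ^ ((k : ℝ) * (d / p)) * Q n) := by
    intro n k
    rw [lowFreq_eq, lpNorm_eq (hU.bddRep hR (bump_lowSym hχ k) (hfin k)).1]
    exact eLpNorm_top_tsum_le.trans (hbound n k)
  -- The terms with `j < n` are small for `n` near `-∞`, uniformly in `k`; the terms with `j ≥ n` are
  -- small as `k → -∞` because `Ṡ_k` maps `L^p` to `L^∞` with norm of order `2^{kd/p}`. Here
  -- `d ≥ 1` is needed.
  rw [MemSh, ENNReal.tendsto_nhds_zero]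
  intro ε hε
  have hε2 : 0 < ε / 2 := ENNReal.half_pos hε.ne'
  have l1 : Tendsto (fun n => N * P n) atBot (𝓝 0) := by
    have := ENNReal.Tendsto.const_mul (a := N) (tendsto_tsum_lt_atBot hneg) (Or.inr hN)
    rwa [mul_zero] at this
  rw [ENNReal.tendsto_nhds_zero] at l1
  obtain ⟨n, hn⟩ := (l1 _ hε2).exists
  have hdp : (0 : ℝ) < d / p := by
    have : (0 : ℝ) < d := by exact_mod_cast hd
    positivity
  have l2 : Tendsto (fun k : ℤ => (2 : ℝ≥0∞) ^ ((k : ℝ) * (d / p))) atBot (𝓝 0) := by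
    have h1 : Tendsto (fun k : ℤ => (2 : ℝ) ^ ((k : ℝ) * (d / p))) atBot (𝓝 0) :=
      (tendsto_rpow_atBot_of_base_gt_one 2 one_lt_two).comp
        ((tendsto_intCast_atBot_iff.2 tendsto_id : Tendsto (fun k : ℤ => (k : ℝ)) atBot atBot).atBot_mul_const hdp)
    have h2 := ENNReal.tendsto_ofReal h1
    rw [ENNReal.ofReal_zero] at h2
    refine h2.congr fun k => ?_
    rw [← ENNReal.ofReal_rpow_of_pos two_pos]
    simp
  have l3 : Tendsto (fun k : ℤ => M * ((2 : ℝ≥0∞) ^ ((k : ℝ) * (d / p)) * Q n)) atBot (𝓝 0) := by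
    have := ENNReal.Tendsto.const_mul (a := M)
      (ENNReal.Tendsto.mul_const (b := Q n) l2 (Or.inr (hpos n))) (Or.inr hM)
    rwa [zero_mul, mul_zero] at this
  rw [ENNReal.tendsto_nhds_zero] at l3
  filter_upwards [l3 _ hε2] with k hk
  refine (hle n k).trans ((add_le_add hn hk).trans_eq (ENNReal.add_halves ε))

/-- The estimate of the remainder for `e^{aΛ₁}`, with a constant that does not depend on `a ≥ 0`, and
its convergence if `s₁ + s₂ < d/p`, or if `s₁ + s₂ = d/p` and `r = 1`. -/
theorem exists_remainder_estimate (hd : 1 ≤ d) (hχ : IsCutoff χ) {p q : ℝ} (hp : 1 < p)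
    (hq : 1 < q) {r r₁ r₂ : ℝ≥0∞} (hr : 1 ≤ r) (hr₁ : 1 ≤ r₁) (hr₂ : 1 ≤ r₂) {s₁ s₂ : ℝ}
    (hs : 0 < s₁ + s₂) (h : r⁻¹ = r₁⁻¹ + r₂⁻¹) :
    ∃ C : ℝ≥0, ∀ a : ℝ, 0 ≤ a → ∀ f g F G : 𝓢'(Space d, ℂ),
      IsMultiplierImage (gevreySymbol a) f F → IsMultiplierImage (gevreySymbol a) g G →
      MemBesov χ (s₁ + d / q) (ENNReal.ofReal q) r₁ F →
      MemBesov χ s₂ (ENNReal.ofReal p) r₂ G →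
      (∀ R : 𝓢'(Space d, ℂ), IsRemainder χ f g R → MemSh χ R →
        ∃ H : 𝓢'(Space d, ℂ), IsMultiplierImage (gevreySymbol a) R H ∧ MemSh χ H ∧
          besovNorm χ (s₁ + s₂) (ENNReal.ofReal p) r H ≤
            C * besovNorm χ (s₁ + d / q) (ENNReal.ofReal q) r₁ F *
              besovNorm χ s₂ (ENNReal.ofReal p) r₂ G) ∧
      ((s₁ + s₂ < d / p ∨ (s₁ + s₂ = d / p ∧ r = 1)) →
        ∃ R : 𝓢'(Space d, ℂ), IsRemainder χ f g R ∧ MemSh χ R) := by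
  obtain ⟨Cb, hCb⟩ := exists_bilinear_dyadic hχ hp hq
  obtain ⟨L, hL, hL'⟩ := exists_rem_bound hχ hp hq
  obtain ⟨K, hK, hK'⟩ := exists_seqNorm_rem_le hr hr₁ hr₂ (d / q) hs h
  refine ⟨(Cb * K).toNNReal, fun a ha f g F G hfF hgG hF hG => ?_⟩
  have hA : 0 ≤ 2 * Real.pi * a := by positivity
  obtain ⟨s, b, B, hf⟩ := exists_profile hχ hA hfF.gevreyRel hfF.bandBdd hF.1
  obtain ⟨u, c, D, hg⟩ := exists_profile hχ hA hgG.gevreyRel hgG.bandBdd hG.1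
  have hFn := hF.2
  have hGn := hG.2
  rw [hf.besovNorm_eq] at hFn ⊢
  rw [hg.besovNorm_eq] at hGn ⊢
  set x : ℤ → ℝ≥0∞ := fun l => eLpNorm (B l) (ENNReal.ofReal q) volume with hx
  set y : ℤ → ℝ≥0∞ := fun l => eLpNorm (D l) (ENNReal.ofReal p) volume with hy
  obtain ⟨hK1, hK2⟩ := hK' x y
  set X := seqNorm r₁ (fun l => 2 ^ ((l : ℝ) * (s₁ + d / q)) * x l) with hX
  set Y := seqNorm r₂ (fun j => 2 ^ ((j : ℝ) * s₂) * y j) with hY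
  set z : ℤ → ℝ≥0∞ := fun j => ∑ j' ∈ Finset.Icc (j - 1) (j + 1),
    2 ^ ((j : ℝ) * (d / q)) * x j * y j' with hz
  set ρ : ℤ → Space d → ℂ := fun j x => ∑ j' ∈ Finset.Icc (j - 1) (j + 1), b j x * c j' x with hρ
  have hKXY : K * (X * Y) ≠ ⊤ := by
    have h1 := hFn.ne
    have h2 := hGn.ne
    finiteness
  have hρz := fun j => hL' hA hf hg j
  have htail : ∀ n : ℤ, ∑' j : ℤ, (if n ≤ j then z j else 0) ≠ ⊤ := by
    intro n
    have h1 := (le_two_rpow_mul_seqNorm hr (s₁ + s₂)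
      (fun k : ℤ => ∑' j : ℤ, if k + (-4) ≤ j then z j else 0) (n + 4)).trans
      (mul_le_mul_right hK2 _)
    rw [show n + 4 + (-4) = n by ring] at h1
    exact ne_top_of_le_ne_top (ENNReal.mul_ne_top (two_rpow_ne_top _) hKXY) h1
  have hpos : ∀ n : ℤ, ∑' j, (if n ≤ j then
      eLpNorm (ρ j) (ENNReal.ofReal p) volume else 0) ≠ ⊤ := by
    intro n
    refine ne_top_of_le_ne_top (ENNReal.mul_ne_top hL (htail n)) ?_
    rw [← ENNReal.tsum_mul_left]
    refine ENNReal.tsum_le_tsum fun j => ?_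
    split_ifs
    · exact (hρz j).1
    · exact zero_le
  refine ⟨fun R hR hRh => ?_, fun hcase => ?_⟩
  · obtain ⟨W, hW, hWR⟩ := hR
    have hρW : ∀ j, BddRep (∑ j' ∈ Finset.Icc (j - 1) (j + 1), W j j') (ρ j) := fun j =>
      BddRep.sum _ fun j' _ => (hW j j').bddRep (hf.blk j) (hg.blk j')
    have hmain : seqNorm r (fun k => 2 ^ ((k : ℝ) * (s₁ + s₂)) * ∑' j,
        eLpNorm (op (fun η => gevreySymbol (2 * Real.pi * a) η * blockSym χ k η) (ρ j))
          (ENNReal.ofReal p) volume) ≤ Cb * (K * (X * Y)) := by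
      refine le_trans (seqNorm_mono fun k => ?_) ((seqNorm_const_mul hr Cb _).trans_le
        (mul_le_mul_right hK2 _))
      rw [mul_left_comm, ← ENNReal.tsum_mul_left (a := (Cb : ℝ≥0∞))]
      refine mul_le_mul_right (ENNReal.tsum_le_tsum fun j => ?_) _
      split_ifs with hj
      · exact hf.eLpNorm_op_rem_le hχ hp (hCb _ hA) hg k j
      · rw [hρ]
        simp only
        rw [hf.op_blockSym_rem_eq_zero hχ hg _ hj]
        exact eLpNorm_zero'.le.trans zero_le
    have hpp := Real.HolderConjugate.conjExponent hp
    have hone : ∀ k, (fun η => gevreySymbol 0 η * blockSym χ k η) = blockSym χ k := by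
      intro k
      ext η
      simp [gevreySymbol]
    obtain ⟨H, h1, h2, h3⟩ := exists_gevreyImage_of_series hχ hp hr hRh hWR hρW (fun k => by
      refine ne_top_of_le_ne_top (ENNReal.mul_ne_top
        (eLpNorm_ker_ne_top (bump_blockSym hχ k) (ENNReal.ofReal p.conjExponent))
        (hpos (k + (-4)))) ?_
      rw [← ENNReal.tsum_mul_left]
      refine ENNReal.tsum_le_tsum fun j => ?_
      split_ifs with hj
      · exact eLpNorm_op_top_le_holder (bump_blockSym hχ k).hasKer (hρW j).2.1 hpp
      · have := hf.op_blockSym_rem_eq_zero hχ hg 0 hj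
        rw [hone] at this
        rw [hρ]
        simp only
        rw [this]
        exact eLpNorm_zero'.le.trans zero_le)
      (hmain.trans_lt (ENNReal.mul_ne_top ENNReal.coe_ne_top hKXY).lt_top)
    refine ⟨H, h1, h2, h3.trans (hmain.trans_eq ?_)⟩
    rw [ENNReal.coe_toNNReal (by finiteness)]
    ring
  · choose W hW using fun j j' => exists_bddRep (memLp_mul_top (hf.blk j).2 (hg.blk j').2)
    have hρW : ∀ j, BddRep (∑ j' ∈ Finset.Icc (j - 1) (j + 1), W j j') (ρ j) := fun j =>
      BddRep.sum _ fun j' _ => hW j j'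
    have hζ : seqNorm r (fun j => 2 ^ ((j : ℝ) * (s₁ + s₂)) * z j) ≠ ⊤ :=
      ne_top_of_le_ne_top hKXY hK1
    -- Summability in `L^∞` at low frequencies: if `s₁ + s₂ < d/p`, the geometric factor
    -- `2^{j(d/p - s₁ - s₂)}` suffices; if `s₁ + s₂ = d/p` and `r = 1`, the series is the Besov norm.
    have hzneg : ∑' j : ℤ, (if j < 0 then (2 : ℝ≥0∞) ^ ((j : ℝ) * (d / p)) * z j else 0) ≠ ⊤ := by
      rcases hcase with hlt | ⟨heq, rfl⟩
      · have hg := tsum_geometric_ne_top (sub_pos.2 hlt) 1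
        rw [← (Equiv.neg ℤ).tsum_eq] at hg
        refine ne_top_of_le_ne_top (ENNReal.mul_ne_top hg hζ) ?_
        rw [← ENNReal.tsum_mul_right]
        refine ENNReal.tsum_le_tsum fun j => ?_
        simp only [Equiv.neg_apply]
        split_ifs with h1 h2
        · refine (mul_le_mul_right (le_two_rpow_mul_seqNorm hr (s₁ + s₂) z j) _).trans_eq ?_
          rw [← mul_assoc, ← two_rpow_add]
          congr 2
          push_cast
          ring
        · omega
        · exact zero_le
        · exact zero_le
      · rw [seqNorm_one] at hζ
        refine ne_top_of_le_ne_top hζ (ENNReal.tsum_le_tsum fun j => ?_)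
        split_ifs
        · rw [heq]
        · exact zero_le
    obtain ⟨R, h1, h2⟩ := exists_memSh_of_series hd hχ hp hρW (by
      refine ne_top_of_le_ne_top (ENNReal.mul_ne_top hL hzneg) ?_
      rw [← ENNReal.tsum_mul_left]
      refine ENNReal.tsum_le_tsum fun j => ?_
      split_ifs
      · exact (hρz j).2
      · exact zero_le) hpos
    exact ⟨R, ⟨W, fun j j' => isProduct_of_bddRep (hf.blk j) (hg.blk j') (hW j j'), h1⟩, h2⟩

end

end GevreyBesov

end

open GevreyBesov in
theorem proposition2p2 (d : ℕ) (hd : 1 ≤ d) (χ : Space d → ℝ) (hχ : IsCutoff χ)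
    (p q : ℝ) (hp : 1 < p) (hq : 1 < q)
    (r r₁ r₂ : ℝ≥0∞) (hr : 1 ≤ r) (hr₁ : 1 ≤ r₁) (hr₂ : 1 ≤ r₂) :
    -- the paraproduct
    (∀ s σ : ℝ, ((0 < σ ∧ r⁻¹ = r₁⁻¹ + r₂⁻¹) ∨ (σ = 0 ∧ r₁ = 1 ∧ r = r₂)) →
      ∃ C : ℝ≥0, ∀ c₀ t : ℝ, 0 < c₀ → 0 ≤ t → ∀ f g F G : 𝓢'(Space d, ℂ),
        IsGevreyImage c₀ t f F → IsGevreyImage c₀ t g G →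
        MemBesov χ (d / q - σ) (ENNReal.ofReal q) r₁ F →
        MemBesov χ s (ENNReal.ofReal p) r₂ G →
        ∃ T H : 𝓢'(Space d, ℂ), IsParaproduct χ f g T ∧ IsGevreyImage c₀ t T H ∧ MemSh χ H ∧
          besovNorm χ (s - σ) (ENNReal.ofReal p) r H ≤
            C * besovNorm χ (d / q - σ) (ENNReal.ofReal q) r₁ F *
              besovNorm χ s (ENNReal.ofReal p) r₂ G) ∧
    -- the remainder
    (∀ s₁ s₂ : ℝ, 0 < s₁ + s₂ → r⁻¹ = r₁⁻¹ + r₂⁻¹ →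
      ∃ C : ℝ≥0, ∀ c₀ t : ℝ, 0 < c₀ → 0 ≤ t → ∀ f g F G : 𝓢'(Space d, ℂ),
        IsGevreyImage c₀ t f F → IsGevreyImage c₀ t g G →
        MemBesov χ (s₁ + d / q) (ENNReal.ofReal q) r₁ F →
        MemBesov χ s₂ (ENNReal.ofReal p) r₂ G →
        -- the estimate, whenever the series of the remainder converges in `𝒮'_h`
        (∀ R : 𝓢'(Space d, ℂ), IsRemainder χ f g R → MemSh χ R →
          ∃ H : 𝓢'(Space d, ℂ), IsGevreyImage c₀ t R H ∧ MemSh χ H ∧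
            besovNorm χ (s₁ + s₂) (ENNReal.ofReal p) r H ≤
              C * besovNorm χ (s₁ + d / q) (ENNReal.ofReal q) r₁ F *
                besovNorm χ s₂ (ENNReal.ofReal p) r₂ G) ∧
        -- the series converges as soon as the target space is complete
        ((s₁ + s₂ < d / p ∨ (s₁ + s₂ = d / p ∧ r = 1)) →
          ∃ R : 𝓢'(Space d, ℂ), IsRemainder χ f g R ∧ MemSh χ R)) := by
  refine ⟨fun s σ h => ?_, fun s₁ s₂ hs h => ?_⟩
  · obtain ⟨C, hC⟩ := exists_paraproduct_estimate hχ hp hq hr hr₁ hr₂ (s := s) h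
    exact ⟨C, fun c₀ t _ _ => hC _ (Real.sqrt_nonneg _)⟩
  · obtain ⟨C, hC⟩ := exists_remainder_estimate hd hχ hp hq hr hr₁ hr₂ hs h
    exact ⟨C, fun c₀ t _ _ => hC _ (Real.sqrt_nonneg _)⟩
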